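/- Let $0<a<b$, $\Upsilon_0>0$, $\alpha>1$, $D=\mathbb C\setminus(-\infty,0]$, let $H$ be the Heaviside function, and let $\tilde f$ denote the Laplace transform of $f$. Put, with principal branches (and removable singularities removed), $$M(s)=\sqrt{\frac{\ln(bs)}{\ln(as)}\,\frac{as-1}{bs-1}},\qquad \tilde P(x,s)=\frac{\sinh(xsM(s))}{\sinh(sM(s))},\qquad s\in D,\ x\in[0,1],$$ and for $q>0$ let $M(qe^{\pm i\pi})$ be the boundary values on the two lips of the cut, i.e. $\ln(cqe^{\pm i\pi})=\ln(cq)\pm i\pi$ for $c=a,b$. Let $F:\mathbb R\to\mathbb R$ be locally integrable, zero for $t\le 0$, with a Laplace transform converging absolutely in some half-plane $\operatorname{Re}s>A$ and continuing analytically to $D$, such that (i) $\tilde F$ is analytic and nonvanishing on $D$; (ii) $|\tilde F(s)|\asymp|s|^{-\alpha}$ as $|s|\to\infty$ in $D$ (the ratio of the two sides stays between two positive constants); (iii) $s\tilde F(s)\to0$ as $s\to0$ in $D$; and such that the boundary values $\tilde F(qe^{\pm i\pi})=\lim_{s\to-q,\ \pm\operatorname{Im}s>0}\tilde F(s)$ exist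 for every $q>0$. Let $\Upsilon=\Upsilon_0H+F$. Consider the problem, for $x\in[0,1]$, $t>0$, $$\partial_x\sigma=\partial_t^2u,\qquad \int_0^1a^{\gamma}\,{}_0D_t^{\gamma}\sigma\,d\gamma=\int_0^1b^{\gamma}\,{}_0D_t^{\gamma}\varepsilon\,d\gamma,\qquad \varepsilon=\partial_xu ,$$ with ${}_0D_t^\gamma$ the Riemann–Liouville derivative, the constitutive (second) equation being required for $x\in[0,1)$; with $u,\partial_tu,\sigma,\varepsilon$ equal to $0$ at $t=0$ for $x\in[0,1)$; with $u(0,t)=0$ for all $t$ and $u(1,t)=\Upsilon(t)$ for almost every $t$. A solution is a pair $(u,\sigma)$ of real functions on $[0,1]\times\mathbb R$, zero for $t<0$, with $u$ of class $C^2$ and $\sigma$ of class $C^1$ on $R:=([0,1]\times[0,\infty))\setminus\{(1,0)\}$, $u(x,\cdot)$ locally integrable for $x\in[0,1]$ and $\sigma(x,\cdot)$ for $x\in[0,1)$, satisfying all this. It is called Laplace admissible if for some $A$: $|\partial_t^2u|,|\varepsilon|,|\sigma|\le C_re^{At}$ for $0\le x\le r$, $t>0$, for every $r<1$; and $\int_0^\infty|u(x,t)-\Upsilon(t)|e^{-At}dt\to0$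 as $x\to1^-$. Then the following hold. 1. For every $n\ge1$ each of the equations $sM(s)=\pm n i\pi$ has exactly one solution $s_n^{(\pm)}$ in $D$; $s_n^{(-)}=\overline{s_n^{(+)}}$, and both are simple zeros of $\sinh(sM(s))$. For each $x\in[0,1)$ there is a continuous real function $P(x,\cdot)$, zero for $t<0$, whose Laplace transform converges absolutely and equals $\tilde P(x,\cdot)$ in some right half-plane. (For $x=1$, $\tilde P\equiv1$ and $P(1,\cdot)=\delta$.) 2. Let $u_H=\Upsilon_0H*P$ and $u_F=F*P$, so that $u_H(1,\cdot)=\Upsilon_0H$ and $u_F(1,\cdot)=F$ a.e. For $x\in[0,1)$, $t>0$, $$u_H(x,t)=\frac{\Upsilon_0}{2\pi i}\int_0^\infty\Big(\frac{\sinh(xqM(qe^{-i\pi}))}{\sinh(qM(qe^{-i\pi}))}-\frac{\sinh(xqM(qe^{i\pi}))}{\sinh(qM(qe^{i\pi}))}\Big)\frac{1-e^{-qt}}{q}\,dq+\Upsilon_0\int_0^t\sum_{n=1}^\infty\sum_{\pm}\operatorname{Res}\big(\tilde P(x,s)e^{s\tau},s_n^{(\pm)}\big)\,d\tau .$$ 3.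 For all $x\in[0,1]$, $t>0$ (for $x=1$ this fixes the representative $u_F(1,\cdot)$ of $F$), $$u_F(x,t)=\frac1{2\pi i}\int_0^\infty\Big(\tilde F(qe^{-i\pi})\frac{\sinh(xqM(qe^{-i\pi}))}{\sinh(qM(qe^{-i\pi}))}-\tilde F(qe^{i\pi})\frac{\sinh(xqM(qe^{i\pi}))}{\sinh(qM(qe^{i\pi}))}\Big)e^{-qt}\,dq+\sum_{n=1}^\infty\sum_\pm\operatorname{Res}\big(\tilde F(s)\tilde P(x,s)e^{st},s_n^{(\pm)}\big),$$ where the integral is $\lim_{\delta\to0^+}\int_\delta^\infty$ (absolutely convergent for each $\delta>0$), the series converges absolutely, and $$\operatorname{Res}\big(\tilde F(s)\tilde P(x,s)e^{st},s_n^{(\pm)}\big)=\Big[\tilde F(s)\frac{\sinh(xsM(s))}{\frac{d}{ds}\sinh(sM(s))}e^{st}\Big]_{s=s_n^{(\pm)}}$$ (likewise with $\tilde F$ replaced by $1$). Moreover $u_F(x,t)=0$ for $t<0$, and $u_F(x,\cdot)$ is real-valued and locally integrable on $\mathbb R$ for each $x\in[0,1]$. 4. $u=u_H+u_F$ is the solution: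 there is $\sigma$ such that $(u,\sigma)$ is a Laplace admissible solution, and every Laplace admissible solution coincides with $(u,\sigma)$ on $R$. Furthermore $u$ is $C^\infty$ on $[0,1]\times(0,\infty)$. -/

import Mathlib

open Set Filter Topology MeasureTheory

noncomputable section

namespace FractionalRod

/-! ### Laplace-domain functions -/

/-- `ln z / (z - 1)`, with its removable singularity at `z = 1` filled in. -/
def logQuot (z : ℂ) : ℂ := if z = 1 then 1 else Complex.log z / (z - 1)

/-- `M(s) = √( (ln(bs)/ln(as)) · ((as-1)/(bs-1)) )`, principal square root. -/
def M (a b : ℝ) (s : ℂ) : ℂ := (logQuot (b * s) / logQuot (a * s)) ^ (1 / 2 : ℂ)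

/-- The one-sided boundary value `M(q e^{ηiπ})` on the cut, for `q > 0`; here `η = 1` is the upper
lip and `η = -1` the lower lip, and `ln(c q e^{ηiπ}) = ln(cq) + ηiπ`. -/
def MCut (a b η q : ℝ) : ℂ :=
  (((Real.log (b * q) + η * Real.pi * Complex.I) / (Real.log (a * q) + η * Real.pi * Complex.I)) *
    ((a * q + 1) / (b * q + 1))) ^ (1 / 2 : ℂ)

/-- `P̃(x,s) = sinh(x s M(s)) / sinh(s M(s))`. -/
def PTilde (a b x : ℝ) (s : ℂ) : ℂ :=
  Complex.sinh (x * s * M a b s) / Complex.sinh (s * M a b s)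

/-- `sinh(x q M(q e^{ηiπ})) / sinh(q M(q e^{ηiπ}))`. -/
def PCut (a b x η q : ℝ) : ℂ :=
  Complex.sinh (x * q * MCut a b η q) / Complex.sinh (q * MCut a b η q)

/-- `g` is the Laplace transform of `f` in the half-plane `Re s > A`. -/
def HasLaplace (f : ℝ → ℝ) (A : ℝ) (g : ℂ → ℂ) : Prop :=
  ∀ s : ℂ, A < s.re →
    IntegrableOn (fun t : ℝ => (f t : ℂ) * Complex.exp (-s * t)) (Ioi 0) ∧
      ∫ t in Ioi (0 : ℝ), (f t : ℂ) * Complex.exp (-s * t) = g s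

/-- The residue of `f` at an isolated singularity `c` is `r`. -/
def HasResidue (f : ℂ → ℂ) (c r : ℂ) : Prop :=
  ∀ᶠ ρ in 𝓝[>] (0 : ℝ), (2 * Real.pi * Complex.I)⁻¹ * (∮ z in C(c, ρ), f z) = r

/-- `G(s) · sinh(x s M(s)) / (d/ds sinh(s M(s))) · e^{st}`. -/
def resTerm (a b : ℝ) (G : ℂ → ℂ) (x t : ℝ) (s : ℂ) : ℂ :=
  G s * (Complex.sinh (x * s * M a b s) /
    deriv (fun z : ℂ => Complex.sinh (z * M a b z)) s) * Complex.exp (s * t)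

/-- `sp n` and `sm n`, `n ≥ 1`, are the solutions in `ℂ ∖ (-∞,0]` of `s M(s) = n i π` and of
`s M(s) = -n i π`: each of these equations has exactly one solution, the two solutions are
complex conjugate, and they are simple zeros of `sinh(s M(s))`. -/
structure ArePoles (a b : ℝ) (sp sm : ℕ → ℂ) : Prop where
  mem_plus : ∀ n : ℕ, 1 ≤ n → sp n ∈ Complex.slitPlane
  mem_minus : ∀ n : ℕ, 1 ≤ n → sm n ∈ Complex.slitPlane
  eq_plus : ∀ n : ℕ, 1 ≤ n → sp n * M a b (sp n) = n * Complex.I * Real.pi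
  eq_minus : ∀ n : ℕ, 1 ≤ n → sm n * M a b (sm n) = -(n * Complex.I * Real.pi)
  unique_plus : ∀ n : ℕ, 1 ≤ n → ∀ s ∈ Complex.slitPlane,
    s * M a b s = n * Complex.I * Real.pi → s = sp n
  unique_minus : ∀ n : ℕ, 1 ≤ n → ∀ s ∈ Complex.slitPlane,
    s * M a b s = -(n * Complex.I * Real.pi) → s = sm n
  conj : ∀ n : ℕ, 1 ≤ n → sm n = (starRingEnd ℂ) (sp n)
  simple_plus : ∀ n : ℕ, 1 ≤ n → deriv (fun z : ℂ => Complex.sinh (z * M a b z)) (sp n) ≠ 0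
  simple_minus : ∀ n : ℕ, 1 ≤ n → deriv (fun z : ℂ => Complex.sinh (z * M a b z)) (sm n) ≠ 0

/-! ### The boundary datum -/

/-- The Heaviside function. -/
def heaviside (t : ℝ) : ℝ := if 0 ≤ t then 1 else 0

/-- The assumptions on the datum `F` and its (analytically continued) Laplace transform `Ft`:
`F` is locally integrable, zero for `t ≤ 0`, and its Laplace transform extends to an analytic
nonvanishing function `Ft` on `ℂ ∖ (-∞,0]` of order `|s|^{-α}` at infinity, `s Ft(s) = o(1)` at `0`,
with boundary values `Fp q = Ft(q e^{iπ})` and `Fm q = Ft(q e^{-iπ})`, `q > 0`, on the two lips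
of the cut. -/
structure DatumCondition (F : ℝ → ℝ) (Ft : ℂ → ℂ) (Fp Fm : ℝ → ℂ) (α : ℝ) : Prop where
  locallyIntegrable : LocallyIntegrable F
  eq_zero : ∀ t : ℝ, t ≤ 0 → F t = 0
  laplace : ∃ A : ℝ, HasLaplace F A Ft
  analytic : AnalyticOnNhd ℂ Ft Complex.slitPlane
  ne_zero : ∀ s ∈ Complex.slitPlane, Ft s ≠ 0
  atInfinity : Ft =Θ[Bornology.cobounded ℂ ⊓ 𝓟 Complex.slitPlane] fun s : ℂ => ‖s‖ ^ (-α)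
  atZero : Tendsto (fun s : ℂ => s * Ft s) (𝓝[Complex.slitPlane] 0) (𝓝 0)
  upperLip : ∀ q : ℝ, 0 < q → Tendsto Ft (𝓝[{s : ℂ | 0 < s.im}] (-(q : ℂ))) (𝓝 (Fp q))
  lowerLip : ∀ q : ℝ, 0 < q → Tendsto Ft (𝓝[{s : ℂ | s.im < 0}] (-(q : ℂ))) (𝓝 (Fm q))

/-- Convolution `(f * g)(t) = ∫₀ᵗ f(τ) g(t - τ) dτ` of functions supported in `[0,∞)`. -/
def causalConv (f g : ℝ → ℝ) (t : ℝ) : ℝ := ∫ τ in (0 : ℝ)..t, f τ * g (t - τ)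

/-! ### The initial-boundary value problem -/

/-- The left Riemann–Liouville derivative of order `γ ∈ [0,1)`. -/
def rlDeriv (γ : ℝ) (y : ℝ → ℝ) (t : ℝ) : ℝ :=
  (Real.Gamma (1 - γ))⁻¹ * deriv (fun r : ℝ => ∫ τ in (0 : ℝ)..r, y τ / (r - τ) ^ γ) t

/-- The strain `∂u/∂x` on `[0,1]` (one-sided at the ends). -/
def strain (u : ℝ → ℝ → ℝ) (x t : ℝ) : ℝ := derivWithin (fun y => u y t) (Icc 0 1) x

/-- The closed half-strip `[0,1] × [0,∞)` without the corner `(1,0)`, where the prescribed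
displacement may jump. -/
def rodDomain : Set (ℝ × ℝ) := {p | p.1 ∈ Icc (0 : ℝ) 1 ∧ 0 ≤ p.2 ∧ p ≠ (1, 0)}

/-- `(u, σ)` solves
`∂σ/∂x = ∂²u/∂t²`, `∫₀¹ a^γ D^γ σ dγ = ∫₀¹ b^γ D^γ ε dγ`, `ε = ∂u/∂x` for `t > 0`,
with zero initial data, `u(0,t) = 0`, and `u(1,t) = Υ(t)`. At the end `x = 1` (where the stress
contains an impulse at time `0` when `Υ` jumps) the constitutive equation is not imposed. -/
structure IsSolution (a b : ℝ) (Υ : ℝ → ℝ) (u σ : ℝ → ℝ → ℝ) : Prop where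
  u_locallyIntegrable : ∀ x ∈ Icc (0 : ℝ) 1, LocallyIntegrable (u x)
  σ_locallyIntegrable : ∀ x ∈ Ico (0 : ℝ) 1, LocallyIntegrable (σ x)
  u_causal : ∀ x ∈ Icc (0 : ℝ) 1, ∀ t : ℝ, t < 0 → u x t = 0
  σ_causal : ∀ x ∈ Icc (0 : ℝ) 1, ∀ t : ℝ, t < 0 → σ x t = 0
  u_regular : ContDiffOn ℝ 2 (Function.uncurry u) rodDomain
  σ_regular : ContDiffOn ℝ 1 (Function.uncurry σ) rodDomain
  motion : ∀ x ∈ Icc (0 : ℝ) 1, ∀ t : ℝ, 0 < t →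
    HasDerivWithinAt (fun y => σ y t) (iteratedDeriv 2 (u x) t) (Icc 0 1) x
  constitutive : ∀ x ∈ Ico (0 : ℝ) 1, ∀ t : ℝ, 0 < t →
    IntervalIntegrable (fun γ => a ^ γ * rlDeriv γ (σ x) t) volume 0 1 ∧
    IntervalIntegrable (fun γ => b ^ γ * rlDeriv γ (strain u x) t) volume 0 1 ∧
    ∫ γ in (0 : ℝ)..1, a ^ γ * rlDeriv γ (σ x) t =
      ∫ γ in (0 : ℝ)..1, b ^ γ * rlDeriv γ (strain u x) t
  init_u : ∀ x ∈ Ico (0 : ℝ) 1, u x 0 = 0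
  init_ut : ∀ x ∈ Ico (0 : ℝ) 1, HasDerivAt (u x) 0 0
  init_σ : ∀ x ∈ Ico (0 : ℝ) 1, σ x 0 = 0
  init_strain : ∀ x ∈ Ico (0 : ℝ) 1, strain u x 0 = 0
  bc_left : ∀ t : ℝ, u 0 t = 0
  bc_right : ∀ᵐ t : ℝ, u 1 t = Υ t

/-- Growth conditions under which the problem can be Laplace transformed in time: exponential
bounds that are uniform for `x` in compact subsets of `[0,1)`, and `u(x,·) → Υ` in
`L¹((0,∞), e^{-At} dt)` as `x → 1`. -/
def LaplaceAdmissible (Υ : ℝ → ℝ) (u σ : ℝ → ℝ → ℝ) : Prop :=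
  ∃ A : ℝ,
    (∀ r ∈ Ico (0 : ℝ) 1, ∃ C : ℝ, ∀ x ∈ Icc 0 r, ∀ t : ℝ, 0 < t →
      |iteratedDeriv 2 (u x) t| ≤ C * Real.exp (A * t) ∧
      |strain u x t| ≤ C * Real.exp (A * t) ∧
      |σ x t| ≤ C * Real.exp (A * t)) ∧
    Tendsto (fun x : ℝ => ∫⁻ t in Ioi (0 : ℝ),
      ENNReal.ofReal (|u x t - Υ t| * Real.exp (-(A * t)))) (𝓝[<] 1) (𝓝 0)

/-! ### The explicit formulas -/

/-- `y = uH(x,t)`, `x < 1`, `t > 0`, as a branch-cut integral plus the time integral of the series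
of residues. -/
def FormulaH (a b Υ₀ : ℝ) (sp sm : ℕ → ℂ) (x t : ℝ) (y : ℂ) : Prop :=
  let cut : ℝ → ℂ := fun q =>
    (PCut a b x (-1) q - PCut a b x 1 q) * ((1 - Real.exp (-(q * t))) / q)
  let res : ℝ → ℕ → ℂ := fun τ n =>
    resTerm a b (fun _ => 1) x τ (sp (n + 1)) + resTerm a b (fun _ => 1) x τ (sm (n + 1))
  IntegrableOn cut (Ioi 0) ∧ (∀ τ : ℝ, 0 < τ → Summable (res τ)) ∧
    IntervalIntegrable (fun τ => ∑' n, res τ n) volume 0 t ∧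
    y = Υ₀ / (2 * Real.pi * Complex.I) * (∫ q in Ioi (0 : ℝ), cut q) +
      Υ₀ * ∫ τ in (0 : ℝ)..t, ∑' n, res τ n

/-- `y = uF(x,t)`, `t > 0`, as a branch-cut integral (convergent at `∞`, improper at `0`) plus the
series of residues. -/
def FormulaF (a b : ℝ) (Ft : ℂ → ℂ) (Fp Fm : ℝ → ℂ) (sp sm : ℕ → ℂ) (x t : ℝ) (y : ℂ) : Prop :=
  let cut : ℝ → ℂ := fun q =>
    (Fm q * PCut a b x (-1) q - Fp q * PCut a b x 1 q) * Real.exp (-(q * t))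
  let res : ℕ → ℂ := fun n => resTerm a b Ft x t (sp (n + 1)) + resTerm a b Ft x t (sm (n + 1))
  ∃ J : ℂ, (∀ δ : ℝ, 0 < δ → IntegrableOn cut (Ioi δ)) ∧
    Tendsto (fun δ : ℝ => ∫ q in Ioi δ, cut q) (𝓝[>] 0) (𝓝 J) ∧
    Summable res ∧ y = (2 * Real.pi * Complex.I)⁻¹ * J + ∑' n, res n

end FractionalRod

end

/-! Laplace transformation in time turns the constitutive law into `σ̃ = ε̃ / M²` and the equation
of motion into `∂ₓσ̃ = s² ũ`. Hence `ũ = Υ̃(s) sinh(xz)/sinh z` with `z = s M(s)`, and everything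
depends on understanding the single function `z`.

The coordinate `w = log s` unfolds the cut plane into the strip `|Im w| < π` and the two lips into
its boundary lines. Since `∫₀¹ (cs)^γ dγ = Phi (w + log c)` with `Phi v = (e^v - 1)/v`, the function
`mu = log M` is half the difference of two real translates of `ell = log Phi`. The integral formula
shows that `Phi` maps the closed strip into the slit plane and that `|Im mu| < π/2`. A
Phragmén–Lindelöf argument gives `|ell' - 1/2| ≤ 5/6` (`norm_ellDeriv_sub_le`), whence `|mu'| ≤
5/6`. So `psi = w + mu = log z` is the identity plus a contraction: each equation `z = ±nπi` has
exactly one solution, found by Banach's fixed point theorem (`exists_psi_eq`), and `psi' ≠ 0` makes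
the zeros of `sinh z` simple.

The decay of the kernels comes from `a < b`. For large `|s|` the number `Im mu` has the sign
opposite to `Im w`, with a quantitative bound (`mu_im_le`); this bends the argument of `z` towards
`0` and gives `Re z ≥ c|s|^{1/2}` for `Re s ≥ 0`. Elsewhere either the same bound holds or `Re s ≤
-c|s|^{1/2}` (`exists_re_zed_ge`). At a pole `Re z = 0`, so the second alternative holds and the
residue series converges for every `t > 0`. On circles passing between the poles `sinh z` is as
large as `e^{|Re z|}/4` (`exists_arc_bound`).

Instead of `sinh(xz)/sinh z` the proof handles `G e^{xz}/sinh z`, where the symbol `G` is any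
function of `w` of polynomial growth in `s`. Its Bromwich integral `brom` is smooth for `|x| < 1`
and all `t`, and vanishes for `t ≤ 0`. The residue theorem on a keyhole contour identifies it, for
`t > 0`, with `keyI`: an arc around the branch point, the two lips of the cut, and the residues
(`brom_eq_keyI`). The latter converges even for `x` slightly beyond `1`, which yields smoothness up
to the end of the rod. All these pieces are superpositions of exponentials `e^{xz+ts}` and are
differentiated by one common lemma. In the part odd in `x` the kernel stays bounded at the branch
point, so the arc disappears as its radius tends to `0` and the stated formulas remain.

Displacement, strain, stress and acceleration have the symbols `G`, `Gz`, `Gs/M`, `Gs²` (with `sinh`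
or `cosh` in `x`), so the equations of the problem are identities between symbols. The constitutive
equation is transferred to the time domain by writing the distributed-order derivative as the
derivative of a convolution with one integrable kernel whose transform is `Phi(log (cs))/s`, and by
injectivity of the Laplace transform. The boundary value is attained in weighted `L¹`: Plancherel
gives `L²` bounds uniform in `x`, which together with pointwise convergence suffice.

For uniqueness, the difference of two admissible solutions has at each large real `s` transforms
`V`, `T` with `V' = κT`, `T' = s²V`, `κ > 0`, `V(0) = 0` and `V → 0` at `x = 1`. Then `VT` and `V²`
are nondecreasing, so `V` and `T` vanish. -/

noncomputable section

namespace FractionalRod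

/-! ### The function `(e^v - 1)/v` and its logarithm on the strip `|Im v| ≤ π`. -/

/-- The entire function `(e^v - 1) / v`. -/
def Phi (v : ℂ) : ℂ := dslope Complex.exp 0 v

theorem Phi_of_ne {v : ℂ} (hv : v ≠ 0) : Phi v = (Complex.exp v - 1) / v := by
  rw [Phi, dslope_of_ne _ hv, slope_def_field]; simp

theorem Phi_zero : Phi 0 = 1 := by simp [Phi]

theorem differentiable_Phi : Differentiable ℂ Phi := by
  rw [← differentiableOn_univ]
  exact (Complex.differentiableOn_dslope univ_mem).2 Complex.differentiable_exp.differentiableOn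

/-- With `v = log (cs)` this is the symbol `∫₀¹ (cs)^γ dγ` of the distributed-order operator. The
argument of `Phi` is controlled through this integral rather than through the quotient. -/
theorem Phi_eq_integral (v : ℂ) : Phi v = ∫ γ in (0 : ℝ)..1, Complex.exp (v * γ) := by
  rcases eq_or_ne v 0 with rfl | hv
  · simp [Phi_zero]
  · rw [Phi_of_ne hv, integral_exp_mul_complex hv]; simp

theorem Phi_conj (v : ℂ) : Phi ((starRingEnd ℂ) v) = (starRingEnd ℂ) (Phi v) := by
  rcases eq_or_ne v 0 with rfl | hv
  · simp [Phi_zero]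
  · rw [Phi_of_ne hv, Phi_of_ne (by simpa using hv)]
    simp [Complex.exp_conj]

theorem Phi_im (v : ℂ) :
    (Phi v).im = ∫ γ in (0 : ℝ)..1, Real.exp (v.re * γ) * Real.sin (v.im * γ) := by
  rw [Phi_eq_integral]
  have h : IntervalIntegrable (fun γ : ℝ => Complex.exp (v * γ)) volume 0 1 :=
    (by fun_prop : Continuous fun γ : ℝ => Complex.exp (v * γ)).intervalIntegrable _ _
  have := Complex.imCLM.intervalIntegral_comp_comm h
  simp only [Complex.imCLM_apply] at this
  rw [← this]
  congr 1 with γ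
  simp [Complex.exp_im]

/-- For `0 < γ < 1` the angle `γ Im v` lies in `(0, π)`, so the integrand of the imaginary part is
positive. -/
theorem Phi_im_pos {v : ℂ} (h0 : 0 < v.im) (h1 : v.im ≤ Real.pi) : 0 < (Phi v).im := by
  rw [Phi_im]
  refine intervalIntegral.intervalIntegral_pos_of_pos_on
    ((by fun_prop : Continuous _).intervalIntegrable _ _) (fun γ hγ => ?_) one_pos
  refine mul_pos (Real.exp_pos _) (Real.sin_pos_of_pos_of_lt_pi (mul_pos h0 hγ.1) ?_)
  nlinarith [hγ.1, hγ.2]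

theorem Phi_ofReal_pos {v : ℂ} (h0 : v.im = 0) : 0 < (Phi v).re ∧ (Phi v).im = 0 := by
  refine ⟨?_, by rw [Phi_im]; simp [h0]⟩
  rw [Phi_eq_integral]
  have h : IntervalIntegrable (fun γ : ℝ => Complex.exp (v * γ)) volume 0 1 :=
    (by fun_prop : Continuous fun γ : ℝ => Complex.exp (v * γ)).intervalIntegrable _ _
  have := Complex.reCLM.intervalIntegral_comp_comm h
  simp only [Complex.reCLM_apply] at this
  rw [← this]
  refine intervalIntegral.intervalIntegral_pos_of_pos_on
    ((by fun_prop : Continuous _).intervalIntegrable _ _) (fun γ hγ => ?_) one_pos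
  simp [Complex.exp_re, h0, Real.exp_pos]

/-- Off the real axis the imaginary part does not vanish, on it the real part is positive. Hence the
principal logarithm of `Phi` is holomorphic near every point of the closed strip, the lips included.
-/
theorem Phi_mem_slitPlane {v : ℂ} (hv : |v.im| ≤ Real.pi) : Phi v ∈ Complex.slitPlane := by
  rw [Complex.mem_slitPlane_iff]
  rcases lt_trichotomy v.im 0 with h | h | h
  · right
    have h2 := Phi_im_pos (v := (starRingEnd ℂ) v) (by simpa using h)
      (by simpa using (neg_le_abs _).trans hv)
    rw [Phi_conj] at h2
    simp at h2
    exact h2.ne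
  · exact Or.inl (Phi_ofReal_pos h).1
  · exact Or.inr (Phi_im_pos h ((le_abs_self _).trans hv)).ne'

theorem Phi_ne_zero {v : ℂ} (hv : |v.im| ≤ Real.pi) : Phi v ≠ 0 :=
  Complex.slitPlane_ne_zero (Phi_mem_slitPlane hv)

/-- A logarithm of `Phi`, on the closed strip `|Im v| ≤ π`. -/
def ell (v : ℂ) : ℂ := Complex.log (Phi v)

/-- The derivative of `ell`. -/
def ellDeriv (v : ℂ) : ℂ := deriv Phi v / Phi v

theorem hasDerivAt_ell {v : ℂ} (hv : |v.im| ≤ Real.pi) : HasDerivAt ell (ellDeriv v) v :=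
  (differentiable_Phi v).hasDerivAt.clog (Phi_mem_slitPlane hv)

theorem exp_ell {v : ℂ} (hv : |v.im| ≤ Real.pi) : Complex.exp (ell v) = Phi v :=
  Complex.exp_log (Phi_ne_zero hv)

theorem ell_conj {v : ℂ} (hv : |v.im| ≤ Real.pi) :
    ell ((starRingEnd ℂ) v) = (starRingEnd ℂ) (ell v) := by
  rw [ell, Phi_conj, Complex.log_conj _ (Complex.mem_slitPlane_iff_arg.1 (Phi_mem_slitPlane hv)).1,
    ell]

theorem ell_im_pos {v : ℂ} (h0 : 0 < v.im) (h1 : v.im ≤ Real.pi) :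
    0 < (ell v).im ∧ (ell v).im < Real.pi := by
  have h := Phi_im_pos h0 h1
  rw [ell, Complex.log_im]
  constructor
  · exact lt_of_le_of_ne (Complex.arg_nonneg_iff.2 h.le) fun h' => by
      have := (Complex.arg_eq_zero_iff.1 h'.symm).2
      exact h.ne' this
  · exact lt_of_le_of_ne (Complex.arg_le_pi _) fun h' =>
      h.ne' (Complex.arg_eq_pi_iff.1 h').2

theorem ell_im_eq_zero {v : ℂ} (h0 : v.im = 0) : (ell v).im = 0 := by
  rw [ell, Complex.log_im, Complex.arg_eq_zero_iff]
  exact ⟨(Phi_ofReal_pos h0).1.le, (Phi_ofReal_pos h0).2⟩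

theorem exp_ne_one_of_strip {v : ℂ} (hv : |v.im| ≤ Real.pi) (h0 : v ≠ 0) :
    Complex.exp v - 1 ≠ 0 := by
  have := Phi_ne_zero hv
  rw [Phi_of_ne h0] at this
  exact fun h => this (by simp [h])

theorem ellDeriv_eq {v : ℂ} (hv : |v.im| ≤ Real.pi) (h0 : v ≠ 0) :
    ellDeriv v = Complex.exp v / (Complex.exp v - 1) - 1 / v := by
  have h1 := exp_ne_one_of_strip hv h0
  have hd : HasDerivAt Phi ((Complex.exp v * v - (Complex.exp v - 1) * 1) / v ^ 2) v := by
    refine (((Complex.hasDerivAt_exp v).sub_const 1).div (hasDerivAt_id v) h0).congr_of_eventuallyEq ?_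
    filter_upwards [isOpen_ne.mem_nhds h0] with y hy
    rw [Phi_of_ne hy]; simp
  rw [ellDeriv, hd.deriv, Phi_of_ne h0]
  field_simp
  try ring

theorem differentiableAt_ellDeriv {v : ℂ} (hv : |v.im| ≤ Real.pi) :
    DifferentiableAt ℂ ellDeriv v := by
  refine DifferentiableAt.div ?_ (differentiable_Phi v) (Phi_ne_zero hv)
  exact (differentiable_Phi.analyticAt v).deriv.differentiableAt

/-- A crude bound far out in the strip, which supplies the growth hypothesis of the
Phragmén–Lindelöf principle. -/
theorem norm_exp_div_le {v : ℂ} (h : 1 ≤ |v.re|) :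
    ‖Complex.exp v / (Complex.exp v - 1)‖ ≤ 2 := by
  have he : (2 : ℝ) ≤ Real.exp 1 := by linarith [Real.add_one_le_exp (1 : ℝ)]
  rw [norm_div, Complex.norm_exp]
  rcases le_abs.1 h with h | h
  · have h2 : Real.exp 1 ≤ Real.exp v.re := Real.exp_le_exp.2 h
    have h1 : Real.exp v.re - 1 ≤ ‖Complex.exp v - 1‖ := by
      have := norm_sub_norm_le (Complex.exp v) 1
      rwa [Complex.norm_exp, norm_one] at this
    rw [div_le_iff₀ (by linarith)]
    linarith
  · have h2 : Real.exp v.re ≤ Real.exp (-1) := Real.exp_le_exp.2 (by linarith)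
    have h3 : Real.exp (-1) ≤ 1 / 2 := by
      rw [Real.exp_neg, one_div]; exact inv_anti₀ two_pos he
    have h1 : 1 - Real.exp v.re ≤ ‖Complex.exp v - 1‖ := by
      have := norm_sub_norm_le 1 (Complex.exp v)
      rw [Complex.norm_exp, norm_one, norm_sub_rev] at this
      exact this
    rw [div_le_iff₀ (by linarith)]
    linarith

/-- On the boundary lines `e^v = -e^{Re v}`, so `e^v/(e^v - 1)` is a real number of `(0,1)`, at
distance at most `1/2` from `1/2`. The other term is `1/|v| ≤ 1/π ≤ 1/3`, and `5/6 = 1/2 + 1/3`. -/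
theorem norm_ellDeriv_sub_le_of_im {v : ℂ} (h : |v.im| = Real.pi) :
    ‖ellDeriv v - 1 / 2‖ ≤ 5 / 6 := by
  have hpi := Real.pi_gt_three
  have hv0 : v ≠ 0 := by rintro rfl; simp at h; linarith
  have hexp : Complex.exp v = -(Real.exp v.re : ℂ) := by
    conv_lhs => rw [← Complex.re_add_im v]
    rw [Complex.exp_add]
    rcases eq_or_eq_neg_of_abs_eq h with h | h <;> rw [h] <;>
      simp [Complex.exp_neg]
  rw [ellDeriv_eq h.le hv0, hexp]
  have hp := Real.exp_pos v.re
  have e1 : -(Real.exp v.re : ℂ) / (-(Real.exp v.re : ℂ) - 1) - 1 / v - 1 / 2 =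
      (((Real.exp v.re - 1) / (2 * (Real.exp v.re + 1)) : ℝ) : ℂ) - 1 / v := by
    have h3 : (Real.exp v.re : ℂ) + 1 ≠ 0 := by exact_mod_cast (by linarith : Real.exp v.re + 1 ≠ 0)
    have h5 : -(Real.exp v.re : ℂ) / (-(Real.exp v.re : ℂ) - 1) =
        Real.exp v.re / (Real.exp v.re + 1) := by rw [← neg_add', neg_div_neg_eq]
    rw [h5]
    push_cast at h3 ⊢
    field_simp
    ring
  rw [e1]
  refine (norm_sub_le _ _).trans ?_
  have h5 : ‖(((Real.exp v.re - 1) / (2 * (Real.exp v.re + 1)) : ℝ) : ℂ)‖ ≤ 1 / 2 := by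
    rw [Complex.norm_real, Real.norm_eq_abs, abs_div, abs_of_pos (by linarith : 0 < 2 * (Real.exp v.re + 1)),
      div_le_iff₀ (by linarith), abs_le]
    constructor <;> linarith
  have h6 : ‖1 / v‖ ≤ 1 / 3 := by
    rw [norm_div, norm_one]
    refine one_div_le_one_div_of_le (by norm_num) ?_
    linarith [Complex.abs_im_le_norm v]
  linarith

/-- The maximum principle carries the estimate from the two boundary lines to the strip. Centring at
`1/2` is natural because `ell'` runs from `0` at the left end to `1` at the right end; what matters
later is that the bound is below `1`. -/
theorem norm_ellDeriv_sub_le {v : ℂ} (hv : |v.im| ≤ Real.pi) : ‖ellDeriv v - 1 / 2‖ ≤ 5 / 6 := by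
  have hpi := Real.pi_pos
  -- Both growth constants are taken to be `0`: only boundedness far out has to be checked.
  refine PhragmenLindelof.horizontal_strip (f := fun v => ellDeriv v - 1 / 2) (a := -Real.pi)
    (b := Real.pi) ?_ ⟨0, by rw [sub_neg_eq_add]; positivity, 0, ?_⟩ ?_ ?_ (neg_le_of_abs_le hv) (le_of_abs_le hv)
  · refine DifferentiableOn.diffContOnCl fun w hw => ?_
    have hcl : closure (Complex.im ⁻¹' Ioo (-Real.pi) Real.pi) ⊆ Complex.im ⁻¹' Icc (-Real.pi) Real.pi :=
      closure_minimal (preimage_mono Ioo_subset_Icc_self) (isClosed_Icc.preimage Complex.continuous_im)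
    have := hcl hw
    exact ((differentiableAt_ellDeriv (abs_le.2 this)).sub_const _).differentiableWithinAt
  · refine Asymptotics.IsBigO.of_bound 4 ?_
    rw [eventually_inf_principal]
    have : ∀ᶠ v : ℂ in comap (_root_.abs ∘ Complex.re) atTop, 1 ≤ |v.re| :=
      (eventually_ge_atTop (1 : ℝ)).comap _
    filter_upwards [this] with w h1 h2
    have hw : |w.im| ≤ Real.pi := abs_le.2 ⟨h2.1.le, h2.2.le⟩
    have hw0 : w ≠ 0 := by rintro rfl; simp at h1; linarith
    rw [ellDeriv_eq hw hw0]
    have h6 : ‖1 / w‖ ≤ 1 := by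
      rw [norm_div, norm_one, div_le_one (by positivity)]
      exact h1.trans (Complex.abs_re_le_norm w)
    have h7 := norm_exp_div_le h1
    have h8 : ‖(1 / 2 : ℂ)‖ ≤ 1 := by norm_num
    simp only [zero_mul, Real.exp_zero, norm_one, mul_one]
    exact (norm_sub_le _ _).trans (by linarith [norm_sub_le (Complex.exp w / (Complex.exp w - 1)) (1 / w)])
  · intro z hz; exact norm_ellDeriv_sub_le_of_im (by rw [hz, abs_neg, abs_of_pos hpi])
  · intro z hz; exact norm_ellDeriv_sub_le_of_im (by rw [hz, abs_of_pos hpi])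

/-! ### The strip, and `psi = w + mu` as a logarithm of `s M(s)`. -/

/-- The closed strip `|Im w| ≤ π`. -/
def cstrip : Set ℂ := Complex.im ⁻¹' Icc (-Real.pi) Real.pi

/-- The open strip `|Im w| < π`. -/
def ostrip : Set ℂ := Complex.im ⁻¹' Ioo (-Real.pi) Real.pi

theorem mem_cstrip {w : ℂ} : w ∈ cstrip ↔ |w.im| ≤ Real.pi := abs_le.symm
theorem mem_ostrip {w : ℂ} : w ∈ ostrip ↔ |w.im| < Real.pi := abs_lt.symm
theorem ostrip_subset : ostrip ⊆ cstrip := preimage_mono Ioo_subset_Icc_self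
theorem isOpen_ostrip : IsOpen ostrip := isOpen_Ioo.preimage Complex.continuous_im
theorem isClosed_cstrip : IsClosed cstrip := isClosed_Icc.preimage Complex.continuous_im
theorem convex_cstrip : Convex ℝ cstrip :=
  (convex_Icc (-Real.pi) Real.pi).linear_preimage Complex.imLm

theorem add_ofReal_mem_cstrip {w : ℂ} (hw : w ∈ cstrip) (x : ℝ) : w + x ∈ cstrip := by
  simpa [cstrip] using hw

theorem norm_ell_sub_le {v w : ℂ} (hv : v ∈ cstrip) (hw : w ∈ cstrip) :
    ‖ell v - ell w‖ ≤ 4 / 3 * ‖v - w‖ := by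
  refine convex_cstrip.norm_image_sub_le_of_norm_hasDerivWithin_le (f' := ellDeriv)
    (fun x hx => (hasDerivAt_ell (mem_cstrip.1 hx)).hasDerivWithinAt) (fun x hx => ?_) hw hv
  have h1 := norm_ellDeriv_sub_le (mem_cstrip.1 hx)
  have h2 : ‖ellDeriv x‖ ≤ ‖ellDeriv x - 1 / 2‖ + ‖(1 / 2 : ℂ)‖ := by
    simpa using norm_add_le (ellDeriv x - 1 / 2) (1 / 2 : ℂ)
  have h3 : ‖(1 / 2 : ℂ)‖ = 1 / 2 := by norm_num
  linarith

/-- `log M(e^w)`. -/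
def mu (a b : ℝ) (w : ℂ) : ℂ := (ell (w + Real.log a) - ell (w + Real.log b)) / 2

/-- The derivative of `mu`. -/
def muDeriv (a b : ℝ) (w : ℂ) : ℂ := (ellDeriv (w + Real.log a) - ellDeriv (w + Real.log b)) / 2

/-- `log (s M(s))` for `s = e^w`. -/
def psi (a b : ℝ) (w : ℂ) : ℂ := w + mu a b w

/-- `s M(s)` for `s = e^w`. -/
def zed (a b : ℝ) (w : ℂ) : ℂ := Complex.exp (psi a b w)

section

variable {a b : ℝ}

theorem hasDerivAt_mu {w : ℂ} (hw : w ∈ cstrip) : HasDerivAt (mu a b) (muDeriv a b w) w := by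
  have h : ∀ c : ℝ, HasDerivAt (fun w => ell (w + c)) (ellDeriv (w + c)) w := fun c =>
    (hasDerivAt_ell (mem_cstrip.1 (add_ofReal_mem_cstrip hw c))).comp_add_const w c
  exact ((h _).sub (h _)).div_const 2

/-- The centre `1/2` cancels between the two translates, and half of `5/6 + 5/6` remains. That this
is less than `1` gives injectivity of `psi`, existence of the poles and their simplicity. -/
theorem norm_muDeriv_le {w : ℂ} (hw : w ∈ cstrip) : ‖muDeriv a b w‖ ≤ 5 / 6 := by
  have h : ∀ c : ℝ, ‖ellDeriv (w + c) - 1 / 2‖ ≤ 5 / 6 := fun c =>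
    norm_ellDeriv_sub_le (mem_cstrip.1 (add_ofReal_mem_cstrip hw c))
  have e : muDeriv a b w = ((ellDeriv (w + Real.log a) - 1 / 2) -
    (ellDeriv (w + Real.log b) - 1 / 2)) / 2 := by rw [muDeriv]; ring
  rw [e, norm_div, Complex.norm_ofNat, div_le_iff₀ two_pos]
  exact (norm_sub_le _ _).trans (by linarith [h (Real.log a), h (Real.log b)])

theorem norm_mu_sub_le {v w : ℂ} (hv : v ∈ cstrip) (hw : w ∈ cstrip) :
    ‖mu a b v - mu a b w‖ ≤ 5 / 6 * ‖v - w‖ :=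
  convex_cstrip.norm_image_sub_le_of_norm_hasDerivWithin_le (f' := muDeriv a b)
    (fun _ hx => (hasDerivAt_mu hx).hasDerivWithinAt) (fun _ hx => norm_muDeriv_le hx) hw hv

/-- The two arguments of `ell` differ by the constant `log a - log b` and `ell` is Lipschitz.
Consequently `M` is bounded above and below on the whole cut plane, and `|z|` is comparable with
`|s|`. -/
theorem norm_mu_le {w : ℂ} (hw : w ∈ cstrip) :
    ‖mu a b w‖ ≤ |Real.log a - Real.log b| := by
  rw [mu, norm_div, Complex.norm_ofNat, div_le_iff₀ two_pos]
  refine (norm_ell_sub_le (add_ofReal_mem_cstrip hw _) (add_ofReal_mem_cstrip hw _)).trans ?_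
  rw [add_sub_add_left_eq_sub, ← Complex.ofReal_sub, Complex.norm_real, Real.norm_eq_abs]
  nlinarith [abs_nonneg (Real.log a - Real.log b)]

/-- The identity plus a map with Lipschitz constant `5/6` is injective. -/
theorem psi_injOn : InjOn (psi a b) cstrip := by
  intro v hv w hw h
  have h1 : v - w = -(mu a b v - mu a b w) := by
    rw [psi, psi] at h; linear_combination h
  have h2 := norm_mu_sub_le (a := a) (b := b) hv hw
  rw [← norm_neg, ← h1] at h2
  have : ‖v - w‖ = 0 := le_antisymm (by linarith) (norm_nonneg _)
  exact sub_eq_zero.1 (norm_eq_zero.1 this)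

theorem conj_mem_cstrip {w : ℂ} (hw : w ∈ cstrip) : (starRingEnd ℂ) w ∈ cstrip := by
  rw [mem_cstrip] at *; simpa using hw

theorem mu_conj {w : ℂ} (hw : w ∈ cstrip) :
    mu a b ((starRingEnd ℂ) w) = (starRingEnd ℂ) (mu a b w) := by
  have h : ∀ c : ℝ, ell ((starRingEnd ℂ) w + c) = (starRingEnd ℂ) (ell (w + c)) := fun c => by
    rw [← ell_conj (mem_cstrip.1 (add_ofReal_mem_cstrip hw c))]; simp
  simp [mu, h, map_ofNat]

theorem psi_conj {w : ℂ} (hw : w ∈ cstrip) :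
    psi a b ((starRingEnd ℂ) w) = (starRingEnd ℂ) (psi a b w) := by
  simp [psi, mu_conj hw]

theorem zed_conj {w : ℂ} (hw : w ∈ cstrip) :
    zed a b ((starRingEnd ℂ) w) = (starRingEnd ℂ) (zed a b w) := by
  rw [zed, psi_conj hw, Complex.exp_conj, zed]

/-- In the upper half of the strip both values of `ell` have imaginary part in `(0, π)`, so half
their difference is less than `π/2`; the lower half follows by conjugation. This makes `exp mu` the
principal square root and keeps the fixed-point map below inside the strip. -/
theorem abs_mu_im_lt {w : ℂ} (hw : w ∈ cstrip) : |(mu a b w).im| < Real.pi / 2 := by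
  have hpi := Real.pi_pos
  have e : ∀ w : ℂ, (mu a b w).im = ((ell (w + Real.log a)).im - (ell (w + Real.log b)).im) / 2 := by
    intro w; simp [mu]
  have pos : ∀ w : ℂ, 0 < w.im → w.im ≤ Real.pi → |(mu a b w).im| < Real.pi / 2 := by
    intro w h0 h1
    have h : ∀ c : ℝ, 0 < (ell (w + c)).im ∧ (ell (w + c)).im < Real.pi := fun c =>
      ell_im_pos (by simpa using h0) (by simpa using h1)
    have ha := h (Real.log a)
    have hb := h (Real.log b)
    rw [e, abs_lt]
    constructor <;> linarith
  rcases lt_trichotomy w.im 0 with h | h | h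
  · have := pos ((starRingEnd ℂ) w) (by simpa using h) (by simpa using (neg_le.1 hw.1))
    rw [mu_conj hw] at this
    simpa using this
  · rw [e, ell_im_eq_zero (by simpa using h), ell_im_eq_zero (by simpa using h)]
    simpa using hpi
  · exact pos w h hw.2

theorem mu_im_eq_zero {w : ℂ} (hw : w.im = 0) : (mu a b w).im = 0 := by
  simp [mu, ell_im_eq_zero (v := w + Real.log a) (by simpa using hw),
    ell_im_eq_zero (v := w + Real.log b) (by simpa using hw)]

/-- The equation is the fixed-point equation of the contraction `w ↦ ζ - mu w`. Because `Im ζ = π/2`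
and `|Im mu| < π/2`, this map sends the closed strip into `0 < Im w < π`. -/
theorem exists_psi_eq (y : ℝ) :
    ∃ w : ℂ, 0 < w.im ∧ w.im < Real.pi ∧ psi a b w = y + Real.pi / 2 * Complex.I := by
  have hpi := Real.pi_pos
  set ζ : ℂ := y + Real.pi / 2 * Complex.I with hζ
  have hζi : ζ.im = Real.pi / 2 := by simp [hζ]
  set T : ℂ → ℂ := fun w => ζ - mu a b w with hT
  have him : ∀ w ∈ cstrip, 0 < (T w).im ∧ (T w).im < Real.pi := by
    intro w hw
    have := abs_lt.1 (abs_mu_im_lt (a := a) (b := b) hw)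
    simp only [hT, Complex.sub_im, hζi]
    constructor <;> linarith
  have hmaps : MapsTo T cstrip cstrip := fun w hw => by
    have := him w hw
    exact ⟨by linarith, by linarith⟩
  have hc : ContractingWith (5 / 6 : NNReal) (hmaps.restrict T cstrip cstrip) := by
    refine ⟨by rw [div_lt_one (by norm_num)]; norm_num, ?_⟩
    refine LipschitzWith.of_dist_le_mul fun v w => ?_
    have := norm_mu_sub_le (a := a) (b := b) v.2 w.2
    rw [Subtype.dist_eq, Subtype.dist_eq, dist_eq_norm, dist_eq_norm]
    simp only [MapsTo.val_restrict_apply, hT, sub_sub_sub_cancel_left]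
    rw [norm_sub_rev]
    simpa using this
  obtain ⟨w, hw, hfix, -⟩ := hc.exists_fixedPoint' isClosed_cstrip.isComplete hmaps
    (x := 0) (by simp [cstrip, hpi.le]) (edist_ne_top _ _)
  refine ⟨w, ?_, ?_, ?_⟩
  · rw [← hfix.eq]; exact (him w hw).1
  · rw [← hfix.eq]; exact (him w hw).2
  · have : ζ - mu a b w = w := hfix.eq
    rw [psi]; linear_combination -this

/-- There is no ambiguity modulo `2πi`: `|Im psi| < 3π/2`, while the other logarithms have imaginary
part `π/2 + 2πn` with `n ≠ 0`. The value `-3π/2` is excluded only because the inequality is strict.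
-/
theorem psi_eq_of_zed_eq {w : ℂ} (hw : w ∈ cstrip) {y : ℝ}
    (h : zed a b w = Complex.exp (y + Real.pi / 2 * Complex.I)) :
    psi a b w = y + Real.pi / 2 * Complex.I := by
  have hpi := Real.pi_pos
  rw [zed, Complex.exp_eq_exp_iff_exists_int] at h
  obtain ⟨n, hn⟩ := h
  have h1 := congrArg Complex.im hn
  have h2 : (psi a b w).im = w.im + (mu a b w).im := by simp [psi]
  have h3 := abs_lt.1 (abs_mu_im_lt (a := a) (b := b) hw)
  have h4 := abs_le.1 (mem_cstrip.1 hw)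
  simp at h1
  have hn0 : n = 0 := by
    have l1 : (-1 : ℝ) < n := by
      by_contra hcon
      push Not at hcon
      nlinarith
    have l2 : (n : ℝ) < 1 := by
      by_contra hcon
      push Not at hcon
      nlinarith
    have l1' : (-1 : ℤ) < n := by exact_mod_cast l1
    have l2' : n < (1 : ℤ) := by exact_mod_cast l2
    omega
  rw [hn, hn0]; simp

end

/-! ### Return to the variable `s`: `M`, its values on the lips, and the poles. -/

section

variable {a b : ℝ}

theorem log_mem_ostrip {s : ℂ} (hs : s ∈ Complex.slitPlane) : Complex.log s ∈ ostrip := by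
  rw [mem_ostrip, Complex.log_im, abs_lt]
  exact ⟨Complex.neg_pi_lt_arg s, lt_of_le_of_ne (Complex.arg_le_pi s)
    (Complex.mem_slitPlane_iff_arg.1 hs).1⟩

theorem log_mem_cstrip (s : ℂ) : Complex.log s ∈ cstrip := by
  rw [mem_cstrip, Complex.log_im]
  exact Complex.abs_arg_le_pi s

theorem exp_mem_slitPlane {w : ℂ} (hw : w ∈ ostrip) : Complex.exp w ∈ Complex.slitPlane := by
  rw [mem_ostrip, abs_lt] at hw
  rw [Complex.mem_slitPlane_iff_arg, Complex.arg_exp]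
  refine ⟨?_, Complex.exp_ne_zero _⟩
  rw [(toIocMod_eq_self Real.two_pi_pos).2 ⟨hw.1, by linarith [hw.2]⟩]
  exact hw.2.ne

theorem log_exp_of_mem {w : ℂ} (hw : w ∈ ostrip) : Complex.log (Complex.exp w) = w :=
  Complex.log_exp hw.1 hw.2.le

/-- The removable singularity at `cs = 1` corresponds to `Phi 0 = 1`, so the case distinction
disappears in the coordinate `w`. -/
theorem logQuot_eq {c : ℝ} (hc : 0 < c) {s : ℂ} (hs : s ∈ Complex.slitPlane) :
    logQuot (c * s) = (Phi (Complex.log s + Real.log c))⁻¹ := by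
  have hs0 := Complex.slitPlane_ne_zero hs
  have hlog : Complex.log (c * s) = Complex.log s + Real.log c := by
    rw [Complex.log_ofReal_mul hc hs0, add_comm]
  have hexp : Complex.exp (Complex.log s + Real.log c) = c * s := by
    rw [← hlog, Complex.exp_log (mul_ne_zero (by exact_mod_cast hc.ne') hs0)]
  rw [logQuot]
  split_ifs with h
  · rw [← hlog, h, Complex.log_one, Phi_zero, inv_one]
  · have : Complex.log s + Real.log c ≠ 0 := fun h0 => h (by rw [← hexp, h0, Complex.exp_zero])
    rw [Phi_of_ne this, hexp, hlog, inv_div]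

theorem exp_two_mu {w : ℂ} (hw : w ∈ cstrip) :
    Complex.exp (2 * mu a b w) = Phi (w + Real.log a) / Phi (w + Real.log b) := by
  rw [← exp_ell (mem_cstrip.1 (add_ofReal_mem_cstrip hw _)),
    ← exp_ell (mem_cstrip.1 (add_ofReal_mem_cstrip hw _)), ← Complex.exp_sub, mu]
  congr 1; ring

/-- Since `|Im (2 mu)| < π`, the principal logarithm of `exp (2 mu)` is `2 mu` itself. -/
theorem exp_two_mu_cpow {w : ℂ} (hw : w ∈ cstrip) :
    (Complex.exp (2 * mu a b w)) ^ (1 / 2 : ℂ) = Complex.exp (mu a b w) := by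
  have h := abs_lt.1 (abs_mu_im_lt (a := a) (b := b) hw)
  rw [Complex.cpow_def_of_ne_zero (Complex.exp_ne_zero _), Complex.log_exp]
  · congr 1; ring
  · simp; linarith
  · simp; linarith

theorem M_eq (ha : 0 < a) (hb : 0 < b) {s : ℂ} (hs : s ∈ Complex.slitPlane) :
    M a b s = Complex.exp (mu a b (Complex.log s)) := by
  rw [M, logQuot_eq ha hs, logQuot_eq hb hs, ← exp_two_mu_cpow (log_mem_cstrip s),
    exp_two_mu (log_mem_cstrip s), inv_div_inv]

theorem mul_M_eq (ha : 0 < a) (hb : 0 < b) {s : ℂ} (hs : s ∈ Complex.slitPlane) :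
    s * M a b s = zed a b (Complex.log s) := by
  rw [M_eq ha hb hs, zed, psi, Complex.exp_add, Complex.exp_log (Complex.slitPlane_ne_zero hs)]

/-- The point `log q + η i π` of the boundary of the strip. -/
def lip (η q : ℝ) : ℂ := Real.log q + η * Real.pi * Complex.I

theorem lip_re (η q : ℝ) : (lip η q).re = Real.log q := by simp [lip]
theorem lip_im (η q : ℝ) : (lip η q).im = η * Real.pi := by simp [lip]

theorem lip_mem {η : ℝ} (hη : |η| = 1) (q : ℝ) : lip η q ∈ cstrip := by
  rw [mem_cstrip, lip_im, abs_mul, hη, one_mul, abs_of_pos Real.pi_pos]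

theorem exp_lip {η : ℝ} (hη : |η| = 1) {q : ℝ} (hq : 0 < q) : Complex.exp (lip η q) = -q := by
  rw [lip, Complex.exp_add, ← Complex.ofReal_exp, Real.exp_log hq]
  rcases eq_or_eq_neg_of_abs_eq hη with h | h <;> rw [h] <;> simp [Complex.exp_neg]

/-- The lips are honest points of the closed strip, on which `mu` is still given by the same formula
as inside. -/
theorem MCut_eq (ha : 0 < a) (hb : 0 < b) {η : ℝ} (hη : |η| = 1) {q : ℝ} (hq : 0 < q) :
    MCut a b η q = Complex.exp (mu a b (lip η q)) := by
  have hpi := Real.pi_pos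
  have key : ∀ c : ℝ, 0 < c → lip η q + Real.log c = Real.log (c * q) + η * Real.pi * Complex.I ∧
      Real.log (c * q) + η * Real.pi * Complex.I ≠ 0 ∧
      Phi (lip η q + Real.log c) = (-(c * q) - 1) / (Real.log (c * q) + η * Real.pi * Complex.I) ∧
      (c * q + 1 : ℂ) ≠ 0 := by
    intro c hc
    have e : lip η q + Real.log c = Real.log (c * q) + η * Real.pi * Complex.I := by
      rw [Real.log_mul hc.ne' hq.ne', lip]; push_cast; ring
    have hne : Real.log (c * q) + η * Real.pi * Complex.I ≠ 0 := fun h => by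
      have := congrArg Complex.im h
      simp at this
      subst this
      simp at hη
    refine ⟨e, hne, ?_, ?_⟩
    · rw [Phi_of_ne (by rwa [e]), Complex.exp_add, exp_lip hη hq, ← Complex.ofReal_exp,
        Real.exp_log hc, e]
      congr 1; ring
    · have : (0 : ℝ) < c * q + 1 := by positivity
      exact_mod_cast this.ne'
  rw [MCut, ← exp_two_mu_cpow (lip_mem hη q), exp_two_mu (lip_mem hη q)]
  obtain ⟨-, a1, a2, a3⟩ := key a ha
  obtain ⟨-, b1, b2, b3⟩ := key b hb
  have a4 : (-(a * q) - 1 : ℂ) = -(a * q + 1) := by ring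
  have b4 : (-(b * q) - 1 : ℂ) = -(b * q + 1) := by ring
  rw [a2, b2, a4, b4]
  congr 1
  field_simp

theorem mul_MCut_eq (ha : 0 < a) (hb : 0 < b) {η : ℝ} (hη : |η| = 1) {q : ℝ} (hq : 0 < q) :
    q * MCut a b η q = -zed a b (lip η q) := by
  rw [MCut_eq ha hb hη hq, zed, psi, Complex.exp_add, exp_lip hη hq]; ring

/-- `sinh(x z) / sinh z` with `z = s M(s)`, `s = e^w`. -/
def pker (a b x : ℝ) (w : ℂ) : ℂ := Complex.sinh (x * zed a b w) / Complex.sinh (zed a b w)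

theorem PTilde_eq (ha : 0 < a) (hb : 0 < b) (x : ℝ) {s : ℂ} (hs : s ∈ Complex.slitPlane) :
    PTilde a b x s = pker a b x (Complex.log s) := by
  rw [PTilde, mul_assoc, mul_M_eq ha hb hs, pker]

/-- On the lips `s = -q`, so writing `q` for `s` changes the sign of both arguments; this cancels
because `sinh` is odd. -/
theorem PCut_eq (ha : 0 < a) (hb : 0 < b) (x : ℝ) {η : ℝ} (hη : |η| = 1) {q : ℝ} (hq : 0 < q) :
    PCut a b x η q = pker a b x (lip η q) := by
  rw [PCut, mul_assoc, mul_MCut_eq ha hb hη hq, pker, mul_neg, Complex.sinh_neg, Complex.sinh_neg,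
    neg_div_neg_eq]

theorem zed_ne_zero (w : ℂ) : zed a b w ≠ 0 := Complex.exp_ne_zero _

theorem hasDerivAt_zed {w : ℂ} (hw : w ∈ cstrip) :
    HasDerivAt (zed a b) (zed a b w * (1 + muDeriv a b w)) w :=
  ((hasDerivAt_id w).add (hasDerivAt_mu hw)).cexp

theorem one_add_muDeriv_ne_zero {w : ℂ} (hw : w ∈ cstrip) : 1 + muDeriv a b w ≠ 0 := by
  intro h
  have h1 := norm_muDeriv_le (a := a) (b := b) hw
  rw [← neg_eq_of_add_eq_zero_right h, norm_neg, norm_one] at h1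
  norm_num at h1

theorem hasDerivAt_mul_M (ha : 0 < a) (hb : 0 < b) {s : ℂ} (hs : s ∈ Complex.slitPlane) :
    HasDerivAt (fun z => z * M a b z) (M a b s * (1 + muDeriv a b (Complex.log s))) s := by
  have h := (hasDerivAt_zed (a := a) (b := b) (log_mem_cstrip s)).comp s (Complex.hasDerivAt_log hs)
  refine (h.congr_of_eventuallyEq ?_).congr_deriv ?_
  · filter_upwards [Complex.isOpen_slitPlane.mem_nhds hs] with z hz
    exact mul_M_eq ha hb hz
  · rw [← mul_M_eq ha hb hs]
    have := Complex.slitPlane_ne_zero hs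
    field_simp

/-- The solution `w` of `e^w M(e^w) = (y) i`, for `y > 0`. -/
def wsol (a b y : ℝ) : ℂ := (exists_psi_eq (a := a) (b := b) (Real.log y)).choose

theorem wsol_im_pos (y : ℝ) : 0 < (wsol a b y).im :=
  (exists_psi_eq (a := a) (b := b) (Real.log y)).choose_spec.1
theorem wsol_im_lt (y : ℝ) : (wsol a b y).im < Real.pi :=
  (exists_psi_eq (a := a) (b := b) (Real.log y)).choose_spec.2.1
theorem psi_wsol (y : ℝ) : psi a b (wsol a b y) = Real.log y + Real.pi / 2 * Complex.I :=
  (exists_psi_eq (a := a) (b := b) (Real.log y)).choose_spec.2.2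

theorem wsol_mem (y : ℝ) : wsol a b y ∈ ostrip :=
  ⟨by linarith [wsol_im_pos (a := a) (b := b) y, Real.pi_pos], wsol_im_lt y⟩

theorem exp_log_add_half_pi {y : ℝ} (hy : 0 < y) :
    Complex.exp (Real.log y + Real.pi / 2 * Complex.I) = y * Complex.I := by
  rw [Complex.exp_add, ← Complex.ofReal_exp, Real.exp_log hy, Complex.exp_pi_div_two_mul_I]

theorem zed_wsol {y : ℝ} (hy : 0 < y) : zed a b (wsol a b y) = y * Complex.I := by
  rw [zed, psi_wsol, exp_log_add_half_pi hy]

theorem eq_wsol {w : ℂ} (hw : w ∈ cstrip) {y : ℝ} (hy : 0 < y) (h : zed a b w = y * Complex.I) :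
    w = wsol a b y := by
  refine psi_injOn (a := a) (b := b) hw (ostrip_subset (wsol_mem y)) ?_
  rw [psi_wsol]
  exact psi_eq_of_zed_eq hw (by rw [h, exp_log_add_half_pi hy])

/-- The solution of `s M(s) = n i π`. -/
def spole (a b : ℝ) (n : ℕ) : ℂ := Complex.exp (wsol a b (n * Real.pi))

/-- The solution of `s M(s) = - n i π`. -/
def smole (a b : ℝ) (n : ℕ) : ℂ := (starRingEnd ℂ) (spole a b n)

theorem conj_mem_ostrip {w : ℂ} (hw : w ∈ ostrip) : (starRingEnd ℂ) w ∈ ostrip := by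
  rw [mem_ostrip] at *; simpa using hw

theorem spole_mem (n : ℕ) : spole a b n ∈ Complex.slitPlane := exp_mem_slitPlane (wsol_mem _)

theorem smole_eq (n : ℕ) : smole a b n = Complex.exp ((starRingEnd ℂ) (wsol a b (n * Real.pi))) := by
  rw [Complex.exp_conj]; rfl

theorem smole_mem (n : ℕ) : smole a b n ∈ Complex.slitPlane := by
  rw [smole_eq]; exact exp_mem_slitPlane (conj_mem_ostrip (wsol_mem _))

theorem log_spole (n : ℕ) : Complex.log (spole a b n) = wsol a b (n * Real.pi) :=
  log_exp_of_mem (wsol_mem _)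

theorem log_smole (n : ℕ) :
    Complex.log (smole a b n) = (starRingEnd ℂ) (wsol a b (n * Real.pi)) := by
  rw [smole_eq, log_exp_of_mem (conj_mem_ostrip (wsol_mem _))]

theorem npi_pos {n : ℕ} (hn : 1 ≤ n) : (0 : ℝ) < n * Real.pi :=
  mul_pos (by exact_mod_cast hn) Real.pi_pos

theorem hasDerivAt_sinh_mul_M (ha : 0 < a) (hb : 0 < b) {s : ℂ} (hs : s ∈ Complex.slitPlane) :
    HasDerivAt (fun z => Complex.sinh (z * M a b z))
      (Complex.cosh (s * M a b s) * (M a b s * (1 + muDeriv a b (Complex.log s)))) s :=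
  (hasDerivAt_mul_M ha hb hs).csinh

theorem M_ne_zero (ha : 0 < a) (hb : 0 < b) {s : ℂ} (hs : s ∈ Complex.slitPlane) : M a b s ≠ 0 := by
  rw [M_eq ha hb hs]; exact Complex.exp_ne_zero _

/-- `sinh` and `cosh` have no common zero, and `psi' = 1 + mu'` cannot vanish because `|mu'| < 1`.
-/
theorem deriv_sinh_ne_zero (ha : 0 < a) (hb : 0 < b) {s : ℂ} (hs : s ∈ Complex.slitPlane)
    (h : Complex.sinh (s * M a b s) = 0) :
    deriv (fun z => Complex.sinh (z * M a b z)) s ≠ 0 := by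
  rw [(hasDerivAt_sinh_mul_M ha hb hs).deriv]
  refine mul_ne_zero (fun h0 => ?_) (mul_ne_zero (M_ne_zero ha hb hs)
    (one_add_muDeriv_ne_zero (log_mem_cstrip s)))
  have := Complex.cosh_sq_sub_sinh_sq (s * M a b s)
  rw [h, h0] at this
  norm_num at this

theorem zed_spole (ha : 0 < a) (hb : 0 < b) {n : ℕ} (hn : 1 ≤ n) :
    spole a b n * M a b (spole a b n) = n * Complex.I * Real.pi := by
  rw [mul_M_eq ha hb (spole_mem n), log_spole, zed_wsol (npi_pos hn)]; push_cast; ring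

theorem zed_smole (ha : 0 < a) (hb : 0 < b) {n : ℕ} (hn : 1 ≤ n) :
    smole a b n * M a b (smole a b n) = -(n * Complex.I * Real.pi) := by
  rw [mul_M_eq ha hb (smole_mem n), log_smole, zed_conj (ostrip_subset (wsol_mem _)),
    zed_wsol (npi_pos hn)]
  simp; ring

theorem sinh_npi (n : ℕ) : Complex.sinh (n * Complex.I * Real.pi) = 0 := by
  rw [show (n * Complex.I * Real.pi : ℂ) = (n * Real.pi : ℂ) * Complex.I by ring, Complex.sinh_mul_I,
    Complex.sin_nat_mul_pi, zero_mul]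

theorem arePoles (ha : 0 < a) (hb : 0 < b) : ArePoles a b (spole a b) (smole a b) where
  mem_plus n _ := spole_mem n
  mem_minus n _ := smole_mem n
  eq_plus n hn := zed_spole ha hb hn
  eq_minus n hn := zed_smole ha hb hn
  unique_plus n hn s hs h := by
    rw [mul_M_eq ha hb hs] at h
    have := eq_wsol (log_mem_cstrip s) (npi_pos hn) (by rw [h]; push_cast; ring)
    rw [spole, ← this, Complex.exp_log (Complex.slitPlane_ne_zero hs)]
  unique_minus n hn s hs h := by
    rw [mul_M_eq ha hb hs] at h
    have := eq_wsol (conj_mem_cstrip (log_mem_cstrip s)) (npi_pos hn)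
      (by rw [zed_conj (log_mem_cstrip s), h]; simp; ring)
    rw [smole_eq, ← this, Complex.conj_conj, Complex.exp_log (Complex.slitPlane_ne_zero hs)]
  conj n _ := rfl
  simple_plus n hn := deriv_sinh_ne_zero ha hb (spole_mem n) (by rw [zed_spole ha hb hn, sinh_npi])
  simple_minus n hn := deriv_sinh_ne_zero ha hb (smole_mem n)
    (by rw [zed_smole ha hb hn, Complex.sinh_neg, sinh_npi, neg_zero])

/-- The zeros of `sinh` are the `kπi`, and `k = 0` is impossible because `z = e^psi` never vanishes.
The sign of `k` decides between a solution and its conjugate. As the closed strip is allowed, this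
also excludes zeros on the lips. -/
theorem exists_of_sinh_zed_eq_zero {w : ℂ} (hw : w ∈ cstrip) (h : Complex.sinh (zed a b w) = 0) :
    ∃ n : ℕ, 1 ≤ n ∧ (w = wsol a b (n * Real.pi) ∨ w = (starRingEnd ℂ) (wsol a b (n * Real.pi))) := by
  have h1 : Complex.sin (zed a b w * Complex.I) = 0 := by
    rw [Complex.sin_mul_I, h, zero_mul]
  obtain ⟨k, hk⟩ := Complex.sin_eq_zero_iff.1 h1
  have hz : zed a b w = -(k * Real.pi * Complex.I) := by
    rw [← hk, mul_assoc, Complex.I_mul_I]; ring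
  obtain ⟨n, rfl | rfl⟩ := Int.eq_nat_or_neg k
  all_goals
    have hn : 1 ≤ n := Nat.one_le_iff_ne_zero.2 fun h0 => zed_ne_zero w (by rw [hz]; simp [h0])
    refine ⟨n, hn, ?_⟩
  · right
    rw [← eq_wsol (conj_mem_cstrip hw) (npi_pos hn), Complex.conj_conj]
    rw [zed_conj hw, hz]; simp
  · left
    refine eq_wsol hw (npi_pos hn) ?_
    rw [hz]; push_cast; ring

end

/-! ### Asymptotics of `s M(s)` for large `|s|`. -/

theorem norm_exp_sub_one_ge (v : ℂ) : Real.exp v.re - 1 ≤ ‖Complex.exp v - 1‖ := by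
  have := norm_sub_norm_le (Complex.exp v) 1
  rwa [Complex.norm_exp, norm_one] at this

/-- Here `ell' - 1 = 1/(e^v - 1) - 1/v`, and each term is at most `1/Re v`. Thus `mu'`, a difference
of two values of `ell'`, tends to `0` to the right. -/
theorem norm_ellDeriv_sub_one_le {v : ℂ} (hv : v ∈ cstrip) (hr : 0 < v.re) :
    ‖ellDeriv v - 1‖ ≤ 2 / v.re := by
  have h0 : v ≠ 0 := by rintro rfl; simp at hr
  have h1 := exp_ne_one_of_strip (mem_cstrip.1 hv) h0
  have e : ellDeriv v - 1 = 1 / (Complex.exp v - 1) - 1 / v := by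
    rw [ellDeriv_eq (mem_cstrip.1 hv) h0]; field_simp; ring
  have h2 : ‖1 / (Complex.exp v - 1)‖ ≤ 1 / v.re := by
    rw [norm_div, norm_one]
    exact one_div_le_one_div_of_le hr
      (le_trans (by linarith [Real.add_one_le_exp v.re]) (norm_exp_sub_one_ge v))
  have h3 : ‖1 / v‖ ≤ 1 / v.re := by
    rw [norm_div, norm_one]
    exact one_div_le_one_div_of_le hr (Complex.re_le_norm v)
  rw [e]
  refine (norm_sub_le _ _).trans ((add_le_add h2 h3).trans_eq ?_)
  ring

/-- The term `-1/v` contributes `θ/(r² + θ²)` to the imaginary part, which dominates the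
exponentially small contribution of `1/(e^v - 1)`. The weaker bound `θ e^{-r/2}` is kept because it
becomes a power of `|s|`. -/
theorem ellDeriv_im_ge {v : ℂ} (hr : 30 ≤ v.re) (h0 : 0 ≤ v.im) (h1 : v.im ≤ Real.pi) :
    v.im * Real.exp (-v.re / 2) ≤ (ellDeriv v).im := by
  have hpi := Real.pi_lt_four
  have hv : |v.im| ≤ Real.pi := abs_le.2 ⟨by linarith [Real.pi_pos], h1⟩
  have hv0 : v ≠ 0 := by rintro rfl; simp at hr; linarith
  have hne := exp_ne_one_of_strip hv hv0
  set r := v.re with hrdef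
  set θ := v.im with hθ
  set x := Real.exp (r / 2) with hx
  have hx0 : 0 < x := Real.exp_pos _
  -- The fourth-order term of the series gives `x ≥ r⁴/384`, and `r² ≥ 900` does the rest. The
  -- number `16` stands for an upper bound of `π²`.
  have hx1 : 2 * (r ^ 2 + 16) ≤ x := by
    have := Real.pow_div_factorial_le_exp (r / 2) (by linarith) 4
    have h3 : (Nat.factorial 4 : ℝ) = 24 := by norm_num [Nat.factorial]
    rw [h3] at this
    have h4 : (900 : ℝ) ≤ r ^ 2 := by nlinarith
    nlinarith
  have hex : Real.exp r = x ^ 2 := by rw [hx, ← Real.exp_nat_mul]; congr 1; push_cast; ring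
  have hexn : Real.exp (-r / 2) = 1 / x := by
    rw [hx, one_div, ← Real.exp_neg]; congr 1; ring
  have e : ellDeriv v = 1 + 1 / (Complex.exp v - 1) - 1 / v := by
    rw [ellDeriv_eq hv hv0]; field_simp; ring
  have i1 : (1 / v).im = -θ / (r ^ 2 + θ ^ 2) := by
    rw [one_div, Complex.inv_im, Complex.normSq_apply]; congr 1; ring
  have i2 : (1 / (Complex.exp v - 1)).im = -(x ^ 2 * Real.sin θ) / ‖Complex.exp v - 1‖ ^ 2 := by
    rw [one_div, Complex.inv_im, Complex.normSq_eq_norm_sq]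
    congr 2
    simp [Complex.exp_im, ← hrdef, ← hθ, hex]
  have hn : x ^ 2 / 2 ≤ ‖Complex.exp v - 1‖ := by
    refine le_trans ?_ (norm_exp_sub_one_ge v)
    rw [← hrdef, hex]; nlinarith
  have i3 : -(4 * θ / x ^ 2) ≤ (1 / (Complex.exp v - 1)).im := by
    rw [i2, neg_div, neg_le_neg_iff, div_le_div_iff₀ (lt_of_lt_of_le (by positivity) (pow_le_pow_left₀ (by positivity) hn 2)) (by positivity)]
    have h5 : (x ^ 2 / 2) ^ 2 ≤ ‖Complex.exp v - 1‖ ^ 2 := pow_le_pow_left₀ (by positivity) hn 2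
    have h6 := Real.sin_le h0
    calc x ^ 2 * Real.sin θ * x ^ 2 ≤ x ^ 2 * θ * x ^ 2 := by gcongr
      _ = 4 * θ * (x ^ 2 / 2) ^ 2 := by ring
      _ ≤ _ := by gcongr
  have i4 : θ * (2 / x) ≤ θ / (r ^ 2 + θ ^ 2) := by
    rw [div_eq_mul_one_div θ]
    refine mul_le_mul_of_nonneg_left ?_ h0
    rw [div_le_div_iff₀ hx0 (by nlinarith)]
    nlinarith
  have i5 : 4 * θ / x ^ 2 ≤ θ * (1 / x) := by
    rw [mul_one_div, div_le_div_iff₀ (by positivity) hx0]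
    have : 4 ≤ x := by nlinarith
    calc 4 * θ * x ≤ x * θ * x := by gcongr
      _ = θ * x ^ 2 := by ring
  rw [e, Complex.sub_im, Complex.add_im, Complex.one_im, i1, hexn, zero_add, neg_div, sub_neg_eq_add]
  have : θ * (2 / x) = θ * (1 / x) + θ * (1 / x) := by ring
  linarith

section

variable {a b : ℝ}

theorem norm_muDeriv_le_of_re (ha : 0 < a) (hab : a < b) {w : ℂ} (hw : w ∈ cstrip) {R : ℝ} (hR : 0 < R)
    (h : R ≤ w.re + Real.log a) : ‖muDeriv a b w‖ ≤ 2 / R := by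
  have hl : Real.log a < Real.log b := Real.log_lt_log ha hab
  have key : ∀ c : ℝ, R ≤ w.re + c → ‖ellDeriv (w + c) - 1‖ ≤ 2 / R := fun c hc =>
    (norm_ellDeriv_sub_one_le (add_ofReal_mem_cstrip hw c) (by simp; linarith)).trans
      (div_le_div_of_nonneg_left two_pos.le hR (by simpa using hc))
  have e : muDeriv a b w = ((ellDeriv (w + Real.log a) - 1) -
    (ellDeriv (w + Real.log b) - 1)) / 2 := by rw [muDeriv]; ring
  rw [e, norm_div, Complex.norm_ofNat, div_le_iff₀ two_pos]
  exact (norm_sub_le _ _).trans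
    (by linarith [key (Real.log a) h, key (Real.log b) (by linarith)])

theorem norm_mu_sub_le_of_re (ha : 0 < a) (hab : a < b) {v w : ℂ} (hv : v ∈ cstrip) (hw : w ∈ cstrip)
    {R : ℝ} (hR : 0 < R) (h1 : R ≤ v.re + Real.log a) (h2 : R ≤ w.re + Real.log a) :
    ‖mu a b v - mu a b w‖ ≤ 2 / R * ‖v - w‖ := by
  have hconv : Convex ℝ (cstrip ∩ {w : ℂ | R - Real.log a ≤ w.re}) :=
    convex_cstrip.inter (convex_halfSpace_re_ge _)
  exact hconv.norm_image_sub_le_of_norm_hasDerivWithin_le (f' := muDeriv a b)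
    (fun x hx => (hasDerivAt_mu hx.1).hasDerivWithinAt)
    (fun x hx => norm_muDeriv_le_of_re ha hab hx.1 hR (by have := hx.2; simp at this; linarith))
    ⟨hw, by simp; linarith⟩ ⟨hv, by simp; linarith⟩

theorem ofReal_mem_cstrip (x : ℝ) : (x : ℂ) ∈ cstrip := by
  rw [mem_cstrip]; simpa using Real.pi_pos.le

theorem abs_mu_im_le (ha : 0 < a) (hab : a < b) {w : ℂ} (hw : w ∈ cstrip)
    {R : ℝ} (hR : 0 < R) (h : R ≤ w.re + Real.log a) : |(mu a b w).im| ≤ 2 / R * |w.im| := by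
  have h1 := norm_mu_sub_le_of_re ha hab hw (ofReal_mem_cstrip w.re) hR h (by simpa using h)
  have h2 : w - (w.re : ℂ) = w.im * Complex.I := by
    nth_rw 1 [← Complex.re_add_im w]; ring
  have h3 : (mu a b (w.re : ℂ)).im = 0 := mu_im_eq_zero (by simp)
  have h4 := Complex.abs_im_le_norm (mu a b w - mu a b w.re)
  rw [Complex.sub_im, h3, sub_zero] at h4
  rw [h2] at h1
  simpa using h4.trans h1

/-- The lower bound for `Im ell'` is integrated over the real segment from `log a` to `log b`. This
is where `a < b` fixes the sign: `Im mu` is opposite to `Im w`, and multiplication by `M` turns `s`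
towards the positive axis. -/
theorem mu_im_le (ha : 0 < a) (hab : a < b) {w : ℂ} (hr : 30 ≤ w.re + Real.log a) (h0 : 0 ≤ w.im)
    (h1 : w.im ≤ Real.pi) :
    (mu a b w).im ≤ -((Real.log b - Real.log a) / 2 * Real.exp (-Real.log b / 2) * w.im *
      Real.exp (-w.re / 2)) := by
  have hl : Real.log a < Real.log b := Real.log_lt_log ha hab
  have hw : w ∈ cstrip := mem_cstrip.2 (abs_le.2 ⟨by linarith [Real.pi_pos], h1⟩)
  have hd : ∀ t : ℝ, HasDerivAt (fun t : ℝ => (ell (w + t)).im) (ellDeriv (w + t)).im t := fun t => by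
    have h2 : HasDerivAt (fun z : ℂ => ell (w + z)) (ellDeriv (w + t)) t :=
      (hasDerivAt_ell (mem_cstrip.1 (add_ofReal_mem_cstrip hw t))).comp_const_add w t
    exact Complex.imCLM.hasFDerivAt.comp_hasDerivAt t h2.comp_ofReal
  have := (convex_Icc (Real.log a) (Real.log b)).mul_sub_le_image_sub_of_le_deriv
    (f := fun t : ℝ => (ell (w + t)).im) (C := w.im * Real.exp (-(w.re + Real.log b) / 2))
    (fun t _ => (hd t).continuousAt.continuousWithinAt)
    (fun t _ => (hd t).differentiableAt.differentiableWithinAt)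
    (fun t ht => by
      rw [interior_Icc] at ht
      rw [(hd t).deriv]
      refine le_trans ?_ (ellDeriv_im_ge (v := w + t) (by simp; linarith [ht.1]) (by simpa using h0)
        (by simpa using h1))
      simp only [Complex.add_im, Complex.ofReal_im, add_zero, Complex.add_re, Complex.ofReal_re]
      gcongr
      exact ht.2.le) (Real.log a) (left_mem_Icc.2 hl.le) (Real.log b) (right_mem_Icc.2 hl.le) hl.le
  have e : (mu a b w).im = ((ell (w + Real.log a)).im - (ell (w + Real.log b)).im) / 2 := by simp [mu]
  have e2 : Real.exp (-(w.re + Real.log b) / 2) = Real.exp (-Real.log b / 2) * Real.exp (-w.re / 2) := by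
    rw [← Real.exp_add]; congr 1; ring
  rw [e2] at this
  rw [e]
  nlinarith

theorem psi_re (w : ℂ) : (psi a b w).re = w.re + (mu a b w).re := by simp [psi]
theorem psi_im (w : ℂ) : (psi a b w).im = w.im + (mu a b w).im := by simp [psi]

theorem zed_re (w : ℂ) : (zed a b w).re = Real.exp (psi a b w).re * Real.cos (psi a b w).im := by
  rw [zed, Complex.exp_re]

theorem norm_zed (w : ℂ) : ‖zed a b w‖ = Real.exp (psi a b w).re := by rw [zed, Complex.norm_exp]

theorem abs_mu_re_le {w : ℂ} (hw : w ∈ cstrip) : |(mu a b w).re| ≤ |Real.log a - Real.log b| :=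
  (Complex.abs_re_le_norm _).trans (norm_mu_le hw)

theorem norm_zed_le {w : ℂ} (hw : w ∈ cstrip) :
    ‖zed a b w‖ ≤ Real.exp |Real.log a - Real.log b| * Real.exp w.re := by
  rw [norm_zed, ← Real.exp_add, psi_re]
  refine Real.exp_le_exp.2 ?_
  linarith [le_of_abs_le (abs_mu_re_le (a := a) (b := b) hw)]

theorem exp_psi_re_ge {w : ℂ} (hw : w ∈ cstrip) :
    Real.exp (-|Real.log a - Real.log b|) * Real.exp w.re ≤ Real.exp (psi a b w).re := by
  rw [← Real.exp_add, psi_re]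
  refine Real.exp_le_exp.2 ?_
  linarith [neg_le_of_abs_le (abs_mu_re_le (a := a) (b := b) hw)]

/-- Decay of the kernels: `Re z ≥ c |s|^{1/2}` in the right half-plane, and in the whole cut plane
`Re z ≥ c |s|^{1/2}` or `Re s ≤ -c |s|^{1/2}`. -/
theorem exists_re_zed_ge (ha : 0 < a) (hab : a < b) : ∃ c > 0, ∃ r0 ≥ 0, ∀ w ∈ cstrip, r0 ≤ w.re →
    (|w.im| ≤ Real.pi / 2 → c * Real.exp (w.re / 2) ≤ (zed a b w).re) ∧
    (c * Real.exp (w.re / 2) ≤ (zed a b w).re ∨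
      (Complex.exp w).re ≤ -(c * Real.exp (w.re / 2))) := by
  have hpi := Real.pi_pos
  have hl : Real.log a < Real.log b := Real.log_lt_log ha hab
  set L := |Real.log a - Real.log b| with hL
  -- The minimum with `1` ensures `κ ≤ 1` below.
  set c0 := min 1 ((Real.log b - Real.log a) / 2 * Real.exp (-Real.log b / 2)) with hc0
  have hc0p : 0 < c0 := lt_min one_pos (mul_pos (by linarith) (Real.exp_pos _))
  have hc01 : c0 ≤ 1 := min_le_left _ _
  -- The threshold `128` makes `|Im mu| ≤ |Im w|/64`, so `Im psi` keeps the sign of `Im w`; it also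
  -- exceeds the `30` required by `mu_im_le`.
  refine ⟨Real.exp (-L) * c0 / 2, by positivity, max 0 (128 - Real.log a), le_max_left _ _, ?_⟩
  have main : ∀ w ∈ cstrip, max 0 (128 - Real.log a) ≤ w.re → 0 ≤ w.im →
      (|w.im| ≤ Real.pi / 2 → Real.exp (-L) * c0 / 2 * Real.exp (w.re / 2) ≤ (zed a b w).re) ∧
    (Real.exp (-L) * c0 / 2 * Real.exp (w.re / 2) ≤ (zed a b w).re ∨
      (Complex.exp w).re ≤ -(Real.exp (-L) * c0 / 2 * Real.exp (w.re / 2))) := by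
    intro w hw hr h0
    have hw1 : w.im ≤ Real.pi := hw.2
    have hr0 : 0 ≤ w.re := (le_max_left _ _).trans hr
    have hr1 : 128 ≤ w.re + Real.log a := by linarith [(le_max_right _ _).trans hr]
    -- The relative amount, of order `|s|^{-1/2}`, by which `mu` diminishes the argument.
    set κ := c0 * Real.exp (-w.re / 2) with hκ
    have hκ0 : 0 < κ := by positivity
    have hκ1 : κ ≤ 1 := by
      have : Real.exp (-w.re / 2) ≤ 1 := Real.exp_le_one_iff.2 (by linarith)
      nlinarith [Real.exp_pos (-w.re / 2)]
    have hmu : (mu a b w).im ≤ -(κ * w.im) := by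
      refine (mu_im_le ha hab (by linarith) h0 hw1).trans (neg_le_neg ?_)
      have : c0 ≤ (Real.log b - Real.log a) / 2 * Real.exp (-Real.log b / 2) := min_le_right _ _
      calc κ * w.im = c0 * w.im * Real.exp (-w.re / 2) := by rw [hκ]; ring
        _ ≤ _ := by gcongr
    have hmu2 := abs_mu_im_le ha hab hw (by norm_num : (0 : ℝ) < 128) hr1
    rw [abs_of_nonneg h0] at hmu2
    have hpsi0 : 0 ≤ (psi a b w).im := by
      rw [psi_im]; linarith [neg_le_of_abs_le hmu2]
    have hE := exp_psi_re_ge (a := a) (b := b) hw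
    rw [← hL] at hE
    have hexp : Real.exp w.re * Real.exp (-w.re / 2) = Real.exp (w.re / 2) := by
      rw [← Real.exp_add]; congr 1; ring
    -- If the argument of `z` stays below `π/2` by `πκ/4`, Jordan's inequality gives a cosine of at
    -- least `κ/2`, and `|z| κ` is at least of order `|s|^{1/2}`.
    have good : (psi a b w).im ≤ Real.pi / 2 * (1 - κ / 2) →
        Real.exp (-L) * c0 / 2 * Real.exp (w.re / 2) ≤ (zed a b w).re := by
      intro h
      have hcos : κ / 2 ≤ Real.cos (psi a b w).im := by
        have := Real.one_sub_mul_le_cos hpsi0 (h.trans (by nlinarith))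
        refine le_trans ?_ this
        have : 2 / Real.pi * (psi a b w).im ≤ 2 / Real.pi * (Real.pi / 2 * (1 - κ / 2)) := by gcongr
        have h2 : 2 / Real.pi * (Real.pi / 2 * (1 - κ / 2)) = 1 - κ / 2 := by field_simp
        linarith
      rw [zed_re]
      calc Real.exp (-L) * c0 / 2 * Real.exp (w.re / 2)
          = (Real.exp (-L) * Real.exp w.re) * (κ / 2) := by rw [hκ, ← hexp]; ring
        _ ≤ _ := by gcongr
    constructor
    · intro h
      rw [abs_of_nonneg h0] at h
      refine good ?_
      rw [psi_im]
      nlinarith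
    -- Up to the angle `(π/2)(1 + κ/2)` the turn by `κ Im w` still brings the argument of `z` below
    -- `(π/2)(1 - κ/2)`. Beyond this angle `s` itself lies far enough in the left half-plane.
    · by_cases h : w.im ≤ Real.pi / 2 * (1 + κ / 2)
      · left
        refine good ?_
        rw [psi_im]
        by_cases h2 : w.im ≤ Real.pi / 2
        · nlinarith
        · nlinarith
      · right
        push Not at h
        have hη : Real.cos w.im ≤ -(κ / 2) := by
          have e : Real.cos w.im = -Real.sin (w.im - Real.pi / 2) := by
            rw [Real.sin_sub_pi_div_two, neg_neg]
          rw [e, neg_le_neg_iff]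
          have h3 : 0 ≤ w.im - Real.pi / 2 := by nlinarith
          refine le_trans ?_ (Real.mul_le_sin h3 (by linarith))
          have : 2 / Real.pi * (Real.pi / 2 * (κ / 2)) ≤ 2 / Real.pi * (w.im - Real.pi / 2) := by
            gcongr; linarith
          have h2 : 2 / Real.pi * (Real.pi / 2 * (κ / 2)) = κ / 2 := by field_simp
          linarith
        rw [Complex.exp_re]
        have hL1 : Real.exp (-L) ≤ 1 := Real.exp_le_one_iff.2 (by simp [hL])
        calc Real.exp w.re * Real.cos w.im ≤ Real.exp w.re * (-(κ / 2)) := by gcongr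
          _ = -(1 * c0 / 2 * Real.exp (w.re / 2)) := by rw [hκ, ← hexp]; ring
          _ ≤ _ := by gcongr
  intro w hw hr
  rcases le_total 0 w.im with h | h
  · exact main w hw hr h
  · have := main _ (conj_mem_cstrip hw) (by simpa using hr) (by simpa using h)
    simpa [zed_conj hw, Complex.exp_conj] using this

theorem norm_sinh_ge {z : ℂ} (h : 1 ≤ |z.re|) : Real.exp |z.re| / 4 ≤ ‖Complex.sinh z‖ := by
  have h2 : Real.exp |z.re| / 2 ≤ Real.exp |z.re| - Real.exp (-|z.re|) := by
    have h3 : Real.exp (-|z.re|) ≤ 1 := Real.exp_le_one_iff.2 (by linarith)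
    have h4 : 2 ≤ Real.exp |z.re| := by linarith [Real.add_one_le_exp |z.re|]
    linarith
  have key : Real.exp |z.re| - Real.exp (-|z.re|) ≤ ‖Complex.exp z - Complex.exp (-z)‖ := by
    rcases abs_cases z.re with h3 | h3
    · rw [h3.1]
      have := norm_sub_norm_le (Complex.exp z) (Complex.exp (-z))
      simpa [Complex.norm_exp] using this
    · rw [h3.1, neg_neg]
      have := norm_sub_norm_le (Complex.exp (-z)) (Complex.exp z)
      rw [norm_sub_rev] at this
      simpa [Complex.norm_exp] using this
  rw [Complex.sinh, norm_div, Complex.norm_ofNat]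
  linarith

theorem norm_sinh_ge_abs_sin (z : ℂ) : |Real.sin z.im| ≤ ‖Complex.sinh z‖ := by
  have e : (Complex.sinh z).im = Real.cosh z.re * Real.sin z.im := by
    rw [Complex.sinh, Complex.div_ofNat_im, Complex.sub_im, Complex.exp_im, Complex.exp_im, Real.cosh_eq]
    simp; ring
  refine le_trans ?_ (Complex.abs_im_le_norm _)
  rw [e, abs_mul, abs_of_pos (Real.cosh_pos _)]
  nlinarith [Real.one_le_cosh z.re, abs_nonneg (Real.sin z.im)]

/-- Jordan's inequality below `π/2`; above it, reflection gives `sin ≥ 1/2` while the argument is at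
most `3π/4 < 5/2`. -/
theorem abs_le_five_mul_abs_sin {x : ℝ} (h : |x| ≤ 3 * Real.pi / 4) : |x| ≤ 5 * |Real.sin x| := by
  have hpi := Real.pi_pos
  have hpi3 := Real.pi_gt_three
  have hpi4 := Real.pi_lt_four
  have key : ∀ y : ℝ, 0 ≤ y → y ≤ 3 * Real.pi / 4 → y ≤ 5 * Real.sin y := by
    intro y h0 h1
    by_cases h2 : y ≤ Real.pi / 2
    · have := Real.mul_le_sin h0 h2
      have h3 : 1 / 2 * y ≤ 2 / Real.pi * y := by
        refine mul_le_mul_of_nonneg_right ?_ h0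
        rw [div_le_div_iff₀ two_pos hpi]; linarith
      linarith
    · rw [← Real.sin_pi_sub]
      have := Real.mul_le_sin (x := Real.pi - y) (by linarith) (by linarith)
      have h3 : 2 / Real.pi * (Real.pi / 4) ≤ 2 / Real.pi * (Real.pi - y) := by
        gcongr; linarith
      have h4 : 2 / Real.pi * (Real.pi / 4) = 1 / 2 := by field_simp; norm_num
      have h5 : Real.pi < 3.15 := Real.pi_lt_d2
      linarith
  rcases abs_cases x with h1 | h1
  · rw [h1.1] at h ⊢
    exact (key x h1.2 h).trans (by linarith [le_abs_self (Real.sin x)])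
  · rw [h1.1] at h ⊢
    have := key (-x) (by linarith) h
    rw [Real.sin_neg] at this
    linarith [neg_le_abs (Real.sin x)]

end

/-! ### Circles between the poles, and the location of the poles. -/

section

variable {a b : ℝ}

theorem wsol_re (y : ℝ) : (wsol a b y).re = Real.log y - (mu a b (wsol a b y)).re := by
  have := congrArg Complex.re (psi_wsol (a := a) (b := b) y)
  rw [psi_re] at this
  simp at this
  linarith

theorem abs_wsol_re_sub_le (y : ℝ) :
    |(wsol a b y).re - Real.log y| ≤ |Real.log a - Real.log b| := by
  rw [wsol_re, sub_sub_cancel_left, abs_neg]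
  exact abs_mu_re_le (ostrip_subset (wsol_mem y))

theorem tendsto_wsol_re : Tendsto (fun y => (wsol a b y).re) atTop atTop := by
  refine tendsto_atTop_mono (fun y => ?_)
    (tendsto_atTop_add_const_right _ (-|Real.log a - Real.log b|) Real.tendsto_log_atTop)
  have := abs_le.1 (abs_wsol_re_sub_le (a := a) (b := b) y)
  linarith [this.1]

/-- The radii (in logarithmic coordinates) of circles that stay away from the poles. -/
def arcRe (a b : ℝ) (n : ℕ) : ℝ := (wsol a b ((n + 1 / 2) * Real.pi)).re

theorem tendsto_arcRe : Tendsto (arcRe a b) atTop atTop := by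
  refine tendsto_wsol_re.comp (Tendsto.atTop_mul_const Real.pi_pos ?_)
  exact tendsto_atTop_add_const_right _ _ tendsto_natCast_atTop_atTop

theorem sin_natCast_add_half_mul_pi_sub {n : ℕ} {d : ℝ} :
    |Real.sin ((n + 1 / 2) * Real.pi + d)| = |Real.cos d| := by
  have e : (n + 1 / 2) * Real.pi + d = (d + Real.pi / 2) + n * Real.pi := by ring
  rw [e, Real.sin_add_nat_mul_pi, Real.sin_add_pi_div_two, abs_mul]
  simp

/-- The circle passes through the point `w'` where `z = Yi`, `Y = (n + 1/2)π`. If `|Re z| ≥ 1` the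
bound is elementary. Otherwise write `z = Yi e^ζ`, where `ζ` is close to `iΔ`, `Δ = Im w - Im w'`:
then `|Re z| < 1` forces `Δ = O(1/Y)`, so `Im z` stays within `1/2` of `Y`. There `|sin (Im z)| ≥
7/8`, which exceeds `e/4`. -/
theorem exists_arc_bound (ha : 0 < a) (hab : a < b) : ∃ N : ℕ, ∀ n ≥ N, ∀ w ∈ cstrip,
    w.re = arcRe a b n → Real.exp |(zed a b w).re| / 4 ≤ ‖Complex.sinh (zed a b w)‖ := by
  have hpi := Real.pi_pos
  have hpi3 := Real.pi_gt_three
  have hpi4 := Real.pi_lt_four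
  obtain ⟨N1, hN1⟩ := eventually_atTop.1
    ((tendsto_arcRe (a := a) (b := b)).eventually_ge_atTop (128 - Real.log a))
  -- The index `N1` brings the Lipschitz constant of `mu` down to `2/128`; the number `4410` only
  -- has to make `12/Y` and `144/Y` small.
  refine ⟨max N1 4410, fun n hn => ?_⟩
  have hr := hN1 n (le_trans (le_max_left _ _) hn)
  have hn2 : (4410 : ℝ) ≤ n := by exact_mod_cast le_trans (le_max_right _ _) hn
  set Y := ((n : ℝ) + 1 / 2) * Real.pi with hY
  have hY0 : 4410 ≤ Y := by nlinarith
  have hYp : 0 < Y := by linarith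
  set w' := wsol a b Y with hw'
  have hw'r : w'.re = arcRe a b n := rfl
  have hw'm : w' ∈ cstrip := ostrip_subset (wsol_mem Y)
  have main : ∀ w ∈ cstrip, w.re = arcRe a b n → 0 ≤ w.im →
      Real.exp |(zed a b w).re| / 4 ≤ ‖Complex.sinh (zed a b w)‖ := by
    intro w hw hwr h0
    by_cases hbig : 1 ≤ |(zed a b w).re|
    · exact norm_sinh_ge hbig
    push Not at hbig
    set Δ := w.im - w'.im with hΔ
    set e := mu a b w - mu a b w' with he
    have hww : w - w' = Δ * Complex.I := by
      apply Complex.ext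
      · simp [hwr, hw'r]
      · simp [hΔ]
    have hen : ‖e‖ ≤ 1 / 64 * |Δ| := by
      have := norm_mu_sub_le_of_re ha hab hw hw'm (by norm_num : (0 : ℝ) < 128)
        (by rw [hwr]; linarith) (by rw [hw'r]; linarith)
      rw [hww] at this
      simp at this
      rw [he]
      linarith
    set ζ : ℂ := Δ * Complex.I + e with hζ
    have hpsi : psi a b w = psi a b w' + ζ := by
      rw [hζ, ← hww, he, psi, psi]; ring
    have hzed : zed a b w = Y * Complex.I * Complex.exp ζ := by
      rw [zed, hpsi, Complex.exp_add, ← zed, zed_wsol hYp]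
    have hζre : |ζ.re| ≤ 1 / 64 * |Δ| := by
      have : ζ.re = e.re := by simp [hζ]
      rw [this]; exact (Complex.abs_re_le_norm e).trans hen
    have hζim : |ζ.im - Δ| ≤ 1 / 64 * |Δ| := by
      have : ζ.im - Δ = e.im := by simp [hζ]
      rw [this]; exact (Complex.abs_im_le_norm e).trans hen
    have hw'i : |w'.im - Real.pi / 2| ≤ 1 / 64 * Real.pi := by
      have h1 := congrArg Complex.im (psi_wsol (a := a) (b := b) Y)
      rw [psi_im] at h1
      simp at h1
      rw [← hw'] at h1
      have h2 : w'.im - Real.pi / 2 = -(mu a b w').im := by linarith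
      rw [h2, abs_neg]
      have h3 := abs_mu_im_le ha hab hw'm (by norm_num : (0 : ℝ) < 128) (by rw [hw'r]; linarith)
      have h4 := mem_cstrip.1 hw'm
      linarith
    have hΔ1 : |Δ| ≤ 33 / 64 * Real.pi := by
      have h2 := abs_le.1 hw'i
      have h3 := hw.2
      rw [abs_le]; constructor <;> linarith
    have hζim2 : |ζ.im| ≤ 3 * Real.pi / 4 := by
      have := abs_sub_abs_le_abs_sub ζ.im Δ
      linarith
    have hζim3 : 63 / 64 * |Δ| ≤ |ζ.im| := by
      have := abs_sub_abs_le_abs_sub Δ ζ.im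
      have h2 := abs_sub_comm Δ ζ.im
      linarith
    have hsin := abs_le_five_mul_abs_sin hζim2
    have hre : (zed a b w).re = -(Y * (Real.exp ζ.re * Real.sin ζ.im)) := by
      rw [hzed]; simp [Complex.exp_im, Complex.exp_re]
    have hexp : 1 / 2 ≤ Real.exp ζ.re := by
      have h1 := Real.add_one_le_exp ζ.re
      have h2 := abs_le.1 hζre
      linarith
    have hΔY : |Δ| ≤ 11 / Y := by
      rw [hre, abs_neg, abs_mul Y, abs_mul (Real.exp _), abs_of_pos hYp, abs_of_pos (Real.exp_pos _)] at hbig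
      rw [le_div_iff₀ hYp]
      have h1 : Y * (1 / 2 * |Real.sin ζ.im|) ≤ Y * (Real.exp ζ.re * |Real.sin ζ.im|) :=
        mul_le_mul_of_nonneg_left (mul_le_mul_of_nonneg_right hexp (abs_nonneg _)) hYp.le
      have h2 : Y * (63 / 64 * |Δ|) ≤ Y * (5 * |Real.sin ζ.im|) :=
        mul_le_mul_of_nonneg_left (by linarith) hYp.le
      nlinarith
    have hζn : ‖ζ‖ ≤ 12 / Y := by
      have h1 : ‖ζ‖ ≤ |Δ| + ‖e‖ := by
        refine (norm_add_le _ _).trans_eq ?_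
        simp
      have h2 : 12 / Y = 11 / Y + 1 / Y := by ring
      have h3 : (11 : ℝ) / Y = 11 * (1 / Y) := by ring
      have h4 : 0 < 1 / Y := by positivity
      nlinarith
    have hζ1 : ‖ζ‖ ≤ 1 := hζn.trans (by rw [div_le_one hYp]; linarith)
    have hq := Complex.norm_exp_sub_one_sub_id_le hζ1
    set q := Complex.exp ζ - 1 - ζ with hqd
    have him : (zed a b w).im = Y + Y * (ζ.re + q.re) := by
      have : Complex.exp ζ = 1 + ζ + q := by rw [hqd]; ring
      rw [hzed, this]; simp; ring
    -- The leading part `iΔ` of `ζ` is imaginary and does not move `Im z` to first order. Only `Re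
    -- e`, which is at most `|Δ|/64`, and the quadratic remainder `q` contribute.
    have hd : |Y * (ζ.re + q.re)| ≤ 1 / 2 := by
      rw [abs_mul, abs_of_pos hYp]
      have h1 : |q.re| ≤ (12 / Y) ^ 2 :=
        (Complex.abs_re_le_norm q).trans (hq.trans (pow_le_pow_left₀ (norm_nonneg _) hζn 2))
      have h2 : |ζ.re + q.re| ≤ 1 / 64 * (11 / Y) + (12 / Y) ^ 2 :=
        (abs_add_le _ _).trans (add_le_add (hζre.trans (by gcongr)) h1)
      calc Y * |ζ.re + q.re| ≤ Y * (1 / 64 * (11 / Y) + (12 / Y) ^ 2) := by gcongr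
        _ = 11 / 64 + 144 / Y := by field_simp; norm_num
        _ ≤ 11 / 64 + 144 / 4410 := by gcongr
        _ ≤ 1 / 2 := by norm_num
    have hcos : 7 / 8 ≤ |Real.sin (zed a b w).im| := by
      rw [him, hY, sin_natCast_add_half_mul_pi_sub, ← hY]
      refine le_trans ?_ (le_abs_self _)
      refine le_trans ?_ (Real.one_sub_sq_div_two_le_cos)
      have := sq_le_sq' (abs_le.1 hd).1 (abs_le.1 hd).2
      linarith
    have h1 := norm_sinh_ge_abs_sin (zed a b w)
    have h2 : Real.exp |(zed a b w).re| ≤ Real.exp 1 := Real.exp_le_exp.2 hbig.le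
    have h3 := Real.exp_one_lt_d9
    linarith
  intro w hw hwr
  rcases le_total 0 w.im with h | h
  · exact main w hw hwr h
  · have := main _ (conj_mem_cstrip hw) (by simpa using hwr) (by simpa using h)
    rw [zed_conj hw, Complex.sinh_conj, Complex.conj_re, Complex.norm_conj] at this
    exact this

theorem norm_spole (n : ℕ) : ‖spole a b n‖ = Real.exp (wsol a b (n * Real.pi)).re := by
  rw [spole, Complex.norm_exp]

theorem norm_spole_ge {n : ℕ} (hn : 1 ≤ n) :
    Real.exp (-|Real.log a - Real.log b|) * n ≤ ‖spole a b n‖ := by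
  have hp := npi_pos hn
  rw [norm_spole]
  have h1 : Real.exp (-|Real.log a - Real.log b|) * (n * Real.pi) ≤
      Real.exp (wsol a b (n * Real.pi)).re := by
    nth_rw 1 [← Real.exp_log hp]
    rw [← Real.exp_add]
    refine Real.exp_le_exp.2 ?_
    linarith [(abs_le.1 (abs_wsol_re_sub_le (a := a) (b := b) (n * Real.pi))).1]
  refine le_trans ?_ h1
  have : (n : ℝ) ≤ n * Real.pi := by
    nlinarith [Real.pi_gt_three, (Nat.cast_nonneg n : (0 : ℝ) ≤ n)]
  gcongr

theorem norm_spole_le {n : ℕ} (hn : 1 ≤ n) :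
    ‖spole a b n‖ ≤ Real.exp |Real.log a - Real.log b| * (n * Real.pi) := by
  have hp := npi_pos hn
  rw [norm_spole]
  nth_rw 2 [← Real.exp_log hp]
  rw [← Real.exp_add]
  refine Real.exp_le_exp.2 ?_
  linarith [(abs_le.1 (abs_wsol_re_sub_le (a := a) (b := b) (n * Real.pi))).2]

/-- At a pole `Re z = 0`, so of the two alternatives of `exists_re_zed_ge` only `Re s ≤ -c|s|^{1/2}`
remains; the poles of small modulus are absorbed in `C`. This is what makes the residue series
converge for every `t > 0`. -/
theorem exists_spole_re_le (ha : 0 < a) (hab : a < b) : ∃ c > 0, ∃ C : ℝ, ∀ n : ℕ, 1 ≤ n →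
    (spole a b n).re ≤ C - c * Real.sqrt n := by
  obtain ⟨c, hc, r0, -, h⟩ := exists_re_zed_ge ha hab
  set L := |Real.log a - Real.log b| with hL
  refine ⟨c * Real.exp (-L / 2), by positivity, Real.exp r0 + c * Real.exp (r0 / 2), fun n hn => ?_⟩
  have h1 := norm_spole_ge (a := a) (b := b) hn
  rw [norm_spole, ← hL] at h1
  set w := wsol a b (n * Real.pi) with hw
  have h2 : Real.exp (-L / 2) * Real.sqrt n ≤ Real.exp (w.re / 2) := by
    have e1 : Real.exp (-L / 2) * Real.sqrt n = Real.sqrt (Real.exp (-L) * n) := by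
      rw [Real.sqrt_mul (Real.exp_pos _).le, Real.sqrt_eq_rpow (Real.exp (-L)), ← Real.exp_mul]
      congr 2; ring
    have e2 : Real.exp (w.re / 2) = Real.sqrt (Real.exp w.re) := by
      rw [Real.sqrt_eq_rpow (Real.exp w.re), ← Real.exp_mul]
      congr 1; ring
    rw [e1, e2]
    exact Real.sqrt_le_sqrt h1
  have h3 := Real.exp_pos r0
  by_cases hr : r0 ≤ w.re
  · rcases (h w (ostrip_subset (wsol_mem _)) hr).2 with h4 | h4
    · rw [zed_wsol (npi_pos hn)] at h4
      have : 0 < c * Real.exp (w.re / 2) := by positivity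
      simp at h4
      linarith
    · rw [spole, ← hw]
      have : 0 < c * Real.exp (r0 / 2) := by positivity
      have : c * (Real.exp (-L / 2) * Real.sqrt n) ≤ c * Real.exp (w.re / 2) := by gcongr
      linarith
  · push Not at hr
    have h4 : (spole a b n).re ≤ Real.exp w.re := by
      rw [hw, ← norm_spole]; exact Complex.re_le_norm _
    have h5 : Real.exp w.re ≤ Real.exp r0 := Real.exp_le_exp.2 hr.le
    have h6 : Real.exp (w.re / 2) ≤ Real.exp (r0 / 2) := Real.exp_le_exp.2 (by linarith)
    have h7 : c * (Real.exp (-L / 2) * Real.sqrt n) ≤ c * Real.exp (r0 / 2) :=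
      mul_le_mul_of_nonneg_left (h2.trans h6) hc.le
    linarith

theorem smole_re (n : ℕ) : (smole a b n).re = (spole a b n).re := by simp [smole]

/-- On the lips the argument of `z` is `±π + Im mu` with `|Im mu| ≤ π/64`, so `Re z ≤ -|z|/2`. The
decay rate is thus linear in `q`, and for `|x| < 1` the cut integral converges even at `t = 0`. -/
theorem exists_zed_lip_re_le (ha : 0 < a) (hab : a < b) : ∃ c > 0, ∃ r0 : ℝ, ∀ w : ℂ,
    |w.im| = Real.pi → r0 ≤ w.re → (zed a b w).re ≤ -(c * Real.exp w.re) := by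
  have hpi := Real.pi_pos
  refine ⟨Real.exp (-|Real.log a - Real.log b|) / 2, by positivity, 128 - Real.log a,
    fun w hw hr => ?_⟩
  have hwm := mem_cstrip.2 hw.le
  have hE := exp_psi_re_ge (a := a) (b := b) hwm
  have hmu2 := abs_mu_im_le ha hab hwm (by norm_num : (0 : ℝ) < 128) (by linarith)
  rw [hw] at hmu2
  have key : Real.cos (psi a b w).im ≤ -(1 / 2) := by
    have : ∃ d, |d| ≤ 2 / 128 * Real.pi ∧ Real.cos (psi a b w).im = -Real.cos d := by
      refine ⟨_, hmu2, ?_⟩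
      rcases eq_or_eq_neg_of_abs_eq hw with h | h
      · rw [psi_im, h, add_comm, Real.cos_add_pi]
      · rw [psi_im, h, neg_add_eq_sub, Real.cos_sub_pi]
    obtain ⟨d, hd, e⟩ := this
    rw [e]
    have h1 := Real.one_sub_sq_div_two_le_cos (x := d)
    have h2 : |d| ≤ 1 := by linarith [Real.pi_lt_four]
    have h3 : d ^ 2 ≤ 1 := by rw [← sq_abs]; nlinarith [abs_nonneg d]
    linarith
  rw [zed_re]
  have := Real.exp_pos (psi a b w).re
  nlinarith

end

/-! ### Residues, the keyhole contour and the passage to the Bromwich line. -/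

/-- At a simple zero `p` of `B`, the quotient `A / B` is `(A/q)(w) / (w - p)` with `A/q`
holomorphic near `p`. -/
theorem exists_simple_pole {A B : ℂ → ℂ} {p : ℂ} (hA : ∀ᶠ w in 𝓝 p, DifferentiableAt ℂ A w)
    (hB : ∀ᶠ w in 𝓝 p, DifferentiableAt ℂ B w) (h0 : B p = 0) (h1 : deriv B p ≠ 0) :
    ∃ g : ℂ → ℂ, (∀ᶠ w in 𝓝 p, DifferentiableAt ℂ g w) ∧ g p = A p / deriv B p ∧
      ∀ w, w ≠ p → A w / B w = g w / (w - p) := by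
  have hq : ∀ᶠ w in 𝓝 p, DifferentiableAt ℂ (dslope B p) w := by
    obtain ⟨U, hU, hUo, hpU⟩ := eventually_nhds_iff.1 hB
    filter_upwards [hUo.mem_nhds hpU] with w hw
    exact ((Complex.differentiableOn_dslope (hUo.mem_nhds hpU)).2
      (fun x hx => (hU x hx).differentiableWithinAt)).differentiableAt (hUo.mem_nhds hw)
  have hqp : dslope B p p = deriv B p := dslope_same B p
  have hne : ∀ᶠ w in 𝓝 p, dslope B p w ≠ 0 :=
    hq.self_of_nhds.continuousAt.eventually_ne (by rwa [hqp])
  refine ⟨fun w => A w / dslope B p w, ?_, by simp only [hqp], fun w hw => ?_⟩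
  · filter_upwards [hA, hq, hne] with w a b c using a.div b c
  · have e : B w = (w - p) * dslope B p w := by
      rw [dslope_of_ne _ hw, slope_def_field, h0, sub_zero, mul_div_cancel₀ _ (sub_ne_zero.2 hw)]
    rw [e, div_div, mul_comm]

/-- Once the principal part is subtracted, the holomorphic factor leaves a difference quotient. The
limit is the value with which the removable singularity is filled in. -/
theorem exists_tendsto_sub_simple_pole {A B : ℂ → ℂ} {p : ℂ}
    (hA : ∀ᶠ w in 𝓝 p, DifferentiableAt ℂ A w)
    (hB : ∀ᶠ w in 𝓝 p, DifferentiableAt ℂ B w) (h0 : B p = 0) (h1 : deriv B p ≠ 0) :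
    ∃ l : ℂ, Tendsto (fun w => A w / B w - (A p / deriv B p) / (w - p)) (𝓝[≠] p) (𝓝 l) := by
  obtain ⟨g, hg, hgp, hgw⟩ := exists_simple_pole hA hB h0 h1
  refine ⟨deriv g p, ?_⟩
  refine (hasDerivAt_iff_tendsto_slope.1 hg.self_of_nhds.hasDerivAt).congr' ?_
  filter_upwards [self_mem_nhdsWithin] with w hw
  rw [hgw w hw, slope_def_field, ← hgp, sub_div]

theorem hasResidue_of_simple_zero {f A B : ℂ → ℂ} {p : ℂ}
    (hA : ∀ᶠ w in 𝓝 p, DifferentiableAt ℂ A w)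
    (hB : ∀ᶠ w in 𝓝 p, DifferentiableAt ℂ B w) (h0 : B p = 0) (h1 : deriv B p ≠ 0)
    (hf : ∀ w, f w = A w / B w) : HasResidue f p (A p / deriv B p) := by
  obtain ⟨g, hg, hgp, hgw⟩ := exists_simple_pole hA hB h0 h1
  obtain ⟨ε, hε, hball⟩ := Metric.eventually_nhds_iff_ball.1 hg
  filter_upwards [Ioo_mem_nhdsGT hε] with ρ hρ
  have hd : DiffContOnCl ℂ g (Metric.ball p ρ) := by
    refine DifferentiableOn.diffContOnCl fun w hw => ?_
    refine (hball w ?_).differentiableWithinAt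
    exact Metric.closedBall_subset_ball hρ.2 (Metric.closure_ball_subset_closedBall hw)
  have h2 := hd.circleIntegral_sub_inv_smul (Metric.mem_ball_self hρ.1)
  have h3 : (∮ z in C(p, ρ), f z) = ∮ z in C(p, ρ), (z - p)⁻¹ • g z := by
    refine circleIntegral.integral_congr hρ.1.le fun z hz => ?_
    have hz' : z ≠ p := by
      rintro rfl
      simp at hz
      exact hρ.1.ne hz
    simp only [hf z, hgw z hz', smul_eq_mul]
    rw [div_eq_inv_mul]
  rw [h3, h2, smul_eq_mul, ← mul_assoc, inv_mul_cancel₀ (by simp [Real.pi_ne_zero]), one_mul, hgp]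

theorem exp_re_add_mul_I (x y : ℝ) :
    Complex.exp (x + y * Complex.I) = circleMap 0 (Real.exp x) y := by
  rw [circleMap_zero, Complex.exp_add, Complex.ofReal_exp]

/-- A vertical segment of height `2π` in the `w`-plane is a full circle in the `s`-plane;
periodicity accounts for the different starting angle. -/
theorem circle_integral_strip (g : ℂ → ℂ) (x : ℝ) :
    Complex.I * ∫ y in -Real.pi..Real.pi, g (Complex.exp (x + y * Complex.I)) *
      Complex.exp (x + y * Complex.I) = ∮ s in C(0, Real.exp x), g s := by
  have hper : Function.Periodic (fun y : ℝ => g (circleMap 0 (Real.exp x) y) *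
      circleMap 0 (Real.exp x) y) (2 * Real.pi) := fun y => by
    simp only [periodic_circleMap 0 (Real.exp x) y]
  have h := hper.intervalIntegral_add_eq (-Real.pi) 0
  simp only [zero_add] at h
  rw [show -Real.pi + 2 * Real.pi = Real.pi by ring] at h
  simp only [exp_re_add_mul_I]
  rw [h, circleIntegral, ← intervalIntegral.integral_const_mul]
  congr 1 with y
  simp only [deriv_circleMap, smul_eq_mul]
  ring

/-- In the variable `s` this is the integral of `1/(s - e^p)` over a circle about `0`, which sees
the pole or not according to its modulus. -/
theorem strip_integral_pole (x : ℝ) {p : ℂ} (hp : p.re ≠ x) :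
    Complex.I * ∫ y in -Real.pi..Real.pi, Complex.exp (x + y * Complex.I) /
      (Complex.exp (x + y * Complex.I) - Complex.exp p) =
    if p.re < x then 2 * Real.pi * Complex.I else 0 := by
  have := circle_integral_strip (fun s => (s - Complex.exp p)⁻¹) x
  simp only [← div_eq_inv_mul] at this
  rw [this]
  split_ifs with h
  · refine circleIntegral.integral_sub_inv_of_mem_ball ?_
    rw [mem_ball_zero_iff, Complex.norm_exp]
    exact Real.exp_lt_exp.2 h
  · have hx : x < p.re := lt_of_le_of_ne (not_lt.1 h) hp.symm
    have hd : DifferentiableOn ℂ (fun s => (s - Complex.exp p)⁻¹)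
        (Metric.closedBall 0 (Real.exp x)) := fun s hs => by
      refine ((differentiableAt_id.sub_const _).inv ?_).differentiableWithinAt
      rw [sub_ne_zero]
      rintro rfl
      rw [mem_closedBall_zero_iff] at hs
      simp only [Complex.norm_exp, Real.exp_le_exp] at hs
      linarith
    refine Complex.circleIntegral_eq_zero_of_differentiable_on_off_countable (Real.exp_pos x).le
      countable_empty hd.continuousOn fun z hz => ?_
    exact (hd.mono Metric.ball_subset_closedBall).differentiableAt
      (Metric.isOpen_ball.mem_nhds hz.1)

theorem exp_add_pi_I (x : ℝ) : Complex.exp (x + Real.pi * Complex.I) = -Real.exp x := by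
  rw [Complex.exp_add, Complex.exp_pi_mul_I, Complex.ofReal_exp]; ring

theorem exp_sub_pi_I (x : ℝ) : Complex.exp (x + (-Real.pi : ℝ) * Complex.I) = -Real.exp x := by
  rw [Complex.exp_add, Complex.ofReal_neg, neg_mul, Complex.exp_neg_pi_mul_I, Complex.ofReal_exp]; ring

/-- The residue theorem for a keyhole contour, in the coordinate `w = log s`. -/
theorem keyhole {N Q : ℂ → ℂ} (hNc : ContinuousOn N cstrip) (hNd : DifferentiableOn ℂ N ostrip)
    (hQ : ∀ w ∈ cstrip, DifferentiableAt ℂ Q w) {x0 x1 : ℝ} (h01 : x0 < x1) (S : Finset ℂ)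
    (hS : ∀ p ∈ S, p ∈ ostrip ∧ x0 < p.re ∧ p.re < x1 ∧ Q p = 0 ∧ deriv Q p ≠ 0)
    (hz : ∀ w ∈ cstrip, x0 ≤ w.re → w.re ≤ x1 → Q w = 0 → w ∈ S) :
    Complex.I * ∫ y in -Real.pi..Real.pi, N (x1 + y * Complex.I) / Q (x1 + y * Complex.I) *
        Complex.exp (x1 + y * Complex.I) =
      Complex.I * (∫ y in -Real.pi..Real.pi, N (x0 + y * Complex.I) / Q (x0 + y * Complex.I) *
        Complex.exp (x0 + y * Complex.I)) +
      (∫ x in x0..x1, (N (x + (-Real.pi : ℝ) * Complex.I) / Q (x + (-Real.pi : ℝ) * Complex.I) -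
        N (x + Real.pi * Complex.I) / Q (x + Real.pi * Complex.I)) * Real.exp x) +
      2 * Real.pi * Complex.I * ∑ p ∈ S, N p * Complex.exp p / deriv Q p := by
  have hpi := Real.pi_pos
  set f : ℂ → ℂ := fun w => N w / Q w * Complex.exp w with hf
  set r : ℂ → ℂ := fun p => N p * Complex.exp p / deriv Q p with hr
  -- The principal parts are taken in the form `e^w/(e^w - e^p)`. These are `2πi`-periodic, so they
  -- cancel between the two horizontal sides, and their vertical integrals are given by
  -- `strip_integral_pole`.
  set G : ℂ → ℂ := fun w => ∑ p ∈ S, r p * (Complex.exp w / (Complex.exp w - Complex.exp p)) with hG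
  have hexp_ne : ∀ p ∈ S, ∀ w ∈ cstrip, w ≠ p → Complex.exp w - Complex.exp p ≠ 0 := by
    intro p hp w hw hwp h
    obtain ⟨k, hk⟩ := Complex.exp_eq_exp_iff_exists_int.1 (sub_eq_zero.1 h)
    have h1 := congrArg Complex.im hk
    simp at h1
    have h2 := abs_lt.1 (mem_ostrip.1 (hS p hp).1)
    have h3 := abs_le.1 (mem_cstrip.1 hw)
    have l1 : (-1 : ℝ) < k := by by_contra hcon; push Not at hcon; nlinarith
    have l2 : (k : ℝ) < 1 := by by_contra hcon; push Not at hcon; nlinarith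
    have l1' : (-1 : ℤ) < k := by exact_mod_cast l1
    have l2' : k < (1 : ℤ) := by exact_mod_cast l2
    have : k = 0 := by omega
    exact hwp (by rw [hk, this]; simp)
  have hlim : ∀ p ∈ S, ∃ l, Tendsto (fun w => f w - G w) (𝓝[≠] p) (𝓝 l) := by
    intro p hp
    obtain ⟨h1, h2, h3, h4, h5⟩ := hS p hp
    have hno : ∀ᶠ w in 𝓝 p, w ∈ ostrip := isOpen_ostrip.mem_nhds h1
    obtain ⟨l1, hl1⟩ := exists_tendsto_sub_simple_pole (A := fun w => N w * Complex.exp w) (B := Q)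
      (by filter_upwards [hno] with w hw
          exact ((hNd w hw).differentiableAt (isOpen_ostrip.mem_nhds hw)).mul
            Complex.differentiableAt_exp)
      (by filter_upwards [hno] with w hw using hQ w (ostrip_subset hw)) h4 h5
    have hde : deriv (fun w => Complex.exp w - Complex.exp p) p = Complex.exp p := by simp
    obtain ⟨l2, hl2⟩ := exists_tendsto_sub_simple_pole (A := fun w => r p * Complex.exp w)
      (B := fun w => Complex.exp w - Complex.exp p) (p := p)
      (Eventually.of_forall fun w => Complex.differentiableAt_exp.const_mul _)
      (Eventually.of_forall fun w => Complex.differentiableAt_exp.sub_const _) (sub_self _)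
      (by rw [hde]; exact Complex.exp_ne_zero _)
    rw [hde, mul_div_cancel_right₀ _ (Complex.exp_ne_zero p)] at hl2
    have hrest : ContinuousAt (fun w => ∑ p' ∈ S.erase p, r p' *
        (Complex.exp w / (Complex.exp w - Complex.exp p'))) p := by
      refine tendsto_finsetSum _ fun p' hp' => ?_
      rw [Finset.mem_erase] at hp'
      exact ContinuousAt.mul continuousAt_const (ContinuousAt.div (by fun_prop) (by fun_prop)
        (hexp_ne p' hp'.2 p (ostrip_subset h1) hp'.1.symm))
    refine ⟨_, ((hl1.sub hl2).sub (hrest.tendsto.mono_left nhdsWithin_le_nhds)).congr fun w => ?_⟩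
    simp only [hf, hG]
    rw [← Finset.add_sum_erase S _ hp]
    ring
  choose! l hl using hlim
  set R : ℂ → ℂ := fun w => if w ∈ S then l w else f w - G w with hR
  have hfcont : ∀ w ∈ cstrip, x0 ≤ w.re → w.re ≤ x1 → w ∉ S → ContinuousWithinAt f cstrip w := by
    intro w hw h1 h2 h3
    exact ((hNc w hw).div (hQ w hw).continuousAt.continuousWithinAt (fun h => h3 (hz w hw h1 h2 h))).mul
      Complex.continuous_exp.continuousWithinAt
  have hGdiff : ∀ w ∈ cstrip, w ∉ S → DifferentiableAt ℂ G w := by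
    intro w hw h3
    simp only [hG]
    refine DifferentiableAt.fun_sum fun p hp => ?_
    exact (Complex.differentiableAt_exp.div (Complex.differentiableAt_exp.sub_const _)
      (hexp_ne p hp w hw (by rintro rfl; exact h3 hp))).const_mul _
  have hSc : ∀ w ∉ S, ∀ᶠ v in 𝓝 w, v ∉ S := fun w hw => S.finite_toSet.isClosed.isOpen_compl.mem_nhds hw
  have hRect : ((uIcc x0 x1) ×ℂ (uIcc (-Real.pi) Real.pi)) ⊆ cstrip := by
    intro w hw
    rw [Complex.mem_reProdIm, uIcc_of_le (by linarith : -Real.pi ≤ Real.pi)] at hw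
    exact hw.2
  have hrect := Complex.integral_boundary_rect_eq_zero_of_differentiable_on_off_countable R
    (x0 + (-Real.pi : ℝ) * Complex.I) (x1 + Real.pi * Complex.I) S S.countable_toSet
    (by
      simp only [Complex.add_re, Complex.ofReal_re, Complex.re_ofReal_mul, Complex.I_re, mul_zero,
        add_zero, Complex.add_im, Complex.ofReal_im, Complex.im_ofReal_mul, Complex.I_im, mul_one, zero_add]
      intro w hw
      have hwc := hRect hw
      rw [Complex.mem_reProdIm, uIcc_of_le h01.le] at hw
      by_cases hwS : w ∈ S
      · have : ContinuousAt R w := by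
          rw [continuousAt_iff_punctured_nhds]
          have e : R w = l w := by simp [hR, hwS]
          rw [e]
          refine (hl w hwS).congr' ?_
          have : ∀ᶠ v in 𝓝[≠] w, v ∉ S.erase w :=
            nhdsWithin_le_nhds ((S.erase w).finite_toSet.isClosed.isOpen_compl.mem_nhds (by simp))
          filter_upwards [this, self_mem_nhdsWithin] with v hv hv2
          have : v ∉ S := fun h => hv (Finset.mem_erase.2 ⟨hv2, h⟩)
          simp [hR, this]
        exact this.continuousWithinAt
      · have h1 : ContinuousWithinAt (fun w => f w - G w) cstrip w :=
          (hfcont w hwc hw.1.1 hw.1.2 hwS).sub (hGdiff w hwc hwS).continuousAt.continuousWithinAt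
        refine (h1.congr_of_eventuallyEq ?_ (by simp [hR, hwS])).mono hRect
        filter_upwards [nhdsWithin_le_nhds (hSc w hwS)] with v hv
        simp [hR, hv])
    (by
      simp only [Complex.add_re, Complex.ofReal_re, Complex.re_ofReal_mul, Complex.I_re, mul_zero,
        add_zero, Complex.add_im, Complex.ofReal_im, Complex.im_ofReal_mul, Complex.I_im, mul_one, zero_add]
      rw [min_eq_left h01.le, max_eq_right h01.le, min_eq_left (by linarith : -Real.pi ≤ Real.pi),
        max_eq_right (by linarith : -Real.pi ≤ Real.pi)]
      rintro w ⟨hw, hwS⟩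
      have hwo : w ∈ ostrip := hw.2
      have hwc := ostrip_subset hwo
      have h1 : DifferentiableAt ℂ (fun w => f w - G w) w :=
        ((((hNd w hwo).differentiableAt (isOpen_ostrip.mem_nhds hwo)).div (hQ w hwc)
          (fun h => hwS (hz w hwc hw.1.1.le hw.1.2.le h))).mul Complex.differentiableAt_exp).sub
          (hGdiff w hwc hwS)
      refine h1.congr_of_eventuallyEq ?_
      filter_upwards [hSc w hwS] with v hv
      simp [hR, hv])
  simp only [Complex.add_re, Complex.ofReal_re, Complex.re_ofReal_mul, Complex.I_re, mul_zero,
        add_zero, Complex.add_im, Complex.ofReal_im, Complex.im_ofReal_mul, Complex.I_im, mul_one,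
        zero_add, smul_eq_mul] at hrect
  have im_mem : ∀ {x y : ℝ}, y ∈ Icc (-Real.pi) Real.pi → (x + y * Complex.I : ℂ) ∈ cstrip := by
    intro x y hy; simpa [cstrip] using hy
  have hnS : ∀ w : ℂ, (w.re = x0 ∨ w.re = x1 ∨ |w.im| = Real.pi) → w ∉ S := by
    intro w hw hwS
    obtain ⟨h1, h2, h3, -⟩ := hS w hwS
    rcases hw with h | h | h
    · linarith
    · linarith
    · rw [mem_ostrip] at h1; linarith
  have vert : ∀ x : ℝ, (x = x0 ∨ x = x1) →
      (∫ y in -Real.pi..Real.pi, R (x + y * Complex.I)) =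
      (∫ y in -Real.pi..Real.pi, f (x + y * Complex.I)) -
      ∑ p ∈ S, r p * ∫ y in -Real.pi..Real.pi, Complex.exp (x + y * Complex.I) /
        (Complex.exp (x + y * Complex.I) - Complex.exp p) := by
    intro x hx
    have hxS : ∀ y : ℝ, (x + y * Complex.I : ℂ) ∉ S := fun y => hnS _ (by
      rcases hx with h | h <;> simp [h])
    have hxI : x0 ≤ x ∧ x ≤ x1 := by rcases hx with h | h <;> rw [h] <;> constructor <;> linarith
    have e1 : ∀ y : ℝ, R (x + y * Complex.I) = f (x + y * Complex.I) - G (x + y * Complex.I) :=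
      fun y => by simp [hR, hxS y]
    simp only [e1]
    have hmaps : MapsTo (fun y : ℝ => (x + y * Complex.I : ℂ)) (uIcc (-Real.pi) Real.pi) cstrip := by
      intro y hy
      rw [uIcc_of_le (by linarith : -Real.pi ≤ Real.pi)] at hy
      exact im_mem hy
    have hcontI : ∀ p ∈ S, ContinuousOn (fun y : ℝ => Complex.exp (x + y * Complex.I) /
        (Complex.exp (x + y * Complex.I) - Complex.exp p)) (uIcc (-Real.pi) Real.pi) := by
      intro p hp
      refine ContinuousOn.div (by fun_prop) (by fun_prop) fun y hy => ?_
      exact hexp_ne p hp _ (hmaps hy) (fun h => hxS y (h ▸ hp))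
    rw [intervalIntegral.integral_sub, intervalIntegral.integral_finsetSum]
    · simp only [intervalIntegral.integral_const_mul]
    · intro p hp
      exact ((hcontI p hp).intervalIntegrable).const_mul _
    · refine ContinuousOn.intervalIntegrable fun y hy => ?_
      have := hfcont _ (hmaps hy) (by simpa using hxI.1) (by simpa using hxI.2) (hxS y)
      exact this.comp (f := fun y : ℝ => (x + y * Complex.I : ℂ)) (by fun_prop : Continuous fun y : ℝ => (x + y * Complex.I : ℂ)).continuousWithinAt hmaps
    · refine ContinuousOn.intervalIntegrable fun y hy => ?_
      have := (hGdiff _ (hmaps hy) (hxS y)).continuousAt.continuousWithinAt (s := cstrip)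
      exact this.comp (f := fun y : ℝ => (x + y * Complex.I : ℂ)) (by fun_prop : Continuous fun y : ℝ => (x + y * Complex.I : ℂ)).continuousWithinAt hmaps
  have hfI : ∀ c : ℝ, |c| = Real.pi → IntervalIntegrable (fun x : ℝ => R (x + c * Complex.I)) volume x0 x1 := by
    intro c hc
    have hmaps : MapsTo (fun x : ℝ => (x + c * Complex.I : ℂ)) (uIcc x0 x1) cstrip := by
      intro y hy
      rw [mem_cstrip]; simp [hc]
    refine ContinuousOn.intervalIntegrable fun x hx => ?_
    have hxS : ∀ x : ℝ, (x + c * Complex.I : ℂ) ∉ S := fun x => hnS _ (by simp [hc])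
    rw [uIcc_of_le h01.le] at hx
    have h1 : ContinuousWithinAt (fun w => f w - G w) cstrip (x + c * Complex.I) :=
      (hfcont _ (hmaps (by rwa [uIcc_of_le h01.le])) (by simpa using hx.1) (by simpa using hx.2) (hxS x)).sub
        (hGdiff _ (hmaps (by rwa [uIcc_of_le h01.le])) (hxS x)).continuousAt.continuousWithinAt
    have h2 : ContinuousWithinAt (fun x : ℝ => f (x + c * Complex.I) - G (x + c * Complex.I)) (uIcc x0 x1) x :=
      h1.comp (f := fun x : ℝ => (x + c * Complex.I : ℂ))
      (by fun_prop : Continuous fun y : ℝ => (y + c * Complex.I : ℂ)).continuousWithinAt hmaps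
    refine h2.congr (fun y hy => ?_) ?_ <;> simp [hR, hxS]
  have hor : (∫ x in x0..x1, R (x + (-Real.pi : ℝ) * Complex.I)) - ∫ x in x0..x1, R (x + Real.pi * Complex.I) =
      -∫ x in x0..x1, (N (x + (-Real.pi : ℝ) * Complex.I) / Q (x + (-Real.pi : ℝ) * Complex.I) -
        N (x + Real.pi * Complex.I) / Q (x + Real.pi * Complex.I)) * Real.exp x := by
    rw [← intervalIntegral.integral_sub (hfI _ (by rw [abs_neg, abs_of_pos hpi])) (hfI _ (abs_of_pos hpi)),
      ← intervalIntegral.integral_neg]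
    congr 1 with x
    have n1 := hnS (x + (-Real.pi : ℝ) * Complex.I) (by simp [abs_of_pos hpi])
    have n2 := hnS (x + Real.pi * Complex.I) (by simp [abs_of_pos hpi])
    simp only [hR, n1, n2, if_false, hf, hG, exp_add_pi_I, exp_sub_pi_I]
    ring
  rw [vert x0 (Or.inl rfl), vert x1 (Or.inr rfl), hor] at hrect
  have s0 : Complex.I * ∑ p ∈ S, r p * (∫ y in -Real.pi..Real.pi, Complex.exp (x0 + y * Complex.I) /
        (Complex.exp (x0 + y * Complex.I) - Complex.exp p)) = 0 := by
    rw [Finset.mul_sum]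
    refine Finset.sum_eq_zero fun p hp => ?_
    have := strip_integral_pole x0 (p := p) (hS p hp).2.1.ne'
    rw [if_neg (hS p hp).2.1.le.not_gt] at this
    rw [mul_left_comm, this, mul_zero]
  have s1 : Complex.I * ∑ p ∈ S, r p * (∫ y in -Real.pi..Real.pi, Complex.exp (x1 + y * Complex.I) /
        (Complex.exp (x1 + y * Complex.I) - Complex.exp p)) = 2 * Real.pi * Complex.I * ∑ p ∈ S, r p := by
    rw [Finset.mul_sum, Finset.mul_sum]
    refine Finset.sum_congr rfl fun p hp => ?_
    have := strip_integral_pole x1 (p := p) (hS p hp).2.2.1.ne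
    rw [if_pos (hS p hp).2.2.1] at this
    rw [mul_left_comm, this]; ring
  simp only [hf] at hrect
  linear_combination hrect + s1 - s0

/-- Cauchy's theorem for a vertical chord and the arc to its right. -/
theorem integral_arc_eq_chord {f : ℂ → ℂ} {A A' : ℝ} (hAA : A' < A) (hA : 0 < A)
    (hd : DifferentiableOn ℂ f {s | A' < s.re}) {x : ℝ} (hx : A < Real.exp x) :
    ∫ y in -Real.arccos (A / Real.exp x)..Real.arccos (A / Real.exp x),
      f (Complex.exp (x + y * Complex.I)) * Complex.exp (x + y * Complex.I) =
    ∫ ω in -Real.sqrt (Real.exp x ^ 2 - A ^ 2)..Real.sqrt (Real.exp x ^ 2 - A ^ 2),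
      f (A + ω * Complex.I) := by
  set R := Real.exp x with hR
  have hR0 : 0 < R := Real.exp_pos x
  set β := Real.arccos (A / R) with hβ
  set Y := Real.sqrt (R ^ 2 - A ^ 2) with hY
  have hAR : A / R ≤ 1 := by rw [div_le_one hR0]; exact hx.le
  have hAR0 : 0 ≤ A / R := by positivity
  have hcosβ : Real.cos β = A / R := Real.cos_arccos (by linarith) hAR
  have hβ0 : 0 ≤ β := Real.arccos_nonneg _
  have hβπ : β ≤ Real.pi := Real.arccos_le_pi _
  have hYsq : Y ^ 2 = R ^ 2 - A ^ 2 := Real.sq_sqrt (by nlinarith)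
  have hY0 : 0 ≤ Y := Real.sqrt_nonneg _
  have hsinβ : R * Real.sin β = Y := by
    rw [hβ, Real.sin_arccos, hY, ← Real.sqrt_sq hR0.le, ← Real.sqrt_mul (sq_nonneg R), Real.sqrt_sq hR0.le]
    congr 1; field_simp
  -- Centre of a disc that lies in `Re s > A'` and contains the circular segment `Re s ≥ A`, `|s| ≤
  -- R`. On the disc `f` has a primitive, so arc and chord give the same difference of its values.
  set X := R ^ 2 / (A - A') + |A'| + 1 with hX
  have hXp : A' < X := by
    have : 0 ≤ R ^ 2 / (A - A') := div_nonneg (sq_nonneg _) (by linarith)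
    linarith [le_abs_self A']
  have hsub : Metric.ball (X : ℂ) (X - A') ⊆ {s | A' < s.re} := by
    intro s hs
    rw [mem_ball_iff_norm] at hs
    have := (Complex.abs_re_le_norm (s - X)).trans_lt hs
    rw [Complex.sub_re, Complex.ofReal_re] at this
    have := (abs_lt.1 this).1
    show A' < s.re
    linarith
  have hin : ∀ s : ℂ, A ≤ s.re → ‖s‖ ≤ R → s ∈ Metric.ball (X : ℂ) (X - A') := by
    intro s h1 h2
    rw [mem_ball_iff_norm]
    refine lt_of_pow_lt_pow_left₀ 2 (by linarith) ?_
    rw [← Complex.normSq_eq_norm_sq, Complex.normSq_apply]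
    have h3 : s.re * s.re + s.im * s.im ≤ R ^ 2 := by
      rw [← Complex.normSq_apply, Complex.normSq_eq_norm_sq]
      exact pow_le_pow_left₀ (norm_nonneg _) h2 2
    simp only [Complex.sub_re, Complex.sub_im, Complex.ofReal_re, Complex.ofReal_im, sub_zero]
    have h4 : X * (A - A') = R ^ 2 + (|A'| + 1) * (A - A') := by
      rw [hX]; field_simp [(sub_pos.2 hAA).ne']; ring
    have h5 : 0 < (|A'| + 1) * (A - A') := mul_pos (by positivity) (by linarith)
    have h6 : 0 ≤ (|A'| + 1) - A' := by linarith [le_abs_self A']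
    have h7 : 0 ≤ R ^ 2 / (A - A') := div_nonneg (sq_nonneg _) (by linarith)
    have h8 : X * A ≤ X * s.re := mul_le_mul_of_nonneg_left h1 (by linarith [abs_nonneg A'])
    nlinarith [sq_nonneg A']
  obtain ⟨F, hF⟩ := (hd.mono hsub).isExactOn_ball
  have hfc : ∀ s : ℂ, A ≤ s.re → ContinuousAt f s := fun s hs =>
    (hd.differentiableAt ((isOpen_lt continuous_const Complex.continuous_re).mem_nhds
      (show A' < s.re by linarith))).continuousAt
  have earc : ∀ y : ℝ, Complex.exp (x + y * Complex.I) = R * Real.cos y + R * Real.sin y * Complex.I := by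
    intro y
    rw [Complex.exp_add, Complex.exp_mul_I, hR]
    push_cast; ring
  have hre : ∀ y : ℝ, (Complex.exp (x + y * Complex.I)).re = R * Real.cos y := by
    intro y; rw [Complex.exp_re]; simp [hR]
  have harc : ∀ y ∈ uIcc (-β) β, A ≤ (Complex.exp (x + y * Complex.I)).re := by
    intro y hy
    rw [uIcc_of_le (by linarith)] at hy
    rw [hre]
    have : Real.cos β ≤ Real.cos y := by
      rw [← Real.cos_abs y]
      exact Real.cos_le_cos_of_nonneg_of_le_pi (abs_nonneg _) hβπ (abs_le.2 hy)
    rw [hcosβ, div_le_iff₀ hR0] at this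
    linarith
  have h1 : ∫ y in -β..β, f (Complex.exp (x + y * Complex.I)) * Complex.exp (x + y * Complex.I) * Complex.I =
      F (Complex.exp (x + β * Complex.I)) - F (Complex.exp (x + (-β : ℝ) * Complex.I)) := by
    refine intervalIntegral.integral_eq_sub_of_hasDerivAt
      (f := fun y : ℝ => F (Complex.exp (x + y * Complex.I))) (fun y hy => ?_) ?_
    · have h2 : HasDerivAt (fun y : ℝ => Complex.exp (x + y * Complex.I))
          (Complex.exp (x + y * Complex.I) * (1 * Complex.I)) y :=
        (((hasDerivAt_id (y : ℂ)).mul_const Complex.I).const_add (x : ℂ)).cexp.comp_ofReal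
      have h3 := (hF _ (hin _ (harc y hy) (by rw [Complex.norm_exp]; simp [hR]))).comp y h2
      exact h3.congr_deriv (by ring)
    · refine ContinuousOn.intervalIntegrable fun y hy => ?_
      have h2 : Continuous fun y : ℝ => Complex.exp (x + y * Complex.I) := by fun_prop
      exact (((hfc _ (harc y hy)).comp (f := fun y : ℝ => Complex.exp (x + y * Complex.I))
        h2.continuousAt).mul h2.continuousAt).mul continuousAt_const |>.continuousWithinAt
  have hch : ∀ ω ∈ uIcc (-Y) Y, (A + ω * Complex.I : ℂ) ∈ Metric.ball (X : ℂ) (X - A') := by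
    intro ω hω
    rw [uIcc_of_le (by linarith)] at hω
    refine hin _ (by simp) ?_
    refine le_of_sq_le_sq ?_ hR0.le
    rw [← Complex.normSq_eq_norm_sq, Complex.normSq_add_mul_I]
    nlinarith [hω.1, hω.2]
  have h2 : ∫ ω in -Y..Y, f (A + ω * Complex.I) * Complex.I =
      F (A + Y * Complex.I) - F (A + (-Y : ℝ) * Complex.I) := by
    refine intervalIntegral.integral_eq_sub_of_hasDerivAt
      (f := fun y : ℝ => F (A + y * Complex.I)) (fun y hy => ?_) ?_
    · have h2 : HasDerivAt (fun y : ℝ => (A + y * Complex.I : ℂ)) (1 * Complex.I) y :=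
        (((hasDerivAt_id (y : ℂ)).mul_const Complex.I).const_add (A : ℂ)).comp_ofReal
      exact ((hF _ (hch y hy)).comp y h2).congr_deriv (by ring)
    · refine ContinuousOn.intervalIntegrable fun y hy => ?_
      have h2 : Continuous fun y : ℝ => (A + y * Complex.I : ℂ) := by fun_prop
      exact (((hfc _ (by simp)).comp (f := fun y : ℝ => (A + y * Complex.I : ℂ))
        h2.continuousAt).mul continuousAt_const).continuousWithinAt
  have e1 : Complex.exp (x + β * Complex.I) = A + Y * Complex.I := by
    rw [earc, hcosβ, ← hsinβ]
    have : (R : ℂ) ≠ 0 := by exact_mod_cast hR0.ne'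
    push_cast; field_simp
  have e2 : Complex.exp (x + (-β : ℝ) * Complex.I) = A + (-Y : ℝ) * Complex.I := by
    rw [earc, Real.cos_neg, Real.sin_neg, hcosβ, ← hsinβ]
    have : (R : ℂ) ≠ 0 := by exact_mod_cast hR0.ne'
    push_cast; field_simp
  rw [e1, e2, ← h2, intervalIntegral.integral_mul_const, intervalIntegral.integral_mul_const] at h1
  exact mul_right_cancel₀ Complex.I_ne_zero h1

/-- If the integrand is small on the left parts of a sequence of circles, the integrals over the
circles converge to the integral over a vertical line. -/
theorem tendsto_circle_integral {f : ℂ → ℂ} {A A' : ℝ} (hAA : A' < A) (hA : 0 < A)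
    (hd : DifferentiableOn ℂ f {s | A' < s.re})
    (hint : Integrable fun ω : ℝ => f (A + ω * Complex.I)) {g : ℂ → ℂ}
    (hg : ∀ w ∈ cstrip, A ≤ (Complex.exp w).re → g w = f (Complex.exp w) * Complex.exp w)
    {x : ℕ → ℝ} (hx : Tendsto x atTop atTop) {ε : ℕ → ℝ} (hε : Tendsto ε atTop (𝓝 0))
    (hbd : ∀ᶠ n in atTop, ∀ y ∈ Icc (-Real.pi) Real.pi, (Complex.exp (x n + y * Complex.I)).re ≤ A →
      ‖g (x n + y * Complex.I)‖ ≤ ε n)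
    (hgc : ∀ᶠ n in atTop, ContinuousOn (fun y : ℝ => g (x n + y * Complex.I)) (Icc (-Real.pi) Real.pi)) :
    Tendsto (fun n => ∫ y in -Real.pi..Real.pi, g (x n + y * Complex.I)) atTop
      (𝓝 (∫ ω : ℝ, f (A + ω * Complex.I))) := by
  have hpi := Real.pi_pos
  have hR : Tendsto (fun n => Real.exp (x n)) atTop atTop := Real.tendsto_exp_atTop.comp hx
  have hYt : Tendsto (fun n => Real.sqrt (Real.exp (x n) ^ 2 - A ^ 2)) atTop atTop := by
    refine Real.tendsto_sqrt_atTop.comp ?_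
    exact tendsto_atTop_add_const_right _ _ ((tendsto_pow_atTop two_ne_zero).comp hR)
  have hchord := intervalIntegral_tendsto_integral hint (tendsto_neg_atTop_atBot.comp hYt) hYt
  have hrest : Tendsto (fun n => 4 * Real.pi * |ε n|) atTop (𝓝 0) := by
    have := hε.abs.const_mul (4 * Real.pi); simpa using this
  refine hchord.congr_dist (squeeze_zero' (Eventually.of_forall fun _ => dist_nonneg) ?_ hrest)
  filter_upwards [hbd, hgc, hR.eventually_gt_atTop A] with n hbd hgc hxA
  have hR0 := Real.exp_pos (x n)
  -- The angle at which the circle meets the line `Re s = A`: inside `|y| ≤ β` the arc is exchanged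
  -- for the chord, outside the smallness hypothesis applies.
  set β := Real.arccos (A / Real.exp (x n)) with hβ
  have hβ0 : 0 ≤ β := Real.arccos_nonneg _
  have hβπ : β ≤ Real.pi := Real.arccos_le_pi _
  have hcosβ : Real.cos β = A / Real.exp (x n) :=
    Real.cos_arccos (by have : 0 ≤ A / Real.exp (x n) := by positivity
                        linarith) (by rw [div_le_one hR0]; exact hxA.le)
  have hre : ∀ y : ℝ, (Complex.exp (x n + y * Complex.I)).re = Real.exp (x n) * Real.cos y := by
    intro y; rw [Complex.exp_re]; simp
  have hmem : ∀ y ∈ Icc (-Real.pi) Real.pi, (x n + y * Complex.I : ℂ) ∈ cstrip := fun y hy => by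
    simpa [cstrip] using hy
  have hII : ∀ u v : ℝ, u ∈ Icc (-Real.pi) Real.pi → v ∈ Icc (-Real.pi) Real.pi →
      IntervalIntegrable (fun y : ℝ => g (x n + y * Complex.I)) volume u v := fun u v hu hv =>
    (hgc.mono ((convex_Icc _ _).ordConnected.uIcc_subset hu hv)).intervalIntegrable
  have m1 : -Real.pi ∈ Icc (-Real.pi) Real.pi := ⟨le_rfl, by linarith⟩
  have m2 : -β ∈ Icc (-Real.pi) Real.pi := ⟨by linarith, by linarith⟩
  have m3 : β ∈ Icc (-Real.pi) Real.pi := ⟨by linarith, by linarith⟩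
  have m4 : Real.pi ∈ Icc (-Real.pi) Real.pi := ⟨by linarith, le_rfl⟩
  have hmid : ∫ y in -β..β, g (x n + y * Complex.I) = ∫ ω in
      -Real.sqrt (Real.exp (x n) ^ 2 - A ^ 2)..Real.sqrt (Real.exp (x n) ^ 2 - A ^ 2),
      f (A + ω * Complex.I) := by
    rw [← integral_arc_eq_chord hAA hA hd hxA]
    refine intervalIntegral.integral_congr fun y hy => ?_
    rw [uIcc_of_le (by linarith)] at hy
    refine hg _ (hmem y ⟨by linarith [hy.1], by linarith [hy.2]⟩) ?_
    rw [hre]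
    have : Real.cos β ≤ Real.cos y := by
      rw [← Real.cos_abs y]
      exact Real.cos_le_cos_of_nonneg_of_le_pi (abs_nonneg _) hβπ (abs_le.2 hy)
    rw [hcosβ, div_le_iff₀ hR0] at this
    linarith
  have hleft : ∀ y ∈ Icc (-Real.pi) Real.pi, β ≤ |y| → ‖g (x n + y * Complex.I)‖ ≤ |ε n| := by
    intro y hy hyβ
    refine (hbd y hy ?_).trans (le_abs_self _)
    rw [hre]
    have : Real.cos y ≤ Real.cos β := by
      rw [← Real.cos_abs y]
      exact Real.cos_le_cos_of_nonneg_of_le_pi hβ0 (abs_le.2 hy) hyβ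
    rw [hcosβ, le_div_iff₀ hR0] at this
    linarith
  rw [← intervalIntegral.integral_add_adjacent_intervals (hII _ _ m1 m2) (hII _ _ m2 m4),
    ← intervalIntegral.integral_add_adjacent_intervals (hII _ _ m2 m3) (hII _ _ m3 m4), hmid,
    dist_eq_norm, Function.comp_def, ← norm_neg]
  have b1 : ‖∫ y in -Real.pi..-β, g (x n + y * Complex.I)‖ ≤ |ε n| * |-β - -Real.pi| := by
    refine intervalIntegral.norm_integral_le_of_norm_le_const fun y hy => ?_
    rw [uIoc_of_le (by linarith)] at hy
    exact hleft y ⟨hy.1.le, by linarith [hy.2]⟩ (by rw [abs_of_nonpos (by linarith [hy.2])]; linarith [hy.2])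
  have b2 : ‖∫ y in β..Real.pi, g (x n + y * Complex.I)‖ ≤ |ε n| * |Real.pi - β| := by
    refine intervalIntegral.norm_integral_le_of_norm_le_const fun y hy => ?_
    rw [uIoc_of_le (by linarith)] at hy
    exact hleft y ⟨by linarith [hy.1], hy.2⟩ (by rw [abs_of_nonneg (by linarith [hy.1])]; exact hy.1.le)
  have c1 : |ε n| * |-β - -Real.pi| ≤ |ε n| * (2 * Real.pi) := by
    refine mul_le_mul_of_nonneg_left ?_ (abs_nonneg _)
    rw [abs_le]; constructor <;> linarith
  have c2 : |ε n| * |Real.pi - β| ≤ |ε n| * (2 * Real.pi) := by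
    refine mul_le_mul_of_nonneg_left ?_ (abs_nonneg _)
    rw [abs_le]; constructor <;> linarith
  refine le_trans (le_of_eq (congrArg norm ?_)) ((norm_add_le
    (∫ y in -Real.pi..-β, g (x n + y * Complex.I)) (∫ y in β..Real.pi, g (x n + y * Complex.I))).trans (by linarith))
  ring

/-! ### Superpositions of exponentials and their smoothness. -/

section ExpInt

variable {Ω : Type*} [MeasurableSpace Ω]

/-- Superpositions of exponentials `e^{x Z + t S}`. -/
def expInt (μ : Measure Ω) (c Z S : Ω → ℂ) (p : ℝ × ℝ) : ℂ :=
  ∫ ω, c ω * Complex.exp (p.1 * Z ω + p.2 * S ω) ∂μ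

/-- All moments of the superposition converge absolutely on `V`. -/
structure ExpGood (μ : Measure Ω) (c Z S : Ω → ℂ) (V : Set (ℝ × ℝ)) : Prop where
  meas_c : AEStronglyMeasurable c μ
  meas_Z : AEStronglyMeasurable Z μ
  meas_S : AEStronglyMeasurable S μ
  integrable : ∀ p ∈ V, ∀ i j : ℕ, Integrable (fun ω => ‖c ω‖ * ‖Z ω‖ ^ i * ‖S ω‖ ^ j *
    Real.exp (p.1 * (Z ω).re + p.2 * (S ω).re)) μ

variable {μ : Measure Ω} {c Z S : Ω → ℂ} {V : Set (ℝ × ℝ)}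

/-- Because all moments are required, the class is stable under multiplication of the amplitude by
`Z` (and by `S`). These products are the amplitudes of the partial derivatives. -/
theorem ExpGood.mul_Z (h : ExpGood μ c Z S V) : ExpGood μ (fun ω => c ω * Z ω) Z S V where
  meas_c := h.meas_c.mul h.meas_Z
  meas_Z := h.meas_Z
  meas_S := h.meas_S
  integrable p hp i j := by
    refine (h.integrable p hp (i + 1) j).congr (Eventually.of_forall fun ω => ?_)
    simp only [norm_mul, pow_succ]; ring

theorem ExpGood.mul_S (h : ExpGood μ c Z S V) : ExpGood μ (fun ω => c ω * S ω) Z S V where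
  meas_c := h.meas_c.mul h.meas_S
  meas_Z := h.meas_Z
  meas_S := h.meas_S
  integrable p hp i j := by
    refine (h.integrable p hp i (j + 1)).congr (Eventually.of_forall fun ω => ?_)
    simp only [norm_mul, pow_succ]; ring

theorem norm_cexp_lin (x t : ℝ) (z s : ℂ) :
    ‖Complex.exp (x * z + t * s)‖ = Real.exp (x * z.re + t * s.re) := by
  rw [Complex.norm_exp]; simp

theorem ExpGood.meas_integrand (h : ExpGood μ c Z S V) (p : ℝ × ℝ) :
    AEStronglyMeasurable (fun ω => c ω * Complex.exp (p.1 * Z ω + p.2 * S ω)) μ :=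
  h.meas_c.mul (Complex.continuous_exp.comp_aestronglyMeasurable
    ((h.meas_Z.const_mul _).add (h.meas_S.const_mul _)))

theorem ExpGood.integrable_integrand (h : ExpGood μ c Z S V) {p : ℝ × ℝ} (hp : p ∈ V) :
    Integrable (fun ω => c ω * Complex.exp (p.1 * Z ω + p.2 * S ω)) μ := by
  refine (h.integrable p hp 0 0).mono' (h.meas_integrand p) (Eventually.of_forall fun ω => ?_)
  simp [norm_cexp_lin]

/-- Whatever the sign of `r`, one of the two end points gives a larger exponent. In two variables an
exponential on a box is therefore dominated by the sum over the four corners. -/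
theorem exp_mul_le_add {x x0 ε r : ℝ} (h : |x - x0| ≤ ε) :
    Real.exp (x * r) ≤ Real.exp ((x0 - ε) * r) + Real.exp ((x0 + ε) * r) := by
  have h1 := abs_le.1 h
  rcases le_total 0 r with hr | hr
  · have : Real.exp (x * r) ≤ Real.exp ((x0 + ε) * r) := Real.exp_le_exp.2 (by nlinarith)
    linarith [Real.exp_pos ((x0 - ε) * r)]
  · have : Real.exp (x * r) ≤ Real.exp ((x0 - ε) * r) := Real.exp_le_exp.2 (by nlinarith)
    linarith [Real.exp_pos ((x0 + ε) * r)]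

/-- The real linear form `(x, t) ↦ x z + t s`. -/
def linForm (z s : ℂ) : ℝ × ℝ →L[ℝ] ℂ :=
  (ContinuousLinearMap.fst ℝ ℝ ℝ).smulRight z + (ContinuousLinearMap.snd ℝ ℝ ℝ).smulRight s

theorem linForm_apply (z s : ℂ) (q : ℝ × ℝ) : linForm z s q = q.1 * z + q.2 * s := by
  simp [linForm]

theorem norm_linForm_le (z s : ℂ) : ‖linForm z s‖ ≤ ‖z‖ + ‖s‖ := by
  refine ContinuousLinearMap.opNorm_le_bound _ (by positivity) fun q => ?_
  rw [linForm_apply]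
  refine (norm_add_le _ _).trans ?_
  rw [norm_mul, norm_mul, Complex.norm_real, Complex.norm_real, add_mul]
  have h1 := norm_fst_le q
  have h2 := norm_snd_le q
  rw [mul_comm ‖q.1‖, mul_comm ‖q.2‖]
  gcongr

/-- `linForm` as a linear map. -/
def linFormL : ℂ × ℂ →L[ℝ] (ℝ × ℝ →L[ℝ] ℂ) :=
  LinearMap.mkContinuous
    { toFun := fun v => linForm v.1 v.2
      map_add' := fun v w => by
        refine ContinuousLinearMap.ext fun q => ?_
        rw [_root_.add_apply, linForm_apply, linForm_apply, linForm_apply]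
        simp only [Prod.fst_add, Prod.snd_add]
        ring
      map_smul' := fun r v => by
        refine ContinuousLinearMap.ext fun q => ?_
        rw [_root_.smul_apply, linForm_apply, linForm_apply]
        simp only [Prod.smul_fst, Prod.smul_snd, Complex.real_smul, RingHom.id_apply]
        ring } 2 fun v => by
      refine (norm_linForm_le _ _).trans ?_
      have h1 := norm_fst_le v
      have h2 := norm_snd_le v
      linarith

theorem hasFDerivAt_exp_lin (c z s : ℂ) (q : ℝ × ℝ) :
    HasFDerivAt (fun q : ℝ × ℝ => c * Complex.exp (q.1 * z + q.2 * s))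
      (linForm (c * z * Complex.exp (q.1 * z + q.2 * s)) (c * s * Complex.exp (q.1 * z + q.2 * s))) q := by
  have h1 : HasFDerivAt (fun q : ℝ × ℝ => (q.1 * z + q.2 * s : ℂ)) (linForm z s) q := by
    have h2 : (fun q : ℝ × ℝ => (q.1 * z + q.2 * s : ℂ)) = linForm z s :=
      funext fun q => (linForm_apply z s q).symm
    rw [h2]
    exact (linForm z s).hasFDerivAt
  refine (h1.cexp.const_mul c).congr_fderiv ?_
  refine ContinuousLinearMap.ext fun r => ?_
  rw [_root_.smul_apply, _root_.smul_apply, linForm_apply, linForm_apply,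
    smul_eq_mul, smul_eq_mul]
  ring

theorem ExpGood.integrable_box (h : ExpGood μ c Z S V) {x t : ℝ} (hp : (x, t) ∈ V) :
    Integrable (fun ω => (‖c ω‖ * ‖Z ω‖ + ‖c ω‖ * ‖S ω‖) *
      Real.exp (x * (Z ω).re + t * (S ω).re)) μ := by
  refine ((h.integrable _ hp 1 0).add (h.integrable _ hp 0 1)).congr
    (Eventually.of_forall fun ω => ?_)
  simp only [Pi.add_apply, pow_one, pow_zero, mul_one]; ring

theorem exp_lin_le_box {p q : ℝ × ℝ} {ε : ℝ} (hq : q ∈ Metric.ball p ε) (z s : ℝ) :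
    Real.exp (q.1 * z + q.2 * s) ≤ Real.exp ((p.1 - ε) * z + (p.2 - ε) * s) +
      Real.exp ((p.1 - ε) * z + (p.2 + ε) * s) + Real.exp ((p.1 + ε) * z + (p.2 - ε) * s) +
      Real.exp ((p.1 + ε) * z + (p.2 + ε) * s) := by
  rw [Metric.mem_ball, Prod.dist_eq, Real.dist_eq, Real.dist_eq, max_lt_iff] at hq
  simp only [Real.exp_add]
  calc Real.exp (q.1 * z) * Real.exp (q.2 * s)
      ≤ (Real.exp ((p.1 - ε) * z) + Real.exp ((p.1 + ε) * z)) *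
        (Real.exp ((p.2 - ε) * s) + Real.exp ((p.2 + ε) * s)) :=
        mul_le_mul (exp_mul_le_add hq.1.le) (exp_mul_le_add hq.2.le) (Real.exp_pos _).le (by positivity)
    _ = _ := by ring

/-- Differentiation under the integral sign: a small box about `p` lies in `V`, and the integrable
functions at its four corners dominate the derivatives throughout the ball. -/
theorem ExpGood.hasFDerivAt (h : ExpGood μ c Z S V) (hV : IsOpen V) {p : ℝ × ℝ} (hp : p ∈ V) :
    HasFDerivAt (expInt μ c Z S)
      (linForm (expInt μ (fun ω => c ω * Z ω) Z S p) (expInt μ (fun ω => c ω * S ω) Z S p)) p := by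
  obtain ⟨ε, hε, hball⟩ := Metric.nhds_basis_closedBall.mem_iff.1 (hV.mem_nhds hp)
  have hbox : ∀ x t : ℝ, |x - p.1| ≤ ε → |t - p.2| ≤ ε → (x, t) ∈ V := fun x t hx ht => by
    refine hball ?_
    rw [Metric.mem_closedBall, Prod.dist_eq, Real.dist_eq, Real.dist_eq]
    exact max_le hx ht
  have ae : |ε| ≤ ε := (abs_of_pos hε).le
  have hZ := h.mul_Z.integrable_integrand hp
  have hS := h.mul_S.integrable_integrand hp
  have hint : ∫ ω, linForm (c ω * Z ω * Complex.exp (p.1 * Z ω + p.2 * S ω))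
      (c ω * S ω * Complex.exp (p.1 * Z ω + p.2 * S ω)) ∂μ =
      linForm (expInt μ (fun ω => c ω * Z ω) Z S p) (expInt μ (fun ω => c ω * S ω) Z S p) := by
    have h1 := linFormL.integral_comp_comm (hZ.prodMk hS)
    rw [integral_pair hZ hS] at h1
    exact h1
  have hmeas : AEStronglyMeasurable (fun ω => linForm (c ω * Z ω * Complex.exp (p.1 * Z ω + p.2 * S ω))
      (c ω * S ω * Complex.exp (p.1 * Z ω + p.2 * S ω))) μ :=
    (linFormL.integrable_comp (hZ.prodMk hS)).aestronglyMeasurable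
  rw [← hint]
  have i1 := h.integrable_box (hbox (p.1 - ε) (p.2 - ε) (by simp [ae]) (by simp [ae]))
  have i2 := h.integrable_box (hbox (p.1 - ε) (p.2 + ε) (by simp [ae]) (by simp [ae]))
  have i3 := h.integrable_box (hbox (p.1 + ε) (p.2 - ε) (by simp [ae]) (by simp [ae]))
  have i4 := h.integrable_box (hbox (p.1 + ε) (p.2 + ε) (by simp [ae]) (by simp [ae]))
  refine hasFDerivAt_integral_of_dominated_of_fderiv_le (𝕜 := ℝ) (s := Metric.ball p ε)
    (F := fun q ω => c ω * Complex.exp (q.1 * Z ω + q.2 * S ω))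
    (F' := fun q ω => linForm (c ω * Z ω * Complex.exp (q.1 * Z ω + q.2 * S ω))
      (c ω * S ω * Complex.exp (q.1 * Z ω + q.2 * S ω)))
    (Metric.ball_mem_nhds p hε) (Eventually.of_forall fun q => h.meas_integrand q)
    (h.integrable_integrand hp) hmeas (Eventually.of_forall fun ω q hq => ?_)
    (((i1.add i2).add i3).add i4) (Eventually.of_forall fun ω q _ => hasFDerivAt_exp_lin _ _ _ q)
  refine (norm_linForm_le _ _).trans ?_
  rw [norm_mul, norm_mul, norm_mul, norm_mul, norm_cexp_lin, ← add_mul]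
  refine (mul_le_mul_of_nonneg_left (exp_lin_le_box hq _ _) (by positivity)).trans_eq ?_
  simp only [Pi.add_apply]
  ring

/-- The induction runs over all amplitudes at once, since each derivative replaces `c` by `cZ` or
`cS`. -/
theorem ExpGood.contDiffOn_nat (hV : IsOpen V) (n : ℕ) : ∀ c : Ω → ℂ, ExpGood μ c Z S V →
    ContDiffOn ℝ n (expInt μ c Z S) V := by
  induction n with
  | zero =>
    intro c h
    rw [Nat.cast_zero, contDiffOn_zero]
    exact fun p hp => (h.hasFDerivAt hV hp).continuousAt.continuousWithinAt
  | succ n ih =>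
    intro c h
    rw [Nat.cast_succ, contDiffOn_succ_iff_fderiv_of_isOpen hV]
    refine ⟨fun p hp => (h.hasFDerivAt hV hp).differentiableAt.differentiableWithinAt,
      fun h => absurd h (by simp), ?_⟩
    refine ContDiffOn.congr ?_ fun p hp => (h.hasFDerivAt hV hp).fderiv
    exact linFormL.contDiff.comp_contDiffOn ((ih _ h.mul_Z).prodMk (ih _ h.mul_S))

theorem ExpGood.contDiffOn (h : ExpGood μ c Z S V) (hV : IsOpen V) :
    ContDiffOn ℝ (⊤ : ℕ∞) (expInt μ c Z S) V :=
  contDiffOn_infty.2 fun n => ExpGood.contDiffOn_nat hV n c h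

theorem ExpGood.hasDerivAt_fst (h : ExpGood μ c Z S V) (hV : IsOpen V) {x t : ℝ} (hp : (x, t) ∈ V) :
    HasDerivAt (fun y => expInt μ c Z S (y, t)) (expInt μ (fun ω => c ω * Z ω) Z S (x, t)) x := by
  have h1 : HasDerivAt (fun y : ℝ => (y, t)) ((1 : ℝ), (0 : ℝ)) x :=
    (hasDerivAt_id x).prodMk (hasDerivAt_const x t)
  refine ((h.hasFDerivAt hV hp).comp_hasDerivAt x h1).congr_deriv ?_
  simp [linForm_apply]

theorem ExpGood.hasDerivAt_snd (h : ExpGood μ c Z S V) (hV : IsOpen V) {x t : ℝ} (hp : (x, t) ∈ V) :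
    HasDerivAt (fun r => expInt μ c Z S (x, r)) (expInt μ (fun ω => c ω * S ω) Z S (x, t)) t := by
  have h1 : HasDerivAt (fun r : ℝ => (x, r)) ((0 : ℝ), (1 : ℝ)) t :=
    (hasDerivAt_const t x).prodMk (hasDerivAt_id t)
  refine ((h.hasFDerivAt hV hp).comp_hasDerivAt t h1).congr_deriv ?_
  simp [linForm_apply]

end ExpInt

/-! ### The Bromwich integral and its Laplace transform. -/

/-- The Bromwich integral of `f` along `Re s = A`. -/
def Br (A : ℝ) (f : ℂ → ℂ) (t : ℝ) : ℂ :=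
  (2 * Real.pi : ℂ)⁻¹ * ∫ ω : ℝ, f (A + ω * Complex.I) * Complex.exp ((A + ω * Complex.I) * t)

/-- `f` is holomorphic and `O(|s|^{-α})`, `α > 1`, in the half-plane `Re s > A₀ ≥ 1`. -/
structure HalfPlane (f : ℂ → ℂ) (A₀ α C : ℝ) : Prop where
  one_le : 1 ≤ A₀
  one_lt : 1 < α
  diff : DifferentiableOn ℂ f {s | A₀ < s.re}
  bound : ∀ s : ℂ, A₀ < s.re → ‖f s‖ ≤ C * ‖s‖ ^ (-α)

namespace HalfPlane

variable {f : ℂ → ℂ} {A₀ α C : ℝ}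

theorem C_nonneg (h : HalfPlane f A₀ α C) : 0 ≤ C := by
  have h1 := h.bound ((A₀ + 1 : ℝ) : ℂ) (by simp)
  have h2 : 0 < ‖((A₀ + 1 : ℝ) : ℂ)‖ := by
    rw [norm_pos_iff]; exact_mod_cast (by linarith [h.one_le] : A₀ + 1 ≠ 0)
  have h3 := Real.rpow_pos_of_pos h2 (-α)
  by_contra hC
  push Not at hC
  nlinarith [norm_nonneg (f ((A₀ + 1 : ℝ) : ℂ))]

theorem norm_ge {A ω : ℝ} (hA : 1 ≤ A) : (1 + |ω|) / 2 ≤ ‖(A + ω * Complex.I : ℂ)‖ := by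
  have h1 := Complex.abs_re_le_norm (A + ω * Complex.I : ℂ)
  have h2 := Complex.abs_im_le_norm (A + ω * Complex.I : ℂ)
  simp at h1 h2
  linarith [le_abs_self A]

theorem bound_line (h : HalfPlane f A₀ α C) {A : ℝ} (hA : A₀ < A) (ω : ℝ) :
    ‖f (A + ω * Complex.I)‖ ≤ C * 2 ^ α * (1 + ‖ω‖) ^ (-α) := by
  have hα : 0 < α := by linarith [h.one_lt]
  refine (h.bound _ (by simpa using hA)).trans ?_
  rw [mul_assoc]
  refine mul_le_mul_of_nonneg_left ?_ h.C_nonneg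
  have h1 := norm_ge (ω := ω) (h.one_le.trans hA.le)
  have h2 : 0 < 1 + |ω| := by positivity
  calc ‖(A + ω * Complex.I : ℂ)‖ ^ (-α) ≤ ((1 + |ω|) / 2) ^ (-α) :=
        Real.rpow_le_rpow_of_nonpos (by positivity) h1 (by linarith)
    _ = 2 ^ α * (1 + ‖ω‖) ^ (-α) := by
        rw [Real.div_rpow h2.le two_pos.le, Real.rpow_neg two_pos.le, Real.norm_eq_abs]
        field_simp

theorem integrable_bd (h : HalfPlane f A₀ α C) :
    Integrable fun ω : ℝ => C * 2 ^ α * (1 + ‖ω‖) ^ (-α) :=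
  (integrable_one_add_norm (by simpa using h.one_lt)).const_mul _

theorem continuous_line (h : HalfPlane f A₀ α C) {A : ℝ} (hA : A₀ < A) :
    Continuous fun ω : ℝ => f (A + ω * Complex.I) := by
  refine continuous_iff_continuousAt.2 fun ω => ?_
  have h1 : DifferentiableAt ℂ f (A + ω * Complex.I) := h.diff.differentiableAt
    ((isOpen_lt continuous_const Complex.continuous_re).mem_nhds (by simpa using hA))
  exact h1.continuousAt.comp (f := fun ω : ℝ => (A + ω * Complex.I : ℂ))
    (by fun_prop : Continuous fun ω : ℝ => (A + ω * Complex.I : ℂ)).continuousAt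

theorem integrable_line (h : HalfPlane f A₀ α C) {A : ℝ} (hA : A₀ < A) :
    Integrable fun ω : ℝ => f (A + ω * Complex.I) :=
  h.integrable_bd.mono' (h.continuous_line hA).aestronglyMeasurable
    (Eventually.of_forall fun ω => h.bound_line hA ω)

theorem norm_exp_line (A ω t : ℝ) : ‖Complex.exp ((A + ω * Complex.I) * t)‖ = Real.exp (A * t) := by
  rw [Complex.norm_exp]; simp

theorem integrable_line_exp (h : HalfPlane f A₀ α C) {A : ℝ} (hA : A₀ < A) (t : ℝ) :
    Integrable fun ω : ℝ => f (A + ω * Complex.I) * Complex.exp ((A + ω * Complex.I) * t) := by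
  refine (h.integrable_bd.mul_const (Real.exp (A * t))).mono'
    ((h.continuous_line hA).mul (by fun_prop)).aestronglyMeasurable (Eventually.of_forall fun ω => ?_)
  rw [norm_mul, norm_exp_line]
  exact mul_le_mul_of_nonneg_right (h.bound_line hA ω) (Real.exp_pos _).le

/-- The constant does not depend on the abscissa `A`; this uniformity allows `A → ∞` in `Br_of_neg`.
-/
theorem exists_norm_Br_le (h : HalfPlane f A₀ α C) : ∃ K : ℝ, 0 ≤ K ∧ ∀ A, A₀ < A → ∀ t,
    ‖Br A f t‖ ≤ K * Real.exp (A * t) := by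
  refine ⟨(2 * Real.pi)⁻¹ * ∫ ω : ℝ, C * 2 ^ α * (1 + ‖ω‖) ^ (-α), ?_, fun A hA t => ?_⟩
  · have := h.C_nonneg
    have hpi := Real.pi_pos
    refine mul_nonneg (by positivity) (integral_nonneg fun ω => by positivity)
  · rw [Br, norm_mul, mul_assoc]
    have e : ‖(2 * Real.pi : ℂ)⁻¹‖ = (2 * Real.pi)⁻¹ := by
      rw [norm_inv, norm_mul, Complex.norm_real, Real.norm_of_nonneg Real.pi_pos.le]; simp
    rw [e, ← integral_mul_const]
    refine mul_le_mul_of_nonneg_left ?_ (by have := Real.pi_pos; positivity)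
    refine norm_integral_le_of_norm_le (h.integrable_bd.mul_const _) (Eventually.of_forall fun ω => ?_)
    rw [norm_mul, norm_exp_line]
    exact mul_le_mul_of_nonneg_right (h.bound_line hA ω) (Real.exp_pos _).le

/-- Cauchy's theorem on tall rectangles: the horizontal sides are `O(Y^{-α})`. -/
theorem Br_eq (h : HalfPlane f A₀ α C) {A A' : ℝ} (hA : A₀ < A) (hA' : A₀ < A') (t : ℝ) :
    Br A f t = Br A' f t := by
  rw [Br, Br]
  congr 1
  set g : ℂ → ℂ := fun s => f s * Complex.exp (s * t) with hg
  have hgd : DifferentiableOn ℂ g {s | A₀ < s.re} :=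
    h.diff.mul (by fun_prop : Differentiable ℂ fun s : ℂ => Complex.exp (s * t)).differentiableOn
  have t1 := intervalIntegral_tendsto_integral (h.integrable_line_exp hA t)
    tendsto_neg_atTop_atBot tendsto_id
  have t2 := intervalIntegral_tendsto_integral (h.integrable_line_exp hA' t)
    tendsto_neg_atTop_atBot tendsto_id
  have hsub : ∀ Y : ℝ, (uIcc A A' ×ℂ uIcc (-Y) Y) ⊆ {s | A₀ < s.re} := fun Y s hs => by
    have := (Complex.mem_reProdIm.1 hs).1
    rw [uIcc, mem_Icc] at this
    exact lt_of_lt_of_le (lt_min hA hA') this.1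
  have hrect : ∀ Y : ℝ, (∫ x in A..A', g (x + (-Y : ℝ) * Complex.I)) -
      (∫ x in A..A', g (x + Y * Complex.I)) + Complex.I * (∫ y in -Y..Y, g (A' + y * Complex.I)) -
      Complex.I * (∫ y in -Y..Y, g (A + y * Complex.I)) = 0 := fun Y => by
    have := Complex.integral_boundary_rect_eq_zero_of_differentiableOn g
      (A + (-Y : ℝ) * Complex.I) (A' + Y * Complex.I) (hgd.mono (by simpa using hsub Y))
    simpa using this
  have hhor : ∀ η : ℝ, |η| = 1 → Tendsto (fun Y : ℝ => ∫ x in A..A', g (x + (η * Y : ℝ) * Complex.I))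
      atTop (𝓝 0) := by
    intro η hη
    have hb : ∀ Y : ℝ, 1 ≤ Y → ‖∫ x in A..A', g (x + (η * Y : ℝ) * Complex.I)‖ ≤
        C * Y ^ (-α) * Real.exp ((|A| + |A'|) * |t|) * |A' - A| := by
      intro Y hY
      refine intervalIntegral.norm_integral_le_of_norm_le_const fun x hx => ?_
      have hx' := uIoc_subset_uIcc hx
      have hxA : A₀ < x := by
        rw [uIcc, mem_Icc] at hx'
        exact lt_of_lt_of_le (lt_min hA hA') hx'.1
      have hxa : |x| ≤ |A| + |A'| := by
        rw [uIcc, mem_Icc] at hx'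
        have h1 : -(|A| + |A'|) ≤ min A A' := le_min (by linarith [neg_abs_le A, abs_nonneg A'])
          (by linarith [neg_abs_le A', abs_nonneg A])
        have h2 : max A A' ≤ |A| + |A'| := max_le (by linarith [le_abs_self A, abs_nonneg A'])
          (by linarith [le_abs_self A', abs_nonneg A])
        exact abs_le.2 ⟨h1.trans hx'.1, hx'.2.trans h2⟩
      have hn : Y ≤ ‖(x + (η * Y : ℝ) * Complex.I : ℂ)‖ := by
        have := Complex.abs_im_le_norm (x + (η * Y : ℝ) * Complex.I : ℂ)
        simp [abs_mul, hη] at this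
        simpa using (le_abs_self Y).trans this
      simp only [hg]
      rw [norm_mul, norm_exp_line]
      refine mul_le_mul ((h.bound _ (by simpa using hxA)).trans
        (mul_le_mul_of_nonneg_left ?_ h.C_nonneg)) ?_ (Real.exp_pos _).le
        (mul_nonneg h.C_nonneg (by positivity))
      · exact Real.rpow_le_rpow_of_nonpos (by linarith) hn (by linarith [h.one_lt])
      · refine Real.exp_le_exp.2 ((le_abs_self _).trans ?_)
        rw [abs_mul]; gcongr
    refine squeeze_zero_norm' ((eventually_ge_atTop 1).mono fun Y hY => hb Y hY) ?_
    have := (tendsto_rpow_neg_atTop (by linarith [h.one_lt] : 0 < α)).const_mul C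
    have := (this.mul_const (Real.exp ((|A| + |A'|) * |t|))).mul_const |A' - A|
    simpa using this
  have l1 := hhor 1 (by simp)
  have l2 := hhor (-1) (by simp)
  simp only [one_mul, neg_one_mul] at l1 l2
  have t3 := ((l2.sub l1).add (t2.const_mul Complex.I)).sub (t1.const_mul Complex.I)
  have t4 := tendsto_nhds_unique t3 (tendsto_const_nhds.congr fun Y => (hrect Y).symm)
  rw [sub_zero, zero_add, ← mul_sub] at t4
  exact (sub_eq_zero.1 ((mul_eq_zero.1 t4).resolve_left Complex.I_ne_zero)).symm

/-- For `t < 0` the line is pushed to the right, and the bound `K e^{At}` tends to `0`. -/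
theorem Br_of_neg (h : HalfPlane f A₀ α C) {A : ℝ} (hA : A₀ < A) {t : ℝ} (ht : t < 0) :
    Br A f t = 0 := by
  obtain ⟨K, -, hK⟩ := h.exists_norm_Br_le
  have h1 : Tendsto (fun A' : ℝ => K * Real.exp (A' * t)) atTop (𝓝 (K * 0)) :=
    (Real.tendsto_exp_atBot.comp (tendsto_id.atTop_mul_const_of_neg ht)).const_mul K
  rw [mul_zero] at h1
  have h2 : ‖Br A f t‖ ≤ 0 := by
    refine ge_of_tendsto h1 ?_
    filter_upwards [eventually_gt_atTop A₀] with A' hA'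
    rw [h.Br_eq hA hA']
    exact hK A' hA' t
  exact norm_le_zero_iff.1 h2

theorem continuous_Br (h : HalfPlane f A₀ α C) {A : ℝ} (hA : A₀ < A) : Continuous (Br A f) := by
  have e : Br A f = fun t : ℝ => (2 * Real.pi : ℂ)⁻¹ * (Complex.exp (A * t) *
      ∫ ω : ℝ, f (A + ω * Complex.I) * Complex.exp (ω * t * Complex.I)) := by
    funext t
    rw [Br, ← integral_const_mul (Complex.exp (A * t))]
    congr 2 with ω
    rw [mul_left_comm, ← Complex.exp_add]
    congr 2; ring
  rw [e]
  refine continuous_const.mul (Continuous.mul (by fun_prop) ?_)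
  refine continuous_of_dominated (fun t => ((h.continuous_line hA).mul
    (by fun_prop)).aestronglyMeasurable) (fun t => Eventually.of_forall fun ω => ?_) h.integrable_bd
    (Eventually.of_forall fun ω => by fun_prop)
  rw [norm_mul, show (ω * t * Complex.I : ℂ) = ((ω * t : ℝ) : ℂ) * Complex.I by push_cast; ring,
    Complex.norm_exp_ofReal_mul_I, mul_one]
  exact h.bound_line hA ω

theorem Br_of_nonpos (h : HalfPlane f A₀ α C) {A : ℝ} (hA : A₀ < A) {t : ℝ} (ht : t ≤ 0) :
    Br A f t = 0 := by
  rcases ht.lt_or_eq with ht | rfl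
  · exact h.Br_of_neg hA ht
  · have h1 : Tendsto (Br A f) (𝓝[<] 0) (𝓝 (Br A f 0)) :=
      (h.continuous_Br hA).continuousAt.tendsto.mono_left nhdsWithin_le_nhds
    refine tendsto_nhds_unique h1 (tendsto_const_nhds.congr' ?_)
    filter_upwards [self_mem_nhdsWithin] with t ht
    exact (h.Br_of_neg hA ht).symm

theorem integrableOn_Br (h : HalfPlane f A₀ α C) {A : ℝ} (hA : A₀ < A) {s : ℂ} (hs : A₀ < s.re) :
    IntegrableOn (fun t : ℝ => Br A f t * Complex.exp (-s * t)) (Ioi 0) := by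
  obtain ⟨K, hK0, hK⟩ := h.exists_norm_Br_le
  obtain ⟨A', h1, h2⟩ := exists_between hs
  have hi : IntegrableOn (fun t : ℝ => K * Real.exp (-(s.re - A') * t)) (Ioi 0) :=
    (exp_neg_integrableOn_Ioi 0 (by linarith : 0 < s.re - A')).const_mul K
  refine hi.mono' ((h.continuous_Br hA).mul (by fun_prop)).aestronglyMeasurable
    (Eventually.of_forall fun t => ?_)
  rw [norm_mul, h.Br_eq hA h1]
  refine (mul_le_mul_of_nonneg_right (hK A' h1 t) (norm_nonneg _)).trans_eq ?_
  rw [Complex.norm_exp, mul_assoc, ← Real.exp_add]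
  congr 2
  simp; ring

/-- With `σ = Re s`, the function `e^{-σt} Br` is, up to the scaling by `2π`, the inverse Fourier
transform of `ω ↦ f(σ + iω)`. It is integrable, since a line slightly to the left gives a better
exponential bound and `Br` vanishes for `t ≤ 0`. Fourier inversion then returns `f`. -/
theorem laplace (h : HalfPlane f A₀ α C) {A : ℝ} (hA : A₀ < A) {s : ℂ} (hs : A₀ < s.re) :
    ∫ t in Ioi (0 : ℝ), Br A f t * Complex.exp (-s * t) = f s := by
  have hpi := Real.pi_pos
  set σ := s.re with hσ
  set g : ℝ → ℂ := fun ω => f (σ + ω * Complex.I) with hg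
  have hinv : ∀ t : ℝ, FourierTransformInv.fourierInv g t =
      (2 * Real.pi : ℂ) * (Br A f (2 * Real.pi * t) * Complex.exp (-(σ * (2 * Real.pi * t)))) := by
    intro t
    rw [h.Br_eq hA hs, Real.fourierInv_eq_fourier_neg, Real.fourier_real_eq_integral_exp_smul, Br, mul_assoc (2 * Real.pi : ℂ)⁻¹, ← mul_assoc (2 * Real.pi : ℂ),
      mul_inv_cancel₀ (by simp [hpi.ne'] : (2 * Real.pi : ℂ) ≠ 0), one_mul, ← integral_mul_const]
    congr 1 with ω
    rw [smul_eq_mul, mul_assoc (f _), ← Complex.exp_add, mul_comm]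
    congr 2
    push_cast; ring
  have hgint : Integrable g := h.integrable_line hs
  have hgc : Continuous g := h.continuous_line hs
  have hB : Integrable fun t : ℝ => Br A f t * Complex.exp (-σ * t) := by
    have h1 := h.integrableOn_Br hA (s := (σ : ℂ)) (by simpa using hs)
    rw [← integrable_indicator_iff measurableSet_Ioi] at h1
    refine h1.congr (Eventually.of_forall fun t => ?_)
    by_cases ht : 0 < t
    · simp [ht]
    · simp [ht, h.Br_of_nonpos hA (not_lt.1 ht)]
  have hinvI : Integrable (FourierTransformInv.fourierInv g) := by
    have := (hB.comp_mul_left' (by positivity : 2 * Real.pi ≠ 0)).const_mul (2 * Real.pi : ℂ)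
    refine this.congr (Eventually.of_forall fun t => ?_)
    rw [hinv]
    simp only []
    congr 3
    push_cast; ring
  have hF : Integrable (FourierTransform.fourier g) := by
    have := hinvI.comp_neg
    refine this.congr (Eventually.of_forall fun t => ?_)
    simp [Real.fourierInv_eq_fourier_neg]
  have h3 := congrFun (hgc.fourier_fourierInv_eq hgint hF) s.im
  rw [Real.fourier_real_eq_integral_exp_smul] at h3
  have hgs : g s.im = f s := by rw [hg]; simp [hσ, Complex.re_add_im]
  rw [hgs] at h3
  rw [← h3]
  have e1 : ∀ t : ℝ, Complex.exp (↑(-2 * Real.pi * t * s.im) * Complex.I) •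
      FourierTransformInv.fourierInv g t =
      (2 * Real.pi : ℂ) * (fun r : ℝ => Br A f r * Complex.exp (-s * r)) (2 * Real.pi * t) := by
    intro t
    rw [hinv, smul_eq_mul, mul_left_comm]
    congr 1
    rw [mul_left_comm, ← Complex.exp_add]
    congr 2
    conv_rhs => rw [← Complex.re_add_im s, ← hσ]
    push_cast; ring
  simp only [e1]
  rw [integral_const_mul, Measure.integral_comp_mul_left (fun r : ℝ => Br A f r * Complex.exp (-s * r)),
    abs_of_pos (by positivity)]
  have e2 : ∫ r : ℝ, Br A f r * Complex.exp (-s * r) = ∫ t in Ioi (0 : ℝ), Br A f t * Complex.exp (-s * t) := by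
    rw [← integral_indicator measurableSet_Ioi]
    congr 1 with t
    by_cases ht : 0 < t
    · simp [ht]
    · simp [ht, h.Br_of_nonpos hA (not_lt.1 ht)]
  rw [e2, Complex.real_smul, ← mul_assoc]
  have : (2 * Real.pi : ℂ) * (((2 * Real.pi)⁻¹ : ℝ) : ℂ) = 1 := by
    push_cast; exact mul_inv_cancel₀ (by simp [hpi.ne'])
  rw [this, one_mul]

theorem Br_conj {A : ℝ} (hA : A₀ < A)
    (hc : ∀ s : ℂ, A₀ < s.re → f ((starRingEnd ℂ) s) = (starRingEnd ℂ) (f s)) (t : ℝ) :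
    ((Br A f t).re : ℂ) = Br A f t := by
  rw [← Complex.conj_eq_iff_re, Br, map_mul, ← integral_conj]
  congr 1
  · rw [map_inv₀, map_mul, Complex.conj_ofReal, Complex.conj_ofNat]
  · rw [← integral_neg_eq_self]
    congr 1 with ω
    have : (starRingEnd ℂ) (A + (-ω : ℝ) * Complex.I : ℂ) = A + ω * Complex.I := by simp
    rw [map_mul, ← hc _ (by simpa using hA), ← Complex.exp_conj, map_mul, this, Complex.conj_ofReal]

theorem hasLaplace (h : HalfPlane f A₀ α C) {A : ℝ} (hA : A₀ < A)
    (hc : ∀ s : ℂ, A₀ < s.re → f ((starRingEnd ℂ) s) = (starRingEnd ℂ) (f s)) :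
    HasLaplace (fun t => (Br A f t).re) A₀ f := by
  intro s hs
  simp only [Br_conj hA hc]
  exact ⟨h.integrableOn_Br hA hs, h.laplace hA hs⟩

end HalfPlane

/-! ### Symbols and the Bromwich integrals attached to them. -/

section

variable {a b : ℝ}

theorem exists_pow_mul_exp_neg_sqrt_le (N : ℕ) {η : ℝ} (hη : 0 < η) :
    ∃ K : ℝ, 0 ≤ K ∧ ∀ r : ℝ, 0 ≤ r → r ^ N * Real.exp (-(η * Real.sqrt r)) ≤ K := by
  refine ⟨(2 * N).factorial / η ^ (2 * N), by positivity, fun r hr => ?_⟩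
  have h1 := Real.pow_div_factorial_le_exp (η * Real.sqrt r) (by positivity) (2 * N)
  have h2 : (η * Real.sqrt r) ^ (2 * N) = η ^ (2 * N) * r ^ N := by
    rw [mul_pow, pow_mul (Real.sqrt r), Real.sq_sqrt hr]
  rw [h2, div_le_iff₀ (by positivity)] at h1
  rw [le_div_iff₀ (by positivity), Real.exp_neg]
  have h3 := Real.exp_pos (η * Real.sqrt r)
  calc r ^ N * (Real.exp (η * Real.sqrt r))⁻¹ * η ^ (2 * N)
      = (η ^ (2 * N) * r ^ N) * (Real.exp (η * Real.sqrt r))⁻¹ := by ring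
    _ ≤ (Real.exp (η * Real.sqrt r) * (2 * N).factorial) * (Real.exp (η * Real.sqrt r))⁻¹ := by
        gcongr
    _ = _ := by field_simp

/-- Symbols: holomorphic functions of `w = log s` in the strip `|Im w| < π`, continuous up to the
boundary and of at most polynomial growth in `s`. -/
structure Symb (G : ℂ → ℂ) : Prop where
  cont : ContinuousOn G cstrip
  diff : DifferentiableOn ℂ G ostrip
  growth : ∃ k : ℕ, ∀ r : ℝ, ∃ C : ℝ, 0 ≤ C ∧ ∀ w ∈ cstrip, r ≤ w.re → ‖G w‖ ≤ C * Real.exp w.re ^ k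

theorem isCompact_strip_rect (r R : ℝ) : IsCompact (Icc r R ×ℂ Icc (-Real.pi) Real.pi) :=
  isCompact_Icc.reProdIm isCompact_Icc

/-- Between `r` and `R` compactness supplies the bound, so only the growth at the right end has to
be checked. Nothing is required as `Re w → -∞`, which admits symbols such as `e^{-w} = 1/s`. -/
theorem Symb.of_eventually {G : ℂ → ℂ} (hc : ContinuousOn G cstrip) (hd : DifferentiableOn ℂ G ostrip)
    {k : ℕ} {R C : ℝ} (hg : ∀ w ∈ cstrip, R ≤ w.re → ‖G w‖ ≤ C * Real.exp w.re ^ k) : Symb G where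
  cont := hc
  diff := hd
  growth := by
    refine ⟨k, fun r => ?_⟩
    obtain ⟨K, hK⟩ := (isCompact_strip_rect r R).exists_bound_of_continuousOn
      (hc.mono fun w hw => (Complex.mem_reProdIm.1 hw).2)
    have hr : 0 < Real.exp r ^ k := by positivity
    refine ⟨|C| + |K| / Real.exp r ^ k, by positivity, fun w hw h => ?_⟩
    have hm : Real.exp r ^ k ≤ Real.exp w.re ^ k :=
      pow_le_pow_left₀ (Real.exp_pos r).le (Real.exp_le_exp.2 h) k
    have hp : 0 < Real.exp w.re ^ k := by positivity
    rw [add_mul]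
    rcases le_total R w.re with hR | hR
    · have h1 := hg w hw hR
      have h2 : C * Real.exp w.re ^ k ≤ |C| * Real.exp w.re ^ k :=
        mul_le_mul_of_nonneg_right (le_abs_self C) hp.le
      have h3 : 0 ≤ |K| / Real.exp r ^ k * Real.exp w.re ^ k := by positivity
      linarith
    · have h1 := hK w (Complex.mem_reProdIm.2 ⟨⟨h, hR⟩, hw⟩)
      have h2 : |K| ≤ |K| / Real.exp r ^ k * Real.exp w.re ^ k := by
        rw [div_mul_eq_mul_div, le_div_iff₀ hr]
        exact mul_le_mul_of_nonneg_left hm (abs_nonneg K)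
      have h3 : 0 ≤ |C| * Real.exp w.re ^ k := by positivity
      linarith [le_abs_self K]

theorem Symb.mul {G H : ℂ → ℂ} (hG : Symb G) (hH : Symb H) : Symb (fun w => G w * H w) where
  cont := hG.cont.mul hH.cont
  diff := hG.diff.mul hH.diff
  growth := by
    obtain ⟨k, hk⟩ := hG.growth
    obtain ⟨l, hl⟩ := hH.growth
    refine ⟨k + l, fun r => ?_⟩
    obtain ⟨C, hC, h1⟩ := hk r
    obtain ⟨D, hD, h2⟩ := hl r
    refine ⟨C * D, by positivity, fun w hw h => ?_⟩
    rw [norm_mul, pow_add]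
    refine (mul_le_mul (h1 w hw h) (h2 w hw h) (norm_nonneg _) (by positivity)).trans_eq (by ring)

theorem Symb.add {G H : ℂ → ℂ} (hG : Symb G) (hH : Symb H) : Symb (fun w => G w + H w) := by
  obtain ⟨k, hk⟩ := hG.growth
  obtain ⟨l, hl⟩ := hH.growth
  obtain ⟨C, hC, h1⟩ := hk 0
  obtain ⟨D, hD, h2⟩ := hl 0
  refine Symb.of_eventually (hG.cont.add hH.cont) (hG.diff.add hH.diff) (k := k + l) (R := 0)
    (C := C + D) fun w hw h => ?_
  have he : 1 ≤ Real.exp w.re := Real.one_le_exp h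
  refine (norm_add_le _ _).trans ?_
  rw [add_mul]
  refine add_le_add ((h1 w hw h).trans (mul_le_mul_of_nonneg_left ?_ hC))
    ((h2 w hw h).trans (mul_le_mul_of_nonneg_left ?_ hD))
  · exact pow_le_pow_right₀ he (by omega)
  · exact pow_le_pow_right₀ he (by omega)

theorem symb_const (c : ℂ) : Symb fun _ => c :=
  Symb.of_eventually continuousOn_const (differentiableOn_const c) (k := 0) (R := 0) (C := ‖c‖)
    fun w _ _ => by simp

theorem symb_exp : Symb Complex.exp :=
  Symb.of_eventually Complex.continuous_exp.continuousOn Complex.differentiable_exp.differentiableOn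
    (k := 1) (R := 0) (C := 1) fun w _ _ => by rw [Complex.norm_exp]; simp

theorem symb_exp_neg : Symb fun w => Complex.exp (-w) :=
  Symb.of_eventually (by fun_prop) (by fun_prop) (k := 0) (R := 0) (C := 1) fun w _ h => by
    rw [Complex.norm_exp]; simpa using h

theorem continuousOn_mu : ContinuousOn (mu a b) cstrip := fun _ hw =>
  (hasDerivAt_mu hw).continuousAt.continuousWithinAt

theorem differentiableOn_mu : DifferentiableOn ℂ (mu a b) ostrip := fun _ hw =>
  (hasDerivAt_mu (ostrip_subset hw)).differentiableAt.differentiableWithinAt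

theorem continuousOn_zed : ContinuousOn (zed a b) cstrip := fun _ hw =>
  (hasDerivAt_zed hw).continuousAt.continuousWithinAt

theorem differentiableOn_zed : DifferentiableOn ℂ (zed a b) ostrip := fun _ hw =>
  (hasDerivAt_zed (ostrip_subset hw)).differentiableAt.differentiableWithinAt

theorem symb_zed : Symb (zed a b) :=
  Symb.of_eventually continuousOn_zed differentiableOn_zed (k := 1) (R := 0)
    fun w hw _ => by rw [pow_one]; exact norm_zed_le hw

theorem symb_exp_neg_mu : Symb fun w => Complex.exp (-mu a b w) :=
  Symb.of_eventually continuousOn_mu.neg.cexp differentiableOn_mu.neg.cexp (k := 0) (R := 0)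
    (C := Real.exp |Real.log a - Real.log b|) fun w hw _ => by
    rw [Complex.norm_exp, pow_zero, mul_one, Complex.neg_re]
    exact Real.exp_le_exp.2 ((neg_le_abs _).trans (abs_mu_re_le hw))

/-- `s M(s)` as a function of `s`. -/
def kap (a b : ℝ) (s : ℂ) : ℂ := zed a b (Complex.log s)

theorem exp_log_re {s : ℂ} (hs : s ≠ 0) : Real.exp (Complex.log s).re = ‖s‖ := by
  rw [Complex.log_re, Real.exp_log (norm_pos_iff.2 hs)]

theorem norm_kap_le {s : ℂ} (hs : s ≠ 0) :
    ‖kap a b s‖ ≤ Real.exp |Real.log a - Real.log b| * ‖s‖ := by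
  have := norm_zed_le (a := a) (b := b) (log_mem_cstrip s)
  rwa [exp_log_re hs] at this

theorem slitPlane_of_re_pos {s : ℂ} (h : 0 < s.re) : s ∈ Complex.slitPlane := Or.inl h

theorem exists_re_kap_ge (ha : 0 < a) (hab : a < b) : ∃ c > 0, ∃ A₁ : ℝ, 1 ≤ A₁ ∧ ∀ s : ℂ,
    A₁ ≤ s.re → c * Real.sqrt ‖s‖ ≤ (kap a b s).re ∧ 1 ≤ (kap a b s).re := by
  obtain ⟨c, hc, r0, hr0, h⟩ := exists_re_zed_ge ha hab
  refine ⟨c, hc, max (Real.exp r0) (max 1 (1 / c ^ 2)),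
    (le_max_left _ _).trans (le_max_right _ _), fun s hs => ?_⟩
  have h1 : Real.exp r0 ≤ s.re := (le_max_left _ _).trans hs
  have h2 : 1 / c ^ 2 ≤ s.re := ((le_max_right _ _).trans (le_max_right _ _)).trans hs
  have hpos : 0 < s.re := (Real.exp_pos _).trans_le h1
  have hs0 : s ≠ 0 := by rintro rfl; simp at hpos
  have hn : s.re ≤ ‖s‖ := (le_abs_self _).trans (Complex.abs_re_le_norm s)
  have hlog : r0 ≤ (Complex.log s).re := by
    rw [Complex.log_re]
    exact (Real.le_log_iff_exp_le (norm_pos_iff.2 hs0)).2 (h1.trans hn)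
  have him : |(Complex.log s).im| ≤ Real.pi / 2 := by
    rw [Complex.log_im]; exact Complex.abs_arg_le_pi_div_two_iff.2 hpos.le
  have h3 := (h (Complex.log s) (log_mem_cstrip s) hlog).1 him
  have h4 : Real.exp ((Complex.log s).re / 2) = Real.sqrt ‖s‖ := by
    rw [Real.exp_half, exp_log_re hs0]
  rw [h4] at h3
  refine ⟨h3, le_trans ?_ h3⟩
  have h5 : 1 / c ≤ Real.sqrt ‖s‖ := by
    refine Real.le_sqrt_of_sq_le ?_
    rw [div_pow, one_pow]; exact h2.trans hn
  calc (1 : ℝ) = c * (1 / c) := by field_simp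
    _ ≤ _ := mul_le_mul_of_nonneg_left h5 hc.le

/-- The abscissa to the right of which `Re (s M(s)) ≥ max (1, c √|s|)`. -/
def absc (ha : 0 < a) (hab : a < b) : ℝ := (exists_re_kap_ge ha hab).choose_spec.2.choose

theorem one_le_absc (ha : 0 < a) (hab : a < b) : 1 ≤ absc ha hab :=
  (exists_re_kap_ge ha hab).choose_spec.2.choose_spec.1

theorem one_le_re_kap (ha : 0 < a) (hab : a < b) {s : ℂ} (hs : absc ha hab ≤ s.re) :
    1 ≤ (kap a b s).re :=
  ((exists_re_kap_ge ha hab).choose_spec.2.choose_spec.2 s hs).2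

theorem exists_le_re_kap (ha : 0 < a) (hab : a < b) : ∃ c > 0, ∀ s : ℂ, absc ha hab ≤ s.re →
    c * Real.sqrt ‖s‖ ≤ (kap a b s).re :=
  ⟨_, (exists_re_kap_ge ha hab).choose_spec.1,
    fun s hs => ((exists_re_kap_ge ha hab).choose_spec.2.choose_spec.2 s hs).1⟩

theorem norm_sinh_kap_ge (ha : 0 < a) (hab : a < b) {s : ℂ} (hs : absc ha hab ≤ s.re) :
    Real.exp (kap a b s).re / 4 ≤ ‖Complex.sinh (kap a b s)‖ := by
  have h := one_le_re_kap ha hab hs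
  have h1 := norm_sinh_ge (z := kap a b s) (h.trans (le_abs_self _))
  rwa [abs_of_pos (by linarith)] at h1

theorem sinh_kap_ne_zero (ha : 0 < a) (hab : a < b) {s : ℂ} (hs : absc ha hab ≤ s.re) :
    Complex.sinh (kap a b s) ≠ 0 :=
  norm_pos_iff.1 (lt_of_lt_of_le (by positivity) (norm_sinh_kap_ge ha hab hs))

/-- The Bromwich kernel `G / sinh (s M(s))`. -/
def kern (a b : ℝ) (G : ℂ → ℂ) (s : ℂ) : ℂ := G (Complex.log s) / Complex.sinh (kap a b s)

theorem norm_kern_le (ha : 0 < a) (hab : a < b) {G : ℂ → ℂ} (hG : Symb G) : ∃ k : ℕ, ∃ C : ℝ, 0 ≤ C ∧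
    ∀ s : ℂ, absc ha hab ≤ s.re → ‖kern a b G s‖ ≤ C * ‖s‖ ^ k * Real.exp (-(kap a b s).re) := by
  obtain ⟨k, hk⟩ := hG.growth
  obtain ⟨C, hC, h⟩ := hk 0
  refine ⟨k, 4 * C, by positivity, fun s hs => ?_⟩
  have h1 := one_le_absc ha hab
  have hs0 : s ≠ 0 := by rintro rfl; simp at hs; linarith
  have hlog : 0 ≤ (Complex.log s).re := by
    rw [Complex.log_re]
    exact Real.log_nonneg ((h1.trans hs).trans ((le_abs_self _).trans (Complex.abs_re_le_norm s)))
  have h2 := h _ (log_mem_cstrip s) hlog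
  rw [exp_log_re hs0] at h2
  have h3 := norm_sinh_kap_ge ha hab hs
  rw [kern, norm_div, Real.exp_neg]
  calc ‖G (Complex.log s)‖ / ‖Complex.sinh (kap a b s)‖
      ≤ (C * ‖s‖ ^ k) / (Real.exp (kap a b s).re / 4) := by gcongr
    _ = _ := by field_simp

/-- For `|x| ≤ r < 1` the kernel is at most a power of `|s|` times `e^{-(1-r) Re z}`, and `Re z ≥
c|s|^{1/2}` beats all powers. Two more powers are spent to leave the factor `|s|^{-2}`, integrable
on vertical lines. -/
theorem exists_kern_bound (ha : 0 < a) (hab : a < b) {G : ℂ → ℂ} (hG : Symb G) (i j : ℕ) {r : ℝ}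
    (hr : r < 1) : ∃ C : ℝ, 0 ≤ C ∧ ∀ s : ℂ, absc ha hab ≤ s.re → ∀ x : ℝ, |x| ≤ r →
      ‖kern a b G s‖ * ‖kap a b s‖ ^ i * ‖s‖ ^ j * Real.exp (x * (kap a b s).re) ≤
        C * (‖s‖ ^ 2)⁻¹ := by
  obtain ⟨k, C, hC, hk⟩ := norm_kern_le ha hab hG
  obtain ⟨c, hc, h⟩ := exists_le_re_kap ha hab
  obtain ⟨K, hK, hN⟩ := exists_pow_mul_exp_neg_sqrt_le (k + i + j + 2)
    (mul_pos (sub_pos.2 hr) hc)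
  set L := Real.exp |Real.log a - Real.log b| with hL
  refine ⟨C * L ^ i * K, by positivity, fun s hs x hx => ?_⟩
  have h1 := one_le_absc ha hab
  have hs0 : s ≠ 0 := by rintro rfl; simp at hs; linarith
  have hn : 0 < ‖s‖ := norm_pos_iff.2 hs0
  have h2 := norm_kap_le (a := a) (b := b) hs0
  have h3 := one_le_re_kap ha hab hs
  have h4 : Real.exp (-(kap a b s).re) * Real.exp (x * (kap a b s).re) ≤
      Real.exp (-((1 - r) * c * Real.sqrt ‖s‖)) := by
    rw [← Real.exp_add]
    refine Real.exp_le_exp.2 ?_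
    have h5 : x * (kap a b s).re ≤ r * (kap a b s).re :=
      mul_le_mul_of_nonneg_right ((le_abs_self x).trans hx) (by linarith)
    have h6 := mul_le_mul_of_nonneg_left (h s hs) (sub_pos.2 hr).le
    linarith
  calc ‖kern a b G s‖ * ‖kap a b s‖ ^ i * ‖s‖ ^ j * Real.exp (x * (kap a b s).re)
      ≤ (C * ‖s‖ ^ k * Real.exp (-(kap a b s).re)) * (L * ‖s‖) ^ i * ‖s‖ ^ j *
        Real.exp (x * (kap a b s).re) := by
        gcongr
        exact hk s hs
    _ = C * L ^ i * ‖s‖ ^ (k + i + j) * (Real.exp (-(kap a b s).re) * Real.exp (x * (kap a b s).re)) := by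
        rw [mul_pow, pow_add, pow_add]; ring
    _ ≤ C * L ^ i * ‖s‖ ^ (k + i + j) * Real.exp (-((1 - r) * c * Real.sqrt ‖s‖)) := by gcongr
    _ = C * L ^ i * (‖s‖ ^ (k + i + j + 2) * Real.exp (-((1 - r) * c * Real.sqrt ‖s‖))) * (‖s‖ ^ 2)⁻¹ := by
        rw [pow_add _ _ 2]; field_simp
    _ ≤ C * L ^ i * K * (‖s‖ ^ 2)⁻¹ := by
        gcongr
        exact hN _ hn.le

theorem differentiableOn_kap : DifferentiableOn ℂ (kap a b) Complex.slitPlane := fun s hs => by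
  have h1 := (hasDerivAt_zed (a := a) (b := b) (log_mem_cstrip s)).differentiableAt
  exact (h1.comp s (Complex.differentiableAt_log hs)).differentiableWithinAt

theorem Symb.differentiableOn_log {G : ℂ → ℂ} (hG : Symb G) :
    DifferentiableOn ℂ (fun s => G (Complex.log s)) Complex.slitPlane := fun s hs => by
  have h1 := hG.diff.differentiableAt (isOpen_ostrip.mem_nhds (log_mem_ostrip hs))
  exact (h1.comp s (Complex.differentiableAt_log hs)).differentiableWithinAt

theorem differentiableOn_kern (ha : 0 < a) (hab : a < b) {G : ℂ → ℂ} (hG : Symb G) :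
    DifferentiableOn ℂ (kern a b G) {s | absc ha hab < s.re} := by
  have h1 := one_le_absc ha hab
  have hsub : {s : ℂ | absc ha hab < s.re} ⊆ Complex.slitPlane := fun s hs =>
    slitPlane_of_re_pos (by have : absc ha hab < s.re := hs; linarith)
  exact (hG.differentiableOn_log.mono hsub).div (differentiableOn_kap.mono hsub).csinh
    fun s hs => sinh_kap_ne_zero ha hab (le_of_lt hs)

/-- The point of the Bromwich line with ordinate `ω`. -/
def bline (A ω : ℝ) : ℂ := A + ω * Complex.I

theorem bline_re (A ω : ℝ) : (bline A ω).re = A := by simp [bline]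

theorem continuous_bline (A : ℝ) : Continuous (bline A) := by unfold bline; fun_prop

theorem continuous_comp_bline (ha : 0 < a) (hab : a < b) {f : ℂ → ℂ}
    (hf : DifferentiableOn ℂ f {s | absc ha hab < s.re}) {A : ℝ} (hA : absc ha hab < A) :
    Continuous fun ω => f (bline A ω) :=
  hf.continuousOn.comp_continuous (continuous_bline A) fun ω => by
    show absc ha hab < (bline A ω).re
    rw [bline_re]; exact hA

theorem differentiableOn_kap' (ha : 0 < a) (hab : a < b) :
    DifferentiableOn ℂ (kap a b) {s | absc ha hab < s.re} :=
  differentiableOn_kap.mono fun s hs =>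
    slitPlane_of_re_pos (by have : absc ha hab < s.re := hs; linarith [one_le_absc ha hab])

theorem integrable_inv_norm_sq {A : ℝ} (hA : 1 ≤ A) :
    Integrable fun ω : ℝ => (‖bline A ω‖ ^ 2)⁻¹ := by
  have h1 : Integrable fun ω : ℝ => 4 * (1 + ‖ω‖) ^ (-2 : ℝ) :=
    (integrable_one_add_norm (by simp)).const_mul _
  refine h1.mono' ?_ (Eventually.of_forall fun ω => ?_)
  · exact ((continuous_bline A).norm.pow 2).measurable.inv.aestronglyMeasurable
  · have h2 := HalfPlane.norm_ge (ω := ω) hA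
    rw [Real.norm_of_nonneg (by positivity), Real.rpow_neg (by positivity), Real.rpow_two]
    have h3 : (0 : ℝ) < 1 + |ω| := by positivity
    rw [Real.norm_eq_abs, bline]
    calc (‖(A + ω * Complex.I : ℂ)‖ ^ 2)⁻¹ ≤ (((1 + |ω|) / 2) ^ 2)⁻¹ := by gcongr
      _ = _ := by field_simp; norm_num

/-- The Bromwich integral of `G e^{x s M(s)} / sinh (s M(s))`. -/
def brom (a b : ℝ) (G : ℂ → ℂ) (A : ℝ) : ℝ × ℝ → ℂ :=
  expInt volume (fun ω => (2 * Real.pi : ℂ)⁻¹ * kern a b G (bline A ω)) (fun ω => kap a b (bline A ω))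
    (bline A)

/-- The open strip `|x| < 1` in the `(x, t)`-plane. -/
def xstrip : Set (ℝ × ℝ) := {p | |p.1| < 1}

theorem isOpen_xstrip : IsOpen xstrip := isOpen_lt (by fun_prop) continuous_const

/-- On the line `Re s` is constant, so the sign of `t` plays no role: for `|x| < 1` the fields are
smooth across `t = 0`, and the initial conditions follow from their vanishing for `t ≤ 0`. -/
theorem expGood_brom (ha : 0 < a) (hab : a < b) {G : ℂ → ℂ} (hG : Symb G) {A : ℝ}
    (hA : absc ha hab < A) : ExpGood volume (fun ω => (2 * Real.pi : ℂ)⁻¹ * kern a b G (bline A ω))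
      (fun ω => kap a b (bline A ω)) (bline A) xstrip where
  meas_c := (continuous_const.mul
    (continuous_comp_bline ha hab (differentiableOn_kern ha hab hG) hA)).aestronglyMeasurable
  meas_Z := (continuous_comp_bline ha hab (differentiableOn_kap' ha hab) hA).aestronglyMeasurable
  meas_S := (continuous_bline A).aestronglyMeasurable
  integrable p hp i j := by
    obtain ⟨C, hC, h⟩ := exists_kern_bound ha hab hG i j (r := |p.1|) hp
    have hi := (integrable_inv_norm_sq ((one_le_absc ha hab).trans hA.le)).const_mul
      (‖(2 * Real.pi : ℂ)⁻¹‖ * C * Real.exp (p.2 * A))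
    refine hi.mono' ?_ (Eventually.of_forall fun ω => ?_)
    · have c1 := continuous_comp_bline ha hab (differentiableOn_kern ha hab hG) hA
      have c2 := continuous_comp_bline ha hab (differentiableOn_kap' ha hab) hA
      have c3 := continuous_bline A
      have c4 := Complex.continuous_re.comp c2
      have c5 := Complex.continuous_re.comp c3
      exact (((((continuous_const.mul c1).norm.mul (c2.norm.pow i)).mul (c3.norm.pow j)).mul
        (Real.continuous_exp.comp ((c4.const_mul _).add (c5.const_mul _))))).aestronglyMeasurable
    · rw [Real.norm_of_nonneg (by positivity), norm_mul, bline_re, Real.exp_add]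
      have h1 := h (bline A ω) (by rw [bline_re]; exact hA.le) p.1 le_rfl
      calc ‖(2 * Real.pi : ℂ)⁻¹‖ * ‖kern a b G (bline A ω)‖ * ‖kap a b (bline A ω)‖ ^ i *
            ‖bline A ω‖ ^ j * (Real.exp (p.1 * (kap a b (bline A ω)).re) * Real.exp (p.2 * A))
          = ‖(2 * Real.pi : ℂ)⁻¹‖ * Real.exp (p.2 * A) * (‖kern a b G (bline A ω)‖ *
            ‖kap a b (bline A ω)‖ ^ i * ‖bline A ω‖ ^ j * Real.exp (p.1 * (kap a b (bline A ω)).re)) := by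
            ring
        _ ≤ ‖(2 * Real.pi : ℂ)⁻¹‖ * Real.exp (p.2 * A) * (C * (‖bline A ω‖ ^ 2)⁻¹) := by gcongr
        _ = _ := by ring

theorem brom_eq_Br (G : ℂ → ℂ) (A x t : ℝ) :
    brom a b G A (x, t) = Br A (fun s => kern a b G s * Complex.exp (x * kap a b s)) t := by
  rw [brom, expInt, Br, ← integral_const_mul]
  congr 1 with ω
  simp only [bline]
  rw [Complex.exp_add, mul_comm (t : ℂ)]
  ring

theorem halfPlane_kern (ha : 0 < a) (hab : a < b) {G : ℂ → ℂ} (hG : Symb G) {x : ℝ} (hx : |x| < 1) :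
    ∃ C, HalfPlane (fun s => kern a b G s * Complex.exp (x * kap a b s)) (absc ha hab) 2 C := by
  obtain ⟨C, -, h⟩ := exists_kern_bound ha hab hG 0 0 hx
  refine ⟨C, one_le_absc ha hab, one_lt_two, (differentiableOn_kern ha hab hG).mul
    (((differentiableOn_kap' ha hab).const_mul _).cexp), fun s hs => ?_⟩
  have h1 := h s hs.le x le_rfl
  rw [norm_mul, Complex.norm_exp, Real.rpow_neg (norm_nonneg _), Real.rpow_two]
  simpa using h1

theorem brom_mul_zed (G : ℂ → ℂ) (A : ℝ) (p : ℝ × ℝ) :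
    expInt volume (fun ω => (2 * Real.pi : ℂ)⁻¹ * kern a b G (bline A ω) * kap a b (bline A ω))
      (fun ω => kap a b (bline A ω)) (bline A) p = brom a b (fun w => G w * zed a b w) A p := by
  rw [brom, expInt, expInt]
  congr 1 with ω
  simp only [kern, kap]
  ring

theorem brom_mul_exp {G : ℂ → ℂ} {A : ℝ} (hA : 0 < A) (p : ℝ × ℝ) :
    expInt volume (fun ω => (2 * Real.pi : ℂ)⁻¹ * kern a b G (bline A ω) * bline A ω)
      (fun ω => kap a b (bline A ω)) (bline A) p = brom a b (fun w => G w * Complex.exp w) A p := by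
  rw [brom, expInt, expInt]
  congr 1 with ω
  have h0 : bline A ω ≠ 0 := fun h => by
    have := congrArg Complex.re h
    rw [bline_re] at this; simp at this; linarith
  simp only [kern, Complex.exp_log h0]
  ring

variable {G : ℂ → ℂ} {A x t : ℝ}

theorem hasDerivAt_brom_fst (ha : 0 < a) (hab : a < b) (hG : Symb G) (hA : absc ha hab < A)
    (hx : |x| < 1) : HasDerivAt (fun y => brom a b G A (y, t))
      (brom a b (fun w => G w * zed a b w) A (x, t)) x := by
  rw [← brom_mul_zed]
  exact (expGood_brom ha hab hG hA).hasDerivAt_fst isOpen_xstrip hx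

theorem hasDerivAt_brom_snd (ha : 0 < a) (hab : a < b) (hG : Symb G) (hA : absc ha hab < A)
    (hx : |x| < 1) : HasDerivAt (fun r => brom a b G A (x, r))
      (brom a b (fun w => G w * Complex.exp w) A (x, t)) t := by
  rw [← brom_mul_exp (by linarith [one_le_absc ha hab])]
  exact (expGood_brom ha hab hG hA).hasDerivAt_snd isOpen_xstrip hx

theorem contDiffOn_brom (ha : 0 < a) (hab : a < b) (hG : Symb G) (hA : absc ha hab < A) :
    ContDiffOn ℝ (⊤ : ℕ∞) (brom a b G A) xstrip :=
  (expGood_brom ha hab hG hA).contDiffOn isOpen_xstrip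

theorem brom_of_nonpos (ha : 0 < a) (hab : a < b) (hG : Symb G) (hA : absc ha hab < A)
    (hx : |x| < 1) (ht : t ≤ 0) : brom a b G A (x, t) = 0 := by
  obtain ⟨C, h⟩ := halfPlane_kern ha hab hG hx
  rw [brom_eq_Br]
  exact h.Br_of_nonpos hA ht

theorem exists_norm_brom_le (ha : 0 < a) (hab : a < b) (hG : Symb G) (hA : absc ha hab < A) {r : ℝ}
    (hr : r < 1) : ∃ C : ℝ, ∀ x t : ℝ, |x| ≤ r → ‖brom a b G A (x, t)‖ ≤ C * Real.exp (A * t) := by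
  obtain ⟨C, hC, h⟩ := exists_kern_bound ha hab hG 0 0 hr
  have hi := integrable_inv_norm_sq ((one_le_absc ha hab).trans hA.le)
  refine ⟨∫ ω, ‖(2 * Real.pi : ℂ)⁻¹‖ * C * (‖bline A ω‖ ^ 2)⁻¹, fun x t hx => ?_⟩
  rw [← integral_mul_const]
  refine norm_integral_le_of_norm_le ((hi.const_mul _).mul_const _) (Eventually.of_forall fun ω => ?_)
  have h1 := h (bline A ω) (by rw [bline_re]; exact hA.le) x hx
  rw [pow_zero, pow_zero, mul_one, mul_one] at h1
  rw [norm_mul, norm_mul, norm_cexp_lin, bline_re, Real.exp_add, mul_comm t A, ← mul_assoc]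
  refine mul_le_mul_of_nonneg_right ?_ (Real.exp_pos _).le
  rw [mul_assoc, mul_assoc]
  exact mul_le_mul_of_nonneg_left h1 (norm_nonneg _)

end

/-! ### Logarithms of the poles and convergence of the keyhole pieces. -/

section

variable {a b : ℝ}

/-- The logarithm of the `n`-th pole in the upper half-plane, counted from `0`. -/
def wpole (a b : ℝ) (n : ℕ) : ℂ := wsol a b ((n + 1 : ℕ) * Real.pi)

/-- The logarithm of the `n`-th pole in the lower half-plane, counted from `0`. -/
def wpole' (a b : ℝ) (n : ℕ) : ℂ := (starRingEnd ℂ) (wpole a b n)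

theorem exp_wpole (n : ℕ) : Complex.exp (wpole a b n) = spole a b (n + 1) := rfl

theorem exp_wpole' (n : ℕ) : Complex.exp (wpole' a b n) = smole a b (n + 1) := (smole_eq _).symm

theorem wpole_mem (n : ℕ) : wpole a b n ∈ ostrip := wsol_mem _

theorem wpole'_mem (n : ℕ) : wpole' a b n ∈ ostrip := conj_mem_ostrip (wsol_mem _)

theorem zed_wpole (n : ℕ) : zed a b (wpole a b n) = ((n + 1 : ℕ) * Real.pi : ℝ) * Complex.I :=
  zed_wsol (npi_pos n.succ_pos)

theorem zed_wpole' (n : ℕ) : zed a b (wpole' a b n) = -(((n + 1 : ℕ) * Real.pi : ℝ) * Complex.I) := by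
  rw [wpole', zed_conj (ostrip_subset (wpole_mem n)), zed_wpole, map_mul, Complex.conj_ofReal,
    Complex.conj_I, mul_neg]

theorem wpole_injective : Function.Injective (wpole a b) := fun m n h => by
  have h1 := congrArg (zed a b) h
  rw [zed_wpole, zed_wpole] at h1
  have h2 := mul_right_cancel₀ Complex.I_ne_zero h1
  have h3 := mul_right_cancel₀ Real.pi_pos.ne' (Complex.ofReal_injective h2)
  have h4 : m + 1 = n + 1 := by exact_mod_cast h3
  omega

theorem wpole'_injective : Function.Injective (wpole' a b) := fun _ _ h =>
  wpole_injective ((starRingEnd ℂ).injective h)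

theorem wpole_ne_wpole' (m n : ℕ) : wpole a b m ≠ wpole' a b n := fun h => by
  have h1 := congrArg Complex.im h
  have h2 : 0 < (wpole a b m).im := wsol_im_pos _
  have h3 : 0 < (wpole a b n).im := wsol_im_pos _
  rw [wpole', Complex.conj_im] at h1
  linarith

theorem wpole'_re (n : ℕ) : (wpole' a b n).re = (wpole a b n).re := Complex.conj_re _

theorem exists_eq_wpole {w : ℂ} (hw : w ∈ cstrip) (h : Complex.sinh (zed a b w) = 0) :
    ∃ n : ℕ, w = wpole a b n ∨ w = wpole' a b n := by
  obtain ⟨n, hn, h1⟩ := exists_of_sinh_zed_eq_zero hw h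
  obtain ⟨m, rfl⟩ := Nat.exists_eq_add_of_le' hn
  exact ⟨m, h1⟩

theorem exp_wpole_re (n : ℕ) : Real.exp (wpole a b n).re = ‖spole a b (n + 1)‖ :=
  (norm_spole _).symm

/-- The poles stay away from the branch point, so the inner circle of the keyhole can be chosen free
of poles, inside and on it. -/
theorem wpole_re_ge (n : ℕ) : -|Real.log a - Real.log b| ≤ (wpole a b n).re := by
  have h1 := norm_spole_ge (a := a) (b := b) n.succ_pos
  rw [← exp_wpole_re] at h1
  refine Real.exp_le_exp.1 (le_trans ?_ h1)
  refine le_mul_of_one_le_right (Real.exp_pos _).le ?_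
  exact_mod_cast n.succ_pos

theorem exp_wpole_re_le (n : ℕ) : Real.exp (wpole a b n).re ≤
    Real.exp |Real.log a - Real.log b| * Real.pi * (n + 1 : ℕ) := by
  have h1 := norm_spole_le (a := a) (b := b) n.succ_pos
  rw [← exp_wpole_re] at h1
  refine h1.trans_eq (by ring)

theorem sinh_zed_ne_zero_of_re_lt {w : ℂ} (hw : w ∈ cstrip) (h : w.re < -|Real.log a - Real.log b|) :
    Complex.sinh (zed a b w) ≠ 0 := fun h0 => by
  obtain ⟨n, rfl | rfl⟩ := exists_eq_wpole hw h0
  · exact absurd (wpole_re_ge n) (not_le.2 h)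
  · rw [wpole'_re] at h
    exact absurd (wpole_re_ge n) (not_le.2 h)

theorem tendsto_wpole_re : Tendsto (fun n => (wpole a b n).re) atTop atTop := by
  have h1 : Tendsto (fun n : ℕ => ((n + 1 : ℕ) : ℝ) * Real.pi) atTop atTop :=
    (tendsto_natCast_atTop_atTop.comp (tendsto_add_atTop_nat 1)).atTop_mul_const Real.pi_pos
  exact (tendsto_wsol_re (a := a) (b := b)).comp h1

/-- The inverse of `d/ds sinh (s M(s))` at a pole `s = e^w`. -/
def rcoef (a b : ℝ) (w : ℂ) : ℂ :=
  (Complex.cosh (zed a b w) * (Complex.exp (mu a b w) * (1 + muDeriv a b w)))⁻¹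

theorem cosh_ofReal_mul_I_of_sinh {y : ℝ} (h : Complex.sinh (y * Complex.I) = 0) :
    ‖Complex.cosh (y * Complex.I)‖ = 1 := by
  have h1 := Complex.cosh_sq_sub_sinh_sq (y * Complex.I)
  rw [h, zero_pow two_ne_zero, sub_zero] at h1
  have h2 : ‖Complex.cosh (y * Complex.I)‖ ^ 2 = 1 := by rw [← norm_pow, h1, norm_one]
  nlinarith [norm_nonneg (Complex.cosh (y * Complex.I))]

/-- The factor `6` is `1/(1 - 5/6)`, from the lower bound for `|1 + mu'|`; the exponential bounds
`1/|M|`. -/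
theorem norm_rcoef_le {w : ℂ} (hw : w ∈ cstrip) (h : ‖Complex.cosh (zed a b w)‖ = 1) :
    ‖rcoef a b w‖ ≤ 6 * Real.exp |Real.log a - Real.log b| := by
  rw [rcoef, norm_inv, norm_mul, h, one_mul, norm_mul, Complex.norm_exp]
  have h1 : Real.exp (-|Real.log a - Real.log b|) ≤ Real.exp (mu a b w).re :=
    Real.exp_le_exp.2 (by linarith [neg_abs_le (mu a b w).re, abs_mu_re_le (a := a) (b := b) hw])
  have h2 : 1 / 6 ≤ ‖1 + muDeriv a b w‖ := by
    have h3 := norm_sub_norm_le (1 : ℂ) (-muDeriv a b w)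
    rw [norm_one, norm_neg, sub_neg_eq_add] at h3
    linarith [norm_muDeriv_le (a := a) (b := b) hw]
  calc (Real.exp (mu a b w).re * ‖1 + muDeriv a b w‖)⁻¹
      ≤ (Real.exp (-|Real.log a - Real.log b|) * (1 / 6))⁻¹ := by gcongr
    _ = _ := by rw [Real.exp_neg]; field_simp

theorem sinh_zed_wpole (n : ℕ) : Complex.sinh (zed a b (wpole a b n)) = 0 := by
  have := sinh_npi (n + 1)
  rw [zed_wpole, ← this]
  congr 1; push_cast; ring

theorem sinh_zed_wpole' (n : ℕ) : Complex.sinh (zed a b (wpole' a b n)) = 0 := by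
  rw [zed_wpole', Complex.sinh_neg, ← zed_wpole (a := a) (b := b), sinh_zed_wpole, neg_zero]

theorem norm_cosh_wpole (n : ℕ) : ‖Complex.cosh (zed a b (wpole a b n))‖ = 1 := by
  have h := sinh_zed_wpole (a := a) (b := b) n
  rw [zed_wpole] at h ⊢
  exact cosh_ofReal_mul_I_of_sinh h

theorem norm_cosh_wpole' (n : ℕ) : ‖Complex.cosh (zed a b (wpole' a b n))‖ = 1 := by
  rw [zed_wpole', Complex.cosh_neg, ← zed_wpole (a := a) (b := b), norm_cosh_wpole]

/-! ### The three parts of the keyhole representation -/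

/-- Contribution of the arc `|s| = e^{x₀}`. -/
def circI (a b : ℝ) (G : ℂ → ℂ) (x0 : ℝ) : ℝ × ℝ → ℂ :=
  expInt (volume.restrict (Ioc (-Real.pi) Real.pi))
    (fun y => (2 * Real.pi : ℂ)⁻¹ * (G (x0 + y * Complex.I) /
      Complex.sinh (zed a b (x0 + y * Complex.I)) * Complex.exp (x0 + y * Complex.I)))
    (fun y => zed a b (x0 + y * Complex.I)) (fun y => Complex.exp (x0 + y * Complex.I))

/-- Contribution of the lip `s = q e^{ηiπ}`, `q > δ`, of the cut. -/
def cutI (a b : ℝ) (G : ℂ → ℂ) (η δ : ℝ) : ℝ × ℝ → ℂ :=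
  expInt (volume.restrict (Ioi δ))
    (fun q => (2 * Real.pi * Complex.I : ℂ)⁻¹ * (G (lip η q) / Complex.sinh (zed a b (lip η q))))
    (fun q => zed a b (lip η q)) (fun q => -(q : ℂ))

/-- Contribution of the residues at `s = e^{w n}`. -/
def resI (a b : ℝ) (G : ℂ → ℂ) (w : ℕ → ℂ) : ℝ × ℝ → ℂ :=
  expInt Measure.count (fun n => G (w n) * rcoef a b (w n)) (fun n => zed a b (w n))
    (fun n => Complex.exp (w n))

/-- The region of convergence of the keyhole representation. -/
def keyDom (a b : ℝ) : Set (ℝ × ℝ) :=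
  {p | 0 < p.2 ∧ Real.exp |Real.log a - Real.log b| * (|p.1| - 1) < p.2}

theorem isOpen_keyDom : IsOpen (keyDom a b) :=
  (isOpen_lt continuous_const continuous_snd).inter (isOpen_lt (by fun_prop) continuous_snd)

/-- On the lips `|Re z| ≤ q e^{|log a - log b|}`, so the factor `e^{-tq}` compensates a small excess
of `|x|` over `1`. The open set `keyDom` therefore surrounds the closed strip `|x| ≤ 1` for `t > 0`.
-/
theorem mem_keyDom {x t : ℝ} (hx : |x| ≤ 1) (ht : 0 < t) : (x, t) ∈ keyDom a b := by
  refine ⟨ht, lt_of_le_of_lt ?_ ht⟩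
  exact mul_nonpos_of_nonneg_of_nonpos (Real.exp_pos _).le (by simpa using hx)

theorem expGood_of_continuousOn {α β : ℝ} {c Z S : ℝ → ℂ} (hc : ContinuousOn c (Icc α β))
    (hZ : ContinuousOn Z (Icc α β)) (hS : ContinuousOn S (Icc α β)) (V : Set (ℝ × ℝ)) :
    ExpGood (volume.restrict (Ioc α β)) c Z S V where
  meas_c := (hc.mono Ioc_subset_Icc_self).aestronglyMeasurable measurableSet_Ioc
  meas_Z := (hZ.mono Ioc_subset_Icc_self).aestronglyMeasurable measurableSet_Ioc
  meas_S := (hS.mono Ioc_subset_Icc_self).aestronglyMeasurable measurableSet_Ioc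
  integrable p _ i j := by
    have h1 := Complex.continuous_re.comp_continuousOn hZ
    have h2 := Complex.continuous_re.comp_continuousOn hS
    have h3 : ContinuousOn (fun ω => ‖c ω‖ * ‖Z ω‖ ^ i * ‖S ω‖ ^ j *
        Real.exp (p.1 * (Z ω).re + p.2 * (S ω).re)) (Icc α β) :=
      ((hc.norm.mul (hZ.norm.pow i)).mul (hS.norm.pow j)).mul
        (((h1.const_mul _).add (h2.const_mul _)).rexp)
    exact (h3.integrableOn_Icc).mono_set Ioc_subset_Icc_self

theorem arc_mem {x0 y : ℝ} (hy : y ∈ Icc (-Real.pi) Real.pi) : (x0 + y * Complex.I : ℂ) ∈ cstrip := by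
  rw [mem_cstrip]; simpa using abs_le.2 hy

theorem continuousOn_arc {f : ℂ → ℂ} (hf : ContinuousOn f cstrip) (x0 : ℝ) :
    ContinuousOn (fun y : ℝ => f (x0 + y * Complex.I)) (Icc (-Real.pi) Real.pi) :=
  hf.comp (f := fun y : ℝ => (x0 + y * Complex.I : ℂ)) (by fun_prop) fun _ hy => arc_mem hy

theorem expGood_circI {G : ℂ → ℂ} (hG : Symb G) {x0 : ℝ} (hx : x0 < -|Real.log a - Real.log b|)
    (V : Set (ℝ × ℝ)) : ExpGood (volume.restrict (Ioc (-Real.pi) Real.pi))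
      (fun y : ℝ => (2 * Real.pi : ℂ)⁻¹ * (G (x0 + y * Complex.I) /
        Complex.sinh (zed a b (x0 + y * Complex.I)) * Complex.exp (x0 + y * Complex.I)))
      (fun y : ℝ => zed a b (x0 + y * Complex.I)) (fun y : ℝ => Complex.exp (x0 + y * Complex.I)) V := by
  refine expGood_of_continuousOn ?_ (continuousOn_arc continuousOn_zed x0) (by fun_prop) V
  refine ContinuousOn.mul (by fun_prop) (ContinuousOn.mul (ContinuousOn.div (continuousOn_arc hG.cont x0)
    (Complex.continuous_sinh.comp_continuousOn (continuousOn_arc continuousOn_zed x0)) fun y hy => ?_) (by fun_prop))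
  exact sinh_zed_ne_zero_of_re_lt (arc_mem hy) (by simpa using hx)

theorem continuousOn_lip {f : ℂ → ℂ} (hf : ContinuousOn f cstrip) {η : ℝ} (hη : |η| = 1) :
    ContinuousOn (fun q : ℝ => f (lip η q)) (Ioi 0) := by
  refine hf.comp (f := lip η) ?_ fun q _ => lip_mem hη q
  unfold lip
  exact (Complex.continuous_ofReal.comp_continuousOn
    (Real.continuousOn_log.mono fun q hq => (ne_of_gt hq))).add continuousOn_const

theorem sinh_zed_lip_ne_zero {η : ℝ} (hη : |η| = 1) (q : ℝ) :
    Complex.sinh (zed a b (lip η q)) ≠ 0 := fun h => by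
  have him : |(lip η q).im| = Real.pi := by
    rw [lip_im, abs_mul, hη, one_mul, abs_of_pos Real.pi_pos]
  obtain ⟨n, h1 | h1⟩ := exists_eq_wpole (lip_mem hη q) h
  · have := mem_ostrip.1 (wpole_mem (a := a) (b := b) n)
    rw [← h1, him] at this; exact lt_irrefl _ this
  · have := mem_ostrip.1 (wpole'_mem (a := a) (b := b) n)
    rw [← h1, him] at this; exact lt_irrefl _ this

theorem exp_lip_re (η : ℝ) {q : ℝ} (hq : 0 < q) : Real.exp (lip η q).re = q := by
  rw [lip_re, Real.exp_log hq]

/-- The decay of the exponent is left as a hypothesis because it is used in two regimes: `t > 0`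
with `|x|` possibly above `1`, and `t = 0` with `|x| < 1`. -/
theorem integrableOn_cut (ha : 0 < a) (hab : a < b) {G : ℂ → ℂ} (hG : Symb G) {η : ℝ} (hη : |η| = 1)
    {δ : ℝ} (hδ : 0 < δ) (i j : ℕ) {x t ρ : ℝ} (hρ : 0 < ρ)
    (h : ∀ᶠ q in atTop, x * (zed a b (lip η q)).re - t * q - |(zed a b (lip η q)).re| ≤ -(ρ * q)) :
    IntegrableOn (fun q : ℝ => ‖G (lip η q) / Complex.sinh (zed a b (lip η q))‖ *
      ‖zed a b (lip η q)‖ ^ i * ‖-(q : ℂ)‖ ^ j *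
      Real.exp (x * (zed a b (lip η q)).re + t * (-(q : ℂ)).re)) (Ioi δ) := by
  obtain ⟨k, hk⟩ := hG.growth
  obtain ⟨C, hC, hk⟩ := hk 0
  obtain ⟨c, hc, r0, hc'⟩ := exists_zed_lip_re_le ha hab
  have him : ∀ q, |(lip η q).im| = Real.pi := fun q => by
    rw [lip_im, abs_mul, hη, one_mul, abs_of_pos Real.pi_pos]
  set L := Real.exp |Real.log a - Real.log b| with hL
  -- Half of the rate `ρ` is given up to absorb the powers of `q`.
  refine integrable_of_isBigO_exp_neg (half_pos hρ) ?_ ?_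
  · have hsub : Ici δ ⊆ Ioi 0 := fun q hq => hδ.trans_le hq
    have c1 := (continuousOn_lip hG.cont hη).mono hsub
    have c2 := (continuousOn_lip (continuousOn_zed (a := a) (b := b)) hη).mono hsub
    have c3 := Complex.continuous_re.comp_continuousOn c2
    refine ((((c1.div (Complex.continuous_sinh.comp_continuousOn c2) fun q _ => sinh_zed_lip_ne_zero hη q).norm).mul (c2.norm.pow i)).mul
      (by fun_prop)).mul (((c3.const_mul x).add ?_).rexp)
    simp only [Complex.neg_re, Complex.ofReal_re]
    fun_prop
  · have h1 : (fun q : ℝ => q ^ (k + i + j)) =O[atTop] fun q => Real.exp (ρ / 2 * q) :=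
      (isLittleO_pow_exp_pos_mul_atTop _ (half_pos hρ)).isBigO
    have h2 := h1.mul (Asymptotics.isBigO_refl (fun q : ℝ => Real.exp (-(ρ * q))) atTop)
    have e : (fun q => Real.exp (ρ / 2 * q) * Real.exp (-(ρ * q))) = fun q => Real.exp (-(ρ / 2) * q) := by
      funext q; rw [← Real.exp_add]; congr 1; ring
    rw [e] at h2
    refine Asymptotics.IsBigO.trans (Asymptotics.IsBigO.of_bound (4 * C * L ^ i) ?_) h2
    filter_upwards [h, eventually_ge_atTop (Real.exp r0), eventually_ge_atTop 1,
      eventually_ge_atTop (1 / c)] with q hq hq0 hq1 hqc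
    have hqp : 0 < q := by linarith
    have hlog : r0 ≤ (lip η q).re := by rw [lip_re]; exact (Real.le_log_iff_exp_le hqp).2 hq0
    have hz := hc' _ (him q) hlog
    rw [exp_lip_re η hqp] at hz
    have hcq : 1 ≤ c * q := by rw [div_le_iff₀ hc] at hqc; linarith
    have hs := norm_sinh_ge (z := zed a b (lip η q)) (by
      rw [abs_of_neg (by linarith)]; linarith)
    have hg := hk (lip η q) (lip_mem hη q) (by rw [lip_re]; exact Real.log_nonneg hq1)
    rw [exp_lip_re η hqp] at hg
    have hzn := norm_zed_le (a := a) (b := b) (lip_mem hη q)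
    rw [exp_lip_re η hqp, ← hL] at hzn
    rw [Real.norm_of_nonneg (by positivity), Real.norm_of_nonneg (by positivity), norm_div, norm_neg,
      Complex.norm_real, Real.norm_of_nonneg hqp.le, Complex.neg_re, Complex.ofReal_re]
    calc ‖G (lip η q)‖ / ‖Complex.sinh (zed a b (lip η q))‖ * ‖zed a b (lip η q)‖ ^ i * q ^ j *
          Real.exp (x * (zed a b (lip η q)).re + t * -q)
        ≤ C * q ^ k / (Real.exp |(zed a b (lip η q)).re| / 4) * (L * q) ^ i * q ^ j *
          Real.exp (x * (zed a b (lip η q)).re + t * -q) := by gcongr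
      _ = 4 * C * L ^ i * (q ^ (k + i + j) *
          Real.exp (x * (zed a b (lip η q)).re - t * q - |(zed a b (lip η q)).re|)) := by
          rw [Real.exp_sub _ |(zed a b (lip η q)).re|, mul_pow, pow_add, pow_add, mul_neg,
            ← sub_eq_add_neg]
          field_simp
      _ ≤ _ := by gcongr

theorem expGood_cutI (ha : 0 < a) (hab : a < b) {G : ℂ → ℂ} (hG : Symb G) {η : ℝ} (hη : |η| = 1)
    {δ : ℝ} (hδ : 0 < δ) : ExpGood (volume.restrict (Ioi δ))
      (fun q => (2 * Real.pi * Complex.I : ℂ)⁻¹ * (G (lip η q) / Complex.sinh (zed a b (lip η q))))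
      (fun q => zed a b (lip η q)) (fun q => -(q : ℂ)) (keyDom a b) := by
  have hsub : Ioi δ ⊆ Ioi 0 := fun q hq => hδ.trans hq
  have c1 := (continuousOn_lip hG.cont hη).mono hsub
  have c2 := (continuousOn_lip (continuousOn_zed (a := a) (b := b)) hη).mono hsub
  refine ⟨(continuousOn_const.mul (c1.div (Complex.continuous_sinh.comp_continuousOn c2) fun q _ =>
    sinh_zed_lip_ne_zero hη q)).aestronglyMeasurable measurableSet_Ioi,
    c2.aestronglyMeasurable measurableSet_Ioi,
    (by fun_prop : Continuous fun q : ℝ => -(q : ℂ)).aestronglyMeasurable, fun p hp i j => ?_⟩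
  set L := Real.exp |Real.log a - Real.log b| with hL
  have hp1 : 0 < p.2 := hp.1
  have hp2 : L * (|p.1| - 1) < p.2 := hp.2
  have key : ∀ᶠ q in atTop, p.1 * (zed a b (lip η q)).re - p.2 * q - |(zed a b (lip η q)).re| ≤
      -(min p.2 (p.2 - L * (|p.1| - 1)) * q) := by
    filter_upwards [eventually_gt_atTop 0] with q hq
    have hzn := norm_zed_le (a := a) (b := b) (lip_mem hη q)
    rw [exp_lip_re η hq, ← hL] at hzn
    have hr := (Complex.abs_re_le_norm _).trans hzn
    have h1 : p.1 * (zed a b (lip η q)).re ≤ |p.1| * |(zed a b (lip η q)).re| := by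
      rw [← abs_mul]; exact le_abs_self _
    rcases le_total |p.1| 1 with hx | hx
    · have h2 : |p.1| * |(zed a b (lip η q)).re| ≤ |(zed a b (lip η q)).re| :=
        mul_le_of_le_one_left (abs_nonneg _) hx
      have h3 := mul_le_mul_of_nonneg_right (min_le_left p.2 (p.2 - L * (|p.1| - 1))) hq.le
      linarith
    · have h2 := mul_le_mul_of_nonneg_left hr (sub_nonneg.2 hx)
      have h3 := mul_le_mul_of_nonneg_right (min_le_right p.2 (p.2 - L * (|p.1| - 1))) hq.le
      nlinarith
  refine ((integrableOn_cut ha hab hG hη hδ i j (lt_min hp1 (by linarith)) key).const_mul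
    ‖(2 * Real.pi * Complex.I : ℂ)⁻¹‖).congr (Eventually.of_forall fun q => ?_)
  simp only [norm_mul]
  ring

theorem exists_norm_symb_wpole_le {G : ℂ → ℂ} (hG : Symb G) : ∃ k : ℕ, ∃ C : ℝ, 0 ≤ C ∧
    ∀ w ∈ cstrip, -|Real.log a - Real.log b| ≤ w.re → ‖G w‖ ≤ C * Real.exp w.re ^ k := by
  obtain ⟨k, hk⟩ := hG.growth
  obtain ⟨C, hC, hk⟩ := hk (-|Real.log a - Real.log b|)
  exact ⟨k, C, hC, hk⟩

/-- What is needed of a sequence of logarithms of poles. -/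
structure PoleSeq (a b : ℝ) (w : ℕ → ℂ) : Prop where
  mem : ∀ n, w n ∈ ostrip
  re_eq : ∀ n, (w n).re = (wpole a b n).re
  exp_re : ∀ n, (Complex.exp (w n)).re = (Complex.exp (wpole a b n)).re
  norm_zed : ∀ n, ‖zed a b (w n)‖ = (n + 1 : ℕ) * Real.pi
  zed_re : ∀ n, (zed a b (w n)).re = 0
  norm_cosh : ∀ n, ‖Complex.cosh (zed a b (w n))‖ = 1

theorem poleSeq_wpole : PoleSeq a b (wpole a b) where
  mem := wpole_mem
  re_eq _ := rfl
  exp_re _ := rfl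
  norm_zed n := by
    rw [zed_wpole, norm_mul, Complex.norm_I, mul_one, Complex.norm_real,
      Real.norm_of_nonneg (npi_pos n.succ_pos).le]
  zed_re n := by rw [zed_wpole, Complex.re_ofReal_mul, Complex.I_re, mul_zero]
  norm_cosh := norm_cosh_wpole

theorem poleSeq_wpole' : PoleSeq a b (wpole' a b) where
  mem := wpole'_mem
  re_eq := wpole'_re
  exp_re n := by rw [exp_wpole', exp_wpole, smole_re]
  norm_zed n := by
    rw [zed_wpole', norm_neg, norm_mul, Complex.norm_I, mul_one, Complex.norm_real,
      Real.norm_of_nonneg (npi_pos n.succ_pos).le]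
  zed_re n := by rw [zed_wpole', Complex.neg_re, Complex.re_ofReal_mul, Complex.I_re, mul_zero, neg_zero]
  norm_cosh := norm_cosh_wpole'

/-- At the poles `z` is imaginary, so `x` does not affect the size of the terms. The bound `Re s ≤ D
- c√n` makes all moments summable as soon as `t > 0`. -/
theorem expGood_resI (ha : 0 < a) (hab : a < b) {G : ℂ → ℂ} (hG : Symb G) {w : ℕ → ℂ}
    (hw : PoleSeq a b w) : ExpGood Measure.count (fun n => G (w n) * rcoef a b (w n))
      (fun n => zed a b (w n)) (fun n => Complex.exp (w n)) {p | 0 < p.2} := by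
  refine ⟨(measurable_from_nat).aestronglyMeasurable, (measurable_from_nat).aestronglyMeasurable,
    (measurable_from_nat).aestronglyMeasurable, fun p hp i j => ?_⟩
  have hp : 0 < p.2 := hp
  obtain ⟨k, C, hC, hk⟩ := exists_norm_symb_wpole_le (a := a) (b := b) hG
  obtain ⟨c, hc, D, hD⟩ := exists_spole_re_le ha hab
  obtain ⟨K, hK, hN⟩ := exists_pow_mul_exp_neg_sqrt_le (k + i + j + 2) (mul_pos hp hc)
  set L := Real.exp |Real.log a - Real.log b| with hL
  have hLp : 0 < L := Real.exp_pos _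
  have hL1 : 1 ≤ L := Real.one_le_exp (abs_nonneg _)
  have hpi := Real.pi_pos
  rw [integrable_count_iff]
  have hsum : Summable fun n : ℕ => C * (6 * L) * (L * Real.pi) ^ (k + i + j) * Real.exp (p.2 * D) * K *
      (((n + 1 : ℕ) : ℝ) ^ 2)⁻¹ :=
    ((summable_nat_add_iff 1).2 (Real.summable_nat_pow_inv.2 one_lt_two)).mul_left _
  refine Summable.of_nonneg_of_le (fun n => norm_nonneg _) (fun n => ?_) hsum
  set m : ℝ := ((n + 1 : ℕ) : ℝ) with hm
  have hm0 : 0 < m := by rw [hm]; exact_mod_cast n.succ_pos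
  have h1 : Real.exp (w n).re ≤ L * Real.pi * m := by rw [hw.re_eq]; exact exp_wpole_re_le n
  have h2 := hk (w n) (ostrip_subset (hw.mem n)) (by rw [hw.re_eq]; exact wpole_re_ge n)
  have h3 := norm_rcoef_le (ostrip_subset (hw.mem n)) (hw.norm_cosh n)
  have h4 : ‖zed a b (w n)‖ ≤ L * Real.pi * m := by
    rw [hw.norm_zed, ← hm, mul_comm m, mul_assoc]
    exact le_mul_of_one_le_left (by positivity) hL1
  have h5 : (Complex.exp (w n)).re ≤ D - c * Real.sqrt m := by
    rw [hw.exp_re, exp_wpole]; exact hD (n + 1) n.succ_pos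
  have h6 := hN m hm0.le
  rw [Real.norm_of_nonneg (by positivity), norm_mul, hw.zed_re, mul_zero, zero_add, Complex.norm_exp]
  calc ‖G (w n)‖ * ‖rcoef a b (w n)‖ * ‖zed a b (w n)‖ ^ i * Real.exp (w n).re ^ j *
        Real.exp (p.2 * (Complex.exp (w n)).re)
      ≤ (C * (L * Real.pi * m) ^ k) * (6 * L) * (L * Real.pi * m) ^ i * (L * Real.pi * m) ^ j *
        Real.exp (p.2 * (D - c * Real.sqrt m)) := by
        have h2' : ‖G (w n)‖ ≤ C * (L * Real.pi * m) ^ k :=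
          h2.trans (mul_le_mul_of_nonneg_left (pow_le_pow_left₀ (Real.exp_pos _).le h1 k) hC)
        gcongr
    _ = C * (6 * L) * (L * Real.pi) ^ (k + i + j) * Real.exp (p.2 * D) *
        (m ^ (k + i + j + 2) * Real.exp (-(p.2 * c * Real.sqrt m))) * (m ^ 2)⁻¹ := by
        rw [show p.2 * (D - c * Real.sqrt m) = p.2 * D + -(p.2 * c * Real.sqrt m) by ring, Real.exp_add]
        simp only [mul_pow, pow_add]
        field_simp
    _ ≤ _ := by gcongr

/-- The keyhole representation. -/
def keyI (a b : ℝ) (G : ℂ → ℂ) (δ : ℝ) (p : ℝ × ℝ) : ℂ :=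
  circI a b G (Real.log δ) p + (cutI a b G (-1) δ p - cutI a b G 1 δ p) +
    (resI a b G (wpole a b) p + resI a b G (wpole' a b) p)

/-- Smoothness in a neighbourhood of `x = 1`, which is out of reach of the Bromwich representation.
-/
theorem contDiffOn_keyI (ha : 0 < a) (hab : a < b) {G : ℂ → ℂ} (hG : Symb G) {δ : ℝ} (hδ : 0 < δ)
    (hδ' : Real.log δ < -|Real.log a - Real.log b|) :
    ContDiffOn ℝ (⊤ : ℕ∞) (keyI a b G δ) (keyDom a b) := by
  have hO := isOpen_keyDom (a := a) (b := b)
  have hsub : keyDom a b ⊆ {p : ℝ × ℝ | 0 < p.2} := fun p hp => hp.1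
  have hP : IsOpen {p : ℝ × ℝ | 0 < p.2} := isOpen_lt continuous_const continuous_snd
  have h1 := (expGood_circI hG hδ' (keyDom a b)).contDiffOn hO
  have h2 := (expGood_cutI ha hab hG (η := -1) (by simp) hδ).contDiffOn hO
  have h3 := (expGood_cutI ha hab hG (η := 1) (by simp) hδ).contDiffOn hO
  have h4 := ((expGood_resI ha hab hG (poleSeq_wpole)).contDiffOn hP).mono hsub
  have h5 := ((expGood_resI ha hab hG (poleSeq_wpole')).contDiffOn hP).mono hsub
  exact (h1.add (h2.sub h3)).add (h4.add h5)

end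

/-! ### The Bromwich integral equals the keyhole representation. -/

section

variable {a b : ℝ}

theorem integral_comp_exp_mul {g : ℝ → ℂ} (hg : ContinuousOn g (Ioi 0)) (x0 x1 : ℝ) :
    ∫ x in x0..x1, g (Real.exp x) * Real.exp x = ∫ q in Real.exp x0..Real.exp x1, g q := by
  have h := intervalIntegral.integral_deriv_smul_comp' (a := x0) (b := x1) (f := Real.exp)
    (f' := Real.exp) (g := g) (fun x _ => Real.hasDerivAt_exp x) Real.continuous_exp.continuousOn
    (hg.mono (by rintro _ ⟨x, -, rfl⟩; exact Real.exp_pos x))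
  rw [← h]
  refine intervalIntegral.integral_congr fun x _ => ?_
  simp only [Function.comp, Complex.real_smul]
  ring

/-- The integrand of the contour integrals, as a function of `w = log s`. -/
def wker (a b : ℝ) (G : ℂ → ℂ) (x t : ℝ) (w : ℂ) : ℂ :=
  G w * Complex.exp (x * zed a b w + t * Complex.exp w) / Complex.sinh (zed a b w)

theorem cutI_eq (G : ℂ → ℂ) {η : ℝ} (hη : |η| = 1) {δ : ℝ} (hδ : 0 < δ) (x t : ℝ) :
    cutI a b G η δ (x, t) = (2 * Real.pi * Complex.I : ℂ)⁻¹ *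
      ∫ q in Ioi δ, wker a b G x t (lip η q) := by
  rw [cutI, expInt, ← integral_const_mul]
  refine setIntegral_congr_fun measurableSet_Ioi fun q hq => ?_
  have hq : δ < q := hq
  simp only [wker, exp_lip hη (hδ.trans hq)]
  ring

theorem integrableOn_wker_lip (ha : 0 < a) (hab : a < b) {G : ℂ → ℂ} (hG : Symb G) {η : ℝ}
    (hη : |η| = 1) {δ : ℝ} (hδ : 0 < δ) {x t : ℝ} (hp : (x, t) ∈ keyDom a b) :
    IntegrableOn (fun q => wker a b G x t (lip η q)) (Ioi δ) := by
  have h := ((expGood_cutI ha hab hG hη hδ).integrable_integrand hp).const_mul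
    (2 * Real.pi * Complex.I : ℂ)
  refine (integrableOn_congr_fun (fun q hq => ?_) measurableSet_Ioi).1 h
  have hq : δ < q := hq
  have hpi : (2 * Real.pi * Complex.I : ℂ) ≠ 0 := by simp [Real.pi_ne_zero]
  simp only [wker, exp_lip hη (hδ.trans hq)]
  field_simp

theorem circI_eq (G : ℂ → ℂ) (x0 x t : ℝ) :
    circI a b G x0 (x, t) = (2 * Real.pi : ℂ)⁻¹ * ∫ y in -Real.pi..Real.pi,
      wker a b G x t (x0 + y * Complex.I) * Complex.exp (x0 + y * Complex.I) := by
  rw [circI, expInt, intervalIntegral.integral_of_le (by linarith [Real.pi_pos]), ← integral_const_mul]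
  congr 1 with y
  simp only [wker]
  ring

theorem resI_hasSum (ha : 0 < a) (hab : a < b) {G : ℂ → ℂ} (hG : Symb G) {w : ℕ → ℂ}
    (hw : PoleSeq a b w) {x t : ℝ} (ht : 0 < t) :
    HasSum (fun n => G (w n) * rcoef a b (w n) *
      Complex.exp (x * zed a b (w n) + t * Complex.exp (w n))) (resI a b G w (x, t)) := by
  have h := (expGood_resI ha hab hG hw).integrable_integrand (p := (x, t)) ht
  have h1 := (integrable_count_iff.1 h).of_norm.hasSum
  rw [resI, expInt, integral_countable h]
  simpa [measureReal_def] using h1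

theorem hasDerivAt_sinh_zed {w : ℂ} (hw : w ∈ cstrip) :
    HasDerivAt (fun w => Complex.sinh (zed a b w))
      (Complex.cosh (zed a b w) * (zed a b w * (1 + muDeriv a b w))) w :=
  (Complex.hasDerivAt_sinh _).comp w (hasDerivAt_zed hw)

/-- The Jacobian `e^w` of `s = e^w` cancels the factor `e^w` in `z`, so a residue computed in `w`
becomes the residue in `s`. -/
theorem exp_div_deriv_sinh_zed (w : ℂ) :
    Complex.exp w / (Complex.cosh (zed a b w) * (zed a b w * (1 + muDeriv a b w))) = rcoef a b w := by
  have h0 := Complex.exp_ne_zero w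
  rw [rcoef, zed, psi, Complex.exp_add]
  rw [show Complex.cosh (Complex.exp w * Complex.exp (mu a b w)) * (Complex.exp w *
    Complex.exp (mu a b w) * (1 + muDeriv a b w)) = Complex.exp w * (Complex.cosh (Complex.exp w *
    Complex.exp (mu a b w)) * (Complex.exp (mu a b w) * (1 + muDeriv a b w))) by ring, div_mul_eq_div_div,
    div_self h0, one_div]

theorem finite_wpole_re_lt (r : ℝ) : {n : ℕ | (wpole a b n).re < r}.Finite := by
  obtain ⟨N, hN⟩ := eventually_atTop.1 ((tendsto_wpole_re (a := a) (b := b)).eventually_ge_atTop r)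
  refine (finite_lt_nat N).subset fun n hn => ?_
  by_contra h
  exact absurd (hN n (not_lt.1 h)) (not_le.2 hn)

/-- The indices of the poles with `|s| < e^r`. -/
def poleIdx (a b r : ℝ) : Finset ℕ := (finite_wpole_re_lt (a := a) (b := b) r).toFinset

theorem mem_poleIdx {r : ℝ} {n : ℕ} : n ∈ poleIdx a b r ↔ (wpole a b n).re < r := by simp [poleIdx]

theorem tendsto_poleIdx : Tendsto (fun n => poleIdx a b (arcRe a b n)) atTop atTop := by
  refine tendsto_atTop.2 fun T => ?_
  have h : ∀ m ∈ T, ∀ᶠ n in atTop, (wpole a b m).re < arcRe a b n := fun m _ =>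
    tendsto_arcRe.eventually_gt_atTop _
  filter_upwards [(T.eventually_all).2 h] with n hn m hm
  exact mem_poleIdx.2 (hn m hm)

theorem sum_poles (r : ℝ) (f : ℂ → ℂ) :
    ∑ p ∈ (poleIdx a b r).image (wpole a b) ∪ (poleIdx a b r).image (wpole' a b), f p =
      ∑ n ∈ poleIdx a b r, f (wpole a b n) + ∑ n ∈ poleIdx a b r, f (wpole' a b n) := by
  rw [Finset.sum_union, Finset.sum_image fun _ _ _ _ h => wpole_injective h,
    Finset.sum_image fun _ _ _ _ h => wpole'_injective h]
  rw [Finset.disjoint_left]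
  intro p hp hp'
  obtain ⟨m, -, rfl⟩ := Finset.mem_image.1 hp
  obtain ⟨n, -, h⟩ := Finset.mem_image.1 hp'
  exact wpole_ne_wpole' m n h.symm

theorem continuousOn_wker_lip {G : ℂ → ℂ} (hG : Symb G) {η : ℝ} (hη : |η| = 1) (x t : ℝ) :
    ContinuousOn (fun q => wker a b G x t (lip η q)) (Ioi 0) := by
  have c2 := continuousOn_lip (continuousOn_zed (a := a) (b := b)) hη
  have c3 := continuousOn_lip Complex.continuous_exp.continuousOn hη
  exact ((continuousOn_lip hG.cont hη).mul ((c2.const_mul _).add (c3.const_mul _)).cexp).div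
    (Complex.continuous_sinh.comp_continuousOn c2) fun q _ => sinh_zed_lip_ne_zero hη q

theorem log_exp_lip (η x : ℝ) : lip η (Real.exp x) = x + (η * Real.pi : ℝ) * Complex.I := by
  rw [lip, Real.log_exp]; push_cast; ring

/-- The residue theorem on the keyhole contour between `|s| = δ` and `|s| = e^r`. -/
theorem keyhole_wker {G : ℂ → ℂ} (hG : Symb G) {δ : ℝ} (hδ : 0 < δ)
    (hδ' : Real.log δ < -|Real.log a - Real.log b|) {r : ℝ} (hr : Real.log δ < r)
    (hnz : ∀ w ∈ cstrip, w.re = r → Complex.sinh (zed a b w) ≠ 0) (x t : ℝ) :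
    (2 * Real.pi : ℂ)⁻¹ * ∫ y in -Real.pi..Real.pi, wker a b G x t (r + y * Complex.I) *
        Complex.exp (r + y * Complex.I) =
      circI a b G (Real.log δ) (x, t) +
      (2 * Real.pi * Complex.I : ℂ)⁻¹ * ((∫ q in δ..Real.exp r, wker a b G x t (lip (-1) q)) -
        ∫ q in δ..Real.exp r, wker a b G x t (lip 1 q)) +
      (∑ n ∈ poleIdx a b r, G (wpole a b n) * rcoef a b (wpole a b n) *
          Complex.exp (x * zed a b (wpole a b n) + t * Complex.exp (wpole a b n)) +
        ∑ n ∈ poleIdx a b r, G (wpole' a b n) * rcoef a b (wpole' a b n) *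
          Complex.exp (x * zed a b (wpole' a b n) + t * Complex.exp (wpole' a b n))) := by
  have hpi := Real.pi_pos
  set N : ℂ → ℂ := fun w => G w * Complex.exp (x * zed a b w + t * Complex.exp w) with hN
  set Q : ℂ → ℂ := fun w => Complex.sinh (zed a b w) with hQ
  have hNc : ContinuousOn N cstrip := hG.cont.mul
    ((continuousOn_zed.const_mul _).add (Complex.continuous_exp.continuousOn.const_mul _)).cexp
  have hNd : DifferentiableOn ℂ N ostrip := hG.diff.mul
    ((differentiableOn_zed.const_mul _).add (Complex.differentiable_exp.differentiableOn.const_mul _)).cexp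
  have hQd : ∀ w ∈ cstrip, DifferentiableAt ℂ Q w := fun w hw => (hasDerivAt_sinh_zed hw).differentiableAt
  have hpole : ∀ w : ℂ, w ∈ ostrip → Complex.sinh (zed a b w) = 0 → deriv Q w ≠ 0 := fun w hw h0 => by
    rw [(hasDerivAt_sinh_zed (ostrip_subset hw)).deriv]
    refine mul_ne_zero (fun h => ?_) (mul_ne_zero (zed_ne_zero _) (one_add_muDeriv_ne_zero (ostrip_subset hw)))
    have := Complex.cosh_sq_sub_sinh_sq (zed a b w)
    rw [h, h0] at this
    norm_num at this
  have hk := keyhole hNc hNd hQd hr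
    ((poleIdx a b r).image (wpole a b) ∪ (poleIdx a b r).image (wpole' a b)) (fun p hp => by
      rcases Finset.mem_union.1 hp with hp | hp <;> obtain ⟨n, hn, rfl⟩ := Finset.mem_image.1 hp
      · exact ⟨wpole_mem n, hδ'.trans_le (wpole_re_ge n), mem_poleIdx.1 hn, sinh_zed_wpole n,
          hpole _ (wpole_mem n) (sinh_zed_wpole n)⟩
      · refine ⟨wpole'_mem n, ?_, ?_, sinh_zed_wpole' n, hpole _ (wpole'_mem n) (sinh_zed_wpole' n)⟩
        · rw [wpole'_re]; exact hδ'.trans_le (wpole_re_ge n)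
        · rw [wpole'_re]; exact mem_poleIdx.1 hn) (fun w hw _ h2 h3 => by
      have h4 : w.re < r := lt_of_le_of_ne h2 fun h => hnz w hw h h3
      obtain ⟨n, rfl | rfl⟩ := exists_eq_wpole hw h3
      · exact Finset.mem_union_left _ (Finset.mem_image_of_mem _ (mem_poleIdx.2 h4))
      · rw [wpole'_re] at h4
        exact Finset.mem_union_right _ (Finset.mem_image_of_mem _ (mem_poleIdx.2 h4)))
  have e1 : ∀ w, N w / Q w = wker a b G x t w := fun w => rfl
  simp only [e1] at hk
  have hterm : ∀ w ∈ ostrip, N w * Complex.exp w / deriv Q w = G w * rcoef a b w *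
      Complex.exp (x * zed a b w + t * Complex.exp w) := fun w hw => by
    rw [(hasDerivAt_sinh_zed (ostrip_subset hw)).deriv, mul_div_assoc,
      exp_div_deriv_sinh_zed]
    simp only [hN]; ring
  rw [sum_poles, Finset.sum_congr rfl fun n _ => hterm _ (wpole_mem n),
    Finset.sum_congr rfl fun n _ => hterm _ (wpole'_mem n)] at hk
  have cm := continuousOn_wker_lip (a := a) (b := b) hG (η := -1) (by simp) x t
  have cp := continuousOn_wker_lip (a := a) (b := b) hG (η := 1) (by simp) x t
  have hcut : (∫ y in Real.log δ..r, (wker a b G x t (y + (-Real.pi : ℝ) * Complex.I) -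
      wker a b G x t (y + Real.pi * Complex.I)) * Real.exp y) =
      (∫ q in δ..Real.exp r, wker a b G x t (lip (-1) q)) - ∫ q in δ..Real.exp r, wker a b G x t (lip 1 q) := by
    have h := integral_comp_exp_mul (cm.sub cp) (Real.log δ) r
    rw [Real.exp_log hδ] at h
    simp only [Pi.sub_apply] at h
    have hsub : uIcc δ (Real.exp r) ⊆ Ioi 0 := fun q hq =>
      lt_of_lt_of_le (lt_min hδ (Real.exp_pos r)) hq.1
    rw [← intervalIntegral.integral_sub (cm.mono hsub).intervalIntegrable
      (cp.mono hsub).intervalIntegrable, ← h]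
    refine intervalIntegral.integral_congr fun y _ => ?_
    simp only [log_exp_lip]
    simp
  rw [hcut] at hk
  rw [circI_eq]
  have hI : (2 * Real.pi * Complex.I : ℂ) ≠ 0 := by simp [hpi.ne']
  have hp2 : (2 * Real.pi : ℂ) ≠ 0 := by simp [hpi.ne']
  apply mul_left_cancel₀ hI
  rw [mul_add, mul_add, mul_inv_cancel_left₀ hI]
  have e2 : ∀ z : ℂ, 2 * Real.pi * Complex.I * ((2 * Real.pi : ℂ)⁻¹ * z) = Complex.I * z := fun z => by
    field_simp
  rw [e2, e2]
  exact hk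

theorem exp_mem_of_re_pos {w : ℂ} (hw : w ∈ cstrip) (h : 0 < (Complex.exp w).re) :
    Complex.log (Complex.exp w) = w := by
  refine log_exp_of_mem (mem_ostrip.2 (lt_of_le_of_ne (mem_cstrip.1 hw) fun h1 => ?_))
  rw [Complex.exp_re, ← Real.cos_abs, h1, Real.cos_pi] at h
  linarith [Real.exp_pos w.re]

/-- On the large arcs, to the left of the Bromwich line, the integrand is small. -/
theorem exists_arc_wker_bound (ha : 0 < a) (hab : a < b) {G : ℂ → ℂ} (hG : Symb G) {x t : ℝ}
    (hx : |x| < 1) (ht : 0 < t) {A : ℝ} (hA : 0 < A) : ∃ K : ℝ, ∀ᶠ n in atTop, ∀ w ∈ cstrip,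
      w.re = arcRe a b n → (Complex.exp w).re ≤ A →
        ‖wker a b G x t w * Complex.exp w‖ ≤ K * Real.exp (-arcRe a b n) := by
  obtain ⟨c, hc, r0, hr0, hre⟩ := exists_re_zed_ge ha hab
  obtain ⟨N, hN⟩ := exists_arc_bound ha hab
  obtain ⟨k, hk⟩ := hG.growth
  obtain ⟨C, hC, hk⟩ := hk 0
  have hη : 0 < min ((1 - |x|) * c) (t * c) := lt_min (mul_pos (sub_pos.2 hx) hc) (mul_pos ht hc)
  obtain ⟨K, hK, hKb⟩ := exists_pow_mul_exp_neg_sqrt_le (k + 2) hη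
  refine ⟨4 * C * Real.exp (t * A) * K, ?_⟩
  filter_upwards [eventually_ge_atTop N, tendsto_arcRe.eventually_ge_atTop r0,
    tendsto_arcRe.eventually_ge_atTop 0] with n hnN hn0 hn1 w hw hwn hwA
  rw [← hwn] at hn0 hn1 ⊢
  set R := Real.exp w.re with hR
  have hRp : 0 < R := Real.exp_pos _
  have h1 := hN n hnN w hw hwn
  have h2 := hk w hw hn1
  have h3 : Real.exp (w.re / 2) = Real.sqrt R := Real.exp_half _
  -- Of the two alternatives, a large `Re z` gives decay through the factor `1 - |x|`, and a very
  -- negative `Re s` gives it through `t`. The term `tA` covers arc points with `0 < Re s ≤ A`.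
  have h4 : x * (zed a b w).re + t * (Complex.exp w).re - |(zed a b w).re| ≤
      t * A + -(min ((1 - |x|) * c) (t * c) * Real.sqrt R) := by
    have h5 : x * (zed a b w).re ≤ |x| * |(zed a b w).re| := by rw [← abs_mul]; exact le_abs_self _
    have hsq := Real.sqrt_nonneg R
    have h6 := mul_le_mul_of_nonneg_right (min_le_left ((1 - |x|) * c) (t * c)) hsq
    have h7 := mul_le_mul_of_nonneg_right (min_le_right ((1 - |x|) * c) (t * c)) hsq
    rcases (hre w hw hn0).2 with h | h
    · rw [h3] at h
      have h8 := mul_le_mul_of_nonneg_left (h.trans (le_abs_self _)) (sub_pos.2 hx).le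
      have h9 := mul_le_mul_of_nonneg_left hwA ht.le
      linarith
    · rw [h3] at h
      have h8 := mul_le_mul_of_nonneg_left h ht.le
      have h9 := mul_nonneg (sub_pos.2 hx).le (abs_nonneg (zed a b w).re)
      have h10 := mul_pos ht hA
      linarith
  rw [wker, norm_mul, norm_div, norm_mul, norm_cexp_lin, Complex.norm_exp, ← hR, Real.exp_neg, ← hR]
  calc ‖G w‖ * Real.exp (x * (zed a b w).re + t * (Complex.exp w).re) / ‖Complex.sinh (zed a b w)‖ * R
      ≤ (C * R ^ k) * Real.exp (x * (zed a b w).re + t * (Complex.exp w).re) /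
        (Real.exp |(zed a b w).re| / 4) * R := by gcongr
    _ = 4 * C * R ^ (k + 1) *
        Real.exp (x * (zed a b w).re + t * (Complex.exp w).re - |(zed a b w).re|) := by
        rw [Real.exp_sub, pow_succ]; field_simp
    _ ≤ 4 * C * R ^ (k + 1) * Real.exp (t * A + -(min ((1 - |x|) * c) (t * c) * Real.sqrt R)) := by gcongr
    _ = 4 * C * Real.exp (t * A) * (R ^ (k + 2) * Real.exp (-(min ((1 - |x|) * c) (t * c) * Real.sqrt R))) *
        R⁻¹ := by rw [Real.exp_add, pow_succ _ (k + 1)]; field_simp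
    _ ≤ _ := by
        gcongr
        exact hKb R hRp.le

/-- Limit of the keyhole identity along the circles between the poles: the outer circle becomes the
Bromwich line, the cut segments become half-lines, and the finite sums over enclosed poles exhaust
the absolutely convergent series. -/
theorem brom_eq_keyI (ha : 0 < a) (hab : a < b) {G : ℂ → ℂ} (hG : Symb G) {x t : ℝ}
    (hx : |x| < 1) (ht : 0 < t) {A : ℝ} (hA : absc ha hab < A) {δ : ℝ} (hδ : 0 < δ)
    (hδ' : Real.log δ < -|Real.log a - Real.log b|) :
    brom a b G A (x, t) = keyI a b G δ (x, t) := by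
  have hA1 := one_le_absc ha hab
  have hA0 : 0 < A := by linarith
  obtain ⟨N, hN⟩ := exists_arc_bound ha hab
  obtain ⟨K, hK⟩ := exists_arc_wker_bound ha hab hG hx ht hA0
  obtain ⟨C, hH⟩ := halfPlane_kern ha hab hG hx
  have hnz : ∀ n ≥ N, ∀ w ∈ cstrip, w.re = arcRe a b n → Complex.sinh (zed a b w) ≠ 0 :=
    fun n hn w hw h => norm_pos_iff.1 (lt_of_lt_of_le (by positivity) (hN n hn w hw h))
  set f : ℂ → ℂ := fun s => kern a b G s * Complex.exp (x * kap a b s) * Complex.exp (s * t) with hf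
  have hfd : DifferentiableOn ℂ f {s | absc ha hab < s.re} := hH.diff.mul (by fun_prop)
  have hε : Tendsto (fun n => K * Real.exp (-arcRe a b n)) atTop (𝓝 0) := by
    have := (Real.tendsto_exp_neg_atTop_nhds_zero.comp (tendsto_arcRe (a := a) (b := b))).const_mul K
    simpa using this
  have t1 := tendsto_circle_integral hA hA0 hfd (hH.integrable_line_exp hA t)
    (g := fun w => wker a b G x t w * Complex.exp w) (fun w hw h => by
      have h1 := exp_mem_of_re_pos hw (hA0.trans_le h)
      simp only [hf, wker, kern, kap, h1, Complex.exp_add]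
      ring_nf) (tendsto_arcRe (a := a) (b := b)) hε (by
      filter_upwards [hK] with n hn y hy h
      exact hn _ (arc_mem hy) (by simp) h) (by
      filter_upwards [eventually_ge_atTop N] with n hn
      have c2 := continuousOn_arc (continuousOn_zed (a := a) (b := b)) (arcRe a b n)
      refine ContinuousOn.mul (ContinuousOn.div ((continuousOn_arc hG.cont _).mul
        ((c2.const_mul _).add (by fun_prop)).cexp) (Complex.continuous_sinh.comp_continuousOn c2)
        fun y hy => ?_) (by fun_prop)
      exact hnz n hn _ (arc_mem hy) (by simp))
  have t2 := t1.const_mul (2 * Real.pi : ℂ)⁻¹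
  have e0 : brom a b G A (x, t) = (2 * Real.pi : ℂ)⁻¹ * ∫ ω : ℝ, f (A + ω * Complex.I) := by
    rw [brom_eq_Br, Br]
  rw [e0]
  refine tendsto_nhds_unique t2 ?_
  have hR : Tendsto (fun n => Real.exp (arcRe a b n)) atTop atTop :=
    Real.tendsto_exp_atTop.comp tendsto_arcRe
  have hdom := mem_keyDom (a := a) (b := b) hx.le ht
  have tm := intervalIntegral_tendsto_integral_Ioi δ
    (integrableOn_wker_lip ha hab hG (η := -1) (by simp) hδ hdom) hR
  have tp := intervalIntegral_tendsto_integral_Ioi δ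
    (integrableOn_wker_lip ha hab hG (η := 1) (by simp) hδ hdom) hR
  have s1 := (resI_hasSum ha hab hG poleSeq_wpole (x := x) ht).comp (tendsto_poleIdx (a := a) (b := b))
  have s2 := (resI_hasSum ha hab hG poleSeq_wpole' (x := x) ht).comp (tendsto_poleIdx (a := a) (b := b))
  have t3 := (tendsto_const_nhds (x := circI a b G (Real.log δ) (x, t))).add
    ((tm.sub tp).const_mul (2 * Real.pi * Complex.I : ℂ)⁻¹)
  have t4 := t3.add (s1.add s2)
  rw [mul_sub, ← cutI_eq G (by simp) hδ, ← cutI_eq G (by simp) hδ] at t4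
  refine t4.congr' ?_
  filter_upwards [eventually_ge_atTop N, tendsto_arcRe.eventually_gt_atTop (Real.log δ)] with n hn hn'
  exact (keyhole_wker hG hδ hδ' hn' (hnz n hn) x t).symm

end

/-! ### The part odd in `x`, and the shrinking of the inner circle. -/

section

variable {a b : ℝ}

theorem norm_sinh_sub_le {z : ℂ} (hz : ‖z‖ ≤ 1) : ‖Complex.sinh z - z‖ ≤ ‖z‖ ^ 2 := by
  have h1 := Complex.norm_exp_sub_one_sub_id_le hz
  have h2 := Complex.norm_exp_sub_one_sub_id_le (x := -z) (by rwa [norm_neg])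
  rw [norm_neg] at h2
  have e : Complex.sinh z - z = ((Complex.exp z - 1 - z) - (Complex.exp (-z) - 1 - -z)) / 2 := by
    rw [Complex.sinh]; ring
  rw [e, norm_div, Complex.norm_ofNat]
  have := norm_sub_le (Complex.exp z - 1 - z) (Complex.exp (-z) - 1 - -z)
  linarith

/-- `sinh z` differs from `z` by at most `|z|²`, so the numerator is at most `(3/2)|z|` and the
denominator at least `(1/2)|z|`. -/
theorem norm_sinh_div_sinh_le {z : ℂ} (hz : ‖z‖ ≤ 1 / 2) {x : ℝ} (hx : |x| ≤ 1) :
    ‖Complex.sinh (x * z) / Complex.sinh z‖ ≤ 3 := by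
  rcases eq_or_ne z 0 with rfl | h0
  · simp
  have hn : 0 < ‖z‖ := norm_pos_iff.2 h0
  have h1 : ‖(x : ℂ) * z‖ ≤ ‖z‖ := by
    rw [norm_mul, Complex.norm_real]; exact mul_le_of_le_one_left (norm_nonneg _) hx
  have h2 := norm_sinh_sub_le (z := x * z) (by linarith)
  have h3 := norm_sinh_sub_le (z := z) (by linarith)
  have h4 : ‖Complex.sinh (x * z)‖ ≤ 3 / 2 * ‖z‖ := by
    have h5 := norm_sub_norm_le (Complex.sinh (x * z)) (x * z)
    nlinarith [norm_nonneg ((x : ℂ) * z)]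
  have h5 : 1 / 2 * ‖z‖ ≤ ‖Complex.sinh z‖ := by
    have h6 := norm_sub_norm_le z (Complex.sinh z)
    rw [norm_sub_rev] at h6
    nlinarith
  rw [norm_div, div_le_iff₀ (by linarith)]
  linarith

theorem norm_pker_le {w : ℂ} (hw : w ∈ cstrip) (h : w.re ≤ -|Real.log a - Real.log b| - 1) {x : ℝ}
    (hx : |x| ≤ 1) : ‖pker a b x w‖ ≤ 3 := by
  refine norm_sinh_div_sinh_le ((norm_zed_le hw).trans ?_) hx
  rw [← Real.exp_add]
  have h1 : Real.exp (|Real.log a - Real.log b| + w.re) ≤ Real.exp (-1) :=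
    Real.exp_le_exp.2 (by linarith)
  have h2 : Real.exp (-1) ≤ 1 / 2 := by
    rw [Real.exp_neg, one_div]
    exact inv_anti₀ two_pos (by linarith [Real.add_one_le_exp (1 : ℝ)])
  linarith

/-- The integrand with the Dirichlet kernel `sinh (x s M(s)) / sinh (s M(s))`. -/
def dker (a b : ℝ) (G : ℂ → ℂ) (x t : ℝ) (w : ℂ) : ℂ :=
  G w * pker a b x w * Complex.exp (t * Complex.exp w)

theorem half_wker (G : ℂ → ℂ) (x t : ℝ) (w : ℂ) :
    (wker a b G x t w - wker a b G (-x) t w) / 2 = dker a b G x t w := by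
  have e : Complex.sinh (x * zed a b w) =
    (Complex.exp (x * zed a b w) - Complex.exp (-(x * zed a b w))) / 2 := rfl
  rw [wker, wker, dker, pker, e, Complex.exp_add, Complex.exp_add]
  push_cast
  rw [neg_mul]
  ring

/-- The part of `f (x, t)` that is odd in `x`. -/
def oddPart (f : ℝ × ℝ → ℂ) (p : ℝ × ℝ) : ℂ := (f p - f (-p.1, p.2)) / 2

/-- Near the branch point `sinh(xz)/sinh z` is bounded, so the arc is controlled by `G e^w`, that
is, by `s F̃(s) → 0` in the case of the datum. The single exponentials `e^{xz}/sinh z` behave like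
`1/z` there; this is why the odd part is formed before the circle is shrunk. -/
theorem tendsto_circle_dker {G : ℂ → ℂ}
    (h0 : ∀ ε > 0, ∃ r : ℝ, ∀ w ∈ cstrip, w.re ≤ r → ‖G w * Complex.exp w‖ ≤ ε) {x t : ℝ}
    (hx : |x| ≤ 1) (ht : 0 < t) :
    Tendsto (fun δ : ℝ => ∫ y in -Real.pi..Real.pi, dker a b G x t (Real.log δ + y * Complex.I) *
      Complex.exp (Real.log δ + y * Complex.I)) (𝓝[>] 0) (𝓝 0) := by
  have hpi := Real.pi_pos
  rw [Metric.tendsto_nhds]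
  intro ε hε
  obtain ⟨r, hr⟩ := h0 (ε / (3 * Real.exp t * (4 * Real.pi))) (by positivity)
  filter_upwards [Real.tendsto_log_nhdsGT_zero.eventually_le_atBot
    (min r (min 0 (-|Real.log a - Real.log b| - 1)))] with δ hδ
  have hδ1 : Real.log δ ≤ r := hδ.trans (min_le_left _ _)
  have hδ2 : Real.log δ ≤ 0 := hδ.trans ((min_le_right _ _).trans (min_le_left _ _))
  have hδ3 : Real.log δ ≤ -|Real.log a - Real.log b| - 1 :=
    hδ.trans ((min_le_right _ _).trans (min_le_right _ _))
  rw [dist_zero_right]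
  have hb : ∀ y ∈ uIoc (-Real.pi) Real.pi, ‖dker a b G x t (Real.log δ + y * Complex.I) *
      Complex.exp (Real.log δ + y * Complex.I)‖ ≤ ε / (4 * Real.pi) := by
    intro y hy
    rw [uIoc_of_le (by linarith)] at hy
    set w : ℂ := Real.log δ + y * Complex.I with hw
    have hwm : w ∈ cstrip := arc_mem (Ioc_subset_Icc_self hy)
    have hre : w.re = Real.log δ := by simp [hw]
    have h1 := hr w hwm (by rw [hre]; exact hδ1)
    have h2 := norm_pker_le (a := a) (b := b) hwm (by rw [hre]; exact hδ3) hx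
    have h3 : ‖Complex.exp (t * Complex.exp w)‖ ≤ Real.exp t := by
      rw [Complex.norm_exp, Complex.re_ofReal_mul]
      refine Real.exp_le_exp.2 (mul_le_of_le_one_right ht.le ?_)
      refine (Complex.re_le_norm _).trans ?_
      rw [Complex.norm_exp, hre]
      exact Real.exp_le_one_iff.2 hδ2
    calc ‖dker a b G x t w * Complex.exp w‖
        = ‖G w * Complex.exp w‖ * ‖pker a b x w‖ * ‖Complex.exp (t * Complex.exp w)‖ := by
          rw [dker]; simp only [norm_mul]; ring
      _ ≤ ε / (3 * Real.exp t * (4 * Real.pi)) * 3 * Real.exp t := by gcongr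
      _ = _ := by field_simp
  have h4 := intervalIntegral.norm_integral_le_of_norm_le_const hb
  rw [sub_neg_eq_add, abs_of_pos (by linarith)] at h4
  refine h4.trans_lt ?_
  have : ε / (4 * Real.pi) * (Real.pi + Real.pi) = ε / 2 := by field_simp; norm_num
  rw [this]
  linarith

/-- For `|x| < 1` both sides equal the same Bromwich integral, which does not involve the radius.
The case `|x| = 1` follows by continuity along `rx`, `r → 1⁻`. -/
theorem keyI_indep (ha : 0 < a) (hab : a < b) {G : ℂ → ℂ} (hG : Symb G) {x t : ℝ}
    (hx : |x| ≤ 1) (ht : 0 < t) {δ δ' : ℝ} (hδ : 0 < δ) (hδL : Real.log δ < -|Real.log a - Real.log b|)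
    (hδ' : 0 < δ') (hδL' : Real.log δ' < -|Real.log a - Real.log b|) :
    keyI a b G δ (x, t) = keyI a b G δ' (x, t) := by
  have hlim : ∀ d, 0 < d → Real.log d < -|Real.log a - Real.log b| →
      Tendsto (fun r : ℝ => keyI a b G d (r * x, t)) (𝓝[<] 1) (𝓝 (keyI a b G d (x, t))) := by
    intro d hd hd'
    have h1 : ContinuousAt (keyI a b G d) (1 * x, t) :=
      (contDiffOn_keyI ha hab hG hd hd').continuousOn.continuousAt
        (isOpen_keyDom.mem_nhds (by rw [one_mul]; exact mem_keyDom hx ht))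
    have h2 : ContinuousAt (fun r : ℝ => keyI a b G d (r * x, t)) 1 :=
      ContinuousAt.comp (f := fun r : ℝ => (r * x, t)) h1 (by fun_prop)
    have h3 := h2.tendsto.mono_left (nhdsWithin_le_nhds (s := Iio 1))
    rwa [one_mul] at h3
  refine tendsto_nhds_unique_of_eventuallyEq (hlim δ hδ hδL) (hlim δ' hδ' hδL') ?_
  filter_upwards [Ioo_mem_nhdsLT (zero_lt_one (α := ℝ))] with r hr
  have hrx : |r * x| < 1 := by
    rw [abs_mul, abs_of_pos hr.1]
    calc r * |x| ≤ r * 1 := mul_le_mul_of_nonneg_left hx hr.1.le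
      _ < 1 := by linarith [hr.2]
  have hA : absc ha hab < absc ha hab + 1 := by linarith
  rw [← brom_eq_keyI ha hab hG hrx ht hA hδ hδL, ← brom_eq_keyI ha hab hG hrx ht hA hδ' hδL']

/-- The residue of `G sinh (x s M) / sinh (s M) e^{st}` at the pole `s = e^w`. -/
def rterm (a b : ℝ) (G : ℂ → ℂ) (x t : ℝ) (w : ℂ) : ℂ :=
  G w * rcoef a b w * Complex.sinh (x * zed a b w) * Complex.exp (t * Complex.exp w)

theorem half_resI_hasSum (ha : 0 < a) (hab : a < b) {G : ℂ → ℂ} (hG : Symb G) {w : ℕ → ℂ}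
    (hw : PoleSeq a b w) {x t : ℝ} (ht : 0 < t) :
    HasSum (fun n => rterm a b G x t (w n)) (oddPart (resI a b G w) (x, t)) := by
  have h := ((resI_hasSum ha hab hG hw (x := x) ht).sub
    (resI_hasSum ha hab hG hw (x := -x) ht)).div_const 2
  refine h.congr_fun fun n => ?_
  have e : Complex.sinh (x * zed a b (w n)) =
    (Complex.exp (x * zed a b (w n)) - Complex.exp (-(x * zed a b (w n)))) / 2 := rfl
  rw [rterm, e, Complex.exp_add, Complex.exp_add]
  push_cast
  rw [neg_mul]
  ring

theorem integrableOn_dker_lip (ha : 0 < a) (hab : a < b) {G : ℂ → ℂ} (hG : Symb G) {η : ℝ}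
    (hη : |η| = 1) {x t : ℝ} (hx : |x| ≤ 1) (ht : 0 < t) {δ : ℝ} (hδ : 0 < δ) :
    IntegrableOn (fun q => dker a b G x t (lip η q)) (Ioi δ) := by
  have h1 := integrableOn_wker_lip ha hab hG hη hδ (mem_keyDom hx ht)
  have h2 := integrableOn_wker_lip ha hab hG hη hδ (mem_keyDom (x := -x) (by rwa [abs_neg]) ht)
  refine ((h1.sub h2).div_const 2).congr (Eventually.of_forall fun q => ?_)
  simp only [Pi.sub_apply, half_wker]

theorem oddPart_cutI (ha : 0 < a) (hab : a < b) {G : ℂ → ℂ} (hG : Symb G) {η : ℝ}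
    (hη : |η| = 1) {x t : ℝ} (hx : |x| ≤ 1) (ht : 0 < t) {δ : ℝ} (hδ : 0 < δ) :
    oddPart (cutI a b G η δ) (x, t) = (2 * Real.pi * Complex.I : ℂ)⁻¹ *
      ∫ q in Ioi δ, dker a b G x t (lip η q) := by
  have h1 := integrableOn_wker_lip ha hab hG hη hδ (mem_keyDom hx ht)
  have h2 := integrableOn_wker_lip ha hab hG hη hδ (mem_keyDom (x := -x) (by rwa [abs_neg]) ht)
  rw [oddPart, cutI_eq G hη hδ, cutI_eq G hη hδ, ← mul_sub, mul_div_assoc, ← integral_sub h1 h2,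
    ← integral_div]
  simp only [half_wker]

theorem oddPart_circI {G : ℂ → ℂ} (hG : Symb G) {x0 : ℝ} (hx0 : x0 < -|Real.log a - Real.log b|)
    (x t : ℝ) : oddPart (circI a b G x0) (x, t) = (2 * Real.pi : ℂ)⁻¹ * ∫ y in -Real.pi..Real.pi,
        dker a b G x t (x0 + y * Complex.I) * Complex.exp (x0 + y * Complex.I) := by
  have hpi := Real.pi_pos
  have hc : ∀ z : ℝ, IntervalIntegrable (fun y : ℝ => wker a b G z t (x0 + y * Complex.I) *
      Complex.exp (x0 + y * Complex.I)) volume (-Real.pi) Real.pi := fun z => by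
    refine ContinuousOn.intervalIntegrable ?_
    rw [uIcc_of_le (by linarith)]
    have c2 := continuousOn_arc (continuousOn_zed (a := a) (b := b)) x0
    refine ContinuousOn.mul (ContinuousOn.div ((continuousOn_arc hG.cont _).mul
        ((c2.const_mul _).add (by fun_prop)).cexp) (Complex.continuous_sinh.comp_continuousOn c2)
        fun y hy => ?_) (by fun_prop)
    exact sinh_zed_ne_zero_of_re_lt (arc_mem hy) (by simpa using hx0)
  rw [oddPart, circI_eq, circI_eq, ← mul_sub, mul_div_assoc,
    ← intervalIntegral.integral_sub (hc x) (hc (-x)), ← intervalIntegral.integral_div]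
  congr 2 with y
  rw [← half_wker]
  ring

theorem oddPart_keyI (ha : 0 < a) (hab : a < b) {G : ℂ → ℂ} (hG : Symb G) {x t : ℝ}
    (hx : |x| ≤ 1) (ht : 0 < t) {δ : ℝ} (hδ : 0 < δ) (hδL : Real.log δ < -|Real.log a - Real.log b|) :
    oddPart (keyI a b G δ) (x, t) = (2 * Real.pi : ℂ)⁻¹ * (∫ y in -Real.pi..Real.pi,
        dker a b G x t (Real.log δ + y * Complex.I) * Complex.exp (Real.log δ + y * Complex.I)) +
      (2 * Real.pi * Complex.I : ℂ)⁻¹ *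
        (∫ q in Ioi δ, (dker a b G x t (lip (-1) q) - dker a b G x t (lip 1 q))) +
      (oddPart (resI a b G (wpole a b)) (x, t) + oddPart (resI a b G (wpole' a b)) (x, t)) := by
  rw [integral_sub (integrableOn_dker_lip ha hab hG (by simp) hx ht hδ)
    (integrableOn_dker_lip ha hab hG (by simp) hx ht hδ), mul_sub,
    ← oddPart_cutI ha hab hG (by simp) hx ht hδ, ← oddPart_cutI ha hab hG (by simp) hx ht hδ,
    ← oddPart_circI hG hδL]
  simp only [oddPart, keyI]
  ring

theorem eventually_small : ∀ᶠ δ : ℝ in 𝓝[>] 0, 0 < δ ∧ Real.log δ < -|Real.log a - Real.log b| := by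
  filter_upwards [self_mem_nhdsWithin,
    Real.tendsto_log_nhdsGT_zero.eventually_lt_atBot (-|Real.log a - Real.log b|)] with δ h1 h2
  exact ⟨h1, h2⟩

/-- The keyhole representation after the small circle has been shrunk to the branch point. -/
theorem exists_cut_limit (ha : 0 < a) (hab : a < b) {G : ℂ → ℂ} (hG : Symb G)
    (h0 : ∀ ε > 0, ∃ r : ℝ, ∀ w ∈ cstrip, w.re ≤ r → ‖G w * Complex.exp w‖ ≤ ε) {x t : ℝ}
    (hx : |x| ≤ 1) (ht : 0 < t) {δ₀ : ℝ} (hδ₀ : 0 < δ₀)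
    (hδL : Real.log δ₀ < -|Real.log a - Real.log b|) : ∃ J : ℂ,
    Tendsto (fun δ => ∫ q in Ioi δ, (dker a b G x t (lip (-1) q) - dker a b G x t (lip 1 q)))
      (𝓝[>] 0) (𝓝 J) ∧
    Summable (fun n => rterm a b G x t (wpole a b n) + rterm a b G x t (wpole' a b n)) ∧
    oddPart (keyI a b G δ₀) (x, t) = (2 * Real.pi * Complex.I : ℂ)⁻¹ * J +
      ∑' n, (rterm a b G x t (wpole a b n) + rterm a b G x t (wpole' a b n)) := by
  have hs := (half_resI_hasSum ha hab hG poleSeq_wpole (x := x) ht).add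
    (half_resI_hasSum ha hab hG poleSeq_wpole' (x := x) ht)
  set R := oddPart (resI a b G (wpole a b)) (x, t) + oddPart (resI a b G (wpole' a b)) (x, t) with hR
  have hI : (2 * Real.pi * Complex.I : ℂ) ≠ 0 := by simp [Real.pi_ne_zero]
  -- The limit is defined by solving the keyhole identity for it. Convergence holds because the
  -- total does not depend on `δ` and the arc tends to `0`; absolute convergence at the branch point
  -- is not asserted.
  refine ⟨(2 * Real.pi * Complex.I) * (oddPart (keyI a b G δ₀) (x, t) - R), ?_, hs.summable, ?_⟩
  · have h1 := (((tendsto_circle_dker (a := a) (b := b) h0 hx ht).const_mul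
      (2 * Real.pi : ℂ)⁻¹).const_sub (oddPart (keyI a b G δ₀) (x, t) - R)).const_mul
      (2 * Real.pi * Complex.I : ℂ)
    rw [mul_zero, sub_zero] at h1
    refine h1.congr' ?_
    filter_upwards [eventually_small (a := a) (b := b)] with δ hδ
    have h2 := oddPart_keyI ha hab hG hx ht hδ.1 hδ.2
    have h3 : oddPart (keyI a b G δ₀) (x, t) = oddPart (keyI a b G δ) (x, t) := by
      simp only [oddPart]
      rw [keyI_indep ha hab hG hx ht hδ₀ hδL hδ.1 hδ.2,
        keyI_indep ha hab hG (x := -x) (by rwa [abs_neg]) ht hδ₀ hδL hδ.1 hδ.2]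
    rw [h3, h2, ← hR]
    set c := (2 * Real.pi * Complex.I : ℂ) with hc
    set I1 := ∫ q in Ioi δ, (dker a b G x t (lip (-1) q) - dker a b G x t (lip 1 q))
    have : c * (c⁻¹ * I1) = I1 := mul_inv_cancel_left₀ hI _
    linear_combination this
  · rw [inv_mul_cancel_left₀ hI, hs.tsum_eq]
    ring

/-- Near `0` the kernel is bounded by `3`; at infinity it decays exponentially because `-Re z` grows
linearly in `q` and `|x| < 1`. -/
theorem integrableOn_pker_lip (ha : 0 < a) (hab : a < b) {η : ℝ} (hη : |η| = 1) {x : ℝ} (hx : |x| < 1) :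
    IntegrableOn (fun q => pker a b x (lip η q)) (Ioi 0) := by
  set L := |Real.log a - Real.log b| with hL
  set δ := Real.exp (-L - 1) with hδ
  have hδ0 : 0 < δ := Real.exp_pos _
  have c2 := continuousOn_lip (continuousOn_zed (a := a) (b := b)) hη
  have hc : ContinuousOn (fun q => pker a b x (lip η q)) (Ioi 0) :=
    (Complex.continuous_sinh.comp_continuousOn (c2.const_mul _)).div
      (Complex.continuous_sinh.comp_continuousOn c2) fun q _ => sinh_zed_lip_ne_zero hη q
  have hm : AEStronglyMeasurable (fun q => pker a b x (lip η q)) (volume.restrict (Ioi 0)) :=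
    hc.aestronglyMeasurable measurableSet_Ioi
  obtain ⟨c, hc, r0, hc'⟩ := exists_zed_lip_re_le ha hab
  have him : ∀ q, |(lip η q).im| = Real.pi := fun q => by
    rw [lip_im, abs_mul, hη, one_mul, abs_of_pos Real.pi_pos]
  have key : ∀ z : ℝ, |z| = |x| → ∀ᶠ q in atTop, z * (zed a b (lip η q)).re - 0 * q -
      |(zed a b (lip η q)).re| ≤ -((1 - |x|) * c * q) := fun z hz => by
    filter_upwards [eventually_ge_atTop (Real.exp r0), eventually_gt_atTop 0] with q hq0 hq
    have hlog : r0 ≤ (lip η q).re := by rw [lip_re]; exact (Real.le_log_iff_exp_le hq).2 hq0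
    have h1 := hc' _ (him q) hlog
    rw [exp_lip_re η hq] at h1
    have h2 : z * (zed a b (lip η q)).re ≤ |x| * |(zed a b (lip η q)).re| := by
      rw [← hz, ← abs_mul]; exact le_abs_self _
    have h3 : c * q ≤ |(zed a b (lip η q)).re| := by linarith [neg_le_abs (zed a b (lip η q)).re]
    nlinarith [mul_le_mul_of_nonneg_left h3 (sub_pos.2 hx).le]
  have hρ : 0 < (1 - |x|) * c := mul_pos (sub_pos.2 hx) hc
  have i1 := integrableOn_cut ha hab (symb_const 1) hη hδ0 0 0 hρ (key x rfl)
  have i2 := integrableOn_cut ha hab (symb_const 1) hη hδ0 0 0 hρ (key (-x) (abs_neg x))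
  have hbig : IntegrableOn (fun q => pker a b x (lip η q)) (Ioi δ) := by
    refine (i1.add i2).mono' (hm.mono_set (Ioi_subset_Ioi hδ0.le)) (Eventually.of_forall fun q => ?_)
    have h1 : ‖Complex.sinh (x * zed a b (lip η q))‖ ≤ Real.exp (x * (zed a b (lip η q)).re) +
        Real.exp (-x * (zed a b (lip η q)).re) := by
      rw [Complex.sinh, norm_div, Complex.norm_ofNat]
      have h2 := norm_sub_le (Complex.exp (x * zed a b (lip η q))) (Complex.exp (-(x * zed a b (lip η q))))
      rw [Complex.norm_exp, Complex.norm_exp, Complex.neg_re, Complex.re_ofReal_mul] at h2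
      have := Real.exp_pos (x * (zed a b (lip η q)).re)
      have := Real.exp_pos (-x * (zed a b (lip η q)).re)
      rw [neg_mul] at *
      linarith [norm_nonneg (Complex.exp (x * zed a b (lip η q)) - Complex.exp (-(x * zed a b (lip η q))))]
    rw [pker, norm_div]
    simp only [Pi.add_apply, pow_zero, mul_one, zero_mul, add_zero, norm_div, norm_one]
    rw [← mul_add, div_mul_eq_mul_div, one_mul]
    gcongr
  have hsmall : IntegrableOn (fun q => pker a b x (lip η q)) (Ioc 0 δ) := by
    refine IntegrableOn.of_bound (by simp) (hm.mono_set fun q hq => hq.1) 3 ?_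
    refine (ae_restrict_iff' measurableSet_Ioc).2 (Eventually.of_forall fun q hq => ?_)
    refine norm_pker_le (lip_mem hη q) ?_ hx.le
    rw [lip_re, ← hL]
    refine (Real.log_le_log hq.1 hq.2).trans_eq ?_
    rw [hδ, Real.log_exp]
  rw [← Ioc_union_Ioi_eq_Ioi hδ0.le]
  exact hsmall.union hbig

end

/-! ### The explicit formulas in the original variables, and the datum on the closed strip. -/

section

variable {a b : ℝ}

theorem deriv_sinh_exp (ha : 0 < a) (hb : 0 < b) {w : ℂ} (hw : w ∈ ostrip) :
    (deriv (fun z : ℂ => Complex.sinh (z * M a b z)) (Complex.exp w))⁻¹ = rcoef a b w := by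
  have hs := exp_mem_slitPlane hw
  rw [(hasDerivAt_sinh_mul_M ha hb hs).deriv, mul_M_eq ha hb hs, M_eq ha hb hs, log_exp_of_mem hw, rcoef]

theorem resTerm_exp (ha : 0 < a) (hb : 0 < b) {Ft G : ℂ → ℂ} {w : ℂ} (hw : w ∈ ostrip)
    (hG : G w = Ft (Complex.exp w)) (x t : ℝ) :
    resTerm a b Ft x t (Complex.exp w) = rterm a b G x t w := by
  have hs := exp_mem_slitPlane hw
  rw [resTerm, rterm, div_eq_mul_inv, deriv_sinh_exp ha hb hw, mul_assoc (x : ℂ), mul_M_eq ha hb hs,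
    log_exp_of_mem hw, hG, mul_comm (Complex.exp w) (t : ℂ)]
  ring

theorem resTerm_pair (ha : 0 < a) (hb : 0 < b) {Ft G : ℂ → ℂ}
    (hG : ∀ w ∈ ostrip, G w = Ft (Complex.exp w)) (x t : ℝ) (n : ℕ) :
    resTerm a b Ft x t (spole a b (n + 1)) + resTerm a b Ft x t (smole a b (n + 1)) =
      rterm a b G x t (wpole a b n) + rterm a b G x t (wpole' a b n) := by
  rw [← exp_wpole, ← exp_wpole', resTerm_exp ha hb (wpole_mem n) (hG _ (wpole_mem n)),
    resTerm_exp ha hb (wpole'_mem n) (hG _ (wpole'_mem n))]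

theorem dker_lip (ha : 0 < a) (hb : 0 < b) (G : ℂ → ℂ) (x t : ℝ) {η : ℝ} (hη : |η| = 1) {q : ℝ}
    (hq : 0 < q) : dker a b G x t (lip η q) = G (lip η q) * PCut a b x η q * Real.exp (-(q * t)) := by
  rw [dker, PCut_eq ha hb x hη hq, exp_lip hη hq]
  push_cast
  ring_nf

theorem formulaF_oddPart_keyI (ha : 0 < a) (hab : a < b) {G Ft : ℂ → ℂ} {Fp Fm : ℝ → ℂ} (hG : Symb G)
    (h0 : ∀ ε > 0, ∃ r : ℝ, ∀ w ∈ cstrip, w.re ≤ r → ‖G w * Complex.exp w‖ ≤ ε)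
    (hGF : ∀ w ∈ ostrip, G w = Ft (Complex.exp w)) (hp : ∀ q, 0 < q → G (lip 1 q) = Fp q)
    (hm : ∀ q, 0 < q → G (lip (-1) q) = Fm q) {x t : ℝ} (hx : |x| ≤ 1) (ht : 0 < t) {δ₀ : ℝ}
    (hδ₀ : 0 < δ₀) (hδL : Real.log δ₀ < -|Real.log a - Real.log b|) :
    FormulaF a b Ft Fp Fm (spole a b) (smole a b) x t (oddPart (keyI a b G δ₀) (x, t)) := by
  have hb := ha.trans hab
  obtain ⟨J, h1, h2, h3⟩ := exists_cut_limit ha hab hG h0 hx ht hδ₀ hδL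
  have e : ∀ q : ℝ, 0 < q → (Fm q * PCut a b x (-1) q - Fp q * PCut a b x 1 q) * Real.exp (-(q * t)) =
      dker a b G x t (lip (-1) q) - dker a b G x t (lip 1 q) := fun q hq => by
    rw [dker_lip ha hb G x t (by simp) hq, dker_lip ha hb G x t (by simp) hq, hp q hq, hm q hq]
    ring
  refine ⟨J, fun δ hδ => ?_, h1.congr' ?_, ?_, ?_⟩
  · refine (integrableOn_congr_fun (fun q hq => e q (hδ.trans hq)) measurableSet_Ioi).2 ?_
    exact (integrableOn_dker_lip ha hab hG (by simp) hx ht hδ).sub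
      (integrableOn_dker_lip ha hab hG (by simp) hx ht hδ)
  · filter_upwards [self_mem_nhdsWithin] with δ hδ
    exact setIntegral_congr_fun measurableSet_Ioi fun q hq => (e q (lt_trans hδ hq)).symm
  · simpa only [resTerm_pair ha hb hGF] using h2
  · simpa only [resTerm_pair ha hb hGF] using h3

theorem tendsto_integral_Ioi_zero {f : ℝ → ℂ} (hf : IntegrableOn f (Ioi 0)) :
    Tendsto (fun δ => ∫ q in Ioi δ, f q) (𝓝[>] 0) (𝓝 (∫ q in Ioi 0, f q)) := by
  have h1 : ∀ᶠ δ in 𝓝[>] (0 : ℝ), ∫ q in Ioi δ, f q = ∫ q in Ioi 0, (Ioi δ).indicator f q := by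
    filter_upwards [self_mem_nhdsWithin] with δ hδ
    rw [setIntegral_indicator measurableSet_Ioi, inter_eq_right.2 (Ioi_subset_Ioi (le_of_lt hδ))]
  refine Tendsto.congr' (h1.mono fun _ h => h.symm) ?_
  refine tendsto_integral_filter_of_dominated_convergence (fun q => ‖f q‖)
    (Eventually.of_forall fun δ => hf.aestronglyMeasurable.indicator measurableSet_Ioi)
    (Eventually.of_forall fun δ => Eventually.of_forall fun q => norm_indicator_le_norm_self f q)
    hf.norm ?_
  refine (ae_restrict_iff' measurableSet_Ioi).2 (Eventually.of_forall fun q hq => ?_)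
  refine tendsto_const_nhds.congr' ?_
  filter_upwards [Ioo_mem_nhdsGT (mem_Ioi.1 hq)] with δ hδ
  exact (indicator_of_mem (mem_Ioi.2 hδ.2) f).symm

theorem small_one : ∀ ε > 0, ∃ r : ℝ, ∀ w ∈ cstrip, w.re ≤ r → ‖(1 : ℂ) * Complex.exp w‖ ≤ ε :=
  fun ε hε => ⟨Real.log ε, fun w _ hw => by
    rw [one_mul, Complex.norm_exp]
    exact (Real.exp_le_exp.2 hw).trans_eq (Real.exp_log hε)⟩

/-- The keyhole formula for the symbol `1` is integrated over time. On the cut the kernel is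
integrable by itself and `e^{-qτ} ≤ 1`, so Fubini's theorem applies and produces `(1 - e^{-qt})/q`.
-/
theorem formulaH_brom (ha : 0 < a) (hab : a < b) {x t : ℝ} (hx : |x| < 1) (ht : 0 < t) {A : ℝ}
    (hA : absc ha hab < A) (Υ₀ : ℝ) :
    FormulaH a b Υ₀ (spole a b) (smole a b) x t
      (Υ₀ * ∫ τ in (0 : ℝ)..t, oddPart (brom a b (fun _ => 1) A) (x, τ)) := by
  have hb := ha.trans hab
  obtain ⟨δ₀, hδ₀, hδL⟩ := (eventually_small (a := a) (b := b)).exists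
  set D : ℝ → ℂ := fun q => pker a b x (lip (-1) q) - pker a b x (lip 1 q) with hD
  have hDi : IntegrableOn D (Ioi 0) := (integrableOn_pker_lip ha hab (by simp) hx).sub
    (integrableOn_pker_lip ha hab (by simp) hx)
  set p : ℝ → ℂ := fun τ => oddPart (brom a b (fun _ => 1) A) (x, τ) with hp
  set S : ℝ → ℂ := fun τ => ∑' n, (rterm a b (fun _ => 1) x τ (wpole a b n) +
    rterm a b (fun _ => 1) x τ (wpole' a b n)) with hS
  set K : ℝ → ℂ := fun τ => ∫ q in Ioi (0 : ℝ), D q * Complex.exp (-(q * τ)) with hK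
  have hDe : ∀ τ : ℝ, 0 ≤ τ → IntegrableOn (fun q : ℝ => D q * Complex.exp (-(q * τ))) (Ioi 0) := by
    intro τ hτ
    refine Integrable.mono hDi (hDi.aestronglyMeasurable.mul
      (by fun_prop : Continuous fun q : ℝ => Complex.exp (-(q * τ))).aestronglyMeasurable) ?_
    refine (ae_restrict_iff' measurableSet_Ioi).2 (Eventually.of_forall fun q hq => ?_)
    rw [norm_mul, Complex.norm_exp]
    refine mul_le_of_le_one_right (norm_nonneg _) (Real.exp_le_one_iff.2 ?_)
    have hq : 0 < q := hq
    simpa using mul_nonneg hq.le hτ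
  have hpoint : ∀ τ : ℝ, 0 < τ → Summable (fun n => rterm a b (fun _ => 1) x τ (wpole a b n) +
      rterm a b (fun _ => 1) x τ (wpole' a b n)) ∧
      p τ = (2 * Real.pi * Complex.I : ℂ)⁻¹ * K τ + S τ := by
    intro τ hτ
    obtain ⟨J, h1, h2, h3⟩ := exists_cut_limit ha hab (symb_const 1) small_one hx.le hτ hδ₀ hδL
    refine ⟨h2, ?_⟩
    have hJ : J = K τ := by
      refine tendsto_nhds_unique h1 ((tendsto_integral_Ioi_zero (hDe τ hτ.le)).congr' ?_)
      filter_upwards [self_mem_nhdsWithin] with δ hδ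
      refine setIntegral_congr_fun measurableSet_Ioi fun q hq => ?_
      have hq : 0 < q := lt_trans hδ hq
      simp only [hD, dker]
      rw [exp_lip (by simp) hq, exp_lip (by simp) hq]
      ring_nf
    rw [← hJ, hp, ← h3]
    simp only [oddPart]
    rw [brom_eq_keyI ha hab (symb_const 1) hx hτ hA hδ₀ hδL,
      brom_eq_keyI ha hab (symb_const 1) (x := -x) (by rwa [abs_neg]) hτ hA hδ₀ hδL]
  have hpc : Continuous p := by
    obtain ⟨C, h1⟩ := halfPlane_kern ha hab (symb_const 1) hx
    obtain ⟨C', h2⟩ := halfPlane_kern ha hab (symb_const 1) (x := -x) (by rwa [abs_neg])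
    have e : p = fun τ => (Br A _ τ - Br A _ τ) / 2 := funext fun τ => by
      rw [hp]; simp only [oddPart]; rw [brom_eq_Br, brom_eq_Br]
    rw [e]
    exact ((h1.continuous_Br hA).sub (h2.continuous_Br hA)).div_const 2
  have hprod : Integrable (fun z : ℝ × ℝ => D z.2 * Complex.exp (-(z.2 * z.1)))
      ((volume.restrict (Ioc 0 t)).prod (volume.restrict (Ioi 0))) := by
    have h1 : Integrable (fun z : ℝ × ℝ => (1 : ℂ) * D z.2)
        ((volume.restrict (Ioc 0 t)).prod (volume.restrict (Ioi 0))) :=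
      Integrable.mul_prod (f := fun _ : ℝ => (1 : ℂ)) (integrable_const _) hDi
    refine h1.mono ((by simpa using h1.aestronglyMeasurable : AEStronglyMeasurable (fun z : ℝ × ℝ => D z.2) _).mul
      (by fun_prop : Continuous fun z : ℝ × ℝ => Complex.exp (-(z.2 * z.1))).aestronglyMeasurable) ?_
    rw [Measure.prod_restrict]
    refine (ae_restrict_iff' (measurableSet_Ioc.prod measurableSet_Ioi)).2
      (Eventually.of_forall fun z hz => ?_)
    have h2 : 0 < z.1 := hz.1.1
    have h3 : 0 < z.2 := hz.2
    rw [one_mul, norm_mul, Complex.norm_exp]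
    refine mul_le_of_le_one_right (norm_nonneg _) (Real.exp_le_one_iff.2 ?_)
    simpa using mul_nonneg h3.le h2.le
  have hKi : IntervalIntegrable K volume 0 t := by
    rw [intervalIntegrable_iff_integrableOn_Ioc_of_le ht.le]
    exact hprod.integral_prod_left
  have hKint : ∫ τ in (0 : ℝ)..t, K τ = ∫ q in Ioi (0 : ℝ), D q * ((1 - Real.exp (-(q * t))) / q) := by
    rw [intervalIntegral.integral_of_le ht.le]
    simp only [hK]
    rw [integral_integral_swap hprod]
    refine setIntegral_congr_fun measurableSet_Ioi fun q hq => ?_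
    have hq : 0 < q := hq
    have hq' : (-q : ℂ) ≠ 0 := by simpa using hq.ne'
    rw [integral_const_mul, ← intervalIntegral.integral_of_le ht.le]
    congr 1
    have h1 := integral_exp_mul_complex (a := 0) (b := t) hq'
    simp only [neg_mul] at h1
    rw [h1]
    push_cast
    rw [mul_zero, neg_zero, Complex.exp_zero, ← neg_sub 1, neg_div_neg_eq]
  have hDcut : ∀ q : ℝ, 0 < q → (PCut a b x (-1) q - PCut a b x 1 q) * ((1 - Real.exp (-(q * t))) / q) =
      D q * ((1 - Real.exp (-(q * t))) / q) := fun q hq => by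
    rw [PCut_eq ha hb x (by simp) hq, PCut_eq ha hb x (by simp) hq]
  -- The residue series is not estimated near `τ = 0`: it is integrable as the difference of the
  -- continuous function `p` and a multiple of the integrable `K`.
  have hSi : IntervalIntegrable S volume 0 t := by
    refine ((hpc.intervalIntegrable 0 t).sub (hKi.const_mul (2 * Real.pi * Complex.I : ℂ)⁻¹)).congr ?_
    intro τ hτ
    rw [uIoc_of_le ht.le] at hτ
    show p τ - (2 * Real.pi * Complex.I : ℂ)⁻¹ * K τ = S τ
    rw [(hpoint τ hτ.1).2]; ring
  refine ⟨?_, fun τ hτ => ?_, ?_, ?_⟩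
  · refine (integrableOn_congr_fun (fun q hq => hDcut q hq) measurableSet_Ioi).2 ?_
    have := hprod.integral_prod_right
    refine (integrableOn_congr_fun (fun q hq => ?_) measurableSet_Ioi).1 this
    have hq : 0 < q := hq
    have hq' : (-q : ℂ) ≠ 0 := by simpa using hq.ne'
    simp only []
    rw [integral_const_mul, ← intervalIntegral.integral_of_le ht.le]
    congr 1
    have h1 := integral_exp_mul_complex (a := 0) (b := t) hq'
    simp only [neg_mul] at h1
    rw [h1]
    push_cast
    rw [mul_zero, neg_zero, Complex.exp_zero, ← neg_sub 1, neg_div_neg_eq]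
  · simpa only [resTerm_pair ha hb (Ft := fun _ => 1) (G := fun _ => 1) fun _ _ => rfl] using (hpoint τ hτ).1
  · simpa only [resTerm_pair ha hb (Ft := fun _ => 1) (G := fun _ => 1) fun _ _ => rfl] using hSi
  · simp only [resTerm_pair ha hb (Ft := fun _ => 1) (G := fun _ => 1) fun _ _ => rfl]
    rw [setIntegral_congr_fun measurableSet_Ioi fun q hq => hDcut q hq, ← hKint]
    have h1 : ∫ τ in (0 : ℝ)..t, p τ = ∫ τ in (0 : ℝ)..t, ((2 * Real.pi * Complex.I : ℂ)⁻¹ * K τ + S τ) := by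
      refine intervalIntegral.integral_congr_ae (Eventually.of_forall fun τ hτ => ?_)
      rw [uIoc_of_le ht.le] at hτ
      exact (hpoint τ hτ.1).2
    rw [h1, intervalIntegral.integral_add (hKi.const_mul _) hSi, intervalIntegral.integral_const_mul]
    ring

/-! ### The datum as a function on the closed strip -/

/-- `w ↦ Ft (e^w)`, extended continuously to the lips of the cut. -/
def stripExt (Ft : ℂ → ℂ) : ℂ → ℂ := extendFrom ostrip fun w => Ft (Complex.exp w)

theorem scale_im_mem {w : ℂ} (hw : w ∈ cstrip) {r : ℝ} (h0 : 0 ≤ r) (h1 : r < 1) :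
    (w.re + (r * w.im : ℝ) * Complex.I : ℂ) ∈ ostrip := by
  rw [mem_ostrip]
  simp only [Complex.add_im, Complex.ofReal_im, Complex.mul_im, Complex.ofReal_re, Complex.I_re,
    Complex.I_im, mul_one, mul_zero, zero_add, add_zero]
  rw [abs_mul, abs_of_nonneg h0]
  have := mem_cstrip.1 hw
  nlinarith [Real.pi_pos, abs_nonneg w.im]

theorem tendsto_scale_im (w : ℂ) :
    Tendsto (fun r : ℝ => (w.re + (r * w.im : ℝ) * Complex.I : ℂ)) (𝓝[<] 1) (𝓝 w) := by
  have h : Continuous fun r : ℝ => (w.re + (r * w.im : ℝ) * Complex.I : ℂ) := by fun_prop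
  have h1 := (h.tendsto 1).mono_left (nhdsWithin_le_nhds (s := Iio 1))
  simpa using h1

theorem cstrip_subset_closure : cstrip ⊆ closure ostrip := fun w hw => by
  refine mem_closure_of_tendsto (tendsto_scale_im w) ?_
  filter_upwards [Ioo_mem_nhdsLT (zero_lt_one (α := ℝ))] with r hr
  exact scale_im_mem hw hr.1.le hr.2

/-- Bounds assumed on the open cut plane pass to the lips by an approach that keeps the real part of
`w`, that is, the modulus of `s`. -/
theorem norm_le_of_ostrip {g : ℂ → ℂ} (hg : ContinuousOn g cstrip) {w : ℂ} (hw : w ∈ cstrip) {B : ℝ}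
    (h : ∀ v ∈ ostrip, v.re = w.re → ‖g v‖ ≤ B) : ‖g w‖ ≤ B := by
  have hev : ∀ᶠ r : ℝ in 𝓝[<] 1, (w.re + (r * w.im : ℝ) * Complex.I : ℂ) ∈ ostrip := by
    filter_upwards [Ioo_mem_nhdsLT (zero_lt_one (α := ℝ))] with r hr
    exact scale_im_mem hw hr.1.le hr.2
  have h1 : Tendsto (fun r : ℝ => (w.re + (r * w.im : ℝ) * Complex.I : ℂ)) (𝓝[<] 1) (𝓝[cstrip] w) :=
    tendsto_nhdsWithin_iff.2 ⟨tendsto_scale_im w, hev.mono fun r hr => ostrip_subset hr⟩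
  refine le_of_tendsto ((hg w hw).tendsto.comp h1).norm (hev.mono fun r hr => h _ hr ?_)
  simp

theorem lip_eq_of_im {w : ℂ} {η : ℝ} (h : w.im = η * Real.pi) : lip η (Real.exp w.re) = w := by
  apply Complex.ext
  · rw [lip_re, Real.log_exp]
  · rw [lip_im, h]

theorem exp_im_pos {w : ℂ} (h0 : 0 < w.im) (h1 : w.im < Real.pi) : 0 < (Complex.exp w).im := by
  rw [Complex.exp_im]
  exact mul_pos (Real.exp_pos _) (Real.sin_pos_of_pos_of_lt_pi h0 h1)

theorem tendsto_exp_upper (q : ℝ) (hq : 0 < q) :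
    Tendsto Complex.exp (𝓝[ostrip] (lip 1 q)) (𝓝[{s : ℂ | 0 < s.im}] (-(q : ℂ))) := by
  refine tendsto_nhdsWithin_iff.2 ⟨?_, ?_⟩
  · rw [← exp_lip (η := 1) (by simp) hq]
    exact Complex.continuous_exp.continuousAt.tendsto.mono_left nhdsWithin_le_nhds
  · have h1 : ∀ᶠ w : ℂ in 𝓝 (lip 1 q), 0 < w.im :=
      Complex.continuous_im.continuousAt.eventually_const_lt (by rw [lip_im, one_mul]; exact Real.pi_pos)
    filter_upwards [nhdsWithin_le_nhds h1, self_mem_nhdsWithin] with w hw hw'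
    exact exp_im_pos hw hw'.2

theorem tendsto_exp_lower (q : ℝ) (hq : 0 < q) :
    Tendsto Complex.exp (𝓝[ostrip] (lip (-1) q)) (𝓝[{s : ℂ | s.im < 0}] (-(q : ℂ))) := by
  refine tendsto_nhdsWithin_iff.2 ⟨?_, ?_⟩
  · rw [← exp_lip (η := -1) (by simp) hq]
    exact Complex.continuous_exp.continuousAt.tendsto.mono_left nhdsWithin_le_nhds
  · have h1 : ∀ᶠ w : ℂ in 𝓝 (lip (-1) q), w.im < 0 :=
      Complex.continuous_im.continuousAt.eventually_lt_const
        (by rw [lip_im, neg_one_mul]; linarith [Real.pi_pos])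
    filter_upwards [nhdsWithin_le_nhds h1, self_mem_nhdsWithin] with w hw hw'
    have h2 := exp_im_pos (w := (starRingEnd ℂ) w) (by simpa using hw) (by
      have : -Real.pi < w.im := hw'.1
      rw [Complex.conj_im]; linarith)
    rw [Complex.exp_conj, Complex.conj_im] at h2
    show (Complex.exp w).im < 0
    linarith

namespace DatumCondition

variable {F : ℝ → ℝ} {Ft : ℂ → ℂ} {Fp Fm : ℝ → ℂ} {α : ℝ}

theorem continuousAt_exp (h : DatumCondition F Ft Fp Fm α) {w : ℂ} (hw : w ∈ ostrip) :
    ContinuousAt (fun w => Ft (Complex.exp w)) w :=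
  (h.analytic _ (exp_mem_slitPlane hw)).continuousAt.comp Complex.continuous_exp.continuousAt

theorem tendsto_upper (h : DatumCondition F Ft Fp Fm α) {q : ℝ} (hq : 0 < q) :
    Tendsto (fun w => Ft (Complex.exp w)) (𝓝[ostrip] (lip 1 q)) (𝓝 (Fp q)) :=
  (h.upperLip q hq).comp (tendsto_exp_upper q hq)

theorem tendsto_lower (h : DatumCondition F Ft Fp Fm α) {q : ℝ} (hq : 0 < q) :
    Tendsto (fun w => Ft (Complex.exp w)) (𝓝[ostrip] (lip (-1) q)) (𝓝 (Fm q)) :=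
  (h.lowerLip q hq).comp (tendsto_exp_lower q hq)

/-- For an extension by limits, existence of the limit at every boundary point already implies
continuity up to the boundary. No uniformity of the boundary values in `q` is needed. -/
theorem continuousOn_stripExt (h : DatumCondition F Ft Fp Fm α) : ContinuousOn (stripExt Ft) cstrip := by
  refine continuousOn_extendFrom cstrip_subset_closure fun w hw => ?_
  rcases (mem_cstrip.1 hw).lt_or_eq with h1 | h1
  · exact ⟨_, (h.continuousAt_exp (mem_ostrip.2 h1)).tendsto.mono_left nhdsWithin_le_nhds⟩
  · rcases eq_or_eq_neg_of_abs_eq h1 with h2 | h2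
    · refine ⟨Fp (Real.exp w.re), ?_⟩
      have := h.tendsto_upper (Real.exp_pos w.re)
      rwa [lip_eq_of_im (by rw [h2, one_mul])] at this
    · refine ⟨Fm (Real.exp w.re), ?_⟩
      have := h.tendsto_lower (Real.exp_pos w.re)
      rwa [lip_eq_of_im (by rw [h2, neg_one_mul])] at this

theorem stripExt_eq (h : DatumCondition F Ft Fp Fm α) {w : ℂ} (hw : w ∈ ostrip) :
    stripExt Ft w = Ft (Complex.exp w) :=
  extendFrom_eq (cstrip_subset_closure (ostrip_subset hw))
    ((h.continuousAt_exp hw).tendsto.mono_left nhdsWithin_le_nhds)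

theorem stripExt_upper (h : DatumCondition F Ft Fp Fm α) {q : ℝ} (hq : 0 < q) :
    stripExt Ft (lip 1 q) = Fp q :=
  extendFrom_eq (cstrip_subset_closure (lip_mem (by simp) q)) (h.tendsto_upper hq)

theorem stripExt_lower (h : DatumCondition F Ft Fp Fm α) {q : ℝ} (hq : 0 < q) :
    stripExt Ft (lip (-1) q) = Fm q :=
  extendFrom_eq (cstrip_subset_closure (lip_mem (by simp) q)) (h.tendsto_lower hq)

theorem exists_norm_le (h : DatumCondition F Ft Fp Fm α) : ∃ R C : ℝ, 0 ≤ C ∧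
    ∀ s ∈ Complex.slitPlane, R ≤ ‖s‖ → ‖Ft s‖ ≤ C * ‖s‖ ^ (-α) := by
  obtain ⟨C, hC, h1⟩ := h.atInfinity.1.exists_nonneg
  have h2 := h1.bound
  rw [eventually_inf_principal, (hasBasis_cobounded_norm (E := ℂ)).eventually_iff] at h2
  obtain ⟨R, -, hR⟩ := h2
  refine ⟨R, C, hC, fun s hs hn => ?_⟩
  have h3 := hR (show R ≤ ‖s‖ from hn) hs
  rwa [Real.norm_of_nonneg (by positivity)] at h3

theorem symb (h : DatumCondition F Ft Fp Fm α) (hα : 0 ≤ α) : Symb (stripExt Ft) := by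
  obtain ⟨R, C, hC, hR⟩ := h.exists_norm_le
  refine Symb.of_eventually h.continuousOn_stripExt ?_ (k := 0) (R := max 0 R) (C := C) fun w hw hre => ?_
  · intro w hw
    have h1 : DifferentiableAt ℂ (fun w => Ft (Complex.exp w)) w :=
      (h.analytic _ (exp_mem_slitPlane hw)).differentiableAt.comp w Complex.differentiable_exp.differentiableAt
    refine (h1.congr_of_eventuallyEq ?_).differentiableWithinAt
    filter_upwards [isOpen_ostrip.mem_nhds hw] with v hv
    exact h.stripExt_eq hv
  · rw [pow_zero, mul_one]
    refine norm_le_of_ostrip h.continuousOn_stripExt hw fun v hv hvw => ?_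
    have h0 : 0 ≤ v.re := by rw [hvw]; exact (le_max_left _ _).trans hre
    have h1 : R ≤ ‖Complex.exp v‖ := by
      rw [Complex.norm_exp, hvw]
      exact ((le_max_right _ _).trans hre).trans (by linarith [Real.add_one_le_exp w.re])
    rw [h.stripExt_eq hv]
    refine (hR _ (exp_mem_slitPlane hv) h1).trans (mul_le_of_le_one_right hC ?_)
    refine Real.rpow_le_one_of_one_le_of_nonpos ?_ (by linarith)
    rw [Complex.norm_exp]; exact Real.one_le_exp h0

theorem small (h : DatumCondition F Ft Fp Fm α) :
    ∀ ε > 0, ∃ r : ℝ, ∀ w ∈ cstrip, w.re ≤ r → ‖stripExt Ft w * Complex.exp w‖ ≤ ε := by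
  intro ε hε
  have h1 := (Metric.tendsto_nhdsWithin_nhds.1 h.atZero) ε hε
  obtain ⟨d, hd, h2⟩ := h1
  refine ⟨Real.log (d / 2), fun w hw hre => ?_⟩
  refine norm_le_of_ostrip (h.continuousOn_stripExt.mul Complex.continuous_exp.continuousOn) hw
    fun v hv hvw => ?_
  have h3 := h2 (exp_mem_slitPlane hv) (by
    rw [dist_zero_right, Complex.norm_exp, hvw]
    have := Real.exp_le_exp.2 hre
    rw [Real.exp_log (by linarith)] at this
    linarith)
  rw [dist_zero_right] at h3
  rw [Pi.mul_apply, h.stripExt_eq hv, mul_comm]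
  exact h3.le

end DatumCondition

end

/-! ### Injectivity of the Laplace transform, and convolution with a Bromwich integral. -/

/-- The measure with density `max h 0` on the half-line. -/
def posDensity (h : ℝ → ℝ) : Measure ℝ :=
  (volume.restrict (Ioi 0)).withDensity fun t => ENNReal.ofReal (h t)

theorem integral_posDensity {h : ℝ → ℝ} (hm : AEStronglyMeasurable h (volume.restrict (Ioi 0)))
    (g : ℝ → ℂ) : ∫ t, g t ∂(posDensity h) = ∫ t in Ioi (0 : ℝ), ((max (h t) 0 : ℝ) : ℂ) * g t := by
  rw [posDensity, integral_withDensity_eq_integral_toReal_smul₀ hm.aemeasurable.ennreal_ofReal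
    (Eventually.of_forall fun _ => ENNReal.ofReal_lt_top)]
  simp only [ENNReal.toReal_ofReal', Complex.real_smul]

theorem subset_integrableExpSet {h : ℝ → ℝ} (hm : AEStronglyMeasurable h (volume.restrict (Ioi 0)))
    (hi : ∀ p : ℝ, p < 1 → IntegrableOn (fun t => h t * Real.exp (p * t)) (Ioi 0)) :
    Iio 1 ⊆ ProbabilityTheory.integrableExpSet id (posDensity h) := by
  intro p hp
  rw [ProbabilityTheory.integrableExpSet, mem_ofPred_eq, posDensity,
    integrable_withDensity_iff_integrable_smul₀' hm.aemeasurable.ennreal_ofReal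
      (Eventually.of_forall fun _ => ENNReal.ofReal_lt_top)]
  refine Integrable.mono (hi p hp) ?_ (Eventually.of_forall fun t => ?_)
  · exact (hm.aemeasurable.ennreal_ofReal.ennreal_toReal.aestronglyMeasurable).smul
      (by fun_prop : Continuous fun t : ℝ => Real.exp (p * id t)).aestronglyMeasurable
  · rw [ENNReal.toReal_ofReal', norm_smul, norm_mul]
    refine mul_le_mul_of_nonneg_right ?_ (norm_nonneg _)
    rw [Real.norm_of_nonneg (le_max_right _ _)]
    exact max_le (le_abs_self _) (abs_nonneg _)

/-- The positive and negative parts of `h` are densities of two finite measures whose moment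
generating functions agree for real `0 < p < 1`, hence by analyticity on `Re p < 1`. On the
imaginary axis these are the characteristic functions, so the measures coincide; equal positive and
negative parts force `h = 0`. -/
theorem eq_zero_of_laplace_shifted {h : ℝ → ℝ}
    (hi : ∀ p : ℝ, p < 1 → IntegrableOn (fun t => h t * Real.exp (p * t)) (Ioi 0))
    (h0 : ∀ p : ℝ, p < 1 → ∫ t in Ioi (0 : ℝ), h t * Real.exp (p * t) = 0) :
    ∀ᵐ t ∂(volume.restrict (Ioi (0 : ℝ))), h t = 0 := by
  have hint : IntegrableOn h (Ioi 0) := by simpa using hi 0 one_pos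
  have hm := hint.aestronglyMeasurable
  have hintn : IntegrableOn (fun t => -h t) (Ioi 0) := hint.neg
  have hin : ∀ p : ℝ, p < 1 → IntegrableOn (fun t => -h t * Real.exp (p * t)) (Ioi 0) := fun p hp => by
    simpa only [neg_mul] using! (hi p hp).neg
  have f1 : IsFiniteMeasure (posDensity h) := isFiniteMeasure_withDensity_ofReal hint.hasFiniteIntegral
  have f2 : IsFiniteMeasure (posDensity fun t => -h t) :=
    isFiniteMeasure_withDensity_ofReal hintn.hasFiniteIntegral
  have hU : ∀ g : ℝ → ℝ, AEStronglyMeasurable g (volume.restrict (Ioi 0)) →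
      (∀ p : ℝ, p < 1 → IntegrableOn (fun t => g t * Real.exp (p * t)) (Ioi 0)) →
      AnalyticOnNhd ℂ (ProbabilityTheory.complexMGF id (posDensity g)) {z | z.re < 1} := by
    intro g hgm hg z hz
    refine ProbabilityTheory.analyticAt_complexMGF ?_
    exact (interior_maximal (subset_integrableExpSet hgm hg) isOpen_Iio) hz
  have hdiff : ∀ p : ℝ, p < 1 → ProbabilityTheory.complexMGF id (posDensity h) p =
      ProbabilityTheory.complexMGF id (posDensity fun t => -h t) p := by
    intro p hp
    rw [ProbabilityTheory.complexMGF, ProbabilityTheory.complexMGF, integral_posDensity hm,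
      integral_posDensity (h := fun t => -h t) hm.neg, ← sub_eq_zero]
    have key : ∀ g : ℝ → ℝ, IntegrableOn (fun t => g t * Real.exp (p * t)) (Ioi 0) →
        IntegrableOn (fun t : ℝ => ((max (g t) 0 : ℝ) : ℂ) * Complex.exp (p * (id t : ℝ))) (Ioi 0) := by
      intro g hg
      have h1 : IntegrableOn (fun t => ((max (g t * Real.exp (p * t)) 0 : ℝ) : ℂ)) (Ioi 0) :=
        hg.pos_part.ofReal
      refine h1.congr (Eventually.of_forall fun t => ?_)
      have : max (g t * Real.exp (p * t)) 0 = max (g t) 0 * Real.exp (p * t) := by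
        rw [max_mul_of_nonneg _ _ (Real.exp_pos _).le, zero_mul]
      simp only [this, id]
      push_cast
      rfl
    rw [← integral_sub (key h (hi p hp)) (key _ (hin p hp))]
    have e : ∀ t : ℝ, ((max (h t) 0 : ℝ) : ℂ) * Complex.exp (p * (id t : ℝ)) -
        ((max (-h t) 0 : ℝ) : ℂ) * Complex.exp (p * (id t : ℝ)) = ((h t * Real.exp (p * t) : ℝ) : ℂ) := by
      intro t
      rw [← sub_mul, ← Complex.ofReal_sub, max_zero_sub_max_neg_zero_eq_self]
      push_cast
      rfl
    simp only [e]
    rw [integral_complex_ofReal, h0 p hp, Complex.ofReal_zero]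
  have hconv : IsPreconnected {z : ℂ | z.re < 1} :=
    ((convex_Iio (1 : ℝ)).linear_preimage Complex.reLm).isPreconnected
  have heq := (hU h hm hi).eqOn_of_preconnected_of_frequently_eq (hU _ hm.neg hin) hconv
    (z₀ := 0) (by simp) (by
      have h1 : Tendsto (fun p : ℝ => (p : ℂ)) (𝓝[>] 0) (𝓝[≠] 0) := by
        refine tendsto_nhdsWithin_iff.2 ⟨?_, ?_⟩
        · exact (Complex.continuous_ofReal.tendsto' 0 0 (by simp)).mono_left nhdsWithin_le_nhds
        · filter_upwards [self_mem_nhdsWithin] with p hp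
          have hp : 0 < p := hp
          simpa using hp.ne'
      refine h1.frequently (Eventually.frequently ?_)
      filter_upwards [Ioo_mem_nhdsGT (zero_lt_one (α := ℝ))] with p hp
      exact hdiff p hp.2)
  have hν : posDensity h = posDensity fun t => -h t := by
    refine Measure.ext_of_charFun (funext fun t => ?_)
    rw [← ProbabilityTheory.complexMGF_id_mul_I, ← ProbabilityTheory.complexMGF_id_mul_I]
    exact heq (by simp)
  have h2 := (withDensity_eq_iff hm.aemeasurable.ennreal_ofReal hm.neg.aemeasurable.ennreal_ofReal
    (by
      have := hint.lintegral_lt_top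
      exact this.ne)).1 hν
  filter_upwards [h2] with t ht
  rcases lt_trichotomy (h t) 0 with h3 | h3 | h3
  · have h4 : ENNReal.ofReal (-h t) = 0 := by
      rw [← ENNReal.ofReal_of_nonpos h3.le]; exact ht.symm
    rw [ENNReal.ofReal_eq_zero] at h4
    linarith
  · exact h3
  · have h4 : ENNReal.ofReal (h t) = 0 := by
      rw [← ENNReal.ofReal_of_nonpos (neg_neg_of_pos h3).le]; exact ht
    rw [ENNReal.ofReal_eq_zero] at h4
    linarith

/-- Injectivity of the (real) Laplace transform. -/
theorem ae_eq_zero_of_laplace {f : ℝ → ℝ} {A : ℝ}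
    (hi : ∀ s : ℝ, A < s → IntegrableOn (fun t => f t * Real.exp (-(s * t))) (Ioi 0))
    (h0 : ∀ s : ℝ, A < s → ∫ t in Ioi (0 : ℝ), f t * Real.exp (-(s * t)) = 0) :
    ∀ᵐ t ∂(volume.restrict (Ioi (0 : ℝ))), f t = 0 := by
  have e : ∀ p t : ℝ, f t * Real.exp (-((A + 1) * t)) * Real.exp (p * t) =
      f t * Real.exp (-((A + 1 - p) * t)) := fun p t => by
    rw [mul_assoc, ← Real.exp_add]; congr 2; ring
  have h1 := eq_zero_of_laplace_shifted (h := fun t => f t * Real.exp (-((A + 1) * t)))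
    (fun p hp => by simpa only [e] using hi (A + 1 - p) (by linarith))
    (fun p hp => by simpa only [e] using h0 (A + 1 - p) (by linarith))
  filter_upwards [h1] with t ht
  exact (mul_eq_zero.1 ht).resolve_right (Real.exp_pos _).ne'

theorem eqOn_of_laplace {f g : ℝ → ℝ} {A : ℝ} (hf : ContinuousOn f (Ioi 0)) (hg : ContinuousOn g (Ioi 0))
    (hfi : ∀ s : ℝ, A < s → IntegrableOn (fun t => f t * Real.exp (-(s * t))) (Ioi 0))
    (hgi : ∀ s : ℝ, A < s → IntegrableOn (fun t => g t * Real.exp (-(s * t))) (Ioi 0))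
    (h : ∀ s : ℝ, A < s → ∫ t in Ioi (0 : ℝ), f t * Real.exp (-(s * t)) =
      ∫ t in Ioi (0 : ℝ), g t * Real.exp (-(s * t))) : EqOn f g (Ioi 0) := by
  have h1 := ae_eq_zero_of_laplace (f := fun t => f t - g t) (A := A)
    (fun s hs => by simpa only [sub_mul] using! (hfi s hs).sub (hgi s hs))
    (fun s hs => by
      simp only [sub_mul]
      rw [integral_sub (hfi s hs) (hgi s hs), h s hs, sub_self])
  refine Measure.eqOn_open_of_ae_eq (μ := volume) ?_ isOpen_Ioi hf hg
  filter_upwards [h1] with t ht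
  exact sub_eq_zero.1 ht

/-- Convolution with an inverse Laplace transform. -/
theorem HalfPlane.causalConv_Br {f : ℂ → ℂ} {A₀ α C : ℝ} (h : HalfPlane f A₀ α C) {F : ℝ → ℝ}
    {Ft : ℂ → ℂ} {A₁ : ℝ} (hL : HasLaplace F A₁ Ft) (hF : ∀ t ≤ 0, F t = 0) {A : ℝ} (hA : A₀ < A)
    (hA₁ : A₁ < A) (t : ℝ) :
    ∫ τ in (0 : ℝ)..t, (F τ : ℂ) * Br A f (t - τ) = Br A (fun s => f s * Ft s) t := by
  have hFi : IntegrableOn (fun τ : ℝ => (F τ : ℂ) * Complex.exp (-(A : ℂ) * τ)) (Ioi 0) :=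
    (hL A (by simpa using hA₁)).1
  -- Up to a factor of constant modulus this is the product of the integrable functions
  -- `F(τ)e^{-Aτ}` and `f(A + iω)`, so the two integrations may be exchanged.
  have hprod : Integrable (fun z : ℝ × ℝ => ((F z.1 : ℂ) * Complex.exp (-(A : ℂ) * z.1)) *
      (f (A + z.2 * Complex.I) * Complex.exp (A * t + z.2 * (t - z.1) * Complex.I)))
      ((volume.restrict (Ioi 0)).prod volume) := by
    have h1 := hFi.mul_prod (h.integrable_line hA)
    have h2 := h1.mul_const (Complex.exp (A * t))
    refine h2.mono ?_ (Eventually.of_forall fun z => ?_)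
    · have h3 := h1.aestronglyMeasurable.mul (by fun_prop : Continuous fun z : ℝ × ℝ =>
        Complex.exp (A * t + z.2 * (t - z.1) * Complex.I)).aestronglyMeasurable
      refine h3.congr (Eventually.of_forall fun z => ?_)
      simp only [Pi.mul_apply]
      ring
    · simp only [norm_mul, Complex.norm_exp]
      rw [mul_assoc (‖(F z.1 : ℂ)‖ * _)]
      simp
  have hswap := integral_integral_swap (f := fun (τ ω : ℝ) => ((F τ : ℂ) * Complex.exp (-(A : ℂ) * τ)) *
    (f (A + ω * Complex.I) * Complex.exp (A * t + ω * (t - τ) * Complex.I))) hprod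
  have hL1 : ∀ τ : ℝ, ∫ ω : ℝ, ((F τ : ℂ) * Complex.exp (-(A : ℂ) * τ)) *
      (f (A + ω * Complex.I) * Complex.exp (A * t + ω * (t - τ) * Complex.I)) =
      (2 * Real.pi : ℂ) * ((F τ : ℂ) * Br A f (t - τ)) := by
    intro τ
    rw [Br, integral_const_mul, mul_left_comm (F τ : ℂ), mul_inv_cancel_left₀ (by simp [Real.pi_ne_zero]),
      mul_assoc, ← integral_const_mul]
    congr 2 with ω
    rw [mul_left_comm, ← Complex.exp_add]
    congr 2
    push_cast; ring
  have hL2 : ∀ ω : ℝ, ∫ τ in Ioi (0 : ℝ), ((F τ : ℂ) * Complex.exp (-(A : ℂ) * τ)) *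
      (f (A + ω * Complex.I) * Complex.exp (A * t + ω * (t - τ) * Complex.I)) =
      f (A + ω * Complex.I) * Ft (A + ω * Complex.I) * Complex.exp ((A + ω * Complex.I) * t) := by
    intro ω
    rw [← (hL (A + ω * Complex.I) (by simpa using hA₁)).2, mul_right_comm, ← integral_const_mul]
    congr 1 with τ
    have : Complex.exp (-(A : ℂ) * τ) * Complex.exp (A * t + ω * (t - τ) * Complex.I) =
        Complex.exp ((A + ω * Complex.I) * t) * Complex.exp (-(A + ω * Complex.I) * τ) := by
      rw [← Complex.exp_add, ← Complex.exp_add]; congr 1; ring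
    linear_combination (F τ : ℂ) * f (A + ω * Complex.I) * this
  simp only [hL1, hL2] at hswap
  rw [integral_const_mul] at hswap
  rw [Br, ← hswap, inv_mul_cancel_left₀ (by simp [Real.pi_ne_zero] : (2 * Real.pi : ℂ) ≠ 0)]
  rcases le_total t 0 with ht | ht
  · rw [intervalIntegral.integral_of_ge ht, setIntegral_congr_fun measurableSet_Ioc (g := fun _ => 0)
      (fun τ hτ => by simp [hF τ hτ.2]), setIntegral_congr_fun measurableSet_Ioi (g := fun _ => 0)
      (fun τ hτ => by
        have hτ : 0 < τ := hτ
        simp [h.Br_of_nonpos hA (by linarith : t - τ ≤ 0)])]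
    simp
  · rw [intervalIntegral.integral_of_le ht]
    symm
    refine setIntegral_eq_of_subset_of_forall_sdiff_eq_zero measurableSet_Ioi Ioc_subset_Ioi_self ?_
    intro τ hτ
    have h1 : t < τ := by
      by_contra h1
      exact hτ.2 ⟨hτ.1, not_lt.1 h1⟩
    simp [h.Br_of_nonpos hA (by linarith : t - τ ≤ 0)]

theorem HasLaplace.conj {F : ℝ → ℝ} {Ft : ℂ → ℂ} {A : ℝ} (hL : HasLaplace F A Ft) {s : ℂ}
    (hs : A < s.re) : Ft ((starRingEnd ℂ) s) = (starRingEnd ℂ) (Ft s) := by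
  rw [← (hL s hs).2, ← (hL _ (by simpa using hs)).2, ← integral_conj]
  congr 1 with t
  rw [map_mul, Complex.conj_ofReal, ← Complex.exp_conj, map_mul, map_neg, Complex.conj_ofReal]

theorem HasLaplace.mono {F : ℝ → ℝ} {Ft : ℂ → ℂ} {A A' : ℝ} (hL : HasLaplace F A Ft) (h : A ≤ A') :
    HasLaplace F A' Ft := fun s hs => hL s (h.trans_lt hs)

/-- The Laplace transform at a real point, in terms of real integrals. -/
theorem HasLaplace.real {F : ℝ → ℝ} {Ft : ℂ → ℂ} {A : ℝ} (hL : HasLaplace F A Ft) {s : ℝ} (hs : A < s) :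
    IntegrableOn (fun t => F t * Real.exp (-(s * t))) (Ioi 0) ∧
      ((∫ t in Ioi (0 : ℝ), F t * Real.exp (-(s * t)) : ℝ) : ℂ) = Ft s := by
  obtain ⟨h1, h2⟩ := hL s (by simpa using hs)
  have e : (fun t : ℝ => (F t : ℂ) * Complex.exp (-(s : ℂ) * t)) =
      fun t : ℝ => ((F t * Real.exp (-(s * t)) : ℝ) : ℂ) := by
    funext t; push_cast; rw [neg_mul]
  rw [e] at h1 h2
  refine ⟨?_, ?_⟩
  · refine h1.re.congr (Eventually.of_forall fun t => ?_)
    exact Complex.ofReal_re _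
  · rw [← h2, integral_complex_ofReal]

/-! ### Distributed-order derivatives as derivatives of convolutions. -/

/-- `y` vanishes for `t ≤ 0` and is `C¹` on `[0,∞)`, with derivative `z`. -/
structure CausalC1 (y z : ℝ → ℝ) : Prop where
  y_nonpos : ∀ t ≤ 0, y t = 0
  z_neg : ∀ t < 0, z t = 0
  z_cont : ContinuousOn z (Ici 0)
  deriv : ∀ t, 0 < t → HasDerivAt y (z t) t
  y_cont : Continuous y

namespace CausalC1

variable {y z : ℝ → ℝ}

theorem hasDerivAt (h : CausalC1 y z) {t : ℝ} (ht : t ≠ 0) : HasDerivAt y (z t) t := by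
  rcases ht.lt_or_gt with ht | ht
  · rw [h.z_neg t ht]
    refine (hasDerivAt_const t (0 : ℝ)).congr_of_eventuallyEq ?_
    filter_upwards [Iio_mem_nhds ht] with s hs
    exact h.y_nonpos s (le_of_lt hs)
  · exact h.deriv t ht

theorem measurable_z (h : CausalC1 y z) : Measurable z := by
  classical
  have h1 : Measurable ((Ici (0 : ℝ)).piecewise z 0) :=
    h.z_cont.measurable_piecewise continuousOn_const measurableSet_Ici
  have e : (Ici (0 : ℝ)).piecewise z 0 = z := by
    funext t
    by_cases ht : 0 ≤ t
    · exact piecewise_eq_of_mem _ _ _ (mem_Ici.2 ht)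
    · rw [piecewise_eq_of_notMem (Ici (0:ℝ)) _ _ (fun h => ht h), h.z_neg t (not_le.1 ht)]; rfl
  rwa [e] at h1

theorem exists_bound (h : CausalC1 y z) (B : ℝ) : ∃ L : ℝ, 0 ≤ L ∧ ∀ t ≤ B, |z t| ≤ L := by
  obtain ⟨L, hL⟩ := (isCompact_Icc (a := (0 : ℝ)) (b := B)).exists_bound_of_continuousOn
    (h.z_cont.mono Icc_subset_Ici_self)
  refine ⟨max L 0, le_max_right _ _, fun t ht => ?_⟩
  rcases lt_or_ge t 0 with h0 | h0
  · rw [h.z_neg t h0]; simp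
  · exact (hL t ⟨h0, ht⟩).trans (le_max_left _ _)

/-- The function `z` may jump at `0`, so the fundamental theorem is used in the form that tolerates
the exceptional point `0`. -/
theorem abs_sub_le (h : CausalC1 y z) {B L : ℝ} (hL : ∀ t ≤ B, |z t| ≤ L) {r r' : ℝ} (hr : r ≤ B)
    (hr' : r' ≤ B) : |y r - y r'| ≤ L * |r - r'| := by
  wlog hle : r' ≤ r generalizing r r'
  · rw [abs_sub_comm, abs_sub_comm r]; exact this hr' hr (le_of_not_ge hle)
  have hint : IntervalIntegrable z volume r' r := by
    rw [intervalIntegrable_iff_integrableOn_Ioc_of_le hle]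
    refine IntegrableOn.of_bound (by simp) h.measurable_z.aestronglyMeasurable L ?_
    exact (ae_restrict_iff' measurableSet_Ioc).2 (Eventually.of_forall fun t ht => hL t (ht.2.trans hr))
  have h1 := MeasureTheory.integral_eq_of_hasDerivAt_off_countable_of_le (E := ℝ) y z hle (countable_singleton (0 : ℝ))
    h.y_cont.continuousOn (fun t ht => h.hasDerivAt ht.2) hint
  rw [← h1]
  rw [← Real.norm_eq_abs]
  refine intervalIntegral.norm_integral_le_of_norm_le_const (E := ℝ) fun t ht => ?_
  rw [uIoc_of_le hle] at ht
  exact hL t (ht.2.trans hr)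

/-- With the shift placed on `y`, the derivative falls on `y` and the kernel need only be
integrable: its absolute value times a Lipschitz constant of `y` dominates. -/
theorem hasDerivAt_conv (h : CausalC1 y z) {k : ℝ → ℝ} {B T : ℝ} (hk : IntegrableOn k (Ioc 0 B)) :
    HasDerivAt (fun r => ∫ θ in Ioc 0 B, y (r - θ) * k θ) (∫ θ in Ioc 0 B, z (T - θ) * k θ) T := by
  obtain ⟨L, hL0, hL⟩ := h.exists_bound (T + 1)
  have hbd : ∀ x θ : ℝ, x ∈ Iio (T + 1) → 0 < θ → x - θ ≤ T + 1 := fun x θ hx hθ => by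
    have hx : x < T + 1 := hx
    linarith
  have hm : ∀ x, AEStronglyMeasurable (fun θ => y (x - θ) * k θ) (volume.restrict (Ioc 0 B)) := fun x =>
    (h.y_cont.comp (continuous_const.sub continuous_id)).aestronglyMeasurable.mul hk.aestronglyMeasurable
  refine (hasDerivAt_integral_of_dominated_loc_of_lip (𝕜 := ℝ) (F := fun r θ => y (r - θ) * k θ)
    (bound := fun θ => L * ‖k θ‖) (Iio_mem_nhds (by linarith : T < T + 1)) (Eventually.of_forall hm)
    ?_ ?_ ?_ (hk.norm.const_mul L) ?_).2
  · obtain ⟨C, hC⟩ := (isCompact_Icc (a := T - B) (b := T)).exists_bound_of_continuousOn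
      h.y_cont.continuousOn
    refine (hk.norm.const_mul C).mono' (hm T) ((ae_restrict_iff' measurableSet_Ioc).2
      (Eventually.of_forall fun θ hθ => ?_))
    rw [norm_mul]
    exact mul_le_mul_of_nonneg_right (hC _ ⟨by linarith [hθ.2], by linarith [hθ.1]⟩) (norm_nonneg _)
  · exact (h.measurable_z.comp (measurable_const.sub measurable_id)).aestronglyMeasurable.mul
      hk.aestronglyMeasurable
  · refine (ae_restrict_iff' measurableSet_Ioc).2 (Eventually.of_forall fun θ hθ => ?_)
    refine LipschitzOnWith.of_dist_le_mul fun r hr r' hr' => ?_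
    rw [Real.dist_eq, Real.dist_eq, Real.coe_nnabs, Real.norm_eq_abs,
      abs_of_nonneg (mul_nonneg hL0 (abs_nonneg (k θ))), ← sub_mul, abs_mul]
    have h1 := h.abs_sub_le hL (hbd r θ hr hθ.1) (hbd r' θ hr' hθ.1)
    rw [sub_sub_sub_cancel_right] at h1
    calc |y (r - θ) - y (r' - θ)| * |k θ| ≤ (L * |r - r'|) * |k θ| := by gcongr
      _ = _ := by ring
  -- Only at `θ = T`, a null set, can `y (· - θ)` fail to be differentiable at `T`.
  · have hne : ∀ᵐ θ ∂(volume.restrict (Ioc 0 B)), θ ≠ T :=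
      ae_restrict_of_ae (Measure.ae_ne volume T)
    filter_upwards [hne] with θ hθ
    have h1 := (h.hasDerivAt (sub_ne_zero.2 hθ.symm)).comp_sub_const T θ
    exact h1.mul_const (k θ)

/-- Because `y` vanishes for nonpositive arguments, the variable upper limit `r` can be replaced by
a fixed `B`, and `r` remains only in the integrand. -/
theorem conv_eq (h : CausalC1 y z) (k : ℝ → ℝ) {B r : ℝ} (h0 : 0 ≤ r) (hr : r ≤ B) :
    ∫ τ in (0 : ℝ)..r, y τ * k (r - τ) = ∫ θ in Ioc 0 B, y (r - θ) * k θ := by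
  have h1 := intervalIntegral.integral_comp_sub_left (a := 0) (b := r) (fun τ => y τ * k (r - τ)) r
  rw [sub_self, sub_zero] at h1
  rw [← h1, intervalIntegral.integral_of_le h0]
  simp only [sub_sub_cancel]
  symm
  refine setIntegral_eq_of_subset_of_forall_sdiff_eq_zero measurableSet_Ioc (Ioc_subset_Ioc_right hr) ?_
  intro θ hθ
  have h2 : r < θ := by
    by_contra h2
    exact hθ.2 ⟨hθ.1.1, not_lt.1 h2⟩
  rw [h.y_nonpos _ (by linarith), zero_mul]

end CausalC1

/-- The kernel of `c^γ ₀D_t^γ`, before differentiation. -/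
def rlKer (c γ θ : ℝ) : ℝ := c ^ γ * (Real.Gamma (1 - γ))⁻¹ * (θ ^ γ)⁻¹

/-- The kernel of the distributed-order derivative, before differentiation. -/
def distKer (c θ : ℝ) : ℝ := ∫ γ in Ioo (0 : ℝ) 1, rlKer c γ θ

/-- The Laplace transform of `distKer`. -/
def distSym (c s : ℝ) : ℝ := ∫ γ in Ioo (0 : ℝ) 1, c ^ γ * (1 / s) ^ (1 - γ)

section

variable {c s : ℝ}

theorem rlKer_nonneg (hc : 0 < c) {γ θ : ℝ} (hγ : γ < 1) (hθ : 0 < θ) : 0 ≤ rlKer c γ θ := by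
  have := Real.Gamma_pos_of_pos (sub_pos.2 hγ)
  unfold rlKer
  positivity

theorem integrableOn_rpow_inv_mul_exp (hs : 0 < s) {γ : ℝ} (hγ : γ < 1) :
    IntegrableOn (fun θ : ℝ => (θ ^ γ)⁻¹ * Real.exp (-(s * θ))) (Ioi 0) ∧
    ∫ θ in Ioi (0 : ℝ), (θ ^ γ)⁻¹ * Real.exp (-(s * θ)) = (1 / s) ^ (1 - γ) * Real.Gamma (1 - γ) := by
  have h1 := Real.integral_rpow_mul_exp_neg_mul_Ioi (sub_pos.2 hγ) hs
  have e : ∫ θ in Ioi (0 : ℝ), (θ ^ γ)⁻¹ * Real.exp (-(s * θ)) =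
      (1 / s) ^ (1 - γ) * Real.Gamma (1 - γ) := by
    rw [← h1]
    refine setIntegral_congr_fun measurableSet_Ioi fun θ hθ => ?_
    have hθ : 0 < θ := hθ
    rw [← Real.rpow_neg hθ.le]
    congr 2; ring
  refine ⟨?_, e⟩
  -- The integral of a nonintegrable function is `0` by convention, so a nonzero value proves
  -- integrability.
  refine Integrable.of_integral_ne_zero (by
    rw [e]
    exact (mul_pos (Real.rpow_pos_of_pos (by positivity) _) (Real.Gamma_pos_of_pos (sub_pos.2 hγ))).ne')

theorem integral_rlKer_mul_exp (hs : 0 < s) {γ : ℝ} (hγ : γ < 1) :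
    ∫ θ in Ioi (0 : ℝ), rlKer c γ θ * Real.exp (-(s * θ)) = c ^ γ * (1 / s) ^ (1 - γ) := by
  have h1 : ∀ θ : ℝ, rlKer c γ θ * Real.exp (-(s * θ)) =
      c ^ γ * (Real.Gamma (1 - γ))⁻¹ * ((θ ^ γ)⁻¹ * Real.exp (-(s * θ))) := fun θ => by
    rw [rlKer]; ring
  simp only [h1]
  rw [integral_const_mul, (integrableOn_rpow_inv_mul_exp hs hγ).2]
  have := (Real.Gamma_pos_of_pos (sub_pos.2 hγ)).ne'
  field_simp

/-- By Tonelli it is enough to integrate in `θ` first. The Gamma function that appears cancels the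
one in the kernel, and `c^γ (1/s)^{1-γ}` is continuous on `[0,1]`, so the endpoint `γ = 1` does no
harm. -/
theorem integrable_rlKer (hc : 0 < c) (hs : 0 < s) :
    Integrable (fun p : ℝ × ℝ => rlKer c p.1 p.2 * Real.exp (-(s * p.2)))
      ((volume.restrict (Ioo 0 1)).prod (volume.restrict (Ioi 0))) := by
  have hcont : ContinuousOn (fun p : ℝ × ℝ => rlKer c p.1 p.2 * Real.exp (-(s * p.2)))
      (Ioo 0 1 ×ˢ Ioi 0) := by
    unfold rlKer
    refine ContinuousOn.mul (ContinuousOn.mul (ContinuousOn.mul ?_ ?_) ?_) (by fun_prop)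
    · exact continuousOn_const.rpow continuousOn_fst fun p _ => Or.inl hc.ne'
    · refine ContinuousOn.inv₀ (fun p hp => ?_) fun p hp =>
        (Real.Gamma_pos_of_pos (sub_pos.2 hp.1.2)).ne'
      have h1 : ContinuousAt Real.Gamma (1 - p.1) :=
        (Real.differentiableAt_Gamma fun m h => by
          have := hp.1.2
          have h2 : (0 : ℝ) ≤ m := m.cast_nonneg
          linarith).continuousAt
      exact (ContinuousAt.comp (f := fun p : ℝ × ℝ => 1 - p.1) h1 (by fun_prop)).continuousWithinAt
    · refine ContinuousOn.inv₀ (continuousOn_snd.rpow continuousOn_fst fun p hp => Or.inl (ne_of_gt hp.2))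
        fun p hp => (Real.rpow_pos_of_pos hp.2 _).ne'
  have hm : AEStronglyMeasurable (fun p : ℝ × ℝ => rlKer c p.1 p.2 * Real.exp (-(s * p.2)))
      ((volume.restrict (Ioo 0 1)).prod (volume.restrict (Ioi 0))) := by
    rw [Measure.prod_restrict]
    exact hcont.aestronglyMeasurable (measurableSet_Ioo.prod measurableSet_Ioi)
  rw [integrable_prod_iff hm]
  refine ⟨(ae_restrict_iff' measurableSet_Ioo).2 (Eventually.of_forall fun γ hγ => ?_), ?_⟩
  · have h1 := (integrableOn_rpow_inv_mul_exp hs hγ.2).1.const_mul (c ^ γ * (Real.Gamma (1 - γ))⁻¹)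
    refine h1.congr (Eventually.of_forall fun θ => ?_)
    simp only [rlKer]; ring
  · have h1 : ∀ γ ∈ Ioo (0 : ℝ) 1, ∫ θ in Ioi (0 : ℝ), ‖rlKer c γ θ * Real.exp (-(s * θ))‖ =
        c ^ γ * (1 / s) ^ (1 - γ) := fun γ hγ => by
      rw [← integral_rlKer_mul_exp hs hγ.2]
      refine setIntegral_congr_fun measurableSet_Ioi fun θ hθ => ?_
      exact Real.norm_of_nonneg (mul_nonneg (rlKer_nonneg hc hγ.2 hθ) (Real.exp_pos _).le)
    refine (integrableOn_congr_fun h1 measurableSet_Ioo).2 ?_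
    have hs' : (1 / s) ≠ 0 := by positivity
    have h2 : Continuous fun γ : ℝ => c ^ γ * (1 / s) ^ (1 - γ) :=
      (continuous_const.rpow continuous_id fun _ => Or.inl hc.ne').mul
        (continuous_const.rpow (continuous_const.sub continuous_id) fun _ => Or.inl hs')
    exact (h2.integrableOn_Icc (a := 0) (b := 1)).mono_set Ioo_subset_Icc_self

theorem integrableOn_distKer (hc : 0 < c) (hs : 0 < s) :
    IntegrableOn (fun θ => distKer c θ * Real.exp (-(s * θ))) (Ioi 0) ∧
    ∫ θ in Ioi (0 : ℝ), distKer c θ * Real.exp (-(s * θ)) = distSym c s := by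
  have h := integrable_rlKer hc hs
  have e : ∀ θ, ∫ γ in Ioo (0 : ℝ) 1, rlKer c γ θ * Real.exp (-(s * θ)) =
      distKer c θ * Real.exp (-(s * θ)) := fun θ => by rw [integral_mul_const, distKer]
  refine ⟨?_, ?_⟩
  · have h1 := h.integral_prod_right
    simpa only [e, IntegrableOn] using! h1
  · have h1 := integral_integral_swap (f := fun γ θ : ℝ => rlKer c γ θ * Real.exp (-(s * θ))) h
    simp only [e] at h1
    rw [← h1, distSym]
    exact setIntegral_congr_fun measurableSet_Ioo fun γ hγ => integral_rlKer_mul_exp hs hγ.2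

/-- Since `c^γ s^{γ-1} = s⁻¹ e^{γ log (cs)}`, the transform of the time-domain kernel is expressed
through the same function `Phi` that defines `M`. -/
theorem distSym_eq (hc : 0 < c) (hs : 0 < s) :
    (distSym c s : ℂ) = Phi (Complex.log s + Real.log c) / s := by
  have e : ∀ γ : ℝ, c ^ γ * (1 / s) ^ (1 - γ) = s⁻¹ * Real.exp ((Real.log s + Real.log c) * γ) := fun γ => by
    have h1 : s⁻¹ = Real.exp (-Real.log s) := by rw [Real.exp_neg, Real.exp_log hs]
    rw [one_div, h1, Real.rpow_def_of_pos hc, ← Real.exp_mul, ← Real.exp_add, ← Real.exp_add]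
    congr 1; ring
  rw [distSym]
  simp only [e]
  rw [integral_const_mul, Phi_eq_integral, intervalIntegral.integral_of_le zero_le_one,
    integral_Ioc_eq_integral_Ioo, Complex.ofReal_mul, ← integral_complex_ofReal, Complex.ofReal_inv,
    div_eq_inv_mul]
  congr 2 with γ
  rw [← Complex.ofReal_log hs.le]
  push_cast
  rfl

theorem integrableOn_distKer_Ioc (hc : 0 < c) (B : ℝ) : IntegrableOn (distKer c) (Ioc 0 B) := by
  have h1 := (integrableOn_distKer hc one_pos).1.mono_set (Ioc_subset_Ioi_self : Ioc 0 B ⊆ Ioi 0)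
  have h2 : IntegrableOn (fun θ => Real.exp θ * (distKer c θ * Real.exp (-(1 * θ)))) (Ioc 0 B) :=
    h1.continuousOn_mul_of_subset Real.continuous_exp.continuousOn isCompact_Icc measurableSet_Ioc
      Ioc_subset_Icc_self
  refine h2.congr (Eventually.of_forall fun θ => ?_)
  simp only [one_mul]
  rw [mul_left_comm, ← Real.exp_add, add_neg_cancel, Real.exp_zero, mul_one]

/-- The distributed-order integral whose derivative is the distributed-order derivative of `y`. -/
def distInt (c : ℝ) (y : ℝ → ℝ) (r : ℝ) : ℝ := ∫ τ in (0 : ℝ)..r, y τ * distKer c (r - τ)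

variable {y z : ℝ → ℝ}

theorem CausalC1.rlDeriv_eq (h : CausalC1 y z) {γ T : ℝ} (hγ : γ < 1) (hT : 0 < T) :
    rlDeriv γ y T = (Real.Gamma (1 - γ))⁻¹ * ∫ θ in Ioc 0 (T + 1), z (T - θ) * (θ ^ γ)⁻¹ := by
  have hk : IntegrableOn (fun θ : ℝ => (θ ^ γ)⁻¹) (Ioc 0 (T + 1)) := by
    have h1 := (intervalIntegral.intervalIntegrable_rpow' (r := -γ) (a := 0) (b := T + 1) (by linarith)).1
    refine (integrableOn_congr_fun (fun θ hθ => ?_) measurableSet_Ioc).1 h1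
    exact Real.rpow_neg hθ.1.le γ
  rw [rlDeriv]
  congr 1
  refine ((h.hasDerivAt_conv (T := T) hk).congr_of_eventuallyEq ?_).deriv
  filter_upwards [Ioo_mem_nhds hT (by linarith : T < T + 1)] with r hr
  exact h.conv_eq (fun θ => (θ ^ γ)⁻¹) hr.1.le hr.2.le

/-- Fubini's theorem exchanges the order `γ` with the time lag `θ`: the integral of the fractional
derivatives over `γ` is the derivative of one convolution with `distKer`. -/
theorem CausalC1.hasDerivAt_distInt (h : CausalC1 y z) (hc : 0 < c) {T : ℝ} (hT : 0 < T) :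
    IntervalIntegrable (fun γ => c ^ γ * rlDeriv γ y T) volume 0 1 ∧
    HasDerivAt (distInt c y) (∫ γ in (0 : ℝ)..1, c ^ γ * rlDeriv γ y T) T := by
  set B := T + 1 with hB
  obtain ⟨L, hL0, hL⟩ := h.exists_bound T
  have hk := integrableOn_distKer_Ioc hc B
  have hprod : Integrable (fun p : ℝ × ℝ => z (T - p.2) * rlKer c p.1 p.2)
      ((volume.restrict (Ioo 0 1)).prod (volume.restrict (Ioc 0 B))) := by
    have h1 := integrable_rlKer hc one_pos
    rw [Measure.prod_restrict] at h1 ⊢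
    have h2 := (IntegrableOn.mono_set h1 (prod_mono_right (Ioc_subset_Ioi_self : Ioc 0 B ⊆ Ioi 0))).const_mul
      (L * Real.exp B)
    have hm : AEStronglyMeasurable (fun p : ℝ × ℝ => rlKer c p.1 p.2)
        ((volume.prod volume).restrict (Ioo 0 1 ×ˢ Ioc 0 B)) := by
      have h3 := (IntegrableOn.mono_set h1 (prod_mono_right (Ioc_subset_Ioi_self : Ioc 0 B ⊆ Ioi 0))).aestronglyMeasurable.mul
        (by fun_prop : Continuous fun p : ℝ × ℝ => Real.exp p.2).aestronglyMeasurable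
      refine h3.congr (Eventually.of_forall fun p => ?_)
      simp only [Pi.mul_apply, one_mul]
      rw [mul_assoc, ← Real.exp_add, neg_add_cancel, Real.exp_zero, mul_one]
    refine h2.mono' ((h.measurable_z.comp
      (measurable_const.sub measurable_snd)).aestronglyMeasurable.mul hm) ?_
    refine (ae_restrict_iff' (measurableSet_Ioo.prod measurableSet_Ioc)).2
      (Eventually.of_forall fun p hp => ?_)
    have h3 := rlKer_nonneg hc hp.1.2 hp.2.1
    have h4 : |z (T - p.2)| ≤ L := hL _ (by linarith [hp.2.1])
    have h5 : 1 ≤ Real.exp B * Real.exp (-(1 * p.2)) := by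
      rw [← Real.exp_add]
      exact Real.one_le_exp (by linarith [hp.2.2])
    rw [norm_mul, Real.norm_eq_abs, Real.norm_of_nonneg h3]
    calc |z (T - p.2)| * rlKer c p.1 p.2 ≤ L * rlKer c p.1 p.2 * 1 := by
          rw [mul_one]; gcongr
      _ ≤ L * rlKer c p.1 p.2 * (Real.exp B * Real.exp (-(1 * p.2))) := by gcongr
      _ = _ := by ring
  have e : ∀ γ ∈ Ioo (0 : ℝ) 1, ∫ θ in Ioc 0 B, z (T - θ) * rlKer c γ θ = c ^ γ * rlDeriv γ y T := by
    intro γ hγ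
    rw [h.rlDeriv_eq hγ.2 hT, ← mul_assoc, ← integral_const_mul]
    congr 1 with θ
    rw [rlKer]; ring
  refine ⟨?_, ?_⟩
  · rw [intervalIntegrable_iff_integrableOn_Ioo_of_le zero_le_one]
    exact (integrableOn_congr_fun e measurableSet_Ioo).1 hprod.integral_prod_left
  · have h1 := h.hasDerivAt_conv (T := T) hk
    have h2 : ∫ θ in Ioc 0 B, z (T - θ) * distKer c θ = ∫ γ in (0 : ℝ)..1, c ^ γ * rlDeriv γ y T := by
      rw [intervalIntegral.integral_of_le zero_le_one,
        integral_Ioc_eq_integral_Ioo (f := fun γ => c ^ γ * rlDeriv γ y T), ← setIntegral_congr_fun measurableSet_Ioo e,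
        integral_integral_swap (f := fun γ θ => z (T - θ) * rlKer c γ θ) hprod]
      simp only [integral_const_mul, distKer]
    rw [h2] at h1
    refine h1.congr_of_eventuallyEq ?_
    filter_upwards [Ioo_mem_nhds hT (by linarith : T < B)] with r hr
    exact h.conv_eq (distKer c) hr.1.le hr.2.le

theorem CausalC1.tendsto_distInt (h : CausalC1 y z) (hc : 0 < c) :
    Tendsto (distInt c y) (𝓝[>] 0) (𝓝 0) := by
  have h1 := (h.hasDerivAt_conv (T := 0) (integrableOn_distKer_Ioc hc 1)).continuousAt.tendsto
  have h2 : ∫ θ in Ioc (0 : ℝ) 1, y (0 - θ) * distKer c θ = 0 := by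
    rw [setIntegral_congr_fun measurableSet_Ioc (g := fun _ => 0) fun θ hθ => by
      simp [h.y_nonpos (-θ) (by linarith [hθ.1])]]
    simp
  rw [h2] at h1
  refine (h1.mono_left nhdsWithin_le_nhds).congr' ?_
  filter_upwards [Ioo_mem_nhdsGT (zero_lt_one (α := ℝ))] with r hr
  exact (h.conv_eq (distKer c) hr.1.le hr.2.le).symm

theorem integrableOn_mul_exp_of_le {f : ℝ → ℝ} {A C : ℝ} (hf : AEStronglyMeasurable f (volume.restrict (Ioi 0)))
    (hb : ∀ t, 0 < t → |f t| ≤ C * Real.exp (A * t)) (hs : A < s) :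
    IntegrableOn (fun t => f t * Real.exp (-(s * t))) (Ioi 0) := by
  have hi : IntegrableOn (fun t : ℝ => C * Real.exp (-(s - A) * t)) (Ioi 0) :=
    (exp_neg_integrableOn_Ioi 0 (by linarith : 0 < s - A)).const_mul C
  refine hi.mono' (hf.mul (by fun_prop : Continuous fun t : ℝ => Real.exp (-(s * t))).aestronglyMeasurable)
    ((ae_restrict_iff' measurableSet_Ioi).2 (Eventually.of_forall fun t ht => ?_))
  rw [norm_mul, Real.norm_eq_abs, Real.norm_of_nonneg (Real.exp_pos _).le]
  refine (mul_le_mul_of_nonneg_right (hb t ht) (Real.exp_pos _).le).trans_eq ?_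
  rw [mul_assoc, ← Real.exp_add]
  congr 2; ring

theorem laplace_distInt (hc : 0 < c) (hs : 0 < s)
    (hy : IntegrableOn (fun t => y t * Real.exp (-(s * t))) (Ioi 0)) :
    IntegrableOn (fun t => distInt c y t * Real.exp (-(s * t))) (Ioi 0) ∧
    ∫ t in Ioi (0 : ℝ), distInt c y t * Real.exp (-(s * t)) =
      (∫ t in Ioi (0 : ℝ), y t * Real.exp (-(s * t))) * distSym c s := by
  obtain ⟨hk, hk'⟩ := integrableOn_distKer hc hs
  have e : ∀ r, ∫ τ in (0 : ℝ)..r, (ContinuousLinearMap.mul ℝ ℝ) (y τ * Real.exp (-(s * τ)))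
      (distKer c (r - τ) * Real.exp (-(s * (r - τ)))) = distInt c y r * Real.exp (-(s * r)) := by
    intro r
    rw [distInt, ← intervalIntegral.integral_mul_const]
    congr 1 with τ
    rw [ContinuousLinearMap.mul_apply', mul_mul_mul_comm, ← Real.exp_add]
    congr 2; ring
  refine ⟨?_, ?_⟩
  · have h1 := (integrable_posConvolution hy hk (ContinuousLinearMap.mul ℝ ℝ)).integrableOn (s := Ioi 0)
    refine (integrableOn_congr_fun (fun r hr => ?_) measurableSet_Ioi).1 h1
    rw [posConvolution, indicator_of_mem hr, e]
  · have h1 := integral_posConvolution hy hk (ContinuousLinearMap.mul ℝ ℝ)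
    simp only [e] at h1
    rw [h1, hk', ContinuousLinearMap.mul_apply']

end

/-! ### Equivalence of the constitutive law with an identity of transforms. -/

section Constitutive

variable {y₁ z₁ y₂ z₂ : ℝ → ℝ} {a b A : ℝ}

/-- Equal derivatives make the difference of the two convolutions constant for `t > 0`, and the
constant is `0` because both tend to `0` as `t → 0⁺`. Their transforms therefore agree. -/
theorem laplace_of_constitutive (ha : 0 < a) (hb : 0 < b) (h₁ : CausalC1 y₁ z₁) (h₂ : CausalC1 y₂ z₂)
    (hA : 0 ≤ A)
    (i₁ : ∀ s, A < s → IntegrableOn (fun t => y₁ t * Real.exp (-(s * t))) (Ioi 0))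
    (i₂ : ∀ s, A < s → IntegrableOn (fun t => y₂ t * Real.exp (-(s * t))) (Ioi 0))
    (h : ∀ t, 0 < t → ∫ γ in (0 : ℝ)..1, a ^ γ * rlDeriv γ y₁ t =
      ∫ γ in (0 : ℝ)..1, b ^ γ * rlDeriv γ y₂ t) {s : ℝ} (hs : A < s) :
    (∫ t in Ioi (0 : ℝ), y₁ t * Real.exp (-(s * t))) * distSym a s =
      (∫ t in Ioi (0 : ℝ), y₂ t * Real.exp (-(s * t))) * distSym b s := by
  have hs0 : 0 < s := hA.trans_lt hs
  rw [← (laplace_distInt ha hs0 (i₁ s hs)).2, ← (laplace_distInt hb hs0 (i₂ s hs)).2]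
  have hd : ∀ t, 0 < t → HasDerivAt (fun r => distInt a y₁ r - distInt b y₂ r) 0 t := fun t ht => by
    have h1 := (h₁.hasDerivAt_distInt ha ht).2.sub (h₂.hasDerivAt_distInt hb ht).2
    rwa [h t ht, sub_self] at h1
  have h0 : Tendsto (fun r => distInt a y₁ r - distInt b y₂ r) (𝓝[>] 0) (𝓝 0) := by
    simpa using (h₁.tendsto_distInt ha).sub (h₂.tendsto_distInt hb)
  have hconst : ∀ r t, 0 < r → 0 < t → distInt a y₁ r - distInt b y₂ r =
      distInt a y₁ t - distInt b y₂ t := fun r t hr ht =>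
    isOpen_Ioi.is_const_of_deriv_eq_zero isPreconnected_Ioi
      (fun u hu => (hd u hu).differentiableAt.differentiableWithinAt) (fun u hu => (hd u hu).deriv)
      (mem_Ioi.2 hr) (mem_Ioi.2 ht)
  refine setIntegral_congr_fun measurableSet_Ioi fun t ht => ?_
  have h1 : distInt a y₁ t - distInt b y₂ t = 0 := by
    refine tendsto_nhds_unique (tendsto_const_nhds.congr' ?_) h0
    filter_upwards [self_mem_nhdsWithin] with r hr
    exact hconst t r ht hr
  simp only [sub_eq_zero.1 h1]

/-- The converse: injectivity of the transform identifies the two convolutions on `(0,∞)`, and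
differentiation gives the law pointwise. -/
theorem constitutive_of_laplace (ha : 0 < a) (hb : 0 < b) (h₁ : CausalC1 y₁ z₁) (h₂ : CausalC1 y₂ z₂)
    (hA : 0 ≤ A)
    (i₁ : ∀ s, A < s → IntegrableOn (fun t => y₁ t * Real.exp (-(s * t))) (Ioi 0))
    (i₂ : ∀ s, A < s → IntegrableOn (fun t => y₂ t * Real.exp (-(s * t))) (Ioi 0))
    (h : ∀ s, A < s → (∫ t in Ioi (0 : ℝ), y₁ t * Real.exp (-(s * t))) * distSym a s =
      (∫ t in Ioi (0 : ℝ), y₂ t * Real.exp (-(s * t))) * distSym b s) {t : ℝ} (ht : 0 < t) :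
    IntervalIntegrable (fun γ => a ^ γ * rlDeriv γ y₁ t) volume 0 1 ∧
    IntervalIntegrable (fun γ => b ^ γ * rlDeriv γ y₂ t) volume 0 1 ∧
    ∫ γ in (0 : ℝ)..1, a ^ γ * rlDeriv γ y₁ t = ∫ γ in (0 : ℝ)..1, b ^ γ * rlDeriv γ y₂ t := by
  have d1 := fun t ht => h₁.hasDerivAt_distInt ha (T := t) ht
  have d2 := fun t ht => h₂.hasDerivAt_distInt hb (T := t) ht
  have heq := eqOn_of_laplace (A := A) (fun t ht => (d1 t ht).2.continuousAt.continuousWithinAt)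
    (fun t ht => (d2 t ht).2.continuousAt.continuousWithinAt)
    (fun s hs => (laplace_distInt ha (hA.trans_lt hs) (i₁ s hs)).1)
    (fun s hs => (laplace_distInt hb (hA.trans_lt hs) (i₂ s hs)).1)
    (fun s hs => by
      rw [(laplace_distInt ha (hA.trans_lt hs) (i₁ s hs)).2,
        (laplace_distInt hb (hA.trans_lt hs) (i₂ s hs)).2, h s hs])
  refine ⟨(d1 t ht).1, (d2 t ht).1, ?_⟩
  refine (d1 t ht).2.unique ((d2 t ht).2.congr_of_eventuallyEq ?_)
  filter_upwards [Ioi_mem_nhds ht] with r hr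
  exact heq hr

end Constitutive

/-! ### Real-valued fields attached to a symbol, up to `|x| = 1`. -/

/-- Symbols that commute with conjugation in the half-plane `Re s > A₀`. -/
structure RealSymb (A₀ : ℝ) (G : ℂ → ℂ) : Prop extends Symb G where
  conj : ∀ s : ℂ, A₀ < s.re →
    G (Complex.log ((starRingEnd ℂ) s)) = (starRingEnd ℂ) (G (Complex.log s))

theorem log_conj_of_re_pos {s : ℂ} (hs : 0 < s.re) :
    Complex.log ((starRingEnd ℂ) s) = (starRingEnd ℂ) (Complex.log s) := by
  refine Complex.log_conj s fun h => ?_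
  rw [Complex.arg_eq_pi_iff] at h
  linarith [h.1]

theorem log_mem_ostrip_of_re_pos {s : ℂ} (hs : 0 < s.re) : Complex.log s ∈ ostrip := by
  rw [mem_ostrip, Complex.log_im]
  exact (Complex.abs_arg_lt_pi_div_two_iff.2 (Or.inl hs)).trans (by linarith [Real.pi_pos])

/-- The parameters of the representations of the fields: the inversion abscissa `A > A₀` and the
radius `δ` of the circle of the keyhole contour. -/
structure Params (a b A₀ A δ : ℝ) : Prop where
  ha : 0 < a
  hab : a < b
  absc_le : absc ha hab ≤ A₀
  lt : A₀ < A
  pos : 0 < δ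
  log_lt : Real.log δ < -|Real.log a - Real.log b|

/-- Inverse Laplace transform of the symbol `G · e^{xz} / sinh z`. -/
def wave (a b A δ : ℝ) (G : ℂ → ℂ) (x t : ℝ) : ℝ :=
  if |x| < 1 then (brom a b G A (x, t)).re else if 0 < t then (keyI a b G δ (x, t)).re else 0

section

variable {a b A₀ A δ : ℝ} {G H : ℂ → ℂ}

namespace RealSymb

theorem mul (hG : RealSymb A₀ G) (hH : RealSymb A₀ H) : RealSymb A₀ (fun w => G w * H w) where
  toSymb := hG.toSymb.mul hH.toSymb
  conj s hs := by rw [hG.conj s hs, hH.conj s hs, map_mul]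

theorem add (hG : RealSymb A₀ G) (hH : RealSymb A₀ H) : RealSymb A₀ (fun w => G w + H w) where
  toSymb := hG.toSymb.add hH.toSymb
  conj s hs := by rw [hG.conj s hs, hH.conj s hs, map_add]

theorem const (r : ℝ) : RealSymb A₀ (fun _ => (r : ℂ)) where
  toSymb := symb_const _
  conj _ _ := (Complex.conj_ofReal r).symm

theorem exp (h0 : 0 ≤ A₀) : RealSymb A₀ Complex.exp where
  toSymb := symb_exp
  conj s hs := by rw [log_conj_of_re_pos (h0.trans_lt hs), Complex.exp_conj]

theorem exp_neg (h0 : 0 ≤ A₀) : RealSymb A₀ (fun w => Complex.exp (-w)) where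
  toSymb := symb_exp_neg
  conj s hs := by rw [log_conj_of_re_pos (h0.trans_lt hs), ← Complex.exp_conj, map_neg]

theorem zed (h0 : 0 ≤ A₀) : RealSymb A₀ (zed a b) where
  toSymb := symb_zed
  conj s hs := by
    have hs := h0.trans_lt hs
    rw [log_conj_of_re_pos hs, zed_conj (ostrip_subset (log_mem_ostrip_of_re_pos hs))]

theorem exp_neg_mu (h0 : 0 ≤ A₀) : RealSymb A₀ (fun w => Complex.exp (-mu a b w)) where
  toSymb := symb_exp_neg_mu
  conj s hs := by
    have hs := h0.trans_lt hs
    rw [log_conj_of_re_pos hs, mu_conj (ostrip_subset (log_mem_ostrip_of_re_pos hs)),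
      ← Complex.exp_conj, map_neg]

end RealSymb

theorem kap_conj {s : ℂ} (hs : 0 < s.re) :
    kap a b ((starRingEnd ℂ) s) = (starRingEnd ℂ) (kap a b s) :=
  (RealSymb.zed le_rfl).conj s hs

theorem HalfPlane.mono {f : ℂ → ℂ} {A₀ A₀' α C : ℝ} (h : HalfPlane f A₀ α C) (hA : A₀ ≤ A₀') :
    HalfPlane f A₀' α C where
  one_le := h.one_le.trans hA
  one_lt := h.one_lt
  diff := h.diff.mono fun _ hs => hA.trans_lt hs
  bound s hs := h.bound s (hA.trans_lt hs)

/-- Carries identities known from the Bromwich integral for `|x| < 1` to `|x| = 1`, where only the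
keyhole representation is available. -/
theorem eq_of_eqOn_abs_lt {E : Type*} [TopologicalSpace E] [T2Space E] {f g : ℝ → E} {x : ℝ}
    (hx : |x| ≤ 1) (hf : ContinuousAt f x) (hg : ContinuousAt g x) (h : ∀ y, |y| < 1 → f y = g y) :
    f x = g x := by
  have hcl : x ∈ closure (Ioo (-1 : ℝ) 1) := by
    rw [closure_Ioo (by norm_num)]; exact abs_le.1 hx
  have := mem_closure_iff_nhdsWithin_neBot.1 hcl
  refine tendsto_nhds_unique ((hf.mono_left nhdsWithin_le_nhds).congr' ?_)
    (hg.mono_left (nhdsWithin_le_nhds (s := Ioo (-1) 1)))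
  filter_upwards [self_mem_nhdsWithin] with y hy
  exact h y (abs_lt.2 hy)

namespace Params

variable (h : Params a b A₀ A δ)
include h

theorem absc_lt : absc h.ha h.hab < A := h.absc_le.trans_lt h.lt

theorem one_le : 1 ≤ A₀ := (one_le_absc h.ha h.hab).trans h.absc_le

theorem nonneg : 0 ≤ A₀ := zero_le_one.trans h.one_le

theorem exists_halfPlane (hG : Symb G) {x : ℝ} (hx : |x| < 1) :
    ∃ C, HalfPlane (fun s => kern a b G s * Complex.exp (x * kap a b s)) A₀ 2 C := by
  obtain ⟨C, hC⟩ := halfPlane_kern h.ha h.hab hG hx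
  exact ⟨C, hC.mono h.absc_le⟩

theorem kern_conj (hG : RealSymb A₀ G) (x : ℝ) (s : ℂ) (hs : A₀ < s.re) :
    kern a b G ((starRingEnd ℂ) s) * Complex.exp (x * kap a b ((starRingEnd ℂ) s)) =
      (starRingEnd ℂ) (kern a b G s * Complex.exp (x * kap a b s)) := by
  have h0 : 0 < s.re := h.nonneg.trans_lt hs
  rw [kern, kern, hG.conj s hs, kap_conj h0, map_mul, map_div₀, Complex.sinh_conj, ← Complex.exp_conj,
    map_mul, Complex.conj_ofReal]

theorem brom_eq_ofReal (hG : RealSymb A₀ G) {x : ℝ} (hx : |x| < 1) (t : ℝ) :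
    ((brom a b G A (x, t)).re : ℂ) = brom a b G A (x, t) := by
  obtain ⟨C, hC⟩ := h.exists_halfPlane hG.toSymb hx
  rw [brom_eq_Br]
  exact HalfPlane.Br_conj h.lt (h.kern_conj hG x) t

theorem contDiffAt_keyI (hG : Symb G) {p : ℝ × ℝ} (hp : p ∈ keyDom a b) :
    ContDiffAt ℝ (⊤ : ℕ∞) (keyI a b G δ) p :=
  (contDiffOn_keyI h.ha h.hab hG h.pos h.log_lt).contDiffAt (isOpen_keyDom.mem_nhds hp)

theorem continuousAt_keyI_fst (hG : Symb G) {x t : ℝ} (hx : |x| ≤ 1) (ht : 0 < t) :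
    ContinuousAt (fun y => keyI a b G δ (y, t)) x :=
  (h.contDiffAt_keyI hG (mem_keyDom hx ht)).continuousAt.comp (f := fun y : ℝ => (y, t)) (by fun_prop)

theorem keyI_eq_ofReal (hG : RealSymb A₀ G) {x t : ℝ} (hx : |x| ≤ 1) (ht : 0 < t) :
    ((keyI a b G δ (x, t)).re : ℂ) = keyI a b G δ (x, t) := by
  have h1 := h.continuousAt_keyI_fst hG.toSymb hx ht
  refine eq_of_eqOn_abs_lt hx (f := fun y => ((keyI a b G δ (y, t)).re : ℂ))
    (Complex.continuous_ofReal.continuousAt.comp (Complex.continuous_re.continuousAt.comp h1)) h1 ?_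
  intro y hy
  rw [← brom_eq_keyI h.ha h.hab hG.toSymb hy ht h.absc_lt h.pos h.log_lt]
  exact h.brom_eq_ofReal hG hy t

theorem wave_eq_brom (hG : RealSymb A₀ G) {x : ℝ} (hx : |x| < 1) (t : ℝ) :
    (wave a b A δ G x t : ℂ) = brom a b G A (x, t) := by
  rw [wave, if_pos hx, h.brom_eq_ofReal hG hx]

/-- For `t > 0` the two branches in the definition of `wave` agree, so the field is smooth across
`|x| = 1`. -/
theorem wave_eq_re_keyI (hG : Symb G) {x t : ℝ} (ht : 0 < t) :
    wave a b A δ G x t = (keyI a b G δ (x, t)).re := by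
  rw [wave]
  split_ifs with hx
  · rw [brom_eq_keyI h.ha h.hab hG hx ht h.absc_lt h.pos h.log_lt]
  · rfl

theorem wave_eq_keyI (hG : RealSymb A₀ G) {x t : ℝ} (hx : |x| ≤ 1) (ht : 0 < t) :
    (wave a b A δ G x t : ℂ) = keyI a b G δ (x, t) := by
  rw [h.wave_eq_re_keyI hG.toSymb ht, h.keyI_eq_ofReal hG hx ht]

theorem wave_of_nonpos (hG : Symb G) {x t : ℝ} (ht : t ≤ 0) : wave a b A δ G x t = 0 := by
  rw [wave]
  split_ifs with hx h0
  · rw [brom_of_nonpos h.ha h.hab hG h.absc_lt hx ht, Complex.zero_re]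
  · exact absurd ht (not_le.2 h0)
  · rfl

theorem contDiffAt_wave_of_abs_lt (hG : Symb G) {p : ℝ × ℝ} (hp : |p.1| < 1) :
    ContDiffAt ℝ (⊤ : ℕ∞) (Function.uncurry (wave a b A δ G)) p := by
  have h1 := (contDiffOn_brom h.ha h.hab hG h.absc_lt).contDiffAt (isOpen_xstrip.mem_nhds hp)
  refine (Complex.reCLM.contDiff.contDiffAt.comp p h1).congr_of_eventuallyEq ?_
  filter_upwards [isOpen_xstrip.mem_nhds hp] with q hq
  exact if_pos (show |q.1| < 1 from hq)

theorem contDiffAt_wave_of_pos (hG : Symb G) {p : ℝ × ℝ} (hp : |p.1| ≤ 1) (ht : 0 < p.2) :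
    ContDiffAt ℝ (⊤ : ℕ∞) (Function.uncurry (wave a b A δ G)) p := by
  have h1 := h.contDiffAt_keyI hG (mem_keyDom hp ht)
  refine (Complex.reCLM.contDiff.contDiffAt.comp p h1).congr_of_eventuallyEq ?_
  filter_upwards [(isOpen_lt continuous_const continuous_snd).mem_nhds ht] with q hq
  exact h.wave_eq_re_keyI hG hq

theorem hasDerivAt_wave_snd_of_abs_lt (hG : Symb G) {x : ℝ} (hx : |x| < 1) (t : ℝ) :
    HasDerivAt (wave a b A δ G x) (wave a b A δ (fun w => G w * Complex.exp w) x t) t := by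
  have h1 := Complex.reCLM.hasFDerivAt.comp_hasDerivAt t
    (hasDerivAt_brom_snd h.ha h.hab hG h.absc_lt (t := t) hx)
  rw [wave, if_pos hx]
  refine h1.congr_of_eventuallyEq (Eventually.of_forall fun r => ?_)
  exact if_pos hx

theorem hasDerivAt_wave_fst_of_abs_lt (hG : Symb G) {x : ℝ} (hx : |x| < 1) (t : ℝ) :
    HasDerivAt (fun y => wave a b A δ G y t) (wave a b A δ (fun w => G w * zed a b w) x t) x := by
  have h1 := Complex.reCLM.hasFDerivAt.comp_hasDerivAt x
    (hasDerivAt_brom_fst h.ha h.hab hG h.absc_lt (t := t) hx)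
  rw [wave, if_pos hx]
  refine h1.congr_of_eventuallyEq ?_
  filter_upwards [(isOpen_lt continuous_abs continuous_const).mem_nhds hx] with y hy
  exact if_pos hy

theorem continuousAt_wave_fst (hG : Symb G) {x t : ℝ} (hx : |x| ≤ 1) (ht : 0 < t) :
    ContinuousAt (fun y => wave a b A δ G y t) x :=
  (h.contDiffAt_wave_of_pos hG (p := (x, t)) hx ht).continuousAt.comp (f := fun y : ℝ => (y, t))
    (by fun_prop)

theorem continuousAt_fderiv_wave_fst (hG : Symb G) {x t : ℝ} (hx : |x| ≤ 1) (ht : 0 < t) (v : ℝ × ℝ) :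
    ContinuousAt (fun y => fderiv ℝ (Function.uncurry (wave a b A δ G)) (y, t) v) x := by
  have h1 : ContinuousAt (fderiv ℝ (Function.uncurry (wave a b A δ G))) (x, t) :=
    ((h.contDiffAt_wave_of_pos hG (p := (x, t)) hx ht).fderiv_right (m := 0) (by simp)).continuousAt
  have h2 : ContinuousAt (fun y : ℝ => (y, t)) x := by fun_prop
  exact (ContinuousAt.comp (f := fun y : ℝ => (y, t)) h1 h2).clm_apply continuousAt_const

/-- Smoothness supplies the derivative at `|x| = 1`; its value is identified by continuity in `x`
with the one computed from the Bromwich integral for `|x| < 1`. -/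
theorem hasDerivAt_wave_snd_of_pos (hG : Symb G) {x t : ℝ} (hx : |x| ≤ 1) (ht : 0 < t) :
    HasDerivAt (wave a b A δ G x) (wave a b A δ (fun w => G w * Complex.exp w) x t) t := by
  have h1 : ∀ y : ℝ, |y| ≤ 1 → HasDerivAt (wave a b A δ G y)
      (fderiv ℝ (Function.uncurry (wave a b A δ G)) (y, t) (0, 1)) t := fun y hy =>
    ((h.contDiffAt_wave_of_pos hG (p := (y, t)) hy ht).differentiableAt (by simp)).hasFDerivAt.comp_hasDerivAt
      t ((hasDerivAt_const t y).prodMk (hasDerivAt_id t))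
  rw [← eq_of_eqOn_abs_lt hx (h.continuousAt_fderiv_wave_fst hG hx ht (0, 1))
    (h.continuousAt_wave_fst (hG.mul symb_exp) hx ht) fun y hy =>
      (h1 y hy.le).unique (h.hasDerivAt_wave_snd_of_abs_lt hG hy t)]
  exact h1 x hx

theorem hasDerivAt_wave_fst_of_pos (hG : Symb G) {x t : ℝ} (hx : |x| ≤ 1) (ht : 0 < t) :
    HasDerivAt (fun y => wave a b A δ G y t) (wave a b A δ (fun w => G w * zed a b w) x t) x := by
  have h1 : ∀ y : ℝ, |y| ≤ 1 → HasDerivAt (fun y => wave a b A δ G y t)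
      (fderiv ℝ (Function.uncurry (wave a b A δ G)) (y, t) (1, 0)) y := fun y hy =>
    HasFDerivAt.comp_hasDerivAt (f := fun y : ℝ => (y, t)) y
      ((h.contDiffAt_wave_of_pos hG (p := (y, t)) hy ht).differentiableAt (by simp)).hasFDerivAt
      ((hasDerivAt_id' y).prodMk (hasDerivAt_const y t))
  rw [← eq_of_eqOn_abs_lt hx (h.continuousAt_fderiv_wave_fst hG hx ht (1, 0))
    (h.continuousAt_wave_fst (hG.mul symb_zed) hx ht) fun y hy =>
      (h1 y hy.le).unique (h.hasDerivAt_wave_fst_of_abs_lt hG hy t)]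
  exact h1 x hx

theorem wave_add (hG : Symb G) (hH : Symb H) {x : ℝ} (hx : |x| ≤ 1) (t : ℝ) :
    wave a b A δ (fun w => G w + H w) x t = wave a b A δ G x t + wave a b A δ H x t := by
  have h1 : ∀ y : ℝ, |y| < 1 →
      wave a b A δ (fun w => G w + H w) y t = wave a b A δ G y t + wave a b A δ H y t := fun y hy => by
    rw [wave, wave, wave, if_pos hy, if_pos hy, if_pos hy, ← Complex.add_re, brom, brom, brom, expInt,
      expInt, expInt, ← integral_add
        ((expGood_brom h.ha h.hab hG h.absc_lt).integrable_integrand (p := (y, t)) hy)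
        ((expGood_brom h.ha h.hab hH h.absc_lt).integrable_integrand (p := (y, t)) hy)]
    congr 2 with ω
    simp only [kern]
    ring
  rcases le_or_gt t 0 with ht | ht
  · simp only [h.wave_of_nonpos (hG.add hH) ht, h.wave_of_nonpos hG ht, h.wave_of_nonpos hH ht, add_zero]
  · exact eq_of_eqOn_abs_lt hx (h.continuousAt_wave_fst (hG.add hH) hx ht)
      ((h.continuousAt_wave_fst hG hx ht).add (h.continuousAt_wave_fst hH hx ht)) h1

theorem exists_abs_wave_le (hG : Symb G) {r : ℝ} (hr : r < 1) :
    ∃ C : ℝ, ∀ x t : ℝ, |x| ≤ r → |wave a b A δ G x t| ≤ C * Real.exp (A * t) := by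
  obtain ⟨C, hC⟩ := exists_norm_brom_le h.ha h.hab hG h.absc_lt hr
  refine ⟨C, fun x t hx => ?_⟩
  rw [wave, if_pos (hx.trans_lt hr)]
  exact (Complex.abs_re_le_norm _).trans (hC x t hx)

theorem hasLaplace_wave (hG : RealSymb A₀ G) {x : ℝ} (hx : |x| < 1) :
    HasLaplace (wave a b A δ G x) A₀ (fun s => kern a b G s * Complex.exp (x * kap a b s)) := by
  obtain ⟨C, hC⟩ := h.exists_halfPlane hG.toSymb hx
  have h1 := hC.hasLaplace h.lt (h.kern_conj hG x)
  have e : (fun t => (Br A (fun s => kern a b G s * Complex.exp (x * kap a b s)) t).re) =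
      wave a b A δ G x := by
    funext t
    rw [wave, if_pos hx, brom_eq_Br]
  rwa [e] at h1

end Params

end

/-! ### Displacement-type and stress-type fields. -/

/-- The odd part in `x` of `wave`, with transform `G sinh(xz) / sinh z`. -/
def disp (a b A δ : ℝ) (G : ℂ → ℂ) (x t : ℝ) : ℝ := (wave a b A δ G x t - wave a b A δ G (-x) t) / 2

/-- The even part in `x` of `wave`, with transform `G cosh(xz) / sinh z`. -/
def strs (a b A δ : ℝ) (G : ℂ → ℂ) (x t : ℝ) : ℝ := (wave a b A δ G x t + wave a b A δ G (-x) t) / 2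

/-- The points of the closed strip `|x| ≤ 1` at which the fields are smooth. -/
def Regular (x t : ℝ) : Prop := |x| < 1 ∨ |x| ≤ 1 ∧ 0 < t

theorem Regular.neg {x t : ℝ} (h : Regular x t) : Regular (-x) t := by rwa [Regular, abs_neg]

theorem regular_of_mem {p : ℝ × ℝ} (hp : p ∈ rodDomain) : Regular p.1 p.2 := by
  obtain ⟨⟨h0, h1⟩, h2, h3⟩ := hp
  have habs : |p.1| = p.1 := abs_of_nonneg h0
  rcases h1.lt_or_eq with h | h
  · exact Or.inl (by rwa [habs])
  · refine Or.inr ⟨by rwa [habs], lt_of_le_of_ne h2 fun h4 => h3 ?_⟩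
    exact Prod.ext h h4.symm

theorem HasLaplace.add {f g : ℝ → ℝ} {A : ℝ} {φ ψ : ℂ → ℂ} (hf : HasLaplace f A φ)
    (hg : HasLaplace g A ψ) : HasLaplace (fun t => f t + g t) A (fun s => φ s + ψ s) := fun s hs => by
  obtain ⟨i1, e1⟩ := hf s hs
  obtain ⟨i2, e2⟩ := hg s hs
  have e : (fun t : ℝ => ((f t + g t : ℝ) : ℂ) * Complex.exp (-s * t)) =
      fun t : ℝ => (f t : ℂ) * Complex.exp (-s * t) + (g t : ℂ) * Complex.exp (-s * t) := by
    funext t; push_cast; ring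
  rw [e]
  exact ⟨Integrable.add i1 i2, by rw [integral_add i1 i2, e1, e2]⟩

theorem HasLaplace.const_mul {f : ℝ → ℝ} {A : ℝ} {φ : ℂ → ℂ} (hf : HasLaplace f A φ) (r : ℝ) :
    HasLaplace (fun t => r * f t) A (fun s => r * φ s) := fun s hs => by
  obtain ⟨i1, e1⟩ := hf s hs
  have e : (fun t : ℝ => ((r * f t : ℝ) : ℂ) * Complex.exp (-s * t)) =
      fun t : ℝ => (r : ℂ) * ((f t : ℂ) * Complex.exp (-s * t)) := by
    funext t; push_cast; ring
  rw [e]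
  exact ⟨Integrable.const_mul i1 _, by rw [integral_const_mul, e1]⟩

theorem HasLaplace.congr {f g : ℝ → ℝ} {A : ℝ} {φ ψ : ℂ → ℂ} (hf : HasLaplace f A φ)
    (hfg : ∀ t, f t = g t) (h : ∀ s : ℂ, A < s.re → φ s = ψ s) : HasLaplace g A ψ := fun s hs => by
  rw [← h s hs, ← funext hfg]
  exact hf s hs

section

variable {a b A₀ A δ : ℝ} {G H : ℂ → ℂ}

theorem disp_zero (t : ℝ) : disp a b A δ G 0 t = 0 := by simp [disp]

theorem kern_mul_sinh (x : ℝ) (s : ℂ) :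
    kern a b G s * Complex.sinh (x * kap a b s) = G (Complex.log s) * pker a b x (Complex.log s) := by
  rw [kern, pker, kap]; ring

namespace Params

variable (h : Params a b A₀ A δ)
include h

theorem contDiffAt_wave (hG : Symb G) {p : ℝ × ℝ} (hp : Regular p.1 p.2) :
    ContDiffAt ℝ (⊤ : ℕ∞) (Function.uncurry (wave a b A δ G)) p :=
  hp.elim (h.contDiffAt_wave_of_abs_lt hG) fun hp => h.contDiffAt_wave_of_pos hG hp.1 hp.2

theorem hasDerivAt_wave_snd (hG : Symb G) {x t : ℝ} (hx : Regular x t) :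
    HasDerivAt (wave a b A δ G x) (wave a b A δ (fun w => G w * Complex.exp w) x t) t :=
  hx.elim (h.hasDerivAt_wave_snd_of_abs_lt hG · t) fun hp => h.hasDerivAt_wave_snd_of_pos hG hp.1 hp.2

theorem hasDerivAt_wave_fst (hG : Symb G) {x t : ℝ} (hx : Regular x t) :
    HasDerivAt (fun y => wave a b A δ G y t) (wave a b A δ (fun w => G w * zed a b w) x t) x :=
  hx.elim (h.hasDerivAt_wave_fst_of_abs_lt hG · t) fun hp => h.hasDerivAt_wave_fst_of_pos hG hp.1 hp.2

theorem contDiffAt_wave_neg (hG : Symb G) {p : ℝ × ℝ} (hp : Regular p.1 p.2) :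
    ContDiffAt ℝ (⊤ : ℕ∞) (fun q : ℝ × ℝ => wave a b A δ G (-q.1) q.2) p :=
  ContDiffAt.comp (f := fun q : ℝ × ℝ => (-q.1, q.2)) p (h.contDiffAt_wave hG hp.neg)
    (contDiffAt_fst.neg.prodMk contDiffAt_snd)

theorem contDiffAt_disp (hG : Symb G) {p : ℝ × ℝ} (hp : Regular p.1 p.2) :
    ContDiffAt ℝ (⊤ : ℕ∞) (Function.uncurry (disp a b A δ G)) p :=
  ((h.contDiffAt_wave hG hp).sub (h.contDiffAt_wave_neg hG hp)).div_const 2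

theorem contDiffAt_strs (hG : Symb G) {p : ℝ × ℝ} (hp : Regular p.1 p.2) :
    ContDiffAt ℝ (⊤ : ℕ∞) (Function.uncurry (strs a b A δ G)) p :=
  ((h.contDiffAt_wave hG hp).add (h.contDiffAt_wave_neg hG hp)).div_const 2

theorem hasDerivAt_disp_snd (hG : Symb G) {x t : ℝ} (hx : Regular x t) :
    HasDerivAt (disp a b A δ G x) (disp a b A δ (fun w => G w * Complex.exp w) x t) t :=
  ((h.hasDerivAt_wave_snd hG hx).sub (h.hasDerivAt_wave_snd hG hx.neg)).div_const 2

theorem hasDerivAt_strs_snd (hG : Symb G) {x t : ℝ} (hx : Regular x t) :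
    HasDerivAt (strs a b A δ G x) (strs a b A δ (fun w => G w * Complex.exp w) x t) t :=
  ((h.hasDerivAt_wave_snd hG hx).add (h.hasDerivAt_wave_snd hG hx.neg)).div_const 2

theorem hasDerivAt_wave_neg (hG : Symb G) {x t : ℝ} (hx : Regular x t) :
    HasDerivAt (fun y => wave a b A δ G (-y) t) (-wave a b A δ (fun w => G w * zed a b w) (-x) t) x := by
  have h1 := (h.hasDerivAt_wave_fst hG hx.neg).scomp x (hasDerivAt_neg x)
  simpa using! h1

theorem hasDerivAt_disp_fst (hG : Symb G) {x t : ℝ} (hx : Regular x t) :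
    HasDerivAt (fun y => disp a b A δ G y t) (strs a b A δ (fun w => G w * zed a b w) x t) x := by
  have h1 := ((h.hasDerivAt_wave_fst hG hx).sub (h.hasDerivAt_wave_neg hG hx)).div_const 2
  rwa [sub_neg_eq_add] at h1

theorem hasDerivAt_strs_fst (hG : Symb G) {x t : ℝ} (hx : Regular x t) :
    HasDerivAt (fun y => strs a b A δ G y t) (disp a b A δ (fun w => G w * zed a b w) x t) x := by
  have h1 := ((h.hasDerivAt_wave_fst hG hx).add (h.hasDerivAt_wave_neg hG hx)).div_const 2
  rwa [← sub_eq_add_neg] at h1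

theorem disp_of_nonpos (hG : Symb G) {x t : ℝ} (ht : t ≤ 0) : disp a b A δ G x t = 0 := by
  simp [disp, h.wave_of_nonpos hG ht]

theorem strs_of_nonpos (hG : Symb G) {x t : ℝ} (ht : t ≤ 0) : strs a b A δ G x t = 0 := by
  simp [strs, h.wave_of_nonpos hG ht]

theorem disp_add (hG : Symb G) (hH : Symb H) {x : ℝ} (hx : |x| ≤ 1) (t : ℝ) :
    disp a b A δ (fun w => G w + H w) x t = disp a b A δ G x t + disp a b A δ H x t := by
  rw [disp, h.wave_add hG hH hx, h.wave_add hG hH (x := -x) (by rwa [abs_neg]), disp, disp]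
  ring

theorem continuous_disp (hG : Symb G) {x : ℝ} (hx : |x| < 1) : Continuous (disp a b A δ G x) :=
  continuous_iff_continuousAt.2 fun _ => (h.hasDerivAt_disp_snd hG (Or.inl hx)).continuousAt

theorem continuous_strs (hG : Symb G) {x : ℝ} (hx : |x| < 1) : Continuous (strs a b A δ G x) :=
  continuous_iff_continuousAt.2 fun _ => (h.hasDerivAt_strs_snd hG (Or.inl hx)).continuousAt

theorem causalC1_strs (hG : Symb G) {x : ℝ} (hx : |x| < 1) :
    CausalC1 (strs a b A δ G x) (strs a b A δ (fun w => G w * Complex.exp w) x) where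
  y_nonpos _ ht := h.strs_of_nonpos hG ht
  z_neg _ ht := h.strs_of_nonpos (hG.mul symb_exp) ht.le
  z_cont := (h.continuous_strs (hG.mul symb_exp) hx).continuousOn
  deriv _ _ := h.hasDerivAt_strs_snd hG (Or.inl hx)
  y_cont := h.continuous_strs hG hx

theorem exists_abs_disp_le (hG : Symb G) {r : ℝ} (hr : r < 1) :
    ∃ C : ℝ, ∀ x t : ℝ, |x| ≤ r → |disp a b A δ G x t| ≤ C * Real.exp (A * t) := by
  obtain ⟨C, hC⟩ := h.exists_abs_wave_le hG hr
  refine ⟨C, fun x t hx => ?_⟩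
  have h1 := abs_le.1 (hC x t hx)
  have h2 := abs_le.1 (hC (-x) t (by rwa [abs_neg]))
  rw [disp, abs_le]
  constructor <;> linarith [h1.1, h1.2, h2.1, h2.2]

theorem exists_abs_strs_le (hG : Symb G) {r : ℝ} (hr : r < 1) :
    ∃ C : ℝ, ∀ x t : ℝ, |x| ≤ r → |strs a b A δ G x t| ≤ C * Real.exp (A * t) := by
  obtain ⟨C, hC⟩ := h.exists_abs_wave_le hG hr
  refine ⟨C, fun x t hx => ?_⟩
  have h1 := abs_le.1 (hC x t hx)
  have h2 := abs_le.1 (hC (-x) t (by rwa [abs_neg]))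
  rw [strs, abs_le]
  constructor <;> linarith [h1.1, h1.2, h2.1, h2.2]

theorem hasLaplace_disp (hG : RealSymb A₀ G) {x : ℝ} (hx : |x| < 1) :
    HasLaplace (disp a b A δ G x) A₀ (fun s => kern a b G s * Complex.sinh (x * kap a b s)) := by
  have h1 := ((h.hasLaplace_wave hG hx).const_mul (1 / 2)).add
    ((h.hasLaplace_wave hG (x := -x) (by rwa [abs_neg])).const_mul (-1 / 2))
  refine h1.congr (fun t => by rw [disp]; ring) fun s _ => ?_
  rw [Complex.sinh]
  push_cast
  rw [neg_mul]
  ring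

theorem hasLaplace_strs (hG : RealSymb A₀ G) {x : ℝ} (hx : |x| < 1) :
    HasLaplace (strs a b A δ G x) A₀ (fun s => kern a b G s * Complex.cosh (x * kap a b s)) := by
  have h1 := ((h.hasLaplace_wave hG hx).const_mul (1 / 2)).add
    ((h.hasLaplace_wave hG (x := -x) (by rwa [abs_neg])).const_mul (1 / 2))
  refine h1.congr (fun t => by rw [strs]; ring) fun s _ => ?_
  rw [Complex.cosh]
  push_cast
  rw [neg_mul]
  ring

theorem disp_eq_brom (hG : RealSymb A₀ G) {x : ℝ} (hx : |x| < 1) (t : ℝ) :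
    (disp a b A δ G x t : ℂ) = oddPart (brom a b G A) (x, t) := by
  rw [disp, oddPart]
  push_cast
  rw [h.wave_eq_brom hG hx, h.wave_eq_brom hG (x := -x) (by rwa [abs_neg])]

theorem disp_eq_keyI (hG : RealSymb A₀ G) {x t : ℝ} (hx : |x| ≤ 1) (ht : 0 < t) :
    (disp a b A δ G x t : ℂ) = oddPart (keyI a b G δ) (x, t) := by
  rw [disp, oddPart]
  push_cast
  rw [h.wave_eq_keyI hG hx ht, h.wave_eq_keyI hG (x := -x) (by rwa [abs_neg]) ht]

theorem disp_eq_Br (hG : RealSymb A₀ G) {x : ℝ} (hx : |x| < 1) (t : ℝ) :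
    (disp a b A δ G x t : ℂ) =
      Br A (fun s => G (Complex.log s) * pker a b x (Complex.log s)) t := by
  obtain ⟨C, hC⟩ := h.exists_halfPlane hG.toSymb hx
  obtain ⟨C', hC'⟩ := h.exists_halfPlane hG.toSymb (x := -x) (by rwa [abs_neg])
  rw [h.disp_eq_brom hG hx, oddPart, brom_eq_Br, brom_eq_Br, Br, Br, Br, ← mul_sub,
    ← integral_sub (hC.integrable_line_exp h.lt t) (hC'.integrable_line_exp h.lt t), mul_div_assoc,
    ← integral_div]
  congr 2 with ω
  rw [← kern_mul_sinh, Complex.sinh]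
  push_cast
  rw [neg_mul]
  ring

end Params

end

/-! ### The equations of the rod at the level of symbols. -/

/-- The symbol of the stress that corresponds to a displacement with symbol `G`. -/
def stressSymb (a b : ℝ) (G : ℂ → ℂ) (w : ℂ) : ℂ := G w * Complex.exp w * Complex.exp (-mu a b w)

/-- The symbol of the second time derivative. -/
def accelSymb (G : ℂ → ℂ) (w : ℂ) : ℂ := G w * Complex.exp w * Complex.exp w

section

variable {a b A₀ A δ : ℝ} {G H : ℂ → ℂ}

/-- The balance of momentum in symbols: `(s/M)(sM) = s²`. -/
theorem stressSymb_mul_zed (w : ℂ) : stressSymb a b G w * zed a b w = accelSymb G w := by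
  rw [stressSymb, accelSymb, zed, psi, Complex.exp_add, Complex.exp_neg]
  have := Complex.exp_ne_zero (mu a b w)
  field_simp

theorem RealSymb.stressSymb (hG : RealSymb A₀ G) (h0 : 0 ≤ A₀) : RealSymb A₀ (stressSymb a b G) :=
  (hG.mul (RealSymb.exp h0)).mul (RealSymb.exp_neg_mu h0)

theorem RealSymb.accelSymb (hG : RealSymb A₀ G) (h0 : 0 ≤ A₀) : RealSymb A₀ (accelSymb G) :=
  (hG.mul (RealSymb.exp h0)).mul (RealSymb.exp h0)

namespace Params

variable (h : Params a b A₀ A δ)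
include h

theorem iteratedDeriv_disp (hG : Symb G) {x t : ℝ} (hx : Regular x t) :
    iteratedDeriv 2 (disp a b A δ G x) t = disp a b A δ (accelSymb G) x t := by
  rw [iteratedDeriv_succ, iteratedDeriv_one]
  have h1 : deriv (disp a b A δ G x) =ᶠ[𝓝 t] disp a b A δ (fun w => G w * Complex.exp w) x := by
    rcases hx with hx | ⟨hx, ht⟩
    · exact Eventually.of_forall fun r => (h.hasDerivAt_disp_snd hG (Or.inl hx)).deriv
    · filter_upwards [Ioi_mem_nhds ht] with r hr
      exact (h.hasDerivAt_disp_snd hG (Or.inr ⟨hx, hr⟩)).deriv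
  rw [h1.deriv_eq]
  exact (h.hasDerivAt_disp_snd (hG.mul symb_exp) hx).deriv

theorem hasDerivAt_stress_fst (hG : RealSymb A₀ G) {x t : ℝ} (hx : Regular x t) :
    HasDerivAt (fun y => strs a b A δ (stressSymb a b G) y t) (disp a b A δ (accelSymb G) x t) x := by
  have h1 := h.hasDerivAt_strs_fst (hG.stressSymb (b := b) (a := a) h.nonneg).toSymb hx
  simpa only [stressSymb_mul_zed] using! h1

/-- By `constitutive_of_laplace` it is enough to compare transforms. There the law reads `Phi(log
(as))/M = M Phi(log (bs))`, which is the definition of `M²`. -/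
theorem constitutive (hG : RealSymb A₀ G) {x t : ℝ} (hx : |x| < 1) (ht : 0 < t) :
    IntervalIntegrable (fun γ => a ^ γ * rlDeriv γ (strs a b A δ (stressSymb a b G) x) t) volume 0 1 ∧
    IntervalIntegrable (fun γ => b ^ γ * rlDeriv γ (strs a b A δ (fun w => G w * zed a b w) x) t)
      volume 0 1 ∧
    ∫ γ in (0 : ℝ)..1, a ^ γ * rlDeriv γ (strs a b A δ (stressSymb a b G) x) t =
      ∫ γ in (0 : ℝ)..1, b ^ γ * rlDeriv γ (strs a b A δ (fun w => G w * zed a b w) x) t := by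
  have hb := h.ha.trans h.hab
  have r1 := hG.stressSymb (b := b) (a := a) h.nonneg
  have r2 := hG.mul (RealSymb.zed (a := a) (b := b) h.nonneg)
  have l1 := h.hasLaplace_strs r1 hx
  have l2 := h.hasLaplace_strs r2 hx
  refine constitutive_of_laplace h.ha hb (h.causalC1_strs r1.toSymb hx) (h.causalC1_strs r2.toSymb hx)
    h.nonneg (fun s hs => (l1.real hs).1) (fun s hs => (l2.real hs).1) (fun s hs => ?_) ht
  have hs0 : 0 < s := h.nonneg.trans_lt hs
  have hsC : (s : ℂ) ≠ 0 := Complex.ofReal_ne_zero.2 hs0.ne'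
  apply Complex.ofReal_injective
  rw [Complex.ofReal_mul, Complex.ofReal_mul, (l1.real hs).2, (l2.real hs).2, distSym_eq h.ha hs0,
    distSym_eq hb hs0]
  have hw : Complex.log s ∈ cstrip := ostrip_subset (log_mem_ostrip_of_re_pos (by simpa using hs0))
  have e1 := exp_two_mu (a := a) (b := b) hw
  have hb0 := Phi_ne_zero (v := Complex.log s + Real.log b)
    (mem_cstrip.1 (add_ofReal_mem_cstrip hw _))
  have hm := Complex.exp_ne_zero (mu a b (Complex.log s))
  rw [eq_div_iff hb0, two_mul, Complex.exp_add] at e1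
  rw [← e1, kern, kern, stressSymb, zed, psi, Complex.exp_add, Complex.exp_neg]
  field_simp

end Params

end

/-! ### Attainment of the boundary value in weighted `L¹`. -/

theorem HalfPlane.lintegral_norm_sq {f : ℂ → ℂ} {A₀ α C A : ℝ} (h : HalfPlane f A₀ α C) (hA : A₀ < A) :
    ∫⁻ t in Ioi (0 : ℝ), ENNReal.ofReal (‖Br A f t‖ ^ 2 * Real.exp (-(2 * A * t))) =
      ENNReal.ofReal ((2 * Real.pi)⁻¹ * ∫ ω : ℝ, ‖f (A + ω * Complex.I)‖ ^ 2) := by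
  set g : ℝ → ℂ := fun t => Br A f t * Complex.exp (-(A : ℂ) * t) with hg
  have hgi : IntegrableOn g (Ioi 0) := h.integrableOn_Br hA (s := A) (by simpa using hA)
  have hfi := h.integrable_line hA
  have hng : ∀ t, ‖g t‖ ^ 2 = ‖Br A f t‖ ^ 2 * Real.exp (-(2 * A * t)) := fun t => by
    rw [hg]
    simp only [norm_mul]
    rw [mul_pow, Complex.norm_exp, ← Real.exp_nat_mul]
    congr 2
    simp
    ring
  have hgc : Continuous g := by
    have := h.continuous_Br hA
    fun_prop
  obtain ⟨K, hK0, hK⟩ := h.exists_norm_Br_le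
  have hgb : ∀ t, ‖g t‖ ≤ K := fun t => by
    have h1 : ‖g t‖ = ‖Br A f t‖ * Real.exp (-(A * t)) := by
      simp only [hg]
      rw [norm_mul, Complex.norm_exp]
      congr 2
      simp
    rw [h1]
    calc _ ≤ (K * Real.exp (A * t)) * Real.exp (-(A * t)) :=
          mul_le_mul_of_nonneg_right (hK A hA t) (Real.exp_pos _).le
      _ = K := by rw [mul_assoc, ← Real.exp_add, add_neg_cancel, Real.exp_zero, mul_one]
  have hsq : IntegrableOn (fun t => ‖g t‖ ^ 2) (Ioi 0) := by
    refine (hgi.norm.const_mul K).mono' (hgc.norm.pow 2).aestronglyMeasurable (Eventually.of_forall fun t => ?_)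
    rw [Real.norm_of_nonneg (by positivity), sq]
    exact mul_le_mul_of_nonneg_right (hgb t) (norm_nonneg _)
  have hconj : ∀ t, (starRingEnd ℂ) (g t) = (2 * Real.pi : ℂ)⁻¹ *
      ∫ ω : ℝ, (starRingEnd ℂ) (f (A + ω * Complex.I)) * Complex.exp (-(ω * Complex.I) * t) := fun t => by
    simp only [hg, Br]
    rw [mul_assoc, ← integral_mul_const, map_mul, ← integral_conj]
    congr 1
    · rw [map_inv₀, map_mul, Complex.conj_ofReal, map_ofNat]
    · congr 1 with ω
      rw [map_mul, map_mul, mul_assoc, ← Complex.exp_conj, ← Complex.exp_conj, ← Complex.exp_add]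
      congr 2
      simp
      ring
  have hprod : Integrable (fun p : ℝ × ℝ => g p.1 * ((starRingEnd ℂ) (f (A + p.2 * Complex.I)) *
      Complex.exp (-(p.2 * Complex.I) * p.1))) ((volume.restrict (Ioi 0)).prod volume) := by
    have hfc : Integrable (fun ω : ℝ => (starRingEnd ℂ) (f (A + ω * Complex.I))) :=
      hfi.mono (Complex.continuous_conj.comp_aestronglyMeasurable hfi.aestronglyMeasurable)
        (Eventually.of_forall fun ω => by simp)
    have h1 := Integrable.mul_prod (show Integrable g (volume.restrict (Ioi 0)) from hgi) hfc
    have h2 : Continuous fun p : ℝ × ℝ => Complex.exp (-(p.2 * Complex.I) * p.1) := by fun_prop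
    refine h1.mono ?_ (Eventually.of_forall fun p => ?_)
    · refine (h1.aestronglyMeasurable.mul h2.aestronglyMeasurable).congr (Eventually.of_forall fun p => ?_)
      simp only [Pi.mul_apply]; ring
    · have h3 : ‖Complex.exp (-(p.2 * Complex.I) * p.1)‖ = 1 := by simp [Complex.norm_exp]
      rw [← mul_assoc]
      refine ((norm_mul (g p.1 * (starRingEnd ℂ) (f (A + p.2 * Complex.I))) _).trans ?_).le
      rw [h3, mul_one]
  -- Plancherel's identity: the Bromwich formula is inserted for the conjugate of `g`, the order of
  -- integration is exchanged, and the inner integral is the Laplace transform, which returns `f`.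
  have key : ((∫ t in Ioi (0 : ℝ), ‖g t‖ ^ 2 : ℝ) : ℂ) =
      (((2 * Real.pi)⁻¹ * ∫ ω : ℝ, ‖f (A + ω * Complex.I)‖ ^ 2 : ℝ) : ℂ) := by
    rw [Complex.ofReal_mul, ← integral_complex_ofReal, ← integral_complex_ofReal]
    have e1 : ∀ t, ((‖g t‖ ^ 2 : ℝ) : ℂ) = (2 * Real.pi : ℂ)⁻¹ * ∫ ω : ℝ,
        g t * ((starRingEnd ℂ) (f (A + ω * Complex.I)) * Complex.exp (-(ω * Complex.I) * t)) := fun t => by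
      rw [integral_const_mul, mul_left_comm, ← hconj, Complex.mul_conj, Complex.normSq_eq_norm_sq]
    simp only [e1]
    rw [integral_const_mul, integral_integral_swap hprod]
    push_cast
    congr 2 with ω
    have h1 := h.laplace hA (s := A + ω * Complex.I) (by simpa using hA)
    have e2 : ∀ t : ℝ, g t * ((starRingEnd ℂ) (f (A + ω * Complex.I)) * Complex.exp (-(ω * Complex.I) * t)) =
        (starRingEnd ℂ) (f (A + ω * Complex.I)) * (Br A f t * Complex.exp (-(A + ω * Complex.I) * t)) := fun t => by
      simp only [hg]
      rw [show -((A : ℂ) + ω * Complex.I) * t = -(A : ℂ) * t + -(ω * Complex.I) * t by ring, Complex.exp_add]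
      ring
    simp only [e2]
    rw [integral_const_mul, h1, mul_comm, Complex.mul_conj, Complex.normSq_eq_norm_sq]
    push_cast; rfl
  rw [← Complex.ofReal_injective key, ofReal_integral_eq_lintegral_ofReal hsq
    (Eventually.of_forall fun t => by positivity)]
  simp only [hng]

section

variable {a b A₀ A δ : ℝ} {G : ℂ → ℂ}

theorem norm_pker_log_le (ha : 0 < a) (hab : a < b) {s : ℂ} (hs : absc ha hab ≤ s.re) {x : ℝ}
    (hx : |x| ≤ 1) : ‖pker a b x (Complex.log s)‖ ≤ 4 := by
  have h1 := norm_sinh_kap_ge ha hab hs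
  have h2 := one_le_re_kap ha hab hs
  rw [pker, norm_div]
  change ‖Complex.sinh (x * kap a b s)‖ / ‖Complex.sinh (kap a b s)‖ ≤ 4
  rw [div_le_iff₀ ((by positivity : 0 < Real.exp (kap a b s).re / 4).trans_le h1)]
  have h3 : ‖Complex.sinh (x * kap a b s)‖ ≤ Real.exp (kap a b s).re := by
    have hx' := abs_le.1 hx
    rw [Complex.sinh, norm_div, Complex.norm_ofNat]
    have h4 := norm_sub_le (Complex.exp (x * kap a b s)) (Complex.exp (-(x * kap a b s)))
    rw [Complex.norm_exp, Complex.norm_exp, Complex.neg_re, Complex.re_ofReal_mul] at h4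
    have h5 : Real.exp (x * (kap a b s).re) ≤ Real.exp (kap a b s).re := Real.exp_le_exp.2 (by nlinarith)
    have h6 : Real.exp (-(x * (kap a b s).re)) ≤ Real.exp (kap a b s).re := Real.exp_le_exp.2 (by nlinarith)
    linarith
  linarith

theorem tendsto_pker_one (ha : 0 < a) (hab : a < b) {s : ℂ} (hs : absc ha hab ≤ s.re) :
    Tendsto (fun x : ℝ => pker a b x (Complex.log s)) (𝓝[<] 1) (𝓝 1) := by
  have h0 := sinh_kap_ne_zero ha hab hs
  have h1 : Continuous fun x : ℝ => pker a b x (Complex.log s) := by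
    unfold pker; fun_prop
  have h2 := (h1.tendsto 1).mono_left (nhdsWithin_le_nhds (s := Iio 1))
  have e : pker a b (1 : ℝ) (Complex.log s) = 1 := by
    rw [pker, Complex.ofReal_one, one_mul]; exact div_self h0
  rwa [e] at h2

theorem eventually_left_one : ∀ᶠ x : ℝ in 𝓝[<] 1, x ∈ Ioo (0 : ℝ) 1 := Ioo_mem_nhdsLT zero_lt_one

namespace Params

variable (h : Params a b A₀ A δ)
include h

theorem exists_halfPlane_pker (hG : Symb G) {x : ℝ} (hx : |x| < 1) :
    ∃ C, HalfPlane (fun s => G (Complex.log s) * pker a b x (Complex.log s)) A₀ 2 C := by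
  obtain ⟨C₁, h1⟩ := h.exists_halfPlane hG hx
  obtain ⟨C₂, h2⟩ := h.exists_halfPlane hG (x := -x) (by rwa [abs_neg])
  have e : (fun s => G (Complex.log s) * pker a b x (Complex.log s)) = fun s =>
      (kern a b G s * Complex.exp (x * kap a b s) - kern a b G s * Complex.exp ((-x : ℝ) * kap a b s)) / 2 := by
    funext s
    rw [← kern_mul_sinh, Complex.sinh]
    push_cast
    rw [neg_mul]; ring
  refine ⟨(C₁ + C₂) / 2, h.one_le, one_lt_two, ?_, fun s hs => ?_⟩
  · rw [e]
    exact (h1.diff.sub h2.diff).div_const 2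
  · have e' := congrFun e s
    rw [e']
    have b1 := h1.bound s hs
    have b2 := h2.bound s hs
    have b3 := norm_sub_le (kern a b G s * Complex.exp (x * kap a b s))
      (kern a b G s * Complex.exp ((-x : ℝ) * kap a b s))
    simp only [norm_div, Complex.norm_ofNat]
    linarith

/-- By Plancherel, a symbol of size `1/|s|` and a kernel bounded uniformly for `|x| ≤ 1` give an
`L²` bound independent of `x`. The `L²` norm is used because `1/|s|`, the size of the Heaviside
part, is square integrable but not integrable on the line. -/
theorem exists_lintegral_sq_le (hG : RealSymb A₀ G) {C : ℝ}
    (hC : ∀ s : ℂ, A₀ < s.re → ‖G (Complex.log s)‖ ≤ C * ‖s‖⁻¹) : ∃ K : ℝ, ∀ x ∈ Ioo (0 : ℝ) 1,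
    ∫⁻ t in Ioi (0 : ℝ), ENNReal.ofReal (disp a b A δ G x t ^ 2 * Real.exp (-(2 * A * t))) ≤
      ENNReal.ofReal K := by
  refine ⟨(2 * Real.pi)⁻¹ * ∫ ω : ℝ, (4 * C) ^ 2 * (‖bline A ω‖ ^ 2)⁻¹, fun x hx => ?_⟩
  have hx1 : |x| < 1 := by rw [abs_of_pos hx.1]; exact hx.2
  obtain ⟨C', hf⟩ := h.exists_halfPlane_pker hG.toSymb hx1
  have h1 := hf.lintegral_norm_sq h.lt
  have e1 : ∀ t, disp a b A δ G x t ^ 2 =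
      ‖Br A (fun s => G (Complex.log s) * pker a b x (Complex.log s)) t‖ ^ 2 := fun t => by
    rw [← h.disp_eq_Br hG hx1, Complex.norm_real, Real.norm_eq_abs, sq_abs]
  simp only [e1]
  rw [h1]
  refine ENNReal.ofReal_le_ofReal (mul_le_mul_of_nonneg_left ?_ (by positivity))
  have hA1 : 1 ≤ A := h.one_le.trans h.lt.le
  refine integral_mono_of_nonneg (Eventually.of_forall fun ω => by positivity)
    ((integrable_inv_norm_sq hA1).const_mul _) (Eventually.of_forall fun ω => ?_)
  have hre : A₀ < (bline A ω).re := by rw [bline_re]; exact h.lt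
  have b1 := hC (bline A ω) hre
  have b2 := norm_pker_log_le h.ha h.hab (h.absc_le.trans hre.le) hx1.le
  have b3 : ‖G (Complex.log (bline A ω)) * pker a b x (Complex.log (bline A ω))‖ ≤
      4 * C * ‖bline A ω‖⁻¹ := by
    rw [norm_mul]
    calc _ ≤ (C * ‖bline A ω‖⁻¹) * 4 := mul_le_mul b1 b2 (norm_nonneg _) ((norm_nonneg _).trans b1)
      _ = _ := by ring
  have b4 := pow_le_pow_left₀ (norm_nonneg _) b3 2
  rwa [mul_pow, inv_pow] at b4

theorem tendsto_disp_one (hG : Symb G) {t : ℝ} (ht : 0 < t) :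
    Tendsto (fun x => disp a b A δ G x t) (𝓝[<] 1) (𝓝 (disp a b A δ G 1 t)) :=
  ((h.hasDerivAt_disp_fst hG (x := 1) (Or.inr ⟨by simp, ht⟩)).continuousAt.tendsto).mono_left
    nhdsWithin_le_nhds

theorem continuousOn_disp_one (hG : Symb G) : ContinuousOn (disp a b A δ G 1) (Ioi 0) := fun _ ht =>
  (h.hasDerivAt_disp_snd hG (x := 1) (Or.inr ⟨by simp, ht⟩)).continuousAt.continuousWithinAt

theorem measurable_disp_one (hG : Symb G) :
    AEStronglyMeasurable (disp a b A δ G 1) (volume.restrict (Ioi 0)) :=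
  (h.continuousOn_disp_one hG).aestronglyMeasurable measurableSet_Ioi

/-- Pointwise convergence plus a uniform `L²` bound. The difference truncated at height `N` tends to
`0` by dominated convergence; where it exceeds `N` it is at most `(2/N)` times the sum of the
squares, which is uniformly small for large `N`. -/
theorem tendsto_lintegral_disp (hG : RealSymb A₀ G) {C : ℝ}
    (hC : ∀ s : ℂ, A₀ < s.re → ‖G (Complex.log s)‖ ≤ C * ‖s‖⁻¹) :
    Tendsto (fun x => ∫⁻ t in Ioi (0 : ℝ), ENNReal.ofReal
      (|disp a b A δ G x t - disp a b A δ G 1 t| * Real.exp (-(2 * A * t)))) (𝓝[<] 1) (𝓝 0) := by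
  obtain ⟨K, hK⟩ := h.exists_lintegral_sq_le hG hC
  set d := disp a b A δ G with hd
  have hA0 : 0 < A := h.nonneg.trans_lt h.lt
  have hm : ∀ x ∈ Ioo (0 : ℝ) 1, AEStronglyMeasurable (d x) (volume.restrict (Ioi 0)) := fun x hx =>
    (h.continuous_disp hG.toSymb (by rw [abs_of_pos hx.1]; exact hx.2)).aestronglyMeasurable
  have hm1 : AEStronglyMeasurable (d 1) (volume.restrict (Ioi 0)) := h.measurable_disp_one hG.toSymb
  have hw : AEMeasurable (fun t : ℝ => Real.exp (-(2 * A * t))) (volume.restrict (Ioi 0)) :=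
    (by fun_prop : Measurable fun t : ℝ => Real.exp (-(2 * A * t))).aemeasurable
  have hmin : ∀ N : ℝ, ∀ x ∈ Ioo (0 : ℝ) 1, AEMeasurable (fun t => ENNReal.ofReal
      (min |d x t - d 1 t| N * Real.exp (-(2 * A * t)))) (volume.restrict (Ioi 0)) := fun N x hx =>
    ((AEMeasurable.min (AEMeasurable.abs ((hm x hx).sub hm1).aemeasurable)
      (aemeasurable_const (b := N))).mul hw).ennreal_ofReal
  have hlim : ∀ t ∈ Ioi (0 : ℝ), Tendsto (fun x => d x t) (𝓝[<] 1) (𝓝 (d 1 t)) := fun t ht =>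
    h.tendsto_disp_one hG.toSymb ht
  -- Fatou's lemma along a sequence tending to `1` from the left carries the `L²` bound to the trace
  -- at `x = 1`.
  have hK1 : ∫⁻ t in Ioi (0 : ℝ), ENNReal.ofReal (d 1 t ^ 2 * Real.exp (-(2 * A * t))) ≤
      ENNReal.ofReal K := by
    obtain ⟨x, hx⟩ := exists_seq_tendsto (𝓝[<] (1 : ℝ))
    obtain ⟨n₀, hn₀⟩ := eventually_atTop.1 (hx.eventually eventually_left_one)
    have hx' : Tendsto (fun n => x (n + n₀)) atTop (𝓝[<] 1) := (tendsto_add_atTop_iff_nat n₀).2 hx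
    have hx0 : ∀ n, x (n + n₀) ∈ Ioo (0 : ℝ) 1 := fun n => hn₀ _ (Nat.le_add_left _ _)
    have e : ∫⁻ t in Ioi (0 : ℝ), ENNReal.ofReal (d 1 t ^ 2 * Real.exp (-(2 * A * t))) =
        ∫⁻ t in Ioi (0 : ℝ), liminf (fun n => ENNReal.ofReal
          (d (x (n + n₀)) t ^ 2 * Real.exp (-(2 * A * t)))) atTop := by
      refine setLIntegral_congr_fun measurableSet_Ioi fun t ht => (Tendsto.liminf_eq ?_).symm
      exact ENNReal.tendsto_ofReal ((((hlim t ht).comp hx').pow 2).mul_const _)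
    rw [e]
    refine (lintegral_liminf_le' fun n => ((((hm _ (hx0 n)).aemeasurable.pow_const 2).mul
      hw).ennreal_ofReal)).trans ?_
    refine liminf_le_of_le (by isBoundedDefault) fun b hb => ?_
    obtain ⟨n, hn⟩ := hb.exists
    exact hn.trans (hK _ (hx0 n))
  have hN : ∀ N : ℝ, 0 < N → Tendsto (fun x => ∫⁻ t in Ioi (0 : ℝ), ENNReal.ofReal
      (min |d x t - d 1 t| N * Real.exp (-(2 * A * t)))) (𝓝[<] 1) (𝓝 0) := fun N hN => by
    have h0 : ∫⁻ _ in Ioi (0 : ℝ), (0 : ENNReal) = 0 := by simp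
    rw [← h0]
    refine tendsto_lintegral_filter_of_dominated_convergence'
      (fun t => ENNReal.ofReal (N * Real.exp (-(2 * A) * t))) ?_ ?_ ?_ ?_
    · filter_upwards [eventually_left_one] with x hx
      exact hmin N x hx
    · refine Eventually.of_forall fun x => Eventually.of_forall fun t => ENNReal.ofReal_le_ofReal ?_
      rw [neg_mul]
      exact mul_le_mul_of_nonneg_right (min_le_right _ _) (Real.exp_pos _).le
    · exact ((exp_neg_integrableOn_Ioi 0 (by linarith : 0 < 2 * A)).const_mul N).lintegral_lt_top.ne
    · refine (ae_restrict_iff' measurableSet_Ioi).2 (Eventually.of_forall fun t ht => ?_)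
      have h1 : Tendsto (fun x => |d x t - d 1 t|) (𝓝[<] 1) (𝓝 0) := by
        have := ((hlim t ht).sub_const (d 1 t)).abs
        simpa using this
      have h2 := ENNReal.tendsto_ofReal ((h1.min (tendsto_const_nhds (x := N))).mul_const
        (Real.exp (-(2 * A * t))))
      simpa [hN.le] using h2
  have hbound : ∀ N : ℝ, 0 < N → ∀ x ∈ Ioo (0 : ℝ) 1,
      ∫⁻ t in Ioi (0 : ℝ), ENNReal.ofReal (|d x t - d 1 t| * Real.exp (-(2 * A * t))) ≤
        (∫⁻ t in Ioi (0 : ℝ), ENNReal.ofReal (min |d x t - d 1 t| N * Real.exp (-(2 * A * t)))) +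
          ENNReal.ofReal (2 / N) * (ENNReal.ofReal K + ENNReal.ofReal K) := fun N hN x hx => by
    have hp : ∀ t, ENNReal.ofReal (|d x t - d 1 t| * Real.exp (-(2 * A * t))) ≤
        ENNReal.ofReal (min |d x t - d 1 t| N * Real.exp (-(2 * A * t))) +
        ENNReal.ofReal (2 / N) * (ENNReal.ofReal (d x t ^ 2 * Real.exp (-(2 * A * t))) +
          ENNReal.ofReal (d 1 t ^ 2 * Real.exp (-(2 * A * t)))) := fun t => by
      have hE := Real.exp_pos (-(2 * A * t))
      rw [← ENNReal.ofReal_add (by positivity) (by positivity), ← ENNReal.ofReal_mul (by positivity),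
        ← ENNReal.ofReal_add (by positivity) (by positivity)]
      refine ENNReal.ofReal_le_ofReal ?_
      have h1 : |d x t - d 1 t| ≤ min |d x t - d 1 t| N + 2 / N * (d x t ^ 2 + d 1 t ^ 2) := by
        rcases le_total |d x t - d 1 t| N with hle | hle
        · rw [min_eq_left hle]
          have : 0 ≤ 2 / N * (d x t ^ 2 + d 1 t ^ 2) := by positivity
          linarith
        · rw [min_eq_right hle, div_mul_eq_mul_div]
          have h2 : |d x t - d 1 t| * N ≤ |d x t - d 1 t| ^ 2 := by
            rw [sq]; exact mul_le_mul_of_nonneg_left hle (abs_nonneg _)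
          rw [sq_abs] at h2
          have h3 : |d x t - d 1 t| ≤ 2 * (d x t ^ 2 + d 1 t ^ 2) / N := by
            rw [le_div_iff₀ hN]
            nlinarith [sq_nonneg (d x t + d 1 t)]
          linarith
      calc _ ≤ (min |d x t - d 1 t| N + 2 / N * (d x t ^ 2 + d 1 t ^ 2)) * Real.exp (-(2 * A * t)) :=
            mul_le_mul_of_nonneg_right h1 hE.le
        _ = _ := by ring
    refine (lintegral_mono hp).trans ?_
    have m1 : AEMeasurable (fun t => ENNReal.ofReal (d x t ^ 2 * Real.exp (-(2 * A * t))))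
        (volume.restrict (Ioi 0)) := (((hm x hx).aemeasurable.pow_const 2).mul hw).ennreal_ofReal
    have m2 : AEMeasurable (fun t => ENNReal.ofReal (d 1 t ^ 2 * Real.exp (-(2 * A * t))))
        (volume.restrict (Ioi 0)) := ((hm1.aemeasurable.pow_const 2).mul hw).ennreal_ofReal
    rw [lintegral_add_left' (hmin N x hx), lintegral_const_mul' _ _ ENNReal.ofReal_ne_top, lintegral_add_left' m1]
    gcongr
    exact hK x hx
  rw [ENNReal.tendsto_nhds_zero]
  intro ε hε
  have hε2 : 0 < ε / 2 := ENNReal.half_pos hε.ne'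
  have hNlim : Tendsto (fun N : ℝ => ENNReal.ofReal (2 / N) * (ENNReal.ofReal K + ENNReal.ofReal K))
      atTop (𝓝 0) := by
    have h1 := ENNReal.tendsto_ofReal ((tendsto_const_nhds (x := (2 : ℝ))).div_atTop tendsto_id)
    have h2 := ENNReal.Tendsto.mul_const h1 (b := ENNReal.ofReal K + ENNReal.ofReal K)
      (Or.inr (by finiteness))
    simpa using! h2
  obtain ⟨N, hN1, hN0⟩ := ((ENNReal.tendsto_nhds_zero.1 hNlim _ hε2).and (eventually_gt_atTop 0)).exists
  filter_upwards [ENNReal.tendsto_nhds_zero.1 (hN N hN0) _ hε2, eventually_left_one] with x h1 h2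
  exact (hbound N hN0 x h2).trans ((add_le_add h1 hN1).trans_eq (ENNReal.add_halves ε))

end Params

end

/-! ### Traces at `x = 1` and the convolution formulas. -/

theorem Br_congr {A : ℝ} {f g : ℂ → ℂ} (h : ∀ s : ℂ, s.re = A → f s = g s) (t : ℝ) :
    Br A f t = Br A g t := by
  rw [Br, Br]
  congr 2 with ω
  rw [h _ (by simp)]

theorem Br_const_mul (A : ℝ) (c : ℂ) (f : ℂ → ℂ) (t : ℝ) :
    Br A (fun s => c * f s) t = c * Br A f t := by
  simp only [Br, mul_assoc]
  rw [integral_const_mul]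
  ring

/-- The ramp is the primitive of the Heaviside function. Its transform `c/s²` decays fast enough for
Bromwich inversion, unlike `c/s`. -/
theorem laplace_const_mul_max (c : ℝ) {s : ℝ} (hs : 0 < s) :
    IntegrableOn (fun t => c * max t 0 * Real.exp (-(s * t))) (Ioi 0) ∧
      ((∫ t in Ioi (0 : ℝ), c * max t 0 * Real.exp (-(s * t)) : ℝ) : ℂ) = c * ((s : ℂ) ^ 2)⁻¹ := by
  have h1 := Real.integral_rpow_mul_exp_neg_mul_Ioi (zero_lt_two (α := ℝ)) hs
  rw [Real.Gamma_two, mul_one] at h1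
  have e2 : ∫ t in Ioi (0 : ℝ), max t 0 * Real.exp (-(s * t)) = (s ^ 2)⁻¹ := by
    rw [one_div, Real.inv_rpow hs.le, Real.rpow_two] at h1
    rw [← h1]
    refine setIntegral_congr_fun measurableSet_Ioi fun t ht => ?_
    have ht : 0 < t := ht
    rw [max_eq_left ht.le, show (2 : ℝ) - 1 = 1 by norm_num, Real.rpow_one]
  have hi : IntegrableOn (fun t => max t 0 * Real.exp (-(s * t))) (Ioi 0) := by
    refine Integrable.of_integral_ne_zero ?_
    rw [e2]
    positivity
  simp only [mul_assoc]
  refine ⟨Integrable.const_mul hi c, ?_⟩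
  rw [integral_const_mul, e2]
  push_cast
  rfl

section

variable {a b A₀ A δ : ℝ} {G : ℂ → ℂ}

theorem RealSymb.one : RealSymb A₀ (fun _ => 1) := by
  simpa using! RealSymb.const (A₀ := A₀) 1

namespace Params

variable (h : Params a b A₀ A δ)
include h

/-- Dominated convergence as `x → 1⁻` on the Bromwich line: there the kernel is bounded by `4` and
tends to `1`. -/
theorem disp_one_eq_Br (hG : RealSymb A₀ G) {α C : ℝ} (hf : HalfPlane (fun s => G (Complex.log s)) A₀ α C)
    {t : ℝ} (ht : 0 < t) : (disp a b A δ G 1 t : ℂ) = Br A (fun s => G (Complex.log s)) t := by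
  have h1 : Tendsto (fun x => (disp a b A δ G x t : ℂ)) (𝓝[<] 1) (𝓝 (disp a b A δ G 1 t : ℂ)) :=
    (Complex.continuous_ofReal.tendsto _).comp (h.tendsto_disp_one hG.toSymb ht)
  have hx1 : ∀ᶠ x : ℝ in 𝓝[<] 1, |x| < 1 := by
    filter_upwards [eventually_left_one] with x hx
    rw [abs_of_pos hx.1]; exact hx.2
  have habs : ∀ ω : ℝ, absc h.ha h.hab ≤ (A + ω * Complex.I : ℂ).re := fun ω => by
    simpa using h.absc_lt.le
  refine tendsto_nhds_unique (h1.congr' (hx1.mono fun x hx => h.disp_eq_Br hG hx t)) ?_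
  refine Tendsto.const_mul _ ?_
  refine tendsto_integral_filter_of_dominated_convergence
    (fun ω : ℝ => 4 * ‖G (Complex.log (A + ω * Complex.I)) * Complex.exp ((A + ω * Complex.I) * t)‖)
    ?_ ?_ ((hf.integrable_line_exp h.lt t).norm.const_mul 4) ?_
  · filter_upwards [hx1] with x hx
    obtain ⟨C', hC'⟩ := h.exists_halfPlane_pker hG.toSymb hx
    exact (hC'.integrable_line_exp h.lt t).aestronglyMeasurable
  · filter_upwards [hx1] with x hx
    refine Eventually.of_forall fun ω => ?_
    have h2 := norm_pker_log_le h.ha h.hab (habs ω) hx.le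
    rw [mul_right_comm, norm_mul, mul_comm]
    exact mul_le_mul_of_nonneg_right h2 (norm_nonneg _)
  · refine Eventually.of_forall fun ω => ?_
    have h2 := (tendsto_pker_one h.ha h.hab (habs ω)).const_mul (G (Complex.log (A + ω * Complex.I)))
    rw [mul_one] at h2
    exact h2.mul_const _

/-- The trace and `F` have the same Laplace transform. Only equality almost everywhere can be
expected, as `F` is merely locally integrable. -/
theorem disp_one_ae_eq (hG : RealSymb A₀ G) {α C : ℝ}
    (hf : HalfPlane (fun s => G (Complex.log s)) A₀ α C) {F : ℝ → ℝ} {Ft : ℂ → ℂ}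
    (hL : ∀ s : ℝ, A₀ < s → IntegrableOn (fun t => F t * Real.exp (-(s * t))) (Ioi 0) ∧
      ((∫ t in Ioi (0 : ℝ), F t * Real.exp (-(s * t)) : ℝ) : ℂ) = Ft s)
    (hGF : ∀ s : ℂ, A₀ < s.re → G (Complex.log s) = Ft s)
    (hF : ∀ t ≤ 0, F t = 0) : ∀ᵐ t : ℝ, disp a b A δ G 1 t = F t := by
  have hB := hf.hasLaplace h.lt hG.conj
  have h1 := ae_eq_zero_of_laplace (f := fun t => (Br A (fun s => G (Complex.log s)) t).re - F t) (A := A₀)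
    (fun s hs => by
      simp only [sub_mul]
      exact (hB.real hs).1.sub (hL s hs).1)
    (fun s hs => by
      simp only [sub_mul]
      rw [integral_sub (hB.real hs).1 (hL s hs).1, sub_eq_zero]
      apply Complex.ofReal_injective
      rw [(hB.real hs).2, (hL s hs).2, hGF s (by simpa using hs)])
  rw [ae_restrict_iff' measurableSet_Ioi] at h1
  filter_upwards [h1] with t ht
  rcases le_or_gt t 0 with h0 | h0
  · rw [h.disp_of_nonpos hG.toSymb h0, hF t h0]
  · have h2 := h.disp_one_eq_Br hG hf h0
    have h3 := ht h0
    rw [← h2, Complex.ofReal_re] at h3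
    exact sub_eq_zero.1 h3

theorem disp_const_mul (hG : RealSymb A₀ G) (c : ℝ) {x : ℝ} (hx : |x| < 1) (t : ℝ) :
    disp a b A δ (fun w => c * G w) x t = c * disp a b A δ G x t := by
  apply Complex.ofReal_injective
  rw [h.disp_eq_Br ((RealSymb.const c).mul hG) hx, Complex.ofReal_mul, h.disp_eq_Br hG hx, ← Br_const_mul]
  simp only [mul_assoc]

/-- The symbol `c/s` is not absolutely integrable on the Bromwich line, so the trace is first
identified for `c/s²` as the ramp `ct`, and that identity is differentiated in `t`. -/
theorem disp_exp_neg_one (c : ℝ) {t : ℝ} (ht : 0 < t) :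
    disp a b A δ (fun w => c * Complex.exp (-w)) 1 t = c := by
  have hS : RealSymb A₀ (fun w => c * Complex.exp (-w)) :=
    (RealSymb.const c).mul (RealSymb.exp_neg h.nonneg)
  have hS2 : RealSymb A₀ (fun w => c * Complex.exp (-w) * Complex.exp (-w)) :=
    hS.mul (RealSymb.exp_neg h.nonneg)
  have e : ∀ s : ℂ, A₀ < s.re → c * Complex.exp (-Complex.log s) * Complex.exp (-Complex.log s) =
      c * (s ^ 2)⁻¹ := fun s hs => by
    have hs0 : s ≠ 0 := fun h0 => by rw [h0, Complex.zero_re] at hs; linarith [h.nonneg]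
    rw [Complex.exp_neg, Complex.exp_log hs0, mul_assoc, ← mul_inv, sq]
  have hf : HalfPlane (fun s => c * Complex.exp (-Complex.log s) * Complex.exp (-Complex.log s)) A₀ 2 |c| := by
    refine ⟨h.one_le, one_lt_two, ?_, fun s hs => ?_⟩
    · exact hS2.toSymb.differentiableOn_log.mono fun s hs => slitPlane_of_re_pos (h.nonneg.trans_lt hs)
    · rw [e s hs, norm_mul, norm_inv, norm_pow, Complex.norm_real, Real.norm_eq_abs,
        Real.rpow_neg (norm_nonneg s), Real.rpow_two]
  have h1 := h.disp_one_ae_eq hS2 hf (F := fun t => c * max t 0)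
    (Ft := fun s => c * (s ^ 2)⁻¹) (fun s hs => laplace_const_mul_max c (h.nonneg.trans_lt hs)) e
    (fun t ht => by rw [max_eq_right ht, mul_zero])
  have h2 : EqOn (disp a b A δ (fun w => c * Complex.exp (-w) * Complex.exp (-w)) 1) (fun t => c * max t 0)
      (Ioi 0) :=
    Measure.eqOn_open_of_ae_eq (μ := volume) (ae_restrict_of_ae h1) isOpen_Ioi
      (h.continuousOn_disp_one hS2.toSymb) (by fun_prop)
  have h3 := h.hasDerivAt_disp_snd hS2.toSymb (x := 1) (t := t) (Or.inr ⟨by simp, ht⟩)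
  have h4 : HasDerivAt (disp a b A δ (fun w => c * Complex.exp (-w) * Complex.exp (-w)) 1) c t := by
    have h5 := (hasDerivAt_id t).const_mul c
    rw [mul_one] at h5
    refine h5.congr_of_eventuallyEq ?_
    filter_upwards [Ioi_mem_nhds ht] with r hr
    rw [h2 hr]
    simp only [max_eq_left (le_of_lt (mem_Ioi.1 hr)), id]
  have h6 := h3.unique h4
  simpa [mul_assoc, ← Complex.exp_add] using h6

theorem const_mul_integral_disp (c : ℝ) {x : ℝ} (hx : |x| < 1) (t : ℝ) :
    c * ∫ τ in (0 : ℝ)..t, disp a b A δ (fun _ => 1) x τ =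
      disp a b A δ (fun w => c * Complex.exp (-w)) x t := by
  have hS : RealSymb A₀ (fun w => c * Complex.exp (-w)) :=
    (RealSymb.const c).mul (RealSymb.exp_neg h.nonneg)
  have h1 := RealSymb.one (A₀ := A₀)
  have hd : ∀ r, HasDerivAt (disp a b A δ (fun w => c * Complex.exp (-w)) x)
      (c * disp a b A δ (fun _ => 1) x r) r := fun r => by
    rw [← h.disp_const_mul h1 c hx r]
    simpa [mul_assoc, ← Complex.exp_add] using
      h.hasDerivAt_disp_snd hS.toSymb (x := x) (t := r) (Or.inl hx)
  rw [← intervalIntegral.integral_const_mul, intervalIntegral.integral_eq_sub_of_hasDerivAt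
    (fun r _ => hd r) ((continuous_const.mul (h.continuous_disp h1.toSymb hx)).intervalIntegrable _ _),
    h.disp_of_nonpos hS.toSymb le_rfl, sub_zero]

theorem causalConv_heaviside (c : ℝ) {x : ℝ} (hx : |x| < 1) (t : ℝ) :
    c * causalConv heaviside (disp a b A δ (fun _ => 1) x) t =
      disp a b A δ (fun w => c * Complex.exp (-w)) x t := by
  rcases le_or_gt t 0 with ht | ht
  · rw [h.disp_of_nonpos ((RealSymb.const c).mul (RealSymb.exp_neg h.nonneg)).toSymb ht, causalConv,
      intervalIntegral.integral_symm, intervalIntegral.integral_of_le ht, integral_Ioc_eq_integral_Ioo,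
      setIntegral_congr_fun measurableSet_Ioo (g := fun _ => 0) fun τ hτ => by
        simp [heaviside, not_le.2 hτ.2]]
    simp
  · have h2 := intervalIntegral.integral_comp_sub_left (a := 0) (b := t) (disp a b A δ (fun _ => 1) x) t
    rw [sub_self, sub_zero] at h2
    rw [← h.const_mul_integral_disp c hx, ← h2, causalConv]
    congr 1
    refine intervalIntegral.integral_congr fun τ hτ => ?_
    rw [uIcc_of_le ht.le] at hτ
    simp [heaviside, hτ.1]

theorem causalConv_disp (hG : RealSymb A₀ G) {F : ℝ → ℝ} {Ft : ℂ → ℂ} (hL : HasLaplace F A₀ Ft)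
    (hF : ∀ t ≤ 0, F t = 0) (hGF : ∀ s : ℂ, A₀ < s.re → G (Complex.log s) = Ft s) {x : ℝ} (hx : |x| < 1)
    (t : ℝ) : causalConv F (disp a b A δ (fun _ => 1) x) t = disp a b A δ G x t := by
  obtain ⟨C, hC⟩ := h.exists_halfPlane_pker (RealSymb.one (A₀ := A₀)).toSymb hx
  apply Complex.ofReal_injective
  rw [h.disp_eq_Br hG hx, causalConv, ← intervalIntegral.integral_ofReal]
  simp only [Complex.ofReal_mul, h.disp_eq_Br RealSymb.one hx]
  rw [hC.causalConv_Br hL hF h.lt h.lt]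
  refine Br_congr (fun s hs => ?_) t
  rw [hGF s (by rw [hs]; exact h.lt), one_mul, mul_comm]

end Params

end

/-! ### The constructed fields form an admissible solution. -/

section

variable {a b A₀ A δ : ℝ} {G : ℂ → ℂ} {u : ℝ → ℝ → ℝ} {Υ : ℝ → ℝ}

/-- `u` is the displacement with symbol `G`, except possibly at the corner `(1, 0)`. -/
def HasSymbol (a b A δ : ℝ) (G : ℂ → ℂ) (u : ℝ → ℝ → ℝ) : Prop :=
  ∀ x ∈ Icc (0 : ℝ) 1, ∀ t : ℝ, x < 1 ∨ t ≠ 0 → u x t = disp a b A δ G x t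

theorem abs_lt_one_of_mem_Ico {x : ℝ} (hx : x ∈ Ico (0 : ℝ) 1) : |x| < 1 := by
  rw [abs_of_nonneg hx.1]; exact hx.2

theorem abs_le_one_of_mem_Icc {x : ℝ} (hx : x ∈ Icc (0 : ℝ) 1) : |x| ≤ 1 := by
  rw [abs_of_nonneg hx.1]; exact hx.2

theorem HasSymbol.eq_of_mem_Ico (hu : HasSymbol a b A δ G u) {x : ℝ} (hx : x ∈ Ico (0 : ℝ) 1) :
    u x = disp a b A δ G x :=
  funext fun t => hu x (Ico_subset_Icc_self hx) t (Or.inl hx.2)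

namespace Params

variable (h : Params a b A₀ A δ)
include h

theorem strain_eq (hG : Symb G) (hu : HasSymbol a b A δ G u) {x : ℝ} (hx : x ∈ Ico (0 : ℝ) 1) :
    strain u x = strs a b A δ (fun w => G w * zed a b w) x := by
  funext t
  have e : (fun y => u y t) =ᶠ[𝓝[Icc 0 1] x] fun y => disp a b A δ G y t := by
    filter_upwards [self_mem_nhdsWithin, mem_nhdsWithin_of_mem_nhds (Iio_mem_nhds hx.2)] with y h1 h2
    exact hu y h1 t (Or.inl h2)
  rw [strain, e.derivWithin_eq (hu x (Ico_subset_Icc_self hx) t (Or.inl hx.2))]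
  exact (h.hasDerivAt_disp_fst hG (Or.inl (abs_lt_one_of_mem_Ico hx))).hasDerivWithinAt.derivWithin
    (uniqueDiffOn_Icc zero_lt_one x (Ico_subset_Icc_self hx))

theorem iteratedDeriv_eq (hG : Symb G) (hu : HasSymbol a b A δ G u) {x t : ℝ} (hx : x ∈ Icc (0 : ℝ) 1)
    (ht : 0 < t) : iteratedDeriv 2 (u x) t = disp a b A δ (accelSymb G) x t := by
  rw [← h.iteratedDeriv_disp hG (Or.inr ⟨abs_le_one_of_mem_Icc hx, ht⟩)]
  refine Filter.EventuallyEq.iteratedDeriv_eq 2 ?_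
  filter_upwards [Ioi_mem_nhds ht] with r hr
  exact hu x hx r (Or.inr (ne_of_gt hr))

theorem isSolution (hG : RealSymb A₀ G) (hu : HasSymbol a b A δ G u) (hloc : LocallyIntegrable (u 1))
    (hbc : ∀ᵐ t : ℝ, u 1 t = Υ t) : IsSolution a b Υ u (strs a b A δ (stressSymb a b G)) where
  u_locallyIntegrable x hx := by
    rcases hx.2.lt_or_eq with h1 | h1
    · rw [hu.eq_of_mem_Ico ⟨hx.1, h1⟩]
      exact (h.continuous_disp hG.toSymb (abs_lt_one_of_mem_Ico ⟨hx.1, h1⟩)).locallyIntegrable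
    · rwa [h1]
  σ_locallyIntegrable x hx :=
    (h.continuous_strs (hG.stressSymb h.nonneg).toSymb (abs_lt_one_of_mem_Ico hx)).locallyIntegrable
  u_causal x hx t ht := by rw [hu x hx t (Or.inr ht.ne), h.disp_of_nonpos hG.toSymb ht.le]
  σ_causal x _ t ht := h.strs_of_nonpos (hG.stressSymb h.nonneg).toSymb ht.le
  u_regular := by
    have h1 : ContDiffOn ℝ 2 (Function.uncurry (disp a b A δ G)) rodDomain := fun p hp =>
      ((h.contDiffAt_disp hG.toSymb (regular_of_mem hp)).of_le (WithTop.coe_le_coe.2 (le_top : (2 : ℕ∞) ≤ ⊤))).contDiffWithinAt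
    refine h1.congr fun p hp => hu p.1 hp.1 p.2 ?_
    by_contra h2
    rw [not_or, not_lt, not_not] at h2
    exact hp.2.2 (Prod.ext (le_antisymm hp.1.2 h2.1) h2.2)
  σ_regular := fun p hp => ((h.contDiffAt_strs (hG.stressSymb h.nonneg).toSymb (regular_of_mem hp)).of_le
    (by exact_mod_cast le_top)).contDiffWithinAt
  motion x hx t ht := by
    rw [h.iteratedDeriv_eq hG.toSymb hu hx ht]
    exact (h.hasDerivAt_stress_fst hG (Or.inr ⟨abs_le_one_of_mem_Icc hx, ht⟩)).hasDerivWithinAt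
  constitutive x hx t ht := by
    rw [h.strain_eq hG.toSymb hu hx]
    exact h.constitutive hG (abs_lt_one_of_mem_Ico hx) ht
  init_u x hx := by rw [hu.eq_of_mem_Ico hx, h.disp_of_nonpos hG.toSymb le_rfl]
  init_ut x hx := by
    have h1 := h.hasDerivAt_disp_snd hG.toSymb (t := 0) (Or.inl (abs_lt_one_of_mem_Ico hx))
    rw [h.disp_of_nonpos (hG.toSymb.mul symb_exp) le_rfl] at h1
    rwa [hu.eq_of_mem_Ico hx]
  init_σ x _ := h.strs_of_nonpos (hG.stressSymb h.nonneg).toSymb le_rfl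
  init_strain x hx := by
    rw [h.strain_eq hG.toSymb hu hx, h.strs_of_nonpos (hG.toSymb.mul symb_zed) le_rfl]
  bc_left t := by rw [hu 0 (by simp) t (Or.inl zero_lt_one), disp_zero]
  bc_right := hbc

theorem laplaceAdmissible (hG : RealSymb A₀ G) {C : ℝ}
    (hC : ∀ s : ℂ, A₀ < s.re → ‖G (Complex.log s)‖ ≤ C * ‖s‖⁻¹) (hu : HasSymbol a b A δ G u)
    (hbc : ∀ᵐ t : ℝ, u 1 t = Υ t) : LaplaceAdmissible Υ u (strs a b A δ (stressSymb a b G)) := by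
  have hA0 : 0 < A := h.nonneg.trans_lt h.lt
  -- The weight `e^{-2At}` is dictated by the `L²` estimate at `x → 1`; the pointwise bounds hold
  -- already with `e^{At}`.
  refine ⟨2 * A, fun r hr => ?_, ?_⟩
  · obtain ⟨C₁, h1⟩ := h.exists_abs_disp_le (hG.accelSymb h.nonneg).toSymb hr.2
    obtain ⟨C₂, h2⟩ := h.exists_abs_strs_le (hG.toSymb.mul (symb_zed (a := a) (b := b))) hr.2
    obtain ⟨C₃, h3⟩ := h.exists_abs_strs_le (hG.stressSymb (a := a) (b := b) h.nonneg).toSymb hr.2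
    refine ⟨|C₁| + |C₂| + |C₃|, fun x hx t ht => ?_⟩
    have hx1 : x ∈ Ico (0 : ℝ) 1 := ⟨hx.1, hx.2.trans_lt hr.2⟩
    have hxr : |x| ≤ r := by rw [abs_of_nonneg hx.1]; exact hx.2
    have hexp : Real.exp (A * t) ≤ Real.exp (2 * A * t) := Real.exp_le_exp.2 (by nlinarith)
    have key : ∀ K : ℝ, |K| ≤ |C₁| + |C₂| + |C₃| → ∀ y : ℝ, |y| ≤ K * Real.exp (A * t) →
        |y| ≤ (|C₁| + |C₂| + |C₃|) * Real.exp (2 * A * t) := fun K hK y hy =>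
      hy.trans (mul_le_mul ((le_abs_self K).trans hK) hexp (Real.exp_pos _).le (by positivity))
    refine ⟨?_, ?_, ?_⟩
    · rw [h.iteratedDeriv_eq hG.toSymb hu (Ico_subset_Icc_self hx1) ht]
      exact key C₁ (by linarith [abs_nonneg C₂, abs_nonneg C₃]) _ (h1 x t hxr)
    · rw [h.strain_eq hG.toSymb hu hx1]
      exact key C₂ (by linarith [abs_nonneg C₁, abs_nonneg C₃]) _ (h2 x t hxr)
    · exact key C₃ (by linarith [abs_nonneg C₁, abs_nonneg C₂]) _ (h3 x t hxr)
  · refine (h.tendsto_lintegral_disp hG hC).congr' ?_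
    filter_upwards [eventually_left_one] with x hx
    refine lintegral_congr_ae ?_
    filter_upwards [ae_restrict_of_ae hbc, self_mem_ae_restrict measurableSet_Ioi] with t ht h0
    rw [← ht, hu x (Ioo_subset_Icc_self hx) t (Or.inl hx.2), hu 1 (by simp) t (Or.inr (ne_of_gt h0))]

end Params

end

/-! ### Uniqueness of the admissible solution. -/

/-- The Laplace transform at the real point `s`. -/
def lap (s : ℝ) (f : ℝ → ℝ) : ℝ := ∫ t in Ioi (0 : ℝ), f t * Real.exp (-(s * t))

/-- `f x t = O(e^{At})` uniformly for `x` in compact subsets of `[0,1)`. -/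
def ExpBounded (A : ℝ) (f : ℝ → ℝ → ℝ) : Prop :=
  ∀ r ∈ Ico (0 : ℝ) 1, ∃ C : ℝ, ∀ x ∈ Icc 0 r, ∀ t : ℝ, 0 < t → |f x t| ≤ C * Real.exp (A * t)

theorem ExpBounded.mono {A A' : ℝ} {f : ℝ → ℝ → ℝ} (h : ExpBounded A f) (hA : A ≤ A') :
    ExpBounded A' f := fun r hr => by
  obtain ⟨C, hC⟩ := h r hr
  refine ⟨|C|, fun x hx t ht => (hC x hx t ht).trans ?_⟩
  exact mul_le_mul (le_abs_self C) (Real.exp_le_exp.2 (mul_le_mul_of_nonneg_right hA ht.le))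
    (Real.exp_pos _).le (abs_nonneg C)

/-- An exponential bound for the derivative integrates to one for `y`, so the boundary term at
infinity vanishes in the integration by parts. Thus no growth condition on `y` itself has to be
imposed. -/
theorem lap_deriv {y z : ℝ → ℝ} {A C : ℝ} (hA : 0 < A) (hy : ContinuousOn y (Ici 0)) (h0 : y 0 = 0)
    (hd : ∀ t, 0 < t → HasDerivAt y (z t) t) (hz : ∀ t, 0 < t → |z t| ≤ C * Real.exp (A * t)) :
    (∀ t, 0 < t → |y t| ≤ C / A * Real.exp (A * t)) ∧ ∀ s, A < s → lap s z = s * lap s y := by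
  have hC : 0 ≤ C := by
    have h1 := (abs_nonneg _).trans (hz 1 one_pos)
    exact nonneg_of_mul_nonneg_left h1 (Real.exp_pos _)
  have hb : ∀ t, 0 < t → |y t| ≤ C / A * Real.exp (A * t) := fun t ht => by
    have hB : ∀ r, HasDerivAt (fun r => C / A * Real.exp (A * r)) (C * Real.exp (A * r)) r := fun r => by
      have h1 := (((hasDerivAt_id r).const_mul A).exp).const_mul (C / A)
      refine h1.congr_deriv ?_
      simp only [id]
      field_simp
    -- The derivative is available only for `t > 0`, so the mean value inequality is applied on `[ε,
    -- t]` and `ε` is sent to `0`.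
    have hle : ∀ ε ∈ Ioc 0 t, |y t| ≤ |y ε| + C / A * Real.exp (A * t) := fun ε hε => by
      have h1 := image_norm_le_of_norm_deriv_right_le_deriv_boundary (f := fun r => y r) (f' := z)
        (a := ε) (b := t) (hy.mono fun r hr => hε.1.le.trans hr.1)
        (fun r hr => (hd r (hε.1.trans_le hr.1)).hasDerivWithinAt)
        (B := fun r => |y ε| + C / A * Real.exp (A * r)) (B' := fun r => C * Real.exp (A * r))
        (by rw [Real.norm_eq_abs]; exact le_add_of_nonneg_right (by positivity))
        (fun r => (hB r).const_add _) (fun r hr => hz r (hε.1.trans_le hr.1))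
      exact h1 ⟨hε.2, le_rfl⟩
    have hlim : Tendsto (fun ε => |y ε| + C / A * Real.exp (A * t)) (𝓝[>] 0)
        (𝓝 (|y 0| + C / A * Real.exp (A * t))) :=
      (((hy 0 self_mem_Ici).mono Ioi_subset_Ici_self).tendsto.abs).add_const _
    rw [h0, abs_zero, zero_add] at hlim
    refine ge_of_tendsto hlim ?_
    filter_upwards [Ioc_mem_nhdsGT ht] with ε hε
    exact hle ε hε
  refine ⟨hb, fun s hs => ?_⟩
  have hym : AEStronglyMeasurable y (volume.restrict (Ioi 0)) :=
    (hy.mono Ioi_subset_Ici_self).aestronglyMeasurable measurableSet_Ioi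
  have hzm : AEStronglyMeasurable z (volume.restrict (Ioi 0)) :=
    (stronglyMeasurable_deriv y).aestronglyMeasurable.congr ((ae_restrict_iff' measurableSet_Ioi).2
      (Eventually.of_forall fun t ht => (hd t ht).deriv))
  have iy := integrableOn_mul_exp_of_le hym hb hs
  have iz := integrableOn_mul_exp_of_le hzm hz hs
  have h1 : ∫ t in Ioi (0 : ℝ), (z t * Real.exp (-(s * t)) - s * (y t * Real.exp (-(s * t)))) = 0 - 0 := by
    refine integral_Ioi_of_hasDerivAt_of_tendsto (f := fun t => y t * Real.exp (-(s * t))) (a := 0)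
      (m := 0) ?_ (fun t ht => ?_) (iz.sub (iy.const_mul s)) ?_ |>.trans ?_
    · exact (hy 0 self_mem_Ici).mul (by fun_prop)
    · have h2 := (hd t ht).mul (((hasDerivAt_id t).const_mul s).neg.exp)
      refine h2.congr_deriv ?_
      simp only [Pi.neg_apply, Pi.sub_apply, id]
      ring
    · have h2 : Tendsto (fun t : ℝ => C / A * Real.exp (-((s - A) * t))) atTop (𝓝 0) := by
        have h3 := (Real.tendsto_exp_neg_atTop_nhds_zero.comp
          (tendsto_id.const_mul_atTop (sub_pos.2 hs))).const_mul (C / A)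
        simpa using! h3
      refine squeeze_zero_norm' ?_ h2
      filter_upwards [eventually_gt_atTop 0] with t ht
      rw [norm_mul, Real.norm_of_nonneg (Real.exp_pos _).le]
      refine (mul_le_mul_of_nonneg_right (hb t ht) (Real.exp_pos _).le).trans_eq ?_
      rw [mul_assoc, ← Real.exp_add]
      congr 2; ring
    · rw [h0, zero_mul]
  rw [integral_sub iz (iy.const_mul s), integral_const_mul, sub_zero, sub_eq_zero] at h1
  exact h1

section Transform

variable {f g : ℝ → ℝ → ℝ} {A s : ℝ}

theorem continuousOn_lap (hs : A < s) (hf : ExpBounded A f)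
    (hm : ∀ x ∈ Ico (0 : ℝ) 1, AEStronglyMeasurable (f x) (volume.restrict (Ioi 0)))
    (hc : ∀ t, 0 < t → ContinuousOn (fun x => f x t) (Ico 0 1)) :
    ContinuousOn (fun x => lap s (f x)) (Ico 0 1) := by
  intro x hx
  obtain ⟨r, hxr, hr⟩ := exists_between hx.2
  obtain ⟨C, hC⟩ := hf r ⟨hx.1.trans hxr.le, hr⟩
  have hnear : ∀ᶠ y in 𝓝[Ico 0 1] x, y ∈ Icc 0 r := by
    filter_upwards [self_mem_nhdsWithin, mem_nhdsWithin_of_mem_nhds (Iio_mem_nhds hxr)] with y h1 h2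
    exact ⟨h1.1, le_of_lt h2⟩
  have hexp : Continuous fun t : ℝ => Real.exp (-(s * t)) := by fun_prop
  refine continuousWithinAt_of_dominated (bound := fun t => C * Real.exp (-(s - A) * t)) ?_ ?_
    ((exp_neg_integrableOn_Ioi 0 (sub_pos.2 hs)).const_mul C) ?_
  · filter_upwards [self_mem_nhdsWithin] with y hy
    exact (hm y hy).mul hexp.aestronglyMeasurable
  · filter_upwards [hnear] with y hy
    refine (ae_restrict_iff' measurableSet_Ioi).2 (Eventually.of_forall fun t ht => ?_)
    rw [norm_mul, Real.norm_of_nonneg (Real.exp_pos _).le]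
    refine (mul_le_mul_of_nonneg_right (hC y hy t ht) (Real.exp_pos _).le).trans_eq ?_
    rw [mul_assoc, ← Real.exp_add]
    congr 2; ring
  · exact (ae_restrict_iff' measurableSet_Ioi).2 (Eventually.of_forall fun t ht =>
      (hc t ht x hx).mul continuousWithinAt_const)

theorem hasDerivAt_lap (hs : A < s) (hf : ExpBounded A f) (hg : ExpBounded A g)
    (hmf : ∀ x ∈ Ico (0 : ℝ) 1, AEStronglyMeasurable (f x) (volume.restrict (Ioi 0)))
    (hmg : ∀ x ∈ Ico (0 : ℝ) 1, AEStronglyMeasurable (g x) (volume.restrict (Ioi 0)))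
    (hd : ∀ t, 0 < t → ∀ x ∈ Ioo (0 : ℝ) 1, HasDerivAt (fun y => f y t) (g x t) x) {x : ℝ}
    (hx : x ∈ Ioo (0 : ℝ) 1) : HasDerivAt (fun x => lap s (f x)) (lap s (g x)) x := by
  obtain ⟨r, hxr, hr⟩ := exists_between hx.2
  have hr0 : r ∈ Ico (0 : ℝ) 1 := ⟨hx.1.le.trans hxr.le, hr⟩
  obtain ⟨C, hC⟩ := hg r hr0
  obtain ⟨C', hC'⟩ := hf r hr0
  have hexp : Continuous fun t : ℝ => Real.exp (-(s * t)) := by fun_prop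
  refine (hasDerivAt_integral_of_dominated_loc_of_deriv_le (s := Ioo 0 r)
    (F := fun x t => f x t * Real.exp (-(s * t))) (F' := fun x t => g x t * Real.exp (-(s * t)))
    (bound := fun t => C * Real.exp (-(s - A) * t)) (Ioo_mem_nhds hx.1 hxr) ?_ ?_ ?_ ?_
    ((exp_neg_integrableOn_Ioi 0 (sub_pos.2 hs)).const_mul C) ?_).2
  · filter_upwards [Ioo_mem_nhds hx.1 hx.2] with y hy
    exact (hmf y (Ioo_subset_Ico_self hy)).mul hexp.aestronglyMeasurable
  · exact integrableOn_mul_exp_of_le (hmf x (Ioo_subset_Ico_self hx)) (hC' x ⟨hx.1.le, hxr.le⟩) hs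
  · exact (hmg x (Ioo_subset_Ico_self hx)).mul hexp.aestronglyMeasurable
  · refine (ae_restrict_iff' measurableSet_Ioi).2 (Eventually.of_forall fun t ht y hy => ?_)
    rw [norm_mul, Real.norm_of_nonneg (Real.exp_pos _).le]
    refine (mul_le_mul_of_nonneg_right (hC y ⟨hy.1.le, hy.2.le⟩ t ht) (Real.exp_pos _).le).trans_eq ?_
    rw [mul_assoc, ← Real.exp_add]
    congr 2; ring
  · exact (ae_restrict_iff' measurableSet_Ioi).2 (Eventually.of_forall fun t ht y hy =>
      (hd t ht y ⟨hy.1, hy.2.trans hr⟩).mul_const _)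

end Transform

/-- A solution of `V' = κ T`, `T' = λ V` that vanishes at `0` and, in the limit, at `1` is trivial. -/
theorem eq_zero_of_transformed {V T : ℝ → ℝ} {κ l : ℝ} (hκ : 0 < κ) (hl : 0 ≤ l)
    (hV : ContinuousOn V (Ico 0 1)) (hT : ContinuousOn T (Ico 0 1)) (h0 : V 0 = 0)
    (hV' : ∀ x ∈ Ioo (0 : ℝ) 1, HasDerivAt V (κ * T x) x)
    (hT' : ∀ x ∈ Ioo (0 : ℝ) 1, HasDerivAt T (l * V x) x) (h1 : Tendsto V (𝓝[<] 1) (𝓝 0)) {x : ℝ}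
    (hx : x ∈ Ico (0 : ℝ) 1) : V x = 0 ∧ T x = 0 := by
  have hint : interior (Ico (0 : ℝ) 1) = Ioo 0 1 := interior_Ico
  -- An energy argument: `(VT)' = κT² + λV² ≥ 0` and `V(0) = 0` give `VT ≥ 0`; then `(V²)' = 2κVT ≥
  -- 0`, so `V²` is nondecreasing with limit `0` at the right end.
  have m1 : MonotoneOn (fun x => V x * T x) (Ico 0 1) := by
    refine monotoneOn_of_deriv_nonneg (convex_Ico 0 1) (hV.mul hT) ?_ ?_
    · rw [hint]
      exact fun y hy => ((hV' y hy).mul (hT' y hy)).differentiableAt.differentiableWithinAt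
    · rw [hint]
      intro y hy
      have e : deriv (fun x => V x * T x) y = _ := ((hV' y hy).mul (hT' y hy)).deriv
      rw [e]
      nlinarith [mul_nonneg hκ.le (sq_nonneg (T y)), mul_nonneg hl (sq_nonneg (V y))]
  have hpos : ∀ y ∈ Ico (0 : ℝ) 1, 0 ≤ V y * T y := fun y hy => by
    have h2 := m1 (left_mem_Ico.2 one_pos) hy hy.1
    simpa [h0] using h2
  have m2 : MonotoneOn (fun x => V x ^ 2) (Ico 0 1) := by
    refine monotoneOn_of_deriv_nonneg (convex_Ico 0 1) (hV.pow 2) ?_ ?_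
    · rw [hint]
      exact fun y hy => ((hV' y hy).pow 2).differentiableAt.differentiableWithinAt
    · rw [hint]
      intro y hy
      have e : deriv (fun x => V x ^ 2) y = _ := ((hV' y hy).pow 2).deriv
      rw [e]
      have := mul_nonneg hκ.le (hpos y (Ioo_subset_Ico_self hy))
      simp only [Nat.cast_ofNat, Nat.add_one_sub_one, pow_one]
      nlinarith
  have hVz : ∀ y ∈ Ico (0 : ℝ) 1, V y = 0 := fun y hy => by
    have h2 : V y ^ 2 ≤ 0 ^ 2 := by
      refine ge_of_tendsto (h1.pow 2) ?_
      filter_upwards [Ioo_mem_nhdsLT hy.2] with z hz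
      exact m2 hy ⟨hy.1.trans hz.1.le, hz.2⟩ hz.1.le
    have h3 : V y ^ 2 = 0 := le_antisymm (by simpa using h2) (sq_nonneg _)
    exact pow_eq_zero_iff two_ne_zero |>.1 h3
  have hTz : ∀ y ∈ Ioo (0 : ℝ) 1, T y = 0 := fun y hy => by
    have h2 : HasDerivAt V 0 y := by
      refine (hasDerivAt_const y (0 : ℝ)).congr_of_eventuallyEq ?_
      filter_upwards [Ioo_mem_nhds hy.1 hy.2] with z hz
      exact hVz z (Ioo_subset_Ico_self hz)
    have h3 := (hV' y hy).unique h2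
    exact (mul_eq_zero.1 h3).resolve_left hκ.ne'
  refine ⟨hVz x hx, ?_⟩
  rcases hx.1.eq_or_lt with h2 | h2
  · subst h2
    have h3 : Tendsto T (𝓝[>] 0) (𝓝 (T 0)) := by
      rw [← nhdsWithin_Ioo_eq_nhdsGT one_pos]
      exact (hT 0 hx).mono Ioo_subset_Ico_self
    refine tendsto_nhds_unique h3 (tendsto_const_nhds.congr' ?_)
    filter_upwards [Ioo_mem_nhdsGT one_pos] with y hy
    exact (hTz y hy).symm
  · exact hTz x ⟨h2, hx.2⟩

theorem distSym_pos {c s : ℝ} (hc : 0 < c) (hs : 0 < s) : 0 < distSym c s := by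
  have h2 : Continuous fun γ : ℝ => c ^ γ * (1 / s) ^ (1 - γ) :=
    (continuous_const.rpow continuous_id fun _ => Or.inl hc.ne').mul
      (continuous_const.rpow (continuous_const.sub continuous_id) fun _ => Or.inl (by positivity))
  rw [distSym, ← integral_Ioc_eq_integral_Ioo, ← intervalIntegral.integral_of_le zero_le_one]
  exact intervalIntegral.intervalIntegral_pos_of_pos (h2.intervalIntegrable 0 1)
    (fun γ => by positivity) zero_lt_one

theorem mem_rodDomain_of_lt {x t : ℝ} (hx : x ∈ Ico (0 : ℝ) 1) (ht : 0 ≤ t) : (x, t) ∈ rodDomain :=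
  ⟨Ico_subset_Icc_self hx, ht, fun h => hx.2.ne (congrArg Prod.fst h)⟩

theorem mem_rodDomain_of_pos {x t : ℝ} (hx : x ∈ Icc (0 : ℝ) 1) (ht : 0 < t) : (x, t) ∈ rodDomain :=
  ⟨hx, ht.le, fun h => ht.ne' (congrArg Prod.snd h)⟩

theorem uniqueDiffOn_rodDomain : UniqueDiffOn ℝ rodDomain := by
  have e : rodDomain = (Icc (0 : ℝ) 1 ×ˢ Ici (0 : ℝ)) ∩ {((1 : ℝ), (0 : ℝ))}ᶜ := by
    ext p
    exact and_assoc.symm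
  rw [e]
  exact ((uniqueDiffOn_Icc zero_lt_one).prod (uniqueDiffOn_Ici 0)).inter isOpen_compl_singleton

theorem contDiffOn_snd_of_rodDomain {f : ℝ × ℝ → ℝ} {n : WithTop ℕ∞} (hf : ContDiffOn ℝ n f rodDomain)
    {x : ℝ} (hx : x ∈ Ico (0 : ℝ) 1) : ContDiffOn ℝ n (fun t => f (x, t)) (Ici 0) :=
  hf.comp (f := fun t : ℝ => (x, t)) (by fun_prop) fun _ ht => mem_rodDomain_of_lt hx ht

theorem CausalC1.of_contDiffOn {y : ℝ → ℝ} (h : ContDiffOn ℝ 1 y (Ici 0)) (h0 : ∀ t ≤ 0, y t = 0) :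
    CausalC1 y (fun t => if t < 0 then 0 else derivWithin y (Ici 0) t) where
  y_nonpos := h0
  z_neg _ ht := if_pos ht
  z_cont := (h.continuousOn_derivWithin (uniqueDiffOn_Ici 0) le_rfl).congr fun t ht =>
    if_neg (not_lt.2 ht)
  deriv t ht := by
    rw [if_neg (not_lt.2 ht.le)]
    exact ((h.differentiableOn one_ne_zero t ht.le).hasDerivWithinAt).hasDerivAt (Ici_mem_nhds ht)
  y_cont := by
    rw [← continuousOn_univ, ← Iic_union_Ici (a := (0 : ℝ))]
    exact ContinuousOn.union_of_isClosed (continuousOn_const.congr h0) h.continuousOn isClosed_Iic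
      isClosed_Ici

namespace IsSolution

variable {a b A s : ℝ} {Υ : ℝ → ℝ} {v τ : ℝ → ℝ → ℝ} (hS : IsSolution a b Υ v τ)
include hS

theorem contDiffOn_u_snd {x : ℝ} (hx : x ∈ Ico (0 : ℝ) 1) : ContDiffOn ℝ 2 (v x) (Ici 0) :=
  contDiffOn_snd_of_rodDomain hS.u_regular hx

/-- Expressing the strain by the derivative relative to the region shows that it is `C¹` in time up
to `t = 0`, as required for the distributed-order derivative. -/
theorem strain_eq {x t : ℝ} (hx : x ∈ Ico (0 : ℝ) 1) (ht : 0 ≤ t) :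
    strain v x t = fderivWithin ℝ (Function.uncurry v) rodDomain (x, t) (1, 0) := by
  have h1 := (hS.u_regular.differentiableOn two_ne_zero (x, t) (mem_rodDomain_of_lt hx ht)).hasFDerivWithinAt
  have h2 : HasDerivWithinAt (fun y => v y t)
      (fderivWithin ℝ (Function.uncurry v) rodDomain (x, t) (1, 0)) (Ico 0 1) x :=
    HasFDerivWithinAt.comp_hasDerivWithinAt (f := fun y : ℝ => (y, t)) x h1
      ((hasDerivAt_id' x).prodMk (hasDerivAt_const x t)).hasDerivWithinAt
      (fun y hy => mem_rodDomain_of_lt hy ht)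
  have h3 : Ico (0 : ℝ) 1 ∈ 𝓝[Icc 0 1] x := by
    filter_upwards [self_mem_nhdsWithin, mem_nhdsWithin_of_mem_nhds (Iio_mem_nhds hx.2)] with y h4 h5
    exact ⟨h4.1, h5⟩
  exact (h2.mono_of_mem_nhdsWithin h3).derivWithin
    (uniqueDiffOn_Icc zero_lt_one x (Ico_subset_Icc_self hx))

theorem contDiffOn_strain {x : ℝ} (hx : x ∈ Ico (0 : ℝ) 1) : ContDiffOn ℝ 1 (strain v x) (Ici 0) := by
  have h1 : ContDiffOn ℝ 1 (fun p => fderivWithin ℝ (Function.uncurry v) rodDomain p (1, 0)) rodDomain :=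
    (hS.u_regular.fderivWithin uniqueDiffOn_rodDomain (by rw [one_add_one_eq_two])).clm_apply contDiffOn_const
  exact (contDiffOn_snd_of_rodDomain h1 hx).congr fun t ht => hS.strain_eq hx ht

theorem causalC1_strain {x : ℝ} (hx : x ∈ Ico (0 : ℝ) 1) : CausalC1 (strain v x)
    (fun t => if t < 0 then 0 else derivWithin (strain v x) (Ici 0) t) := by
  refine CausalC1.of_contDiffOn (hS.contDiffOn_strain hx) fun t ht => ?_
  rcases ht.lt_or_eq with ht | rfl
  · rw [strain, derivWithin_congr (f := fun _ => (0 : ℝ)) (fun y hy => hS.u_causal y hy t ht)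
      (hS.u_causal x (Ico_subset_Icc_self hx) t ht)]
    simp
  · exact hS.init_strain x hx

theorem causalC1_stress {x : ℝ} (hx : x ∈ Ico (0 : ℝ) 1) : CausalC1 (τ x)
    (fun t => if t < 0 then 0 else derivWithin (τ x) (Ici 0) t) := by
  refine CausalC1.of_contDiffOn (contDiffOn_snd_of_rodDomain hS.σ_regular hx) fun t ht => ?_
  rcases ht.lt_or_eq with ht | rfl
  · exact hS.σ_causal x (Ico_subset_Icc_self hx) t ht
  · exact hS.init_σ x hx

theorem hasDerivWithinAt_strain {x t : ℝ} (hx : x ∈ Icc (0 : ℝ) 1) (ht : 0 < t) :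
    HasDerivWithinAt (fun y => v y t) (strain v x t) (Icc 0 1) x := by
  have h1 : ContDiffOn ℝ 2 (fun y => v y t) (Icc 0 1) :=
    hS.u_regular.comp (f := fun y : ℝ => (y, t)) (by fun_prop) fun _ hy => mem_rodDomain_of_pos hy ht
  exact (h1.differentiableOn two_ne_zero x hx).hasDerivWithinAt

/-- Admissibility bounds the strain but not `u`; the bound for `u` follows from `u(0,t) = 0` by the
mean value inequality. -/
theorem expBounded_u (hE : ExpBounded A (strain v)) : ExpBounded A v := fun r hr => by
  obtain ⟨C, hC⟩ := hE r hr
  refine ⟨C, fun x hx t ht => ?_⟩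
  have h1 := (convex_Icc (0 : ℝ) r).norm_image_sub_le_of_norm_hasDerivWithin_le (f := fun y => v y t)
    (f' := fun y => strain v y t) (C := C * Real.exp (A * t))
    (fun y hy => (hS.hasDerivWithinAt_strain ⟨hy.1, hy.2.trans hr.2.le⟩ ht).mono
      (Icc_subset_Icc_right hr.2.le)) (fun y hy => hC y hy t ht) (left_mem_Icc.2 hr.1) hx
  rw [hS.bc_left t, sub_zero, sub_zero, Real.norm_eq_abs, Real.norm_eq_abs, abs_of_nonneg hx.1] at h1
  have h2 := (abs_nonneg _).trans (hC x hx t ht)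
  exact h1.trans (mul_le_of_le_one_right h2 (hx.2.trans hr.2.le))

theorem hasDerivAt_accel {x t : ℝ} (hx : x ∈ Ico (0 : ℝ) 1) (ht : 0 < t) :
    HasDerivAt (derivWithin (v x) (Ici 0)) (iteratedDeriv 2 (v x) t) t := by
  have h1 := hS.contDiffOn_u_snd hx
  have h2 : ContDiffOn ℝ 1 (derivWithin (v x) (Ici 0)) (Ici 0) :=
    h1.derivWithin (uniqueDiffOn_Ici 0) (by rw [one_add_one_eq_two])
  have h3 : deriv (v x) =ᶠ[𝓝 t] derivWithin (v x) (Ici 0) := by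
    filter_upwards [Ioi_mem_nhds ht] with r hr
    exact (derivWithin_of_mem_nhds (Ici_mem_nhds hr)).symm
  rw [iteratedDeriv_succ, iteratedDeriv_one, h3.deriv_eq]
  exact ((h2.differentiableOn one_ne_zero t ht.le).differentiableAt (Ici_mem_nhds ht)).hasDerivAt

theorem lap_accel (hA : 0 < A) (hs : A < s) (hW : ExpBounded A fun x => iteratedDeriv 2 (v x)) {x : ℝ}
    (hx : x ∈ Ico (0 : ℝ) 1) : lap s (iteratedDeriv 2 (v x)) = s ^ 2 * lap s (v x) := by
  obtain ⟨C, hC⟩ := hW x hx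
  have h1 := hS.contDiffOn_u_snd hx
  have h0 : derivWithin (v x) (Ici 0) 0 = 0 :=
    (hS.init_ut x hx).hasDerivWithinAt.derivWithin (uniqueDiffOn_Ici 0 0 self_mem_Ici)
  obtain ⟨hb, hl⟩ := lap_deriv hA (h1.continuousOn_derivWithin (uniqueDiffOn_Ici 0) one_le_two) h0
    (fun t ht => hS.hasDerivAt_accel hx ht) (fun t ht => hC x ⟨hx.1, le_rfl⟩ t ht)
  obtain ⟨-, hl'⟩ := lap_deriv hA h1.continuousOn (hS.init_u x hx)
    (fun t ht => ((h1.differentiableOn two_ne_zero t (le_of_lt ht)).hasDerivWithinAt).hasDerivAt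
      (Ici_mem_nhds ht)) hb
  rw [hl s hs, hl' s hs]
  ring

theorem measurable_u {x : ℝ} (hx : x ∈ Ico (0 : ℝ) 1) :
    AEStronglyMeasurable (v x) (volume.restrict (Ioi 0)) :=
  ((hS.contDiffOn_u_snd hx).continuousOn.mono Ioi_subset_Ici_self).aestronglyMeasurable measurableSet_Ioi

theorem lap_strain (ha : 0 < a) (hb : 0 < b) (hA : 0 < A) (hs : A < s) (hE : ExpBounded A (strain v))
    (hT : ExpBounded A τ) {x : ℝ} (hx : x ∈ Ico (0 : ℝ) 1) :
    lap s (strain v x) = distSym a s / distSym b s * lap s (τ x) := by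
  obtain ⟨C, hC⟩ := hE x hx
  obtain ⟨C', hC'⟩ := hT x hx
  have c1 := hS.causalC1_stress hx
  have c2 := hS.causalC1_strain hx
  have h1 := laplace_of_constitutive ha hb c1 c2 hA.le
    (fun r hr => integrableOn_mul_exp_of_le c1.y_cont.aestronglyMeasurable
      (fun t ht => hC' x ⟨hx.1, le_rfl⟩ t ht) hr)
    (fun r hr => integrableOn_mul_exp_of_le c2.y_cont.aestronglyMeasurable
      (fun t ht => hC x ⟨hx.1, le_rfl⟩ t ht) hr)
    (fun t ht => (hS.constitutive x hx t ht).2.2) hs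
  have h2 := (distSym_pos hb (hA.trans hs)).ne'
  change lap s (τ x) * distSym a s = lap s (strain v x) * distSym b s at h1
  rw [div_mul_eq_mul_div, eq_div_iff h2, ← h1, mul_comm]

theorem continuousOn_fst {t : ℝ} (ht : 0 < t) : ContinuousOn (fun x => v x t) (Icc 0 1) :=
  fun _ hx => (hS.hasDerivWithinAt_strain hx ht).continuousWithinAt

theorem continuousOn_stress_fst {t : ℝ} (ht : 0 < t) : ContinuousOn (fun x => τ x t) (Icc 0 1) :=
  fun x hx => (hS.motion x hx t ht).continuousWithinAt

theorem transformed (ha : 0 < a) (hb : 0 < b) (hA : 0 < A) (hs : A < s) (hE : ExpBounded A (strain v))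
    (hT : ExpBounded A τ) (hW : ExpBounded A fun x => iteratedDeriv 2 (v x)) :
    ContinuousOn (fun x => lap s (v x)) (Ico 0 1) ∧ ContinuousOn (fun x => lap s (τ x)) (Ico 0 1) ∧
    lap s (v 0) = 0 ∧
    (∀ x ∈ Ioo (0 : ℝ) 1, HasDerivAt (fun x => lap s (v x)) (distSym a s / distSym b s * lap s (τ x)) x) ∧
    ∀ x ∈ Ioo (0 : ℝ) 1, HasDerivAt (fun x => lap s (τ x)) (s ^ 2 * lap s (v x)) x := by
  have hV := hS.expBounded_u hE
  have mT : ∀ x ∈ Ico (0 : ℝ) 1, AEStronglyMeasurable (τ x) (volume.restrict (Ioi 0)) := fun x hx =>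
    (hS.causalC1_stress hx).y_cont.aestronglyMeasurable
  refine ⟨continuousOn_lap hs hV (fun x hx => hS.measurable_u hx) fun t ht =>
      (hS.continuousOn_fst ht).mono Ico_subset_Icc_self,
    continuousOn_lap hs hT mT fun t ht => (hS.continuousOn_stress_fst ht).mono Ico_subset_Icc_self,
    by simp [lap, hS.bc_left], fun x hx => ?_, fun x hx => ?_⟩
  · rw [← hS.lap_strain ha hb hA hs hE hT (Ioo_subset_Ico_self hx)]
    exact hasDerivAt_lap hs hV hE (fun x hx => hS.measurable_u hx)
      (fun x hx => (hS.causalC1_strain hx).y_cont.aestronglyMeasurable)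
      (fun t ht y hy => (hS.hasDerivWithinAt_strain (Ioo_subset_Icc_self hy) ht).hasDerivAt
        (Icc_mem_nhds hy.1 hy.2)) hx
  · rw [← hS.lap_accel hA hs hW (Ioo_subset_Ico_self hx)]
    refine hasDerivAt_lap hs hT hW mT (fun _ _ => ?_)
      (fun t ht y hy => (hS.motion y (Ioo_subset_Icc_self hy) t ht).hasDerivAt
        (Icc_mem_nhds hy.1 hy.2)) hx
    rw [iteratedDeriv_succ]
    exact (stronglyMeasurable_deriv _).aestronglyMeasurable

end IsSolution

/-- The Laplace admissible solution is unique. -/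
theorem IsSolution.unique {a b : ℝ} {Υ : ℝ → ℝ} {v τ v' τ' : ℝ → ℝ → ℝ} (ha : 0 < a) (hb : 0 < b)
    (hS : IsSolution a b Υ v τ) (hL : LaplaceAdmissible Υ v τ) (hS' : IsSolution a b Υ v' τ')
    (hL' : LaplaceAdmissible Υ v' τ') {p : ℝ × ℝ} (hp : p ∈ rodDomain) :
    v p.1 p.2 = v' p.1 p.2 ∧ τ p.1 p.2 = τ' p.1 p.2 := by
  obtain ⟨A₁, hb₁, ht₁⟩ := hL
  obtain ⟨A₂, hb₂, ht₂⟩ := hL'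
  -- One positive abscissa serves both solutions; positivity is needed for `lap_deriv`.
  set A := max 1 (max A₁ A₂) with hAdef
  have hA : 0 < A := zero_lt_one.trans_le (le_max_left _ _)
  have hA1 : A₁ ≤ A := (le_max_left _ _).trans (le_max_right _ _)
  have hA2 : A₂ ≤ A := (le_max_right _ _).trans (le_max_right _ _)
  have split : ∀ {A₀ : ℝ} {w ρ : ℝ → ℝ → ℝ}, A₀ ≤ A → (∀ r ∈ Ico (0 : ℝ) 1, ∃ C : ℝ, ∀ x ∈ Icc 0 r,
      ∀ t : ℝ, 0 < t → |iteratedDeriv 2 (w x) t| ≤ C * Real.exp (A₀ * t) ∧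
        |strain w x t| ≤ C * Real.exp (A₀ * t) ∧ |ρ x t| ≤ C * Real.exp (A₀ * t)) →
      ExpBounded A (strain w) ∧ ExpBounded A ρ ∧ ExpBounded A fun x => iteratedDeriv 2 (w x) := by
    intro A₀ w ρ hle hbd
    refine ⟨ExpBounded.mono (fun r hr => ?_) hle, ExpBounded.mono (fun r hr => ?_) hle,
      ExpBounded.mono (fun r hr => ?_) hle⟩ <;> obtain ⟨C, hC⟩ := hbd r hr
    · exact ⟨C, fun x hx t ht => (hC x hx t ht).2.1⟩
    · exact ⟨C, fun x hx t ht => (hC x hx t ht).2.2⟩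
    · exact ⟨C, fun x hx t ht => (hC x hx t ht).1⟩
  obtain ⟨hE, hT, hW⟩ := split hA1 hb₁
  obtain ⟨hE', hT', hW'⟩ := split hA2 hb₂
  have hint : ∀ {f : ℝ → ℝ → ℝ}, ExpBounded A f → ∀ {x : ℝ}, x ∈ Ico (0 : ℝ) 1 →
      AEStronglyMeasurable (f x) (volume.restrict (Ioi 0)) → ∀ s, A < s →
      IntegrableOn (fun t => f x t * Real.exp (-(s * t))) (Ioi 0) := fun hf x hx hm s hs => by
    obtain ⟨C, hC⟩ := hf x hx
    exact integrableOn_mul_exp_of_le hm (fun t ht => hC x ⟨hx.1, le_rfl⟩ t ht) hs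
  have hV := hS.expBounded_u hE
  have hV' := hS'.expBounded_u hE'
  have hΥ : AEStronglyMeasurable Υ (volume.restrict (Ioi 0)) := by
    have h1 : ContinuousOn (v 1) (Ioi 0) :=
      hS.u_regular.continuousOn.comp (f := fun t : ℝ => ((1 : ℝ), t)) (by fun_prop)
        fun _ ht => mem_rodDomain_of_pos (by simp) ht
    exact (h1.aestronglyMeasurable measurableSet_Ioi).congr (ae_restrict_of_ae hS.bc_right)
  have key : ∀ s, A < s → ∀ x ∈ Ico (0 : ℝ) 1, lap s (v x) - lap s (v' x) = 0 ∧
      lap s (τ x) - lap s (τ' x) = 0 := by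
    intro s hs x hx
    obtain ⟨c1, c2, c3, c4, c5⟩ := hS.transformed ha hb hA hs hE hT hW
    obtain ⟨d1, d2, d3, d4, d5⟩ := hS'.transformed ha hb hA hs hE' hT' hW'
    have hs0 := hA.trans hs
    refine eq_zero_of_transformed (V := fun x => lap s (v x) - lap s (v' x))
      (T := fun x => lap s (τ x) - lap s (τ' x)) (div_pos (distSym_pos ha hs0) (distSym_pos hb hs0))
      (sq_nonneg s) (c1.sub d1) (c2.sub d2) (by rw [c3, d3, sub_zero])
      (fun y hy => by rw [mul_sub]; exact (c4 y hy).sub (d4 y hy))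
      (fun y hy => by rw [mul_sub]; exact (c5 y hy).sub (d5 y hy)) ?_ hx
    have hle : ∀ {A₀ : ℝ} (w : ℝ → ℝ → ℝ) (y : ℝ), A₀ ≤ A →
        ∫⁻ t in Ioi (0 : ℝ), ENNReal.ofReal (|w y t - Υ t| * Real.exp (-(s * t))) ≤
          ∫⁻ t in Ioi (0 : ℝ), ENNReal.ofReal (|w y t - Υ t| * Real.exp (-(A₀ * t))) := by
      intro A₀ w y h0
      refine setLIntegral_mono' measurableSet_Ioi fun t ht => ENNReal.ofReal_le_ofReal ?_
      refine mul_le_mul_of_nonneg_left (Real.exp_le_exp.2 ?_) (abs_nonneg _)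
      have ht : 0 < t := ht
      nlinarith
    -- The boundary condition of the transformed problem: the difference of the transforms is at
    -- most the sum of the weighted `L¹` distances of the two displacements from `Υ`, and both tend
    -- to `0`.
    have hbound : ∀ y ∈ Ico (0 : ℝ) 1, ‖lap s (v y) - lap s (v' y)‖ₑ ≤
        (∫⁻ t in Ioi (0 : ℝ), ENNReal.ofReal (|v y t - Υ t| * Real.exp (-(A₁ * t)))) +
        ∫⁻ t in Ioi (0 : ℝ), ENNReal.ofReal (|v' y t - Υ t| * Real.exp (-(A₂ * t))) := by
      intro y hy
      refine le_trans ?_ (add_le_add (hle v y hA1) (hle v' y hA2))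
      have e : lap s (v y) - lap s (v' y) =
          ∫ t in Ioi (0 : ℝ), (v y t - v' y t) * Real.exp (-(s * t)) := by
        simp only [sub_mul]
        exact (integral_sub (hint hV hy (hS.measurable_u hy) s hs)
          (hint hV' hy (hS'.measurable_u hy) s hs)).symm
      have hm : AEMeasurable (fun t => ENNReal.ofReal (|v y t - Υ t| * Real.exp (-(s * t))))
          (volume.restrict (Ioi 0)) :=
        ((((hS.measurable_u hy).sub hΥ).aemeasurable.abs).mul
          (by fun_prop : Measurable fun t : ℝ => Real.exp (-(s * t))).aemeasurable).ennreal_ofReal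
      rw [e, ← lintegral_add_left' hm]
      refine (enorm_integral_le_lintegral_enorm _).trans (lintegral_mono fun t => ?_)
      rw [← ENNReal.ofReal_add (by positivity) (by positivity), ← ofReal_norm, norm_mul,
        Real.norm_eq_abs, Real.norm_of_nonneg (Real.exp_pos _).le, ← add_mul]
      refine ENNReal.ofReal_le_ofReal (mul_le_mul_of_nonneg_right ?_ (Real.exp_pos _).le)
      rw [abs_sub_comm (v' y t)]
      exact abs_sub_le _ _ _
    have hlim := (ht₁.add ht₂)
    rw [add_zero] at hlim
    rw [tendsto_zero_iff_enorm_tendsto_zero]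
    refine tendsto_of_tendsto_of_tendsto_of_le_of_le' tendsto_const_nhds hlim
      (Eventually.of_forall fun _ => zero_le) ?_
    filter_upwards [eventually_left_one] with y hy
    exact hbound y (Ioo_subset_Ico_self hy)
  have hv : ∀ x ∈ Ico (0 : ℝ) 1, EqOn (v x) (v' x) (Ioi 0) := fun x hx =>
    eqOn_of_laplace (A := A) ((hS.contDiffOn_u_snd hx).continuousOn.mono Ioi_subset_Ici_self)
      ((hS'.contDiffOn_u_snd hx).continuousOn.mono Ioi_subset_Ici_self)
      (hint hV hx (hS.measurable_u hx)) (hint hV' hx (hS'.measurable_u hx))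
      fun s hs => sub_eq_zero.1 (key s hs x hx).1
  have hτ : ∀ x ∈ Ico (0 : ℝ) 1, EqOn (τ x) (τ' x) (Ioi 0) := fun x hx =>
    eqOn_of_laplace (A := A) (hS.causalC1_stress hx).y_cont.continuousOn
      (hS'.causalC1_stress hx).y_cont.continuousOn
      (hint hT hx (hS.causalC1_stress hx).y_cont.aestronglyMeasurable)
      (hint hT' hx (hS'.causalC1_stress hx).y_cont.aestronglyMeasurable)
      fun s hs => sub_eq_zero.1 (key s hs x hx).2
  -- At `x = 1` the transform is not used; for `t > 0` the equality extends to the end by continuity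
  -- in `x`.
  have hone : ∀ {f g : ℝ → ℝ}, ContinuousOn f (Icc 0 1) → ContinuousOn g (Icc 0 1) →
      (∀ x ∈ Ico (0 : ℝ) 1, f x = g x) → f 1 = g 1 := by
    intro f g hf hg hfg
    have h1 : ∀ {k : ℝ → ℝ}, ContinuousOn k (Icc 0 1) → Tendsto k (𝓝[<] 1) (𝓝 (k 1)) := fun hk => by
      rw [← nhdsWithin_Ioo_eq_nhdsLT zero_lt_one]
      exact (hk 1 (by simp)).mono Ioo_subset_Icc_self
    refine tendsto_nhds_unique (h1 hf) ((h1 hg).congr' ?_)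
    filter_upwards [eventually_left_one] with x hx
    exact (hfg x (Ioo_subset_Ico_self hx)).symm
  obtain ⟨x, t⟩ := p
  simp only
  have ht0 : 0 ≤ t := hp.2.1
  rcases ht0.eq_or_lt with rfl | ht
  · have hx : x ∈ Ico (0 : ℝ) 1 := ⟨hp.1.1, lt_of_le_of_ne hp.1.2 fun h => hp.2.2 (by simpa using h)⟩
    rw [hS.init_u x hx, hS'.init_u x hx, hS.init_σ x hx, hS'.init_σ x hx]
    exact ⟨rfl, rfl⟩
  · have hx : x ∈ Icc (0 : ℝ) 1 := hp.1
    rcases hx.2.lt_or_eq with h1 | h1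
    · exact ⟨hv x ⟨hx.1, h1⟩ ht, hτ x ⟨hx.1, h1⟩ ht⟩
    · rw [h1]
      exact ⟨hone (hS.continuousOn_fst ht) (hS'.continuousOn_fst ht) fun y hy => hv y hy ht,
        hone (hS.continuousOn_stress_fst ht) (hS'.continuousOn_stress_fst ht) fun y hy => hτ y hy ht⟩

/-! ### Residues in the variable `s`, and the choice of the parameters. -/

section

variable {a b : ℝ}

theorem sinh_mul_M_eq_zero {sp sm : ℕ → ℂ} (hp : ArePoles a b sp sm) {n : ℕ} (hn : 1 ≤ n) {s : ℂ}
    (hs : s = sp n ∨ s = sm n) : s ∈ Complex.slitPlane ∧ Complex.sinh (s * M a b s) = 0 ∧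
      deriv (fun z : ℂ => Complex.sinh (z * M a b z)) s ≠ 0 := by
  have h0 : Complex.sinh (n * Complex.I * Real.pi) = 0 := by
    rw [mul_right_comm, Complex.sinh_mul_I, Complex.sin_nat_mul_pi, zero_mul]
  rcases hs with rfl | rfl
  · exact ⟨hp.mem_plus n hn, by rw [hp.eq_plus n hn, h0], hp.simple_plus n hn⟩
  · exact ⟨hp.mem_minus n hn, by rw [hp.eq_minus n hn, Complex.sinh_neg, h0, neg_zero],
      hp.simple_minus n hn⟩

theorem hasResidue_resTerm (ha : 0 < a) (hb : 0 < b) {Ft : ℂ → ℂ}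
    (hFt : DifferentiableOn ℂ Ft Complex.slitPlane) (x t : ℝ) {s : ℂ} (hs : s ∈ Complex.slitPlane)
    (h0 : Complex.sinh (s * M a b s) = 0)
    (h1 : deriv (fun z : ℂ => Complex.sinh (z * M a b z)) s ≠ 0) :
    HasResidue (fun z : ℂ => Ft z * PTilde a b x z * Complex.exp (z * t)) s (resTerm a b Ft x t s) := by
  have hO := Complex.isOpen_slitPlane.mem_nhds hs
  have hM : ∀ᶠ z in 𝓝 s, DifferentiableAt ℂ (fun z => z * M a b z) z := by
    filter_upwards [hO] with z hz
    exact (hasDerivAt_mul_M ha hb hz).differentiableAt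
  have h2 := hasResidue_of_simple_zero (p := s)
    (f := fun z : ℂ => Ft z * PTilde a b x z * Complex.exp (z * t))
    (A := fun z => Ft z * Complex.sinh (x * (z * M a b z)) * Complex.exp (z * t))
    (B := fun z => Complex.sinh (z * M a b z)) ?_ (hM.mono fun z hz => hz.csinh) h0 h1 fun z => by
      rw [PTilde, mul_assoc (x : ℂ)]; ring
  · have e : resTerm a b Ft x t s = Ft s * Complex.sinh (x * (s * M a b s)) * Complex.exp (s * t) /
        deriv (fun z : ℂ => Complex.sinh (z * M a b z)) s := by
      rw [resTerm, mul_assoc (x : ℂ)]; ring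
    rwa [e]
  · filter_upwards [hO, hM] with z hz hz'
    exact ((hFt.differentiableAt (Complex.isOpen_slitPlane.mem_nhds hz)).mul
      (hz'.const_mul (x : ℂ)).csinh).mul (by fun_prop)

theorem stripExt_log {F : ℝ → ℝ} {Ft : ℂ → ℂ} {Fp Fm : ℝ → ℂ} {α : ℝ} (hF : DatumCondition F Ft Fp Fm α)
    {s : ℂ} (hs : 0 < s.re) : stripExt Ft (Complex.log s) = Ft s := by
  rw [hF.stripExt_eq (log_mem_ostrip_of_re_pos hs), Complex.exp_log fun h => by simp [h] at hs]

theorem exists_params (ha : 0 < a) (hab : a < b) {F : ℝ → ℝ} {Ft : ℂ → ℂ} {Fp Fm : ℝ → ℂ} {α : ℝ}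
    (hα : 1 < α) (hF : DatumCondition F Ft Fp Fm α) : ∃ A₀ A δ C : ℝ, Params a b A₀ A δ ∧
      HasLaplace F A₀ Ft ∧ HalfPlane Ft A₀ α C := by
  obtain ⟨AF, hL⟩ := hF.laplace
  obtain ⟨R, C, hC, hb⟩ := hF.exists_norm_le
  obtain ⟨δ, hδ, hδ'⟩ := (eventually_small (a := a) (b := b)).exists
  have h1 := one_le_absc ha hab
  -- To the right of `A₀` three things hold at once: `Re z ≥ max(1, c|s|^{1/2})`, absolute
  -- convergence of the transform of `F`, and the bound `|F̃| ≤ C|s|^{-α}`.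
  set A₀ := max (absc ha hab) (max AF R) with hA₀
  have h2 : absc ha hab ≤ A₀ := le_max_left _ _
  have h3 : ∀ s : ℂ, A₀ < s.re → s ∈ Complex.slitPlane := fun s hs => slitPlane_of_re_pos (by linarith)
  refine ⟨A₀, A₀ + 1, δ, C, ⟨ha, hab, h2, lt_add_one _, hδ, hδ'⟩,
    hL.mono ((le_max_left _ _).trans (le_max_right _ _)), h1.trans h2, hα, ?_, fun s hs => hb s (h3 s hs) ?_⟩
  · exact fun s hs => (hF.analytic s (h3 s hs)).differentiableAt.differentiableWithinAt
  · exact ((le_max_right AF R).trans (le_max_right _ _)).trans (hs.le.trans (Complex.re_le_norm s))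

theorem DatumCondition.realSymb {F : ℝ → ℝ} {Ft : ℂ → ℂ} {Fp Fm : ℝ → ℂ} {α A₀ : ℝ}
    (hF : DatumCondition F Ft Fp Fm α) (hα : 0 ≤ α) (hL : HasLaplace F A₀ Ft) (h0 : 0 ≤ A₀) :
    RealSymb A₀ (stripExt Ft) where
  toSymb := hF.symb hα
  conj s hs := by
    rw [stripExt_log hF (h0.trans_lt hs), stripExt_log hF (by simpa using h0.trans_lt hs), hL.conj hs]

end

end FractionalRod

end

/-! ### Assembly of the theorem. -/

theorem mainTheorem4 (a b Υ₀ α : ℝ) (ha : 0 < a) (hab : a < b) (hΥ : 0 < Υ₀) (hα : 1 < α)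
    (F : ℝ → ℝ) (Ft : ℂ → ℂ) (Fp Fm : ℝ → ℂ)
    (hF : FractionalRod.DatumCondition F Ft Fp Fm α) :
    ∃ (sp sm : ℕ → ℂ) (P uH uF σ : ℝ → ℝ → ℝ),
      FractionalRod.ArePoles a b sp sm ∧
      -- `P(x,·)` is the inverse Laplace transform of `P̃(x,·)`
      (∀ x ∈ Set.Ico (0 : ℝ) 1, Continuous (P x) ∧ (∀ t : ℝ, t < 0 → P x t = 0) ∧
        ∃ A : ℝ, FractionalRod.HasLaplace (P x) A (FractionalRod.PTilde a b x)) ∧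
      -- `uH = Υ₀ H * P`, with `P(1,·) = δ`
      (∀ x ∈ Set.Ico (0 : ℝ) 1, ∀ t : ℝ,
        uH x t = Υ₀ * FractionalRod.causalConv FractionalRod.heaviside (P x) t) ∧
      (∀ t : ℝ, uH 1 t = Υ₀ * FractionalRod.heaviside t) ∧
      (∀ x ∈ Set.Ico (0 : ℝ) 1, ∀ t : ℝ, 0 < t →
        FractionalRod.FormulaH a b Υ₀ sp sm x t (uH x t)) ∧
      -- `uF = F * P`, with `P(1,·) = δ`
      (∀ x ∈ Set.Ico (0 : ℝ) 1, ∀ t : ℝ, uF x t = FractionalRod.causalConv F (P x) t) ∧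
      (∀ᵐ t : ℝ, uF 1 t = F t) ∧
      (∀ x ∈ Set.Icc (0 : ℝ) 1, ∀ t : ℝ, 0 < t →
        FractionalRod.FormulaF a b Ft Fp Fm sp sm x t (uF x t)) ∧
      (∀ x ∈ Set.Icc (0 : ℝ) 1, ∀ t : ℝ, 0 < t → ∀ n : ℕ, 1 ≤ n → ∀ s : ℂ, s = sp n ∨ s = sm n →
        FractionalRod.HasResidue
          (fun z : ℂ => Ft z * FractionalRod.PTilde a b x z * Complex.exp (z * t)) s
          (FractionalRod.resTerm a b Ft x t s) ∧
        FractionalRod.HasResidue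
          (fun z : ℂ => FractionalRod.PTilde a b x z * Complex.exp (z * t)) s
          (FractionalRod.resTerm a b (fun _ => 1) x t s)) ∧
      (∀ x ∈ Set.Icc (0 : ℝ) 1, (∀ t : ℝ, t < 0 → uF x t = 0) ∧ MeasureTheory.LocallyIntegrable (uF x)) ∧
      -- `u = uH + uF` is the solution, and it is smooth for `t > 0`
      FractionalRod.IsSolution a b (fun t => Υ₀ * FractionalRod.heaviside t + F t)
        (fun x t => uH x t + uF x t) σ ∧
      FractionalRod.LaplaceAdmissible (fun t => Υ₀ * FractionalRod.heaviside t + F t)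
        (fun x t => uH x t + uF x t) σ ∧
      (∀ v τ : ℝ → ℝ → ℝ,
        FractionalRod.IsSolution a b (fun t => Υ₀ * FractionalRod.heaviside t + F t) v τ →
        FractionalRod.LaplaceAdmissible (fun t => Υ₀ * FractionalRod.heaviside t + F t) v τ →
        ∀ p ∈ FractionalRod.rodDomain,
          v p.1 p.2 = uH p.1 p.2 + uF p.1 p.2 ∧ τ p.1 p.2 = σ p.1 p.2) ∧
      ContDiffOn ℝ (⊤ : ℕ∞) (Function.uncurry fun x t => uH x t + uF x t)
        (Set.Icc (0 : ℝ) 1 ×ˢ Set.Ioi (0 : ℝ)) := by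
  open FractionalRod Set Filter Topology MeasureTheory in
  have hb := ha.trans hab
  obtain ⟨A₀, A, δ, C, h, hL, hH⟩ := exists_params ha hab hα hF
  have hPoles := arePoles ha hb
  have s1 : RealSymb A₀ (fun _ => 1) := RealSymb.one
  have sH : RealSymb A₀ (fun w => Υ₀ * Complex.exp (-w)) :=
    (RealSymb.const Υ₀).mul (RealSymb.exp_neg h.nonneg)
  have sF : RealSymb A₀ (stripExt Ft) := hF.realSymb (zero_le_one.trans hα.le) hL h.nonneg
  have hGF : ∀ s : ℂ, A₀ < s.re → stripExt Ft (Complex.log s) = Ft s := fun s hs =>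
    stripExt_log hF (h.nonneg.trans_lt hs)
  have sG := sH.add sF
  -- The symbol of the whole boundary datum, `Υ₀/s + F̃(s)`.
  set G : ℂ → ℂ := fun w => Υ₀ * Complex.exp (-w) + stripExt Ft w with hG
  set P := disp a b A δ (fun _ => 1) with hP
  set uF := disp a b A δ (stripExt Ft) with huF
  -- The value at `x = 1` is prescribed separately: at `t = 0` the field `disp` is `0` while the
  -- Heaviside function is `1`. The two differ only at the corner, which `HasSymbol` leaves out.
  set uH : ℝ → ℝ → ℝ := fun x t => if x < 1 then disp a b A δ (fun w => Υ₀ * Complex.exp (-w)) x t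
    else Υ₀ * heaviside t with huH
  have hHs : HalfPlane (fun s => stripExt Ft (Complex.log s)) A₀ α C :=
    ⟨h.one_le, hα, hH.diff.congr hGF, fun s hs => by rw [hGF s hs]; exact hH.bound s hs⟩
  have hF1 : ∀ᵐ t : ℝ, uF 1 t = F t :=
    h.disp_one_ae_eq sF hHs (fun s hs => hL.real hs) hGF hF.eq_zero
  have hu : HasSymbol a b A δ G (fun x t => uH x t + uF x t) := fun x hx t hxt => by
    have h1 := h.disp_add sH.toSymb sF.toSymb (abs_le_one_of_mem_Icc hx) t
    simp only [huH, hG]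
    rw [h1]
    congr 1
    split_ifs with hlt
    · rfl
    · have hx1 : x = 1 := le_antisymm hx.2 (not_lt.1 hlt)
      have ht := hxt.resolve_left hlt
      rw [hx1]
      rcases ht.lt_or_gt with ht | ht
      · rw [h.disp_of_nonpos sH.toSymb ht.le, heaviside, if_neg (not_le.2 ht), mul_zero]
      · rw [h.disp_exp_neg_one Υ₀ ht, heaviside, if_pos ht.le, mul_one]
  have huH1 : ∀ t, uH 1 t = Υ₀ * heaviside t := fun t => if_neg (lt_irrefl 1)
  have hbc : ∀ᵐ t : ℝ, uH 1 t + uF 1 t = Υ₀ * heaviside t + F t := by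
    filter_upwards [hF1] with t ht
    rw [huH1, ht]
  have hlocF : LocallyIntegrable (uF 1) := hF.locallyIntegrable.congr (hF1.mono fun t ht => ht.symm)
  have hlocH : LocallyIntegrable fun t => Υ₀ * heaviside t := by
    have hm : Measurable heaviside := Measurable.ite measurableSet_Ici measurable_const measurable_const
    refine LocallyIntegrable.mono (locallyIntegrable_const Υ₀) (hm.const_mul Υ₀).aestronglyMeasurable
      (Eventually.of_forall fun t => ?_)
    rw [norm_mul]
    refine mul_le_of_le_one_right (norm_nonneg _) ?_
    rw [heaviside]
    split_ifs <;> simp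
  have hloc : LocallyIntegrable fun t => uH 1 t + uF 1 t := by
    have h1 := hlocH.add hlocF
    simpa only [huH1] using! h1
  -- Since `α > 1` and `|s| ≥ 1`, the datum is also of size `1/|s|`, the common order used in the
  -- `L²` estimate.
  have hbound : ∀ s : ℂ, A₀ < s.re → ‖G (Complex.log s)‖ ≤ (Υ₀ + C) * ‖s‖⁻¹ := fun s hs => by
    have hs1 : 1 ≤ ‖s‖ := h.one_le.trans (hs.le.trans (Complex.re_le_norm s))
    have hs0 : s ≠ 0 := norm_pos_iff.1 (zero_lt_one.trans_le hs1)
    rw [hG]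
    simp only
    rw [hGF s hs, Complex.exp_neg, Complex.exp_log hs0, add_mul]
    refine (norm_add_le _ _).trans (add_le_add ?_ ?_)
    · rw [norm_mul, norm_inv, Complex.norm_real, Real.norm_of_nonneg hΥ.le]
    · refine (hH.bound s hs).trans (mul_le_mul_of_nonneg_left ?_ hH.C_nonneg)
      rw [← Real.rpow_neg_one]
      exact Real.rpow_le_rpow_of_exponent_le hs1 (by linarith)
  have hsol := h.isSolution sG hu hloc hbc
  have hadm := h.laplaceAdmissible sG hbound hu hbc
  refine ⟨spole a b, smole a b, P, uH, uF, strs a b A δ (stressSymb a b G), hPoles, fun x hx =>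
    ⟨h.continuous_disp s1.toSymb (abs_lt_one_of_mem_Ico hx), fun t ht => h.disp_of_nonpos s1.toSymb ht.le,
      A₀, (h.hasLaplace_disp s1 (abs_lt_one_of_mem_Ico hx)).congr (fun _ => rfl) fun s hs => ?_⟩,
    fun x hx t => ?_, huH1, fun x hx t ht => ?_, fun x hx t => ?_, hF1, fun x hx t ht => ?_,
    fun x _ t _ n hn s hs => ?_, fun x hx => ⟨fun t ht => h.disp_of_nonpos sF.toSymb ht.le, ?_⟩, hsol, hadm,
    fun v τ hS hA p hp => hS.unique ha hb hA hsol hadm hp, ?_⟩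
  · rw [kern_mul_sinh, one_mul, PTilde_eq ha hb x (slitPlane_of_re_pos (h.nonneg.trans_lt hs))]
  · rw [h.causalConv_heaviside Υ₀ (abs_lt_one_of_mem_Ico hx)]
    exact if_pos hx.2
  · have hx1 := abs_lt_one_of_mem_Ico hx
    have h1 := formulaH_brom ha hab hx1 ht h.absc_lt Υ₀
    have h2 : (uH x t : ℂ) = Υ₀ * ∫ τ in (0 : ℝ)..t, oddPart (brom a b (fun _ => 1) A) (x, τ) := by
      have h3 : uH x t = Υ₀ * ∫ τ in (0 : ℝ)..t, P x τ :=
        (if_pos hx.2).trans (h.const_mul_integral_disp Υ₀ hx1 t).symm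
      rw [h3, Complex.ofReal_mul, ← intervalIntegral.integral_ofReal]
      simp only [hP, h.disp_eq_brom s1 hx1]
    rwa [h2]
  · exact (h.causalConv_disp sF hL hF.eq_zero hGF (abs_lt_one_of_mem_Ico hx) t).symm
  · rw [h.disp_eq_keyI sF (abs_le_one_of_mem_Icc hx) ht]
    exact formulaF_oddPart_keyI ha hab sF.toSymb hF.small (fun w hw => hF.stripExt_eq hw)
      (fun q hq => hF.stripExt_upper hq) (fun q hq => hF.stripExt_lower hq) (abs_le_one_of_mem_Icc hx) ht
      h.pos h.log_lt
  · obtain ⟨m1, m2, m3⟩ := sinh_mul_M_eq_zero hPoles hn hs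
    refine ⟨hasResidue_resTerm ha hb (fun z hz => (hF.analytic z hz).differentiableAt.differentiableWithinAt)
      x t m1 m2 m3, ?_⟩
    simpa only [one_mul] using! hasResidue_resTerm ha hb (differentiableOn_const (1 : ℂ)) x t m1 m2 m3
  · rcases hx.2.lt_or_eq with h1 | h1
    · exact (h.continuous_disp sF.toSymb (abs_lt_one_of_mem_Ico ⟨hx.1, h1⟩)).locallyIntegrable
    · rwa [h1]
  · have h1 : ContDiffOn ℝ (⊤ : ℕ∞) (Function.uncurry (disp a b A δ G)) (Icc (0 : ℝ) 1 ×ˢ Ioi 0) :=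
      fun p hp => (h.contDiffAt_disp sG.toSymb
        (Or.inr ⟨abs_le_one_of_mem_Icc hp.1, hp.2⟩)).contDiffWithinAt
    exact h1.congr fun p hp => hu p.1 hp.1 p.2 (Or.inr (ne_of_gt hp.2))
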